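/- **Definitions.** Fix a finite set $\Sigma$ of glues, each unordered pair $g,h$ of which has a strength $\mathrm{str}(g,h)=\mathrm{str}(h,g)\in\mathbb{N}$. A *tile* is a non-rotating unit square whose four edges are labelled with glues. A *configuration* is a partial function $\tilde A$ with finite domain from $\mathbb{Z}^2$ to tiles; an *assembly* $A$ is the class of all translations of a configuration, $|A|$ is its number of tiles, and $A\sqsubseteq B$ means that some configuration of $A$ is contained in some configuration of $B$. The *bond graph* of a configuration has the occupied cells as vertices and an edge between any two edge-adjacent cells whose coincident glues have positive strength; the edge is weighted by that strength. A configuration is *$\tau$-stable* if its bond graph is connected and every edge cut has weight at least $\tau$; an assembly is *tree-bonded* if its bond graph is acyclic. Assemblies $A,B$ are *$\tau$-combinable* into $C$ if they have configurations with disjoint domains whose union is a $\tau$-stable configuration of $C$. A *2HAM system* $\Gamma=(T,\tau)$ consists of a finite set $T$ of tiles (single-tile assemblies) and a temperature $\tau\in\mathbb{Z}_{>0}$; its *producible* assemblies are the least class that contains $T$ and contains $C$ whenever two producible assemblies are $\tau$-combinable into $C$. A producible assembly is *terminal* if it is not $\tau$-combinable with any producible assembly (a further copy of itself included). $\Gamma$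 *uniquely produces* $A$ if $A$ is its only terminal assembly and every producible $B$ satisfies $B\sqsubseteq A$. **Theorem.** The problem Tree-UAV, > Input: a 2HAM system $\Gamma=(T,\tau)$ (the temperature $\tau$ and all strengths being part of the input, in binary) and a non-empty tree-bonded assembly $A$. Output: does $\Gamma$ uniquely produce $A$? is decidable in $O(|A|^5\log\tau)$ time: there are a fixed program for a word RAM and constants $k,c$ such that on every such input, given as arrays of words with one bit of $\tau$ and of each strength per word, and for every word length of at least $k\log_2 N$ bits, where $N$ is the magnitude of the input (number of input words plus the sum of the numbers in them, plus 2), the program halts with the correct answer after at most $c\,|A|^5\,(\lfloor\log_2\tau\rfloor+1)$ elementary steps. The program and the constants do not depend on $\Sigma$, the strengths, $T$, $\tau$ or $A$. -/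

import Mathlib

/-! ## Tiles, configurations, assemblies -/

namespace TwoHAM

/-- A non-rotating unit square tile whose four edges carry glues from `G`. -/
@[ext]
structure Tile (G : Type) where
  north : G
  east : G
  south : G
  west : G

/-- A (finite) configuration: a partial function from the square grid `ℤ²` to tiles, together with
its finite domain. -/
@[ext]
structure Config (G : Type) where
  tile : ℤ × ℤ → Option (Tile G)
  dom : Finset (ℤ × ℤ)
  mem_dom : ∀ p, p ∈ dom ↔ (tile p).isSome

/-- `B` is a translation of `A`: `B = A ∘ (· + u)` for some vector `u`. -/
def Config.IsTranslation {G : Type} (B A : Config G) : Prop :=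
  ∃ u : ℤ × ℤ, ∀ p, B.tile p = A.tile (p + u)

/-- Being translations of each other, as an equivalence relation. -/
def Config.setoid (G : Type) : Setoid (Config G) where
  r A B := B.IsTranslation A
  iseqv :=
    { refl := fun A => ⟨0, fun p => by simp⟩
      symm := fun {A B} ⟨u, hu⟩ => ⟨-u, fun p => by simp [hu]⟩
      trans := fun {A B C} ⟨u, hu⟩ ⟨v, hv⟩ => ⟨v + u, fun p => by rw [hv, hu, add_assoc]⟩ }

/-- An assembly: a configuration up to translation. -/
def Assembly (G : Type) : Type := Quotient (Config.setoid G)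

/-- The assembly of a configuration. A configuration `a` belongs to the assembly `A` exactly when
`a.assembly = A`. -/
def Config.assembly {G : Type} (A : Config G) : Assembly G := Quotient.mk (Config.setoid G) A

/-- `A ⊑ B`: some configuration of `A` is contained, as a partial function, in one of `B`. -/
def Assembly.IsSubassembly {G : Type} (A B : Assembly G) : Prop :=
  ∃ a b : Config G, a.assembly = A ∧ b.assembly = B ∧
    ∀ p t, a.tile p = some t → b.tile p = some t

/-- The configuration with the single tile `t`, placed at the origin. -/
def Config.single {G : Type} (t : Tile G) : Config G where
  tile p := if p = 0 then some t else none
  dom := {0}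
  mem_dom p := by by_cases h : p = 0 <;> simp [h]

/-! ## Systems, bond graphs, stability -/

/-- A two-handed assembly system over the glue set `G`: the strengths of the (unordered) pairs of
glues, a finite set of tiles, and a positive integer temperature. -/
structure System (G : Type) where
  str : G → G → ℕ
  str_symm : ∀ g h, str g h = str h g
  tiles : Finset (Tile G)
  temp : ℕ
  temp_pos : 0 < temp

variable {G : Type}

/-- The weight of the bond between the cells `p` and `q` of a configuration: the strength of the
pair of coincident glues if `p` and `q` are edge-adjacent and both occupied, and `0` otherwise. -/
def System.bond (Γ : System G) (A : Config G) (p q : ℤ × ℤ) : ℕ :=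
  match A.tile p, A.tile q with
  | some s, some t =>
    if q = p + (1, 0) then Γ.str s.east t.west
    else if p = q + (1, 0) then Γ.str s.west t.east
    else if q = p + (0, 1) then Γ.str s.north t.south
    else if p = q + (0, 1) then Γ.str s.south t.north
    else 0
  | _, _ => 0

theorem System.bond_comm (Γ : System G) (A : Config G) (p q : ℤ × ℤ) :
    Γ.bond A p q = Γ.bond A q p := by
  unfold System.bond
  rcases hp : A.tile p with _ | s <;> rcases hq : A.tile q with _ | t <;> simp only
  obtain ⟨p1, p2⟩ := p
  obtain ⟨q1, q2⟩ := q
  simp only [Prod.mk_add_mk, Prod.mk.injEq]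
  split_ifs <;> first | omega | exact Γ.str_symm _ _

theorem System.bond_self (Γ : System G) (A : Config G) (p : ℤ × ℤ) : Γ.bond A p p = 0 := by
  unfold System.bond
  rcases hp : A.tile p with _ | s <;> simp only
  obtain ⟨p1, p2⟩ := p
  simp only [Prod.mk_add_mk, Prod.mk.injEq]
  split_ifs <;> omega

/-- The bond graph of a configuration: the vertices are the occupied cells, and the edges are the
pairs of cells with a bond of positive weight. -/
def System.bondGraph (Γ : System G) (A : Config G) : SimpleGraph {p // p ∈ A.dom} where
  Adj p q := 0 < Γ.bond A p q
  symm := ⟨fun p q h => by rw [Γ.bond_comm]; exact h⟩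
  loopless := ⟨fun p h => by simp [Γ.bond_self] at h⟩

/-- A configuration is `τ`-stable (`τ` the temperature) if its bond graph is connected and every
edge cut has weight at least `τ`. -/
def System.Stable (Γ : System G) (A : Config G) : Prop :=
  (Γ.bondGraph A).Connected ∧
    ∀ S ⊆ A.dom, S.Nonempty → S ≠ A.dom →
      Γ.temp ≤ ∑ p ∈ S, ∑ q ∈ A.dom \ S, Γ.bond A p q

/-- A configuration is tree-bonded if its bond graph is acyclic. -/
def System.TreeBonded (Γ : System G) (A : Config G) : Prop :=
  (Γ.bondGraph A).IsAcyclic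

/-! ## Producible and terminal assemblies, unique production -/

/-- The assemblies `A` and `B` are `τ`-combinable into `C`: they have configurations `a` and `b`
which occupy disjoint sets of cells, and whose union is a `τ`-stable configuration of `C`. -/
def System.Combinable (Γ : System G) (A B C : Assembly G) : Prop :=
  ∃ a b c : Config G, a.assembly = A ∧ b.assembly = B ∧ c.assembly = C ∧
    (∀ p t, c.tile p = some t ↔ a.tile p = some t ∨ b.tile p = some t) ∧
    Disjoint a.dom b.dom ∧ Γ.Stable c

/-- The producible assemblies of a system. -/
inductive System.Producible (Γ : System G) : Assembly G → Prop
  | tile (t : Tile G) (ht : t ∈ Γ.tiles) : Γ.Producible (Config.single t).assembly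
  | combine (A B C : Assembly G) (hA : Γ.Producible A) (hB : Γ.Producible B)
      (h : Γ.Combinable A B C) : Γ.Producible C

/-- A producible assembly is terminal if it is not `τ`-combinable with any producible assembly. -/
def System.Terminal (Γ : System G) (A : Assembly G) : Prop :=
  Γ.Producible A ∧ ∀ B C, Γ.Producible B → ¬ Γ.Combinable A B C

/-- The system uniquely produces `A`: it is the only terminal assembly, and every producible
assembly is a subassembly of `A`. -/
def System.UniquelyProduces (Γ : System G) (A : Assembly G) : Prop :=
  {B | Γ.Terminal B} = {A} ∧ ∀ B, Γ.Producible B → B.IsSubassembly A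

/-! ## Instances as arrays of numbers -/

/-- The four glues of a tile, as numbers. -/
def Tile.words {m : ℕ} (t : Tile (Fin m)) : List ℕ := [t.north, t.east, t.south, t.west]

/-- The binary expansion, least significant bit first, without superfluous zeros. -/
def binary (n : ℕ) : List ℕ := n.bits.map Bool.toNat

/-- The strengths `str g h` of all pairs of glues in row-major order: `str g h` is entry number
`g * m + h`. -/
def System.strengths {m : ℕ} (Γ : System (Fin m)) : List ℕ :=
  (List.finRange m).flatMap fun g => (List.finRange m).map fun h => Γ.str g h

/-- The list `ts` enumerates the tile set of the system, each tile once. -/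
def System.TileList (Γ : System G) (ts : List (Tile G)) : Prop :=
  ts.Nodup ∧ ∀ t, t ∈ ts ↔ t ∈ Γ.tiles

/-- The list `cs` of pairs (cell, tile) enumerates the configuration `A`, each cell once. The
coordinates are natural numbers, that is, `A` is a representative of its assembly that lies in the
first quadrant. -/
def Config.CellList (A : Config G) (cs : List ((ℕ × ℕ) × Tile G)) : Prop :=
  (cs.map Prod.fst).Nodup ∧
    ∀ p t, A.tile p = some t ↔ ∃ x y : ℕ, p = ((x : ℤ), (y : ℤ)) ∧ ((x, y), t) ∈ cs

/-- The input arrays that describe the system `Γ` (with tile list `ts`) and the configuration with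
cell list `cs`:
* array 0: the numbers of glues, of tile types, of cells, and of bits of the temperature;
* array 1: the four glues of each tile type;
* array 2: the two coordinates and the four glues of each cell;
* array 3: the bits of the temperature;
* array 4: the positions in array 5 at which the strengths start (and at which the last one ends);
* array 5: the bits of the strengths of all pairs of glues, one strength after the other. -/
def encode {m : ℕ} (Γ : System (Fin m)) (ts : List (Tile (Fin m)))
    (cs : List ((ℕ × ℕ) × Tile (Fin m))) : List (List ℕ) :=
  [ [m, ts.length, cs.length, (binary Γ.temp).length],
    ts.flatMap Tile.words,
    cs.flatMap fun c => c.1.1 :: c.1.2 :: c.2.words,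
    binary Γ.temp,
    (Γ.strengths.map fun s => (binary s).length).scanl (· + ·) 0,
    Γ.strengths.flatMap binary ]

end TwoHAM

/-! ## A word RAM, programmed by structured programs -/

namespace WordRAM

/-- The binary operations on machine words; comparisons return `1` for true and `0` for false. -/
inductive Op
  | add
  | sub
  | mul
  | div
  | lt
  | eq

/-- The result of an operation, before it is cut to the word length. Subtraction stops at `0`, and
division rounds down. -/
def Op.eval : Op → ℕ → ℕ → ℕ
  | .add, x, y => x + y
  | .sub, x, y => x - y
  | .mul, x, y => x * y
  | .div, x, y => x / y
  | .lt, x, y => if x < y then 1 else 0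
  | .eq, x, y => if x = y then 1 else 0

/-- Expressions: constants, variables, array reads `get a i`, and binary operations. The names of
variables and arrays are fixed in the program; only array indices are computed. -/
inductive Expr
  | const (n : ℕ)
  | var (x : ℕ)
  | get (a : ℕ) (i : Expr)
  | op (o : Op) (e f : Expr)

/-- Structured programs. -/
inductive Prog
  | skip
  | assign (x : ℕ) (e : Expr)
  | put (a : ℕ) (i e : Expr)
  | seq (P Q : Prog)
  | ite (c : Expr) (P Q : Prog)
  | while (c : Expr) (P : Prog)

/-- The memory: the values of the variables and of the array entries. -/
structure State where
  var : ℕ → ℕ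
  arr : ℕ → ℕ → ℕ

/-- The value of an expression on a machine with `w`-bit words: every computed number is reduced
modulo `2 ^ w`. -/
def Expr.eval (w : ℕ) (s : State) : Expr → ℕ
  | .const n => n % 2 ^ w
  | .var x => s.var x
  | .get a i => s.arr a (i.eval w s)
  | .op o e f => o.eval (e.eval w s) (f.eval w s) % 2 ^ w

/-- The number of elementary steps for evaluating an expression: one for each node. -/
def Expr.cost : Expr → ℕ
  | .const _ => 1
  | .var _ => 1
  | .get _ i => i.cost + 1
  | .op _ e f => e.cost + f.cost + 1

/-- Write the value `v` to the variable `x`. -/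
def State.setVar (s : State) (x v : ℕ) : State :=
  { s with var := Function.update s.var x v }

/-- Write the value `v` to entry `i` of the array `a`. -/
def State.setArr (s : State) (a i v : ℕ) : State :=
  { s with arr := Function.update s.arr a (Function.update (s.arr a) i v) }

/-- `Exec w P s t s'`: on a machine with `w`-bit words, the program `P` started in the memory state
`s` halts after exactly `t` elementary steps in the memory state `s'`. Conditions hold if their
value is not `0`. -/
inductive Exec (w : ℕ) : Prog → State → ℕ → State → Prop
  | skip (s : State) : Exec w .skip s 1 s
  | assign (s : State) (x : ℕ) (e : Expr) :
      Exec w (.assign x e) s (e.cost + 1) (s.setVar x (e.eval w s))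
  | put (s : State) (a : ℕ) (i e : Expr) :
      Exec w (.put a i e) s (i.cost + e.cost + 1) (s.setArr a (i.eval w s) (e.eval w s))
  | seq {P Q : Prog} {s s₁ s₂ : State} {t₁ t₂ : ℕ} (h₁ : Exec w P s t₁ s₁)
      (h₂ : Exec w Q s₁ t₂ s₂) : Exec w (.seq P Q) s (t₁ + t₂) s₂
  | iteTrue {c : Expr} {P Q : Prog} {s s₁ : State} {t : ℕ} (hc : c.eval w s ≠ 0)
      (h : Exec w P s t s₁) : Exec w (.ite c P Q) s (c.cost + 1 + t) s₁
  | iteFalse {c : Expr} {P Q : Prog} {s s₁ : State} {t : ℕ} (hc : c.eval w s = 0)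
      (h : Exec w Q s t s₁) : Exec w (.ite c P Q) s (c.cost + 1 + t) s₁
  | whileFalse {c : Expr} {P : Prog} {s : State} (hc : c.eval w s = 0) :
      Exec w (.while c P) s (c.cost + 1) s
  | whileTrue {c : Expr} {P : Prog} {s s₁ s₂ : State} {t₁ t₂ : ℕ} (hc : c.eval w s ≠ 0)
      (h₁ : Exec w P s t₁ s₁) (h₂ : Exec w (.while c P) s₁ t₂ s₂) :
      Exec w (.while c P) s (c.cost + 1 + t₁ + t₂) s₂

/-- The initial memory for given input arrays: everything else is `0`. -/
def State.init (input : List (List ℕ)) : State where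
  var _ := 0
  arr a i := (input.getD a []).getD i 0

/-- The magnitude of the input: a bound, greater than `1`, for the number of input words and for
the numbers in them. -/
def magnitude (input : List (List ℕ)) : ℕ :=
  (input.map fun a => a.length + a.sum).sum + 2

/-- The word length `w` is at least `k` times the binary logarithm of the magnitude of the
input. -/
def WordsSuffice (k w : ℕ) (input : List (List ℕ)) : Prop := magnitude input ^ k ≤ 2 ^ w

/-- On `w`-bit words, `P` halts on the input after at most `T` steps and answers, in variable `0`,
`1` if `answer` is true and `0` if it is false. -/
def DecidesWithin (w : ℕ) (P : Prog) (input : List (List ℕ)) (answer : Prop) (T : ℕ) : Prop :=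
  ∃ (t : ℕ) (s : State), Exec w P (State.init input) t s ∧ t ≤ T ∧
    (answer → s.var 0 = 1) ∧ (¬ answer → s.var 0 = 0)

end WordRAM

/-! The criterion. In a stable tree-bonded configuration the cut at a bond consists of that bond
alone, so every bond reaches the temperature τ (`TreeBonded.strong`). Hence every connected part can
be built by attaching single tiles (`Conn.producible`). By `uniquelyProduces_iff`, unique production
of A amounts to five conditions: A is connected; its bonds all reach τ; the tile types are exactly
the tiles that occur in A; `LeafClosed`, that is, a tile that one strong bond can attach beside a
cell p fits into a translate of the part of A that hangs together with p; and the absence of a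
`Rogue` pair, two disjoint connected parts of two copies of A that are held together by at least two
bonds of total strength at least τ. A rogue union is producible, but its second bond closes a cycle,
so it does not fit into a tree. Conversely, by induction along the production, a union over a single
bond is a connected configuration with strong bonds and embeds tile by tile by `LeafClosed.emb`,
whereas a union over several bonds would be rogue.

Rogue pairs. Fixing one bond between the copies, the root, fixes their relative position. Another
bond can be used beside the root if the tree paths from the root cells to its two ends do not
overlap. Several bonds can be used together if they are pairwise compatible in this sense; the
unions of the paths then serve as the two parts. What is wanted is the heaviest set of pairwise
compatible bonds, a clique problem, which planarity makes easy. A bond g and the root lie on a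
closed lattice curve, formed with their paths, and the parity of ray crossings tells on which side
of it another bond f lies, relative to a fixed side of the root edge. Of two compatible bonds
exactly one is to the left of the other (`side_add_side`), and "compatible and to the left" is
transitive (`Lt.trans`). The compatible sets are therefore the chains of a strict order
(`exists_family_of_chain`, `Family.chain`), and a heaviest chain is found by rounds of relaxation as
in the Bellman–Ford algorithm.

Cost. With n cells and L bits of τ there are at most 4n² roots, and each takes 4n rounds over (4n)²
pairs of slots with additions of L bits, which gives the order n⁵L; the table of reachability after
removal of a cell takes the order n⁵. Strengths with more bits than τ are replaced by τ, which
changes no comparison of a sum with τ.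

The machine. The algorithm is written in a small language of commands whose conditions are formulas
with bounded quantifiers and whose meaning is a function on states in unbounded arithmetic. The
simulation theorems `Fml.exec_comp` and `Cmd.exec_comp` transfer correctness and a time bound to the
word RAM once and for all. The exponents of the time bound are computed from the syntax in
`mainC_poly`. -/

namespace WordRAM

/-! ## Expressions without overflow -/

/-- The value of an expression in unbounded arithmetic. -/
def Expr.val (s : State) : Expr → ℕ
  | .const n => n
  | .var x => s.var x
  | .get a i => s.arr a (i.val s)
  | .op o e f => o.eval (e.val s) (f.val s)

/-- An exponent that bounds the variables of a given name. -/
def varDeg (x : ℕ) : ℕ := if x < 1000 then 4 else 0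

/-- An exponent that bounds the entries of a given array. -/
def arrDeg (a : ℕ) : ℕ := if a < 6 then 1 else 4

/-- The crude estimate n ≤ 2 ^ n ≤ N ^ n is enough, since only small constants occur in the program.
-/
def constDeg (n : ℕ) : ℕ := if n ≤ 1 then 0 else n

/-- An exponent that bounds the value of an expression. -/
def Expr.deg : Expr → ℕ
  | .const n => constDeg n
  | .var x => varDeg x
  | .get a _ => arrDeg a
  | .op .add e f => max e.deg f.deg + 1
  | .op .sub e _ => e.deg
  | .op .mul e f => e.deg + f.deg
  | .op .div e _ => e.deg
  | .op .lt _ _ => 0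
  | .op .eq _ _ => 0

/-- All subexpressions have degree less than `50`. -/
def Expr.small : Expr → Bool
  | .const n => decide (constDeg n < 50)
  | .var _ => true
  | .get _ i => i.small
  | .op o e f => e.small && f.small && decide ((Expr.op o e f).deg < 50)

/-- All variables of an expression satisfy `p`. -/
def Expr.reads (p : ℕ → Bool) : Expr → Bool
  | .const _ => true
  | .var x => p x
  | .get _ i => i.reads p
  | .op _ e f => e.reads p && f.reads p

/-- The invariant that excludes overflow; N is the magnitude of the input. The variables from 1000
on have exponent 0, so they hold bits. -/
structure State.Bounded (N : ℕ) (s : State) : Prop where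
  var : ∀ x, s.var x ≤ N ^ varDeg x
  arr : ∀ a i, s.arr a i ≤ N ^ arrDeg a

theorem le_pow_constDeg {N : ℕ} (hN : 2 ≤ N) (n : ℕ) : n ≤ N ^ constDeg n := by
  unfold constDeg
  split_ifs with h
  · simpa using h
  · exact (Nat.lt_two_pow_self).le.trans (Nat.pow_le_pow_left hN n)

theorem Expr.val_le {N : ℕ} (hN : 2 ≤ N) {s : State} (hs : s.Bounded N) (e : Expr) :
    e.val s ≤ N ^ e.deg := by
  have hN0 : 0 < N := by omega
  induction e with
  | const n => exact le_pow_constDeg hN n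
  | var x => exact hs.var x
  | get a i => exact hs.arr a _
  | op o e f he hf =>
    cases o <;> simp only [Expr.val, Op.eval, Expr.deg]
    -- Two summands below the larger of the two powers fit under one more factor N, because 2 ≤ N.
    · rw [pow_succ]
      have h1 := Nat.pow_le_pow_right hN0 (le_max_left e.deg f.deg)
      have h2 := Nat.pow_le_pow_right hN0 (le_max_right e.deg f.deg)
      nlinarith
    · omega
    · rw [pow_add]; exact Nat.mul_le_mul he hf
    · exact (Nat.div_le_self _ _).trans he
    · split_ifs <;> simp
    · split_ifs <;> simp

/-- All intermediate values stay below N ^ 50, so no reduction modulo the word size has an effect.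
This is where the factor 50 in the required word length comes from. -/
theorem Expr.eval_eq_val {N w : ℕ} (hN : 2 ≤ N) (hw : N ^ 50 ≤ 2 ^ w) {s : State}
    (hs : s.Bounded N) (e : Expr) (he : e.small) : e.eval w s = e.val s := by
  have key : ∀ d < 50, ∀ v ≤ N ^ d, v % 2 ^ w = v := fun d hd v hv =>
    Nat.mod_eq_of_lt (hv.trans_lt ((Nat.pow_lt_pow_right hN hd).trans_le hw))
  induction e with
  | const n =>
    exact key _ (by simpa [Expr.small] using he) _ (le_pow_constDeg hN n)
  | var x => rfl
  | get a i ih => simp only [Expr.eval, Expr.val]; rw [ih (by simpa [Expr.small] using he)]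
  | op o e f h1 h2 =>
    simp only [Expr.small, Bool.and_eq_true, decide_eq_true_eq] at he
    simp only [Expr.eval, h1 he.1.1, h2 he.1.2]
    exact key _ he.2 _ (Expr.val_le hN hs (Expr.op o e f))

theorem Expr.val_congr {s s' : State} (p : ℕ → Bool) (hv : ∀ x, p x → s.var x = s'.var x)
    (ha : s.arr = s'.arr) (e : Expr) (he : e.reads p) : e.val s = e.val s' := by
  induction e with
  | const n => rfl
  | var x => exact hv x he
  | get a i ih => simp only [Expr.val]; rw [ih he, ha]
  | op o e f h1 h2 =>
    simp only [Expr.reads, Bool.and_eq_true] at he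
    simp only [Expr.val, h1 he.1, h2 he.2]

@[simp] theorem State.setVar_var (s : State) (x v y : ℕ) :
    (s.setVar x v).var y = if y = x then v else s.var y := by
  simp [State.setVar, Function.update_apply]

@[simp] theorem State.setVar_arr (s : State) (x v : ℕ) : (s.setVar x v).arr = s.arr := rfl

@[simp] theorem State.setArr_var (s : State) (a i v : ℕ) : (s.setArr a i v).var = s.var := rfl

@[simp] theorem State.setArr_arr (s : State) (a i v b j : ℕ) :
    (s.setArr a i v).arr b j = if b = a ∧ j = i then v else s.arr b j := by
  simp only [State.setArr, Function.update_apply]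
  split_ifs with h1 h2 <;> simp_all

theorem State.Bounded.setVar {N : ℕ} {s : State} (hs : s.Bounded N) {x v : ℕ}
    (h : v ≤ N ^ varDeg x) : (s.setVar x v).Bounded N where
  var y := by
    rw [State.setVar_var]; split_ifs with hy
    · rw [hy]; exact h
    · exact hs.var y
  arr := hs.arr

theorem State.Bounded.setArr {N : ℕ} {s : State} (hs : s.Bounded N) {a i v : ℕ}
    (h : v ≤ N ^ arrDeg a) : (s.setArr a i v).Bounded N where
  var := hs.var
  arr b j := by
    rw [State.setArr_arr]; split_ifs with hy
    · rw [hy.1]; exact h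
    · exact hs.arr b j

/-! ## Loops -/

/-- The part of a counting loop after its initialization. -/
def countLoop (x b : ℕ) (body : Prog) : Prog :=
  .while (.op .lt (.var x) (.var b))
    (.seq body (.assign x (.op .add (.var x) (.const 1))))

/-- The invariant refers to the state after the counter has been increased. Each iteration adds 8
steps to those of the body: 4 for the test and 4 for the increment; the last, failing test costs 4.
-/
theorem exec_countLoop {w x b cnt T : ℕ} {body : Prog} (I : ℕ → State → Prop)
    (hcnt : cnt < 2 ^ w) (hw : 1 < 2 ^ w)
    (hstep : ∀ i s, i < cnt → I i s → s.var x = i → s.var b = cnt →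
      ∃ t s', Exec w body s t s' ∧ t ≤ T ∧ s'.var x = i ∧
        (s'.setVar x (i + 1)).var b = cnt ∧ I (i + 1) (s'.setVar x (i + 1))) :
    ∀ i s, i ≤ cnt → I i s → s.var x = i → s.var b = cnt →
      ∃ t s', Exec w (countLoop x b body) s t s' ∧ t ≤ (cnt - i) * (T + 8) + 4 ∧
        I cnt s' := by
  suffices H : ∀ k i s, i + k = cnt → I i s → s.var x = i → s.var b = cnt →
      ∃ t s', Exec w (countLoop x b body) s t s' ∧ t ≤ k * (T + 8) + 4 ∧ I cnt s' from
    fun i s hi => H (cnt - i) i s (by omega)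
  intro k
  induction k with
  | zero =>
    intro i s hi hI hx hb
    refine ⟨_, s, Exec.whileFalse ?_, by simp [Expr.cost], by simpa [← hi] using hI⟩
    simp [Expr.eval, Op.eval, hx, hb, ← hi]
  | succ k ih =>
    intro i s hi hI hx hb
    obtain ⟨t, s', he, ht, hx', hb', hI'⟩ := hstep i s (by omega) hI hx hb
    obtain ⟨t2, s2, he2, ht2, hI2⟩ := ih (i + 1) (s'.setVar x (i + 1)) (by omega) hI'
      (by simp) hb'
    refine ⟨_, s2, Exec.whileTrue (s₁ := s'.setVar x (i + 1)) (t₁ := t + 4) ?_ ?_ he2, ?_, hI2⟩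
    · have : i < s.var b := by omega
      simp [Expr.eval, Op.eval, hx, this, Nat.mod_eq_of_lt hw]
    · have := Exec.assign (w := w) s' x (.op .add (.var x) (.const 1))
      simp only [Expr.eval, Op.eval, hx', Expr.cost, Nat.mod_eq_of_lt hw] at this
      rw [Nat.mod_eq_of_lt (by omega)] at this
      exact Exec.seq he this
    · simp only [Expr.cost]
      rw [Nat.add_mul]
      omega

/-! ## Formulas -/

/-- Formulas with bounded quantifiers `ex x b` (for some `x` less than the variable `b`) and
`par x b` (for an odd number of `x` less than the variable `b`). -/
inductive Fml
  | atom (e : Expr)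
  | not (φ : Fml)
  | and (φ ψ : Fml)
  | iff (φ ψ : Fml)
  | ex (x b : ℕ) (φ : Fml)
  | par (x b : ℕ) (φ : Fml)

open Classical in
noncomputable def ind01 (p : Prop) : ℕ := if p then 1 else 0

theorem ind01_le (p : Prop) : ind01 p ≤ 1 := by unfold ind01; split_ifs <;> omega
@[simp] theorem ind01_true {p : Prop} (h : p) : ind01 p = 1 := by simp [ind01, h]
@[simp] theorem ind01_false {p : Prop} (h : ¬ p) : ind01 p = 0 := by simp [ind01, h]
@[simp] theorem ind01_eq_one {p : Prop} : ind01 p = 1 ↔ p := by simp [ind01]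
@[simp] theorem ind01_eq_zero {p : Prop} : ind01 p = 0 ↔ ¬ p := by simp [ind01]

/-- The truth of a formula. -/
def Fml.den : Fml → State → Prop
  | .atom e, s => e.val s ≠ 0
  | .not φ, s => ¬ φ.den s
  | .and φ ψ, s => φ.den s ∧ ψ.den s
  | .iff φ ψ, s => (φ.den s ↔ ψ.den s)
  | .ex x b φ, s => ∃ i < s.var b, φ.den (s.setVar x i)
  | .par x b φ, s => Odd (∑ i ∈ Finset.range (s.var b), ind01 (φ.den (s.setVar x i)))

/-- The program that evaluates a formula to the variable `1000 + r`. -/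
def Fml.comp : Fml → ℕ → Prog
  | .atom e, r => .assign (1000 + r) (.op .lt (.const 0) e)
  | .not φ, r => .seq (φ.comp r) (.assign (1000 + r) (.op .eq (.var (1000 + r)) (.const 0)))
  | .and φ ψ, r => .seq (φ.comp r) (.seq (ψ.comp (r + 1))
      (.assign (1000 + r) (.op .mul (.var (1000 + r)) (.var (1000 + (r + 1))))))
  | .iff φ ψ, r => .seq (φ.comp r) (.seq (ψ.comp (r + 1))
      (.assign (1000 + r) (.op .eq (.var (1000 + r)) (.var (1000 + (r + 1))))))
  | .ex x b φ, r => .seq (.assign (1000 + r) (.const 0)) (.seq (.assign x (.const 0))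
      (countLoop x b (.seq (φ.comp (r + 1)) (.assign (1000 + r)
        (.op .lt (.const 0) (.op .add (.var (1000 + r)) (.var (1000 + (r + 1)))))))))
  | .par x b φ, r => .seq (.assign (1000 + r) (.const 0)) (.seq (.assign x (.const 0))
      (countLoop x b (.seq (φ.comp (r + 1)) (.assign (1000 + r)
        (.op .eq (.op .eq (.var (1000 + r)) (.var (1000 + (r + 1)))) (.const 0))))))

/-- Atoms read program variables and bound variables only, bound variables are taken from
`500, …, 999` without shadowing, and loop bounds are among the variables `1, …, 9`. -/
def Fml.wf : Fml → List ℕ → Bool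
  | .atom e, B => e.small && e.reads fun x => decide (x < 500) || decide (x ∈ B)
  | .not φ, B => φ.wf B
  | .and φ ψ, B => φ.wf B && ψ.wf B
  | .iff φ ψ, B => φ.wf B && ψ.wf B
  | .ex x b φ, B => decide (500 ≤ x) && decide (x < 1000) && decide (x ∉ B) &&
      decide (0 < b) && decide (b < 10) && φ.wf (x :: B)
  | .par x b φ, B => decide (500 ≤ x) && decide (x < 1000) && decide (x ∉ B) &&
      decide (0 < b) && decide (b < 10) && φ.wf (x :: B)

/-- A bound for the time that the evaluation of a formula takes; `β` gives the loop bounds. -/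
def Fml.time (β : ℕ → ℕ) : Fml → ℕ
  | .atom e => e.cost + 3
  | .not φ => φ.time β + 4
  | .and φ ψ => φ.time β + ψ.time β + 4
  | .iff φ ψ => φ.time β + ψ.time β + 4
  | .ex _ b φ => β b * (φ.time β + 14) + 8
  | .par _ b φ => β b * (φ.time β + 14) + 8

/-- Here `s` is the state of the machine and `σ` the ideal one. Result registers, and bound
variables outside of their scope, may differ, because the evaluation of formulas overwrites them. -/
structure Agree (B : List ℕ) (s σ : State) : Prop where
  var : ∀ x, x < 500 ∨ x ∈ B → s.var x = σ.var x
  arr : s.arr = σ.arr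

theorem Agree.mono {B C : List ℕ} {s σ : State} (h : Agree C s σ) (hBC : ∀ x ∈ B, x ∈ C) :
    Agree B s σ :=
  ⟨fun x hx => h.var x (hx.imp id (hBC x)), h.arr⟩

/-- The variables 1 to 9 are the only admissible loop bounds, and no command writes them; so the
time can be bounded in terms of one fixed `β`. -/
def Consts (β : ℕ → ℕ) (s : State) : Prop := ∀ b, 0 < b → b < 10 → s.var b = β b

structure Setting (w N : ℕ) : Prop where
  two_le : 2 ≤ N
  pow_le : N ^ 50 ≤ 2 ^ w

theorem Setting.one_lt {w N : ℕ} (h : Setting w N) : 1 < 2 ^ w :=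
  (Nat.one_lt_pow (by norm_num) h.two_le).trans_le h.pow_le

theorem Setting.bound_lt {w N : ℕ} (h : Setting w N) {v : ℕ} (hv : v ≤ N ^ 4) : v < 2 ^ w :=
  hv.trans_lt ((Nat.pow_lt_pow_right h.two_le (by norm_num)).trans_le h.pow_le)

theorem exec_assign' {w N : ℕ} (hS : Setting w N) {s : State} (hs : s.Bounded N) (x : ℕ)
    (e : Expr) (he : e.small) : Exec w (.assign x e) s (e.cost + 1) (s.setVar x (e.val s)) := by
  have := Exec.assign (w := w) s x e
  rwa [Expr.eval_eq_val hS.two_le hS.pow_le hs e he] at this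

theorem varDeg_res (r : ℕ) : varDeg (1000 + r) = 0 := by unfold varDeg; split_ifs <;> omega
theorem varDeg_lo {x : ℕ} (h : x < 1000) : varDeg x = 4 := by unfold varDeg; split_ifs; rfl

/-- What the evaluation of a formula to the variable `1000 + r` achieves. -/
structure EvalPost (N : ℕ) (B : List ℕ) (r : ℕ) (s σ : State) (p : Prop) (s' : State) :
    Prop where
  agree : Agree B s' σ
  -- The result registers form a stack: a subformula that is evaluated to register r + 1 preserves
  -- what its parent has stored in register r.
  keep : ∀ v, 1000 ≤ v → v < 1000 + r → s'.var v = s.var v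
  bounded : s'.Bounded N
  res : s'.var (1000 + r) = ind01 p

theorem Agree.setRes {B : List ℕ} (hB : ∀ x ∈ B, x < 1000) {s σ : State} (h : Agree B s σ)
    (r v : ℕ) : Agree B (s.setVar (1000 + r) v) σ := by
  refine ⟨fun x hx => ?_, h.arr⟩
  have : x ≠ 1000 + r := by
    rcases hx with hx | hx
    · omega
    · have := hB x hx; omega
  simp [this, h.var x hx]

theorem exec_assign_res {w N : ℕ} (hS : Setting w N) {B : List ℕ} (hB : ∀ x ∈ B, x < 1000)
    {r : ℕ} {s₀ s σ : State} {e : Expr} {p : Prop} (he : e.small) (hs : s.Bounded N)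
    (hag : Agree B s σ) (hk : ∀ v, 1000 ≤ v → v < 1000 + r → s.var v = s₀.var v)
    (hp : e.val s = ind01 p) :
    ∃ s', Exec w (.assign (1000 + r) e) s (e.cost + 1) s' ∧ EvalPost N B r s₀ σ p s' := by
  refine ⟨_, exec_assign' hS hs _ _ he, hag.setRes hB _ _, ?_, ?_, ?_⟩
  · intro v h1 h2
    have : v ≠ 1000 + r := by omega
    simp [this, hk v h1 h2]
  · refine hs.setVar ?_
    rw [hp, varDeg_res]; simpa using ind01_le p
  · simp [hp]

theorem Agree.set {B : List ℕ} {s σ : State} (h : Agree B s σ) (x i : ℕ) :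
    Agree (x :: B) (s.setVar x i) (σ.setVar x i) :=
  ⟨fun y hy => by
    simp only [State.setVar_var]; split_ifs with hyx
    · rfl
    · exact h.var y (hy.imp id fun hy => (List.mem_cons.1 hy).resolve_left hyx), h.arr⟩

theorem Fml.exec_comp {w N : ℕ} (hS : Setting w N) {β : ℕ → ℕ} (φ : Fml) :
    ∀ (r : ℕ) (B : List ℕ) (s σ : State), (∀ x ∈ B, x < 1000) → φ.wf B → Agree B s σ →
      s.Bounded N → Consts β s →
      ∃ t s', Exec w (φ.comp r) s t s' ∧ t ≤ φ.time β ∧ EvalPost N B r s σ (φ.den σ) s' := by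
  have hC : ∀ {B : List ℕ} {s s' σ : State}, Consts β s → Agree B s σ → Agree B s' σ →
      Consts β s' := fun hs h h' b h1 h2 => by
    rw [h'.var b (Or.inl (by omega)), ← h.var b (Or.inl (by omega)), hs b h1 h2]
  -- the common part of the two quantifiers
  have quant : ∀ (x b r : ℕ) (B : List ℕ) (s σ : State) (φ : Fml) (e : Expr)
      (Q : ℕ → Prop),
      (∀ (r : ℕ) (B : List ℕ) (s σ : State), (∀ x ∈ B, x < 1000) → φ.wf B → Agree B s σ →
        s.Bounded N → Consts β s →
        ∃ t s', Exec w (φ.comp r) s t s' ∧ t ≤ φ.time β ∧ EvalPost N B r s σ (φ.den σ) s') →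
      (Fml.ex x b φ).wf B → (∀ x ∈ B, x < 1000) → Agree B s σ → s.Bounded N → Consts β s →
      e.small → e.cost = 5 → ¬ Q 0 →
      (∀ i s', s'.var (1000 + r) = ind01 (Q i) →
        s'.var (1000 + (r + 1)) = ind01 (φ.den (σ.setVar x i)) → e.val s' = ind01 (Q (i + 1))) →
      ∃ t s', Exec w (.seq (.assign (1000 + r) (.const 0)) (.seq (.assign x (.const 0))
          (countLoop x b (.seq (φ.comp (r + 1)) (.assign (1000 + r) e))))) s t s' ∧
        t ≤ β b * (φ.time β + 14) + 8 ∧ EvalPost N B r s σ (Q (σ.var b)) s' := by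
    intro x b r B s σ φ e Q ih hwf hB hag hs hc he hcost hQ0 hstep
    simp only [Fml.wf, Bool.and_eq_true, decide_eq_true_eq] at hwf
    obtain ⟨⟨⟨⟨⟨hx1, hx2⟩, hxB⟩, hb0⟩, hb10⟩, hwf⟩ := hwf
    have hsb : s.var b = β b := hc b hb0 hb10
    have hσb : σ.var b = β b := by rw [← hag.var b (Or.inl (by omega)), hsb]
    have hbN : β b ≤ N ^ 4 := by rw [← hsb, ← varDeg_lo (x := b) (by omega)]; exact hs.var b
    set s1 := (s.setVar (1000 + r) 0).setVar x 0 with hs1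
    have hb1 : s1.Bounded N := (hs.setVar (Nat.zero_le _)).setVar (Nat.zero_le _)
    have hsx : ∀ {s' : State} (i : ℕ), Agree B s' σ → Agree B (s'.setVar x i) σ := fun i h =>
      ⟨fun y hy => by
        have : y ≠ x := by
          rintro rfl
          rcases hy with hy | hy
          · omega
          · exact hxB hy
        simp [this, h.var y hy], h.arr⟩
    -- The proposition `Q i` is what the quantifier says about the first i instances, so the final
    -- postcondition with `Q i` in place of the full quantifier is an invariant.
    let I : ℕ → State → Prop := fun i s' => EvalPost N B r s σ (Q i) s'
    obtain ⟨t, s', hex, ht, hI⟩ := exec_countLoop (w := w) (x := x) (b := b) (cnt := β b)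
      (T := φ.time β + 6) (body := .seq (φ.comp (r + 1)) (.assign (1000 + r) e)) I
      (hS.bound_lt hbN) hS.one_lt (by
        intro i s2 hi hI hx hb
        have hagx : Agree (x :: B) s2 (σ.setVar x i) := by
          refine ⟨fun y hy => ?_, hI.agree.arr⟩
          simp only [State.setVar_var]; split_ifs with hyx
          · rw [hyx, hx]
          · exact hI.agree.var y (hy.imp id fun hy => (List.mem_cons.1 hy).resolve_left hyx)
        obtain ⟨t3, s3, he3, ht3, hp3⟩ := ih (r + 1) (x :: B) s2 (σ.setVar x i)
          (by
            intro y hy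
            rcases List.mem_cons.1 hy with rfl | hy
            · exact hx2
            · exact hB y hy) hwf hagx hI.bounded (hC hc hag hI.agree)
        have hag3 : Agree B s3 σ := by
          refine ⟨fun y hy => ?_, hp3.agree.arr⟩
          rw [hp3.agree.var y (hy.imp id (List.mem_cons_of_mem _))]
          have : y ≠ x := by
            rintro rfl
            rcases hy with hy | hy
            · omega
            · exact hxB hy
          simp [this]
        obtain ⟨s4, he4, hp4⟩ := exec_assign_res (p := Q (i + 1)) hS hB (r := r) (s₀ := s)
          he hp3.bounded hag3
          (fun v h1 h2 => by
            rw [hp3.keep v h1 (by omega), hI.keep v h1 h2])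
          (hstep i s3 (by rw [hp3.keep _ (by omega) (by omega), hI.res]) hp3.res)
        have hx4 : s4.var x = i := by
          have h4 : s4 = s3.setVar (1000 + r) (s4.var (1000 + r)) := by
            cases he4; simp
          rw [h4, State.setVar_var, if_neg (by omega),
            hp3.agree.var x (Or.inr (by simp))]
          simp
        refine ⟨_, s4, Exec.seq he3 he4, by omega, hx4, ?_, hsx _ hp4.agree, ?_, ?_, ?_⟩
        · rw [(hsx (i + 1) hp4.agree).var b (Or.inl (by omega)), hσb]
        · intro v h1 h2
          rw [State.setVar_var, if_neg (by omega), hp4.keep v h1 h2]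
        · refine hp4.bounded.setVar ?_
          rw [varDeg_lo hx2]; omega
        · rw [State.setVar_var, if_neg (by omega), hp4.res])
      0 s1 (Nat.zero_le _) ⟨hsx _ (hag.setRes hB _ _), by
          intro v h1 h2
          have e1 : v ≠ x := by omega
          have e2 : v ≠ 1000 + r := by omega
          simp [hs1, e1, e2], hb1, by
          have : 1000 + r ≠ x := by omega
          simp [hs1, this, hQ0]⟩ (by simp [hs1]) (by
          have e1 : b ≠ x := by omega
          have e2 : b ≠ 1000 + r := by omega
          simp [hs1, e1, e2, hsb])
    refine ⟨_, s', Exec.seq (exec_assign' hS hs _ (.const 0) rfl)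
      (Exec.seq (exec_assign' hS (hs.setVar (Nat.zero_le _)) x (.const 0) rfl) hex), ?_, ?_⟩
    · simp only [Expr.cost]
      rw [Nat.sub_zero] at ht
      linarith
    · rw [hσb]; exact hI
  induction φ with
  | atom e =>
    intro r B s σ hB hwf hag hs hc
    simp only [Fml.wf, Bool.and_eq_true] at hwf
    obtain ⟨s', h1, h2⟩ := exec_assign_res (p := (Fml.atom e).den σ) (s₀ := s)
      (e := .op .lt (.const 0) e) (r := r) hS hB (by
        simp [Expr.small, hwf.1, Expr.deg, constDeg]) hs hag (fun _ _ _ => rfl) (by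
        simp only [Expr.val, Op.eval, Fml.den]
        rw [Expr.val_congr _ (fun x hx => hag.var x (by simpa using hx)) hag.arr e hwf.2]
        by_cases h : e.val σ = 0 <;> simp [ind01, h, Nat.pos_iff_ne_zero])
    exact ⟨_, s', h1, by simp only [Expr.cost, Fml.time]; omega, h2⟩
  | not φ ih =>
    intro r B s σ hB hwf hag hs hc
    obtain ⟨t, s', h1, h2, h3⟩ := ih r B s σ hB hwf hag hs hc
    obtain ⟨s2, h4, h5⟩ := exec_assign_res (p := (Fml.not φ).den σ) (s₀ := s)
      (e := .op .eq (.var (1000 + r)) (.const 0)) (r := r) hS hB (by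
        simp [Expr.small, Expr.deg, constDeg]) h3.bounded h3.agree h3.keep (by
        simp only [Expr.val, Op.eval, Fml.den, h3.res]
        by_cases h : φ.den σ <;> simp [ind01, h])
    exact ⟨_, s2, Exec.seq h1 h4, by simp only [Expr.cost, Fml.time]; omega, h5⟩
  | and φ ψ ih1 ih2 =>
    intro r B s σ hB hwf hag hs hc
    simp only [Fml.wf, Bool.and_eq_true] at hwf
    obtain ⟨t, s', h1, h2, h3⟩ := ih1 r B s σ hB hwf.1 hag hs hc
    obtain ⟨t2, s2, i1, i2, i3⟩ := ih2 (r + 1) B s' σ hB hwf.2 h3.agree h3.bounded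
      (hC hc hag h3.agree)
    obtain ⟨s3, h4, h5⟩ := exec_assign_res (p := (Fml.and φ ψ).den σ) (s₀ := s)
      (e := .op .mul (.var (1000 + r)) (.var (1000 + (r + 1)))) (r := r) hS hB (by
        simp [Expr.small, Expr.deg, varDeg]) i3.bounded i3.agree
      (fun v j1 j2 => by rw [i3.keep v j1 (by omega), h3.keep v j1 j2]) (by
        simp only [Expr.val, Op.eval, Fml.den, i3.res, i3.keep (1000 + r) (by omega) (by omega),
          h3.res]
        by_cases h : φ.den σ <;> by_cases h' : ψ.den σ <;> simp [ind01, h, h'])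
    exact ⟨_, s3, Exec.seq h1 (Exec.seq i1 h4), by simp only [Expr.cost, Fml.time]; omega, h5⟩
  | iff φ ψ ih1 ih2 =>
    intro r B s σ hB hwf hag hs hc
    simp only [Fml.wf, Bool.and_eq_true] at hwf
    obtain ⟨t, s', h1, h2, h3⟩ := ih1 r B s σ hB hwf.1 hag hs hc
    obtain ⟨t2, s2, i1, i2, i3⟩ := ih2 (r + 1) B s' σ hB hwf.2 h3.agree h3.bounded
      (hC hc hag h3.agree)
    obtain ⟨s3, h4, h5⟩ := exec_assign_res (p := (Fml.iff φ ψ).den σ) (s₀ := s)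
      (e := .op .eq (.var (1000 + r)) (.var (1000 + (r + 1)))) (r := r) hS hB (by
        simp [Expr.small, Expr.deg]) i3.bounded i3.agree
      (fun v j1 j2 => by rw [i3.keep v j1 (by omega), h3.keep v j1 j2]) (by
        simp only [Expr.val, Op.eval, Fml.den, i3.res, i3.keep (1000 + r) (by omega) (by omega),
          h3.res]
        by_cases h : φ.den σ <;> by_cases h' : ψ.den σ <;> simp [ind01, h, h'])
    exact ⟨_, s3, Exec.seq h1 (Exec.seq i1 h4), by simp only [Expr.cost, Fml.time]; omega, h5⟩
  | ex x b φ ih =>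
    intro r B s σ hB hwf hag hs hc
    refine quant x b r B s σ φ _ (fun n => ∃ i < n, φ.den (σ.setVar x i)) ih hwf hB hag hs hc
      ?_ rfl (by simp) ?_
    · simp [Expr.small, Expr.deg, constDeg, varDeg]
    · intro i s' h1 h2
      simp only [Expr.val, Op.eval, h1, h2, Nat.lt_succ_iff_lt_or_eq]
      by_cases h : φ.den (σ.setVar x i)
      · rw [ind01_true h, if_pos (by omega), ind01_true ⟨i, Or.inr rfl, h⟩]
      · rw [ind01_false h]
        by_cases h' : ∃ j < i, φ.den (σ.setVar x j)
        · obtain ⟨j, hj, hj'⟩ := h'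
          rw [ind01_true ⟨j, hj, hj'⟩, ind01_true ⟨j, Or.inl hj, hj'⟩]; rfl
        · rw [ind01_false h', ind01_false]; rfl
          rintro ⟨j, hj | rfl, hj'⟩
          · exact h' ⟨j, hj, hj'⟩
          · exact h hj'
  | par x b φ ih =>
    intro r B s σ hB hwf hag hs hc
    refine quant x b r B s σ φ _
      (fun n => Odd (∑ i ∈ Finset.range n, ind01 (φ.den (σ.setVar x i)))) ih
      (by simpa [Fml.wf] using hwf) hB hag hs hc ?_ rfl (by simp) ?_
    · simp [Expr.small, Expr.deg, constDeg]
    · intro i s' h1 h2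
      simp only [Expr.val, Op.eval, h1, h2, Finset.sum_range_succ, Nat.odd_add]
      by_cases h : φ.den (σ.setVar x i) <;>
        by_cases h' : Odd (∑ j ∈ Finset.range i, ind01 (φ.den (σ.setVar x j))) <;>
        simp [ind01_true, ind01_false, h, h']

end WordRAM

namespace WordRAM

/-! ## Commands -/

/-- Structured programs with formulas as conditions and counting loops. -/
inductive Cmd
  | skip
  | assign (x : ℕ) (e : Expr)
  | put (a : ℕ) (i e : Expr)
  | seq (P Q : Cmd)
  | ite (φ : Fml) (P Q : Cmd)
  | loop (x b : ℕ) (P : Cmd)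

/-- The effect of a command on the memory, in unbounded arithmetic. -/
noncomputable def Cmd.run : Cmd → State → State
  | .skip, s => s
  | .assign x e, s => s.setVar x (e.val s)
  | .put a i e, s => s.setArr a (i.val s) (e.val s)
  | .seq P Q, s => Q.run (P.run s)
  | .ite φ P Q, s => open Classical in if φ.den s then P.run s else Q.run s
  | .loop x b P, s =>
    (fun s => (P.run s).setVar x ((P.run s).var x + 1))^[s.var b] (s.setVar x 0)

def Cmd.comp : Cmd → Prog
  | .skip => .skip
  | .assign x e => .assign x e
  | .put a i e => .put a i e
  | .seq P Q => .seq P.comp Q.comp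
  | .ite φ P Q => .seq (φ.comp 0) (.ite (.var 1000) P.comp Q.comp)
  | .loop x b P => .seq (.assign x (.const 0)) (countLoop x b P.comp)

/-- The variables that a command writes. -/
def Cmd.wv : Cmd → List ℕ
  | .skip => []
  | .assign x _ => [x]
  | .put _ _ _ => []
  | .seq P Q => P.wv ++ Q.wv
  | .ite _ P Q => P.wv ++ Q.wv
  | .loop x _ P => x :: P.wv

/-- The arrays that a command writes. -/
def Cmd.wa : Cmd → List ℕ
  | .skip => []
  | .assign _ _ => []
  | .put a _ _ => [a]
  | .seq P Q => P.wa ++ Q.wa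
  | .ite _ P Q => P.wa ++ Q.wa
  | .loop _ _ P => P.wa

def progVar (x : ℕ) : Bool := decide (x < 500)

/-- The syntactic conditions behind the simulation: the loop bounds 1 to 9 and the input arrays 0 to
5 are never written, and stored values have degree at most 4, which preserves `State.Bounded`. Index
expressions are not stored and may have a larger degree. -/
def Cmd.wt : Cmd → Bool
  | .skip => true
  | .assign x e => decide (x < 500) && (decide (x = 0) || decide (10 ≤ x)) && e.small &&
      e.reads progVar && decide (e.deg ≤ 4)
  | .put a i e => decide (6 ≤ a) && i.small && i.reads progVar && e.small && e.reads progVar &&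
      decide (e.deg ≤ 4)
  | .seq P Q => P.wt && Q.wt
  | .ite φ P Q => φ.wf [] && P.wt && Q.wt
  | .loop x b P => decide (10 ≤ x) && decide (x < 500) && decide (0 < b) && decide (b < 10) &&
      decide (x ∉ P.wv) && P.wt

def Cmd.time (β : ℕ → ℕ) : Cmd → ℕ
  | .skip => 1
  | .assign _ e => e.cost + 1
  | .put _ i e => i.cost + e.cost + 1
  | .seq P Q => P.time β + Q.time β
  | .ite φ P Q => φ.time β + P.time β + Q.time β + 2
  | .loop _ b P => β b * (P.time β + 8) + 6

theorem Cmd.run_var (P : Cmd) (s : State) {x : ℕ} (hx : x ∉ P.wv) :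
    (P.run s).var x = s.var x := by
  induction P generalizing s with
  | skip => rfl
  | assign y e =>
    have : x ≠ y := by simpa [Cmd.wv] using hx
    simp [Cmd.run, this]
  | put a i e => rfl
  | seq P Q h1 h2 =>
    simp only [Cmd.wv, List.mem_append, not_or] at hx
    simp only [Cmd.run]; rw [h2 _ hx.2, h1 _ hx.1]
  | ite φ P Q h1 h2 =>
    simp only [Cmd.wv, List.mem_append, not_or] at hx
    simp only [Cmd.run]; split_ifs
    · exact h1 _ hx.1
    · exact h2 _ hx.2
  | loop y b P ih =>
    simp only [Cmd.wv, List.mem_cons, not_or] at hx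
    simp only [Cmd.run]
    have : ∀ k s, ((fun s => (P.run s).setVar y ((P.run s).var y + 1))^[k] s).var x = s.var x := by
      intro k
      induction k with
      | zero => intro s; rfl
      | succ k ihk =>
        intro s
        rw [Function.iterate_succ_apply, ihk]
        simp [hx.1, ih _ hx.2]
    rw [this]; simp [hx.1]

theorem Cmd.run_arr (P : Cmd) (s : State) {a : ℕ} (ha : a ∉ P.wa) :
    (P.run s).arr a = s.arr a := by
  induction P generalizing s with
  | skip => rfl
  | assign y e => rfl
  | put b i e =>
    have : a ≠ b := by simpa [Cmd.wa] using ha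
    funext j; simp [Cmd.run, this]
  | seq P Q h1 h2 =>
    simp only [Cmd.wa, List.mem_append, not_or] at ha
    simp only [Cmd.run]; rw [h2 _ ha.2, h1 _ ha.1]
  | ite φ P Q h1 h2 =>
    simp only [Cmd.wa, List.mem_append, not_or] at ha
    simp only [Cmd.run]; split_ifs
    · exact h1 _ ha.1
    · exact h2 _ ha.2
  | loop y b P ih =>
    simp only [Cmd.run]
    have : ∀ k s, ((fun s => (P.run s).setVar y ((P.run s).var y + 1))^[k] s).arr a = s.arr a := by
      intro k
      induction k with
      | zero => intro s; rfl
      | succ k ihk =>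
        intro s
        rw [Function.iterate_succ_apply, ihk]
        exact ih _ ha
    rw [this]; rfl

theorem Cmd.wt_wv {P : Cmd} (h : P.wt) : ∀ x ∈ P.wv, x = 0 ∨ 10 ≤ x := by
  induction P with
  | skip => simp [Cmd.wv]
  | assign y e =>
    simp only [Cmd.wt, Bool.and_eq_true, Bool.or_eq_true, decide_eq_true_eq] at h
    simpa [Cmd.wv] using h.1.1.1.2
  | put b i e => simp [Cmd.wv]
  | seq P Q h1 h2 =>
    simp only [Cmd.wt, Bool.and_eq_true] at h
    intro x hx
    exact (List.mem_append.1 hx).elim (h1 h.1 x) (h2 h.2 x)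
  | ite φ P Q h1 h2 =>
    simp only [Cmd.wt, Bool.and_eq_true] at h
    intro x hx
    exact (List.mem_append.1 hx).elim (h1 h.1.2 x) (h2 h.2 x)
  | loop y b P ih =>
    simp only [Cmd.wt, Bool.and_eq_true, decide_eq_true_eq] at h
    intro x hx
    rcases List.mem_cons.1 hx with rfl | hx
    · right; omega
    · exact ih h.2 x hx

/-- Induction along the iterations of a loop. -/
theorem Cmd.run_loop {x b : ℕ} {P : Cmd} {s : State} (hx : x ∉ P.wv) (hb : b ∉ x :: P.wv)
    (I : ℕ → State → Prop) (h0 : I 0 (s.setVar x 0))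
    (hstep : ∀ i s', i < s.var b → I i s' → s'.var x = i → s'.var b = s.var b →
      I (i + 1) ((P.run s').setVar x (i + 1))) :
    I (s.var b) ((Cmd.loop x b P).run s) := by
  simp only [List.mem_cons, not_or] at hb
  simp only [Cmd.run]
  set F : State → State := fun s => (P.run s).setVar x ((P.run s).var x + 1) with hF
  have : ∀ k ≤ s.var b, (F^[k] (s.setVar x 0)).var x = k ∧
      (F^[k] (s.setVar x 0)).var b = s.var b ∧ I k (F^[k] (s.setVar x 0)) := by
    intro k
    induction k with
    | zero => intro _; simp [h0, hb.1]
    | succ k ih =>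
      intro hk
      obtain ⟨h1, h2, h3⟩ := ih (by omega)
      rw [Function.iterate_succ_apply']
      have e : F (F^[k] (s.setVar x 0)) =
          (P.run (F^[k] (s.setVar x 0))).setVar x (k + 1) := by
        rw [hF]; simp only; rw [P.run_var _ hx, ← hF, h1]
      rw [e]
      refine ⟨by simp, ?_, hstep k _ (by omega) h3 h1 h2⟩
      rw [State.setVar_var, if_neg hb.1, P.run_var _ hb.2, h2]
  exact (this _ le_rfl).2.2

/-- The simulation theorem. After it, correctness proofs deal only with the function `Cmd.run`, and
running times only with the recursion `Cmd.time`; neither words nor single steps appear again. -/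
theorem Cmd.exec_comp {w N : ℕ} (hS : Setting w N) {β : ℕ → ℕ} (P : Cmd) (hP : P.wt) :
    ∀ (s σ : State), Agree [] s σ → s.Bounded N → Consts β s →
      ∃ t s', Exec w P.comp s t s' ∧ t ≤ P.time β ∧ Agree [] s' (P.run σ) ∧ s'.Bounded N := by
  have readsOK : ∀ {s σ : State}, Agree [] s σ → ∀ e : Expr, e.reads progVar →
      e.val s = e.val σ := fun h e he =>
    Expr.val_congr _ (fun x hx => h.var x (Or.inl (by simpa [progVar] using hx))) h.arr e he
  have hC : ∀ {s s' σ : State}, Consts β s → Agree [] s σ → Agree [] s' σ → Consts β s' :=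
    fun hs h h' b h1 h2 => by
      rw [h'.var b (Or.inl (by omega)), ← h.var b (Or.inl (by omega)), hs b h1 h2]
  have hR : ∀ {P : Cmd} {s s' σ : State}, P.wt → Consts β s → Agree [] s σ →
      Agree [] s' (P.run σ) → Consts β s' := fun {P} {s s' σ} hP hs h h' b h1 h2 => by
    rw [h'.var b (Or.inl (by omega)), P.run_var _ fun hb => by
      have := Cmd.wt_wv hP b hb; omega, ← h.var b (Or.inl (by omega)), hs b h1 h2]
  induction P with
  | skip => intro s σ h hs hc; exact ⟨1, s, Exec.skip s, le_rfl, h, hs⟩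
  | assign x e =>
    intro s σ h hs hc
    simp only [Cmd.wt, Bool.and_eq_true, Bool.or_eq_true, decide_eq_true_eq] at hP
    refine ⟨_, _, exec_assign' hS hs x e hP.1.1.2, le_rfl, ?_, hs.setVar ?_⟩
    · refine ⟨fun y hy => ?_, h.arr⟩
      simp only [Cmd.run, State.setVar_var, readsOK h e hP.1.2]
      split_ifs
      · rfl
      · exact h.var y hy
    · rw [varDeg_lo (by omega)]
      exact (Expr.val_le hS.two_le hs e).trans
        (Nat.pow_le_pow_right (by have := hS.two_le; omega) hP.2)
  | put a i e =>
    intro s σ h hs hc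
    simp only [Cmd.wt, Bool.and_eq_true, decide_eq_true_eq] at hP
    have := Exec.put (w := w) s a i e
    rw [Expr.eval_eq_val hS.two_le hS.pow_le hs i hP.1.1.1.1.2,
      Expr.eval_eq_val hS.two_le hS.pow_le hs e hP.1.1.2] at this
    refine ⟨_, _, this, le_rfl, ?_, hs.setArr ?_⟩
    · refine ⟨fun y hy => h.var y hy, ?_⟩
      simp only [Cmd.run, State.setArr, readsOK h e hP.1.2, readsOK h i hP.1.1.1.2, h.arr]
    · have : arrDeg a = 4 := by unfold arrDeg; rw [if_neg (by omega)]
      rw [this]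
      exact (Expr.val_le hS.two_le hs e).trans
        (Nat.pow_le_pow_right (by have := hS.two_le; omega) hP.2)
  | seq P Q h1 h2 =>
    intro s σ h hs hc
    simp only [Cmd.wt, Bool.and_eq_true] at hP
    obtain ⟨t, s', i1, i2, i3, i4⟩ := h1 hP.1 s σ h hs hc
    obtain ⟨t2, s2, j1, j2, j3, j4⟩ := h2 hP.2 s' _ i3 i4 (hR hP.1 hc h i3)
    exact ⟨_, s2, Exec.seq i1 j1, by simp only [Cmd.time]; omega, j3, j4⟩
  | ite φ P Q h1 h2 =>
    intro s σ h hs hc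
    simp only [Cmd.wt, Bool.and_eq_true] at hP
    obtain ⟨t, s', i1, i2, i3⟩ := Fml.exec_comp hS φ 0 [] s σ (by simp) hP.1.1 h hs hc
    have hres := i3.res
    by_cases hφ : φ.den σ
    · obtain ⟨t2, s2, j1, j2, j3, j4⟩ := h1 hP.1.2 s' σ i3.agree i3.bounded (hC hc h i3.agree)
      refine ⟨_, s2, Exec.seq i1 (Exec.iteTrue ?_ j1), ?_, ?_, j4⟩
      · simp only [Expr.eval]; rw [hres]; simp [hφ]
      · simp only [Cmd.time, Expr.cost]; omega
      · simp only [Cmd.run, if_pos hφ]; exact j3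
    · obtain ⟨t2, s2, j1, j2, j3, j4⟩ := h2 hP.2 s' σ i3.agree i3.bounded (hC hc h i3.agree)
      refine ⟨_, s2, Exec.seq i1 (Exec.iteFalse ?_ j1), ?_, ?_, j4⟩
      · simp only [Expr.eval]; rw [hres]; simp [hφ]
      · simp only [Cmd.time, Expr.cost]; omega
      · simp only [Cmd.run, if_neg hφ]; exact j3
  | loop x b P ih =>
    intro s σ h hs hc
    simp only [Cmd.wt, Bool.and_eq_true, decide_eq_true_eq] at hP
    obtain ⟨⟨⟨⟨⟨hx1, hx2⟩, hb0⟩, hb10⟩, hxP⟩, hwt⟩ := hP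
    have hsb : s.var b = β b := hc b hb0 hb10
    have hσb : σ.var b = β b := by rw [← h.var b (Or.inl (by omega)), hsb]
    have hbN : β b ≤ N ^ 4 := by rw [← hsb, ← varDeg_lo (x := b) (by omega)]; exact hs.var b
    have hset : ∀ {s' σ' : State} (i : ℕ), Agree [] s' σ' →
        Agree [] (s'.setVar x i) (σ'.setVar x i) := fun i h => (h.set x i).mono (by simp)
    have hbx : b ≠ x := by omega
    have hbP : b ∉ P.wv := fun hb => by
      have := Cmd.wt_wv hwt b hb; omega
    set F : State → State := fun s => (P.run s).setVar x ((P.run s).var x + 1) with hF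
    have hFx : ∀ k, (F^[k] (σ.setVar x 0)).var x = k ∧ (F^[k] (σ.setVar x 0)).var b = β b := by
      intro k
      induction k with
      | zero => simp [hbx, hσb]
      | succ k ihk =>
        rw [Function.iterate_succ_apply']
        simp only [hF, State.setVar_var, if_true, if_neg hbx, P.run_var _ hbP]
        rw [← hF, P.run_var _ hxP, ihk.1]
        exact ⟨rfl, ihk.2⟩
    obtain ⟨t, s', hex, ht, hI⟩ := exec_countLoop (w := w) (x := x) (b := b) (cnt := β b)
      (T := P.time β) (body := P.comp)
      (fun i s' => Agree [] s' (F^[i] (σ.setVar x 0)) ∧ s'.Bounded N ∧ Consts β s')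
      (hS.bound_lt hbN) hS.one_lt (by
        intro i s2 hi hI hx hb
        obtain ⟨t3, s3, k1, k2, k3, k4⟩ := ih hwt s2 _ hI.1 hI.2.1 hI.2.2
        have hx3 : s3.var x = i := by
          rw [k3.var x (Or.inl hx2), P.run_var _ hxP, (hFx i).1]
        have hc3 := hR hwt hI.2.2 hI.1 k3
        have hag : Agree [] (s3.setVar x (i + 1)) (F^[i + 1] (σ.setVar x 0)) := by
          rw [Function.iterate_succ_apply']
          have : F (F^[i] (σ.setVar x 0)) =
              (P.run (F^[i] (σ.setVar x 0))).setVar x (i + 1) := by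
            rw [hF]; simp only; rw [P.run_var _ hxP, ← hF, (hFx i).1]
          rw [this]
          exact hset _ k3
        have hc4 : Consts β (s3.setVar x (i + 1)) := fun b' h1 h2 => by
          rw [State.setVar_var, if_neg (by omega), hc3 b' h1 h2]
        refine ⟨t3, s3, k1, k2, hx3, hc4 b hb0 hb10, hag, k4.setVar ?_, hc4⟩
        rw [varDeg_lo (by omega)]; omega)
      0 (s.setVar x 0) (Nat.zero_le _) ⟨hset 0 h, hs.setVar (Nat.zero_le _), fun b' h1 h2 => by
          rw [State.setVar_var, if_neg (by omega), hc b' h1 h2]⟩ (by simp)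
      (by rw [State.setVar_var, if_neg hbx, hsb])
    refine ⟨_, s', Exec.seq (exec_assign' hS hs x (.const 0) rfl) hex, ?_, ?_, hI.2.1⟩
    · simp only [Expr.cost, Cmd.time]
      rw [Nat.sub_zero] at ht
      omega
    · simp only [Cmd.run]; rw [hσb]; exact hI.1

/-! ## Polynomial time bounds -/

/-- The exponents of `n` and of `L` in the value of a loop bound. -/
def boundDeg (b : ℕ) : ℕ × ℕ :=
  if b = 1 ∨ b = 4 ∨ b = 5 ∨ b = 7 then (1, 0) else if b = 3 then (0, 1) else (0, 0)

/-- Coefficient, exponent of n and exponent of L of a monomial that bounds the time. The factor 5 of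
the quantifiers covers the loop bounds 4n, n + 1 and 4. -/
def Fml.poly : Fml → ℕ × ℕ × ℕ
  | .atom e => (e.cost + 3, 0, 0)
  | .not φ => (φ.poly.1 + 4, φ.poly.2)
  | .and φ ψ => (φ.poly.1 + ψ.poly.1 + 4, max φ.poly.2.1 ψ.poly.2.1, max φ.poly.2.2 ψ.poly.2.2)
  | .iff φ ψ => (φ.poly.1 + ψ.poly.1 + 4, max φ.poly.2.1 ψ.poly.2.1, max φ.poly.2.2 ψ.poly.2.2)
  | .ex _ b φ => (5 * (φ.poly.1 + 14) + 8, (boundDeg b).1 + φ.poly.2.1,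
      (boundDeg b).2 + φ.poly.2.2)
  | .par _ b φ => (5 * (φ.poly.1 + 14) + 8, (boundDeg b).1 + φ.poly.2.1,
      (boundDeg b).2 + φ.poly.2.2)

def Cmd.poly : Cmd → ℕ × ℕ × ℕ
  | .skip => (1, 0, 0)
  | .assign _ e => (e.cost + 1, 0, 0)
  | .put _ i e => (i.cost + e.cost + 1, 0, 0)
  | .seq P Q => (P.poly.1 + Q.poly.1, max P.poly.2.1 Q.poly.2.1, max P.poly.2.2 Q.poly.2.2)
  | .ite φ P Q => (φ.poly.1 + P.poly.1 + Q.poly.1 + 2,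
      max (max φ.poly.2.1 P.poly.2.1) Q.poly.2.1, max (max φ.poly.2.2 P.poly.2.2) Q.poly.2.2)
  | .loop _ b P => (5 * (P.poly.1 + 8) + 6, (boundDeg b).1 + P.poly.2.1,
      (boundDeg b).2 + P.poly.2.2)

/-- `a` is at most the monomial with coefficient and exponents `p` in `n` and `L`. -/
def LeMono (n L a : ℕ) (p : ℕ × ℕ × ℕ) : Prop := a ≤ p.1 * n ^ p.2.1 * L ^ p.2.2

theorem LeMono.mono {n L : ℕ} (hn : 0 < n) (hL : 0 < L) {a c i j c' i' j' : ℕ} (h : LeMono n L a (c, i, j)) (hc : c ≤ c')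
    (hi : i ≤ i') (hj : j ≤ j') : LeMono n L a (c', i', j') := by
  refine le_trans h ?_
  exact Nat.mul_le_mul (Nat.mul_le_mul hc (Nat.pow_le_pow_right hn hi))
    (Nat.pow_le_pow_right hL hj)

theorem LeMono.add {n L : ℕ} (hn : 0 < n) (hL : 0 < L) {a c i j a' c' i' j' : ℕ} (h : LeMono n L a (c, i, j))
    (h' : LeMono n L a' (c', i', j')) : LeMono n L (a + a') (c + c', max i i', max j j') := by
  have h1 := LeMono.mono hn hL h le_rfl (le_max_left i i') (le_max_left j j')
  have h2 := LeMono.mono hn hL h' le_rfl (le_max_right i i') (le_max_right j j')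
  simp only [LeMono, Nat.add_mul] at *
  omega

theorem LeMono.add_const {n L : ℕ} (hn : 0 < n) (hL : 0 < L) {a c i j : ℕ} (h : LeMono n L a (c, i, j)) (k : ℕ) :
    LeMono n L (a + k) (c + k, i, j) := by
  have := LeMono.add hn hL h (show LeMono n L k (k, 0, 0) by simp [LeMono])
  simpa using this

theorem LeMono.mul {n L : ℕ} {a c i j a' c' i' j' : ℕ} (h : LeMono n L a (c, i, j))
    (h' : LeMono n L a' (c', i', j')) : LeMono n L (a * a') (c * c', i + i', j + j') := by
  simp only [LeMono] at *
  calc a * a' ≤ (c * n ^ i * L ^ j) * (c' * n ^ i' * L ^ j') := Nat.mul_le_mul h h'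
    _ = _ := by ring

theorem Fml.time_le {n L : ℕ} (hn : 0 < n) (hL : 0 < L) {β : ℕ → ℕ}
    (hβ : ∀ b, LeMono n L (β b) (5, (boundDeg b).1, (boundDeg b).2)) (φ : Fml) :
    LeMono n L (φ.time β) φ.poly := by
  induction φ with
  | atom e => simp [LeMono, Fml.time, Fml.poly]
  | not φ ih => exact LeMono.add_const hn hL ih 4
  | and φ ψ h1 h2 => exact LeMono.add_const hn hL (LeMono.add hn hL h1 h2) 4
  | iff φ ψ h1 h2 => exact LeMono.add_const hn hL (LeMono.add hn hL h1 h2) 4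
  | ex x b φ ih =>
    exact LeMono.add_const hn hL (LeMono.mul (hβ b) (LeMono.add_const hn hL ih 14)) 8
  | par x b φ ih =>
    exact LeMono.add_const hn hL (LeMono.mul (hβ b) (LeMono.add_const hn hL ih 14)) 8

theorem Cmd.time_le {n L : ℕ} (hn : 0 < n) (hL : 0 < L) {β : ℕ → ℕ}
    (hβ : ∀ b, LeMono n L (β b) (5, (boundDeg b).1, (boundDeg b).2)) (P : Cmd) :
    LeMono n L (P.time β) P.poly := by
  induction P with
  | skip => simp [LeMono, Cmd.time, Cmd.poly]
  | assign x e => simp [LeMono, Cmd.time, Cmd.poly]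
  | put a i e => simp [LeMono, Cmd.time, Cmd.poly]
  | seq P Q h1 h2 => exact LeMono.add hn hL h1 h2
  | ite φ P Q h1 h2 =>
    exact LeMono.add_const hn hL (LeMono.add hn hL (LeMono.add hn hL
      (Fml.time_le hn hL hβ φ) h1) h2) 2
  | loop x b P ih =>
    exact LeMono.add_const hn hL (LeMono.mul (hβ b) (LeMono.add_const hn hL ih 8)) 6

end WordRAM

/-! ## Crossing parities of closed lattice curves -/

namespace Planar

abbrev Cell := ℤ × ℤ

def Nb (x y : Cell) : Prop :=
  (x.1 = y.1 ∧ (y.2 = x.2 + 1 ∨ x.2 = y.2 + 1)) ∨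
  (x.2 = y.2 ∧ (y.1 = x.1 + 1 ∨ x.1 = y.1 + 1))

theorem Nb.symm {x y : Cell} (h : Nb x y) : Nb y x := by
  unfold Nb at *; omega

/-- Does the edge `x y` cross the ray that leaves the face `F` to the right? Faces are named by
their lower left corners. -/
def cross (F x y : Cell) : ZMod 2 :=
  if x.1 = y.1 ∧ min x.2 y.2 = F.2 ∧ F.1 < x.1 then 1 else 0

/-- A face that is incident to the edge `x y`. -/
def faceOf (x y : Cell) : Cell := (min x.1 y.1, min x.2 y.2)

/-- The indicator of the edge `a b`. -/
def isEdge (a b x y : Cell) : ZMod 2 :=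
  if (x = a ∧ y = b) ∨ (x = b ∧ y = a) then 1 else 0

theorem cross_comm (F x y : Cell) : cross F x y = cross F y x := by
  unfold cross
  congr 1
  rw [min_comm y.2 x.2]
  exact propext ⟨fun h => ⟨h.1.symm, h.2.1, h.1 ▸ h.2.2⟩, fun h => ⟨h.1.symm, h.2.1, h.1 ▸ h.2.2⟩⟩

theorem faceOf_comm (x y : Cell) : faceOf x y = faceOf y x := by
  simp [faceOf, min_comm]

theorem isEdge_comm (a b x y : Cell) : isEdge a b x y = isEdge a b y x := by
  unfold isEdge; congr 1; exact propext (by tauto)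

theorem zmod_add_self (x : ZMod 2) : x + x = 0 := CharTwo.add_self_eq_zero x

/-- The sum of a function over the consecutive pairs of a list. -/
def pairSum (f : Cell → Cell → ZMod 2) : List Cell → ZMod 2
  | [] => 0
  | [_] => 0
  | x :: y :: l => f x y + pairSum f (y :: l)

theorem pairSum_append_cons (f : Cell → Cell → ZMod 2) (l : List Cell) (a : Cell) (t : List Cell) :
    pairSum f (l ++ a :: t) = pairSum f (l ++ [a]) + pairSum f (a :: t) := by
  induction l with
  | nil => simp [pairSum]
  | cons x l ih =>
    cases l with
    | nil => simp [pairSum]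
    | cons y l => simp only [List.cons_append, pairSum] at ih ⊢; rw [ih, add_assoc]

theorem pairSum_add {f g h : Cell → Cell → ZMod 2} {R : Cell → Cell → Prop}
    (hfg : ∀ x y, R x y → f x y + g x y = h x y) (l : List Cell) (hl : l.IsChain R) :
    pairSum f l + pairSum g l = pairSum h l := by
  induction l with
  | nil => simp [pairSum]
  | cons x l ih =>
    cases l with
    | nil => simp [pairSum]
    | cons y l =>
      rw [List.isChain_cons_cons] at hl
      simp only [pairSum]
      rw [← hfg x y hl.1, ← ih hl.2]; ring

theorem pairSum_telescope (χ : Cell → ZMod 2) (l : List Cell) (x : Cell) :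
    pairSum (fun x y => χ x + χ y) (x :: l) = χ x + χ (l.getLastD x) := by
  induction l generalizing x with
  | nil => simp [pairSum, zmod_add_self]
  | cons y l ih =>
    simp only [pairSum, List.getLastD_cons]
    rw [ih, add_assoc, ← add_assoc (χ y), zmod_add_self, zero_add]

/-- The two rays differ only in the piece that crosses the vertical edge with lower end (a, b). -/
theorem cross_add_left (a b : ℤ) (x y : Cell) (h : Nb x y) :
    cross (a - 1, b) x y + cross (a, b) x y = isEdge (a, b) (a, b + 1) x y := by
  obtain ⟨x1, x2⟩ := x
  obtain ⟨y1, y2⟩ := y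
  simp only [Nb, cross, isEdge, Prod.mk.injEq] at *
  split_ifs <;> first | rfl | (exfalso; omega)

/-- Between the two rays lies the horizontal half-line of lattice points to the right of (a, b).
Apart from the edge to its first point, the change is a sum of a function of the two end points, and
such a term cancels along every closed curve. -/
theorem cross_add_below (a b : ℤ) (x y : Cell) (h : Nb x y) :
    cross (a, b) x y + cross (a, b - 1) x y =
      isEdge (a, b) (a + 1, b) x y + ((if x.2 = b ∧ a < x.1 then 1 else 0) +
        (if y.2 = b ∧ a < y.1 then 1 else 0)) := by
  obtain ⟨x1, x2⟩ := x
  obtain ⟨y1, y2⟩ := y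
  simp only [Nb, cross, isEdge, Prod.mk.injEq] at *
  split_ifs <;> first | rfl | (exfalso; omega)

/-- `φ` is a function on faces whose value jumps by `μ a b` across the edge `a b`. -/
structure IsIndex (φ : Cell → ZMod 2) (μ : Cell → Cell → ZMod 2) : Prop where
  left : ∀ a b : ℤ, φ (a - 1, b) + φ (a, b) = μ (a, b) (a, b + 1)
  below : ∀ a b : ℤ, φ (a, b) + φ (a, b - 1) = μ (a, b) (a + 1, b)
  symm : ∀ x y, μ x y = μ y x

/-- In the sum of two curves the shared edges cancel, so the sum of the two indices does not jump
across them. -/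
theorem IsIndex.add {φ ψ : Cell → ZMod 2} {μ ν : Cell → Cell → ZMod 2} (h : IsIndex φ μ)
    (h' : IsIndex ψ ν) : IsIndex (fun F => φ F + ψ F) (fun x y => μ x y + ν x y) where
  left a b := by rw [← h.left, ← h'.left]; ring
  below a b := by rw [← h.below, ← h'.below]; ring
  symm x y := by rw [h.symm, h'.symm]

theorem Nb.cases {a n : Cell} (h : Nb a n) :
    n = (a.1, a.2 + 1) ∨ n = (a.1 + 1, a.2) ∨ n = (a.1, a.2 - 1) ∨ n = (a.1 - 1, a.2) := by
  obtain ⟨a1, a2⟩ := a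
  obtain ⟨n1, n2⟩ := n
  simp only [Nb, Prod.mk.injEq] at *
  omega

theorem faceOf_up (a : Cell) : faceOf a (a.1, a.2 + 1) = a := by
  ext <;> simp [faceOf]
theorem faceOf_right (a : Cell) : faceOf a (a.1 + 1, a.2) = a := by
  ext <;> simp [faceOf]
theorem faceOf_down (a : Cell) : faceOf a (a.1, a.2 - 1) = (a.1, a.2 - 1) := by
  ext <;> simp [faceOf]
theorem faceOf_left (a : Cell) : faceOf a (a.1 - 1, a.2) = (a.1 - 1, a.2) := by
  ext <;> simp [faceOf]

/-- The four jumps around the vertex `a`. -/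
theorem IsIndex.around {φ : Cell → ZMod 2} {μ : Cell → Cell → ZMod 2} (h : IsIndex φ μ)
    (a : Cell) :
    φ (a.1 - 1, a.2) + φ a = μ a (a.1, a.2 + 1) ∧
    φ a + φ (a.1, a.2 - 1) = μ a (a.1 + 1, a.2) ∧
    φ (a.1 - 1, a.2 - 1) + φ (a.1, a.2 - 1) = μ a (a.1, a.2 - 1) ∧
    φ (a.1 - 1, a.2) + φ (a.1 - 1, a.2 - 1) = μ a (a.1 - 1, a.2) := by
  obtain ⟨a1, a2⟩ := a
  refine ⟨h.left a1 a2, h.below a1 a2, ?_, ?_⟩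
  · have := h.left a1 (a2 - 1)
    rw [sub_add_cancel] at this
    rw [this, h.symm]
  · have := h.below (a1 - 1) a2
    rw [sub_add_cancel] at this
    rw [this, h.symm]

/-- All four jumps around an untouched vertex vanish, so its four faces share one value. Since a
face is named by its lower left corner, `φ a` is that value, and the vertex itself can stand for it.
-/
theorem IsIndex.face_eq_of_untouched {φ : Cell → ZMod 2} {μ : Cell → Cell → ZMod 2}
    (h : IsIndex φ μ) {a n : Cell} (ha : ∀ n, μ a n = 0) (hn : Nb a n) :
    φ (faceOf a n) = φ a := by
  obtain ⟨h1, h2, h3, h4⟩ := h.around a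
  rw [ha] at h1 h2 h3 h4
  rcases hn.cases with rfl | rfl | rfl | rfl
  · rw [faceOf_up]
  · rw [faceOf_right]
  · rw [faceOf_down]; exact (CharTwo.add_eq_zero.1 h2).symm
  · rw [faceOf_left]; exact CharTwo.add_eq_zero.1 h1

/-- Two perpendicular edges at `a` that are not part of the curve lie on the same side. -/
theorem IsIndex.face_eq_of_perp {φ : Cell → ZMod 2} {μ : Cell → Cell → ZMod 2}
    (h : IsIndex φ μ) {a n m : Cell} (hn : Nb a n) (hm : Nb a m) (hnm : n ≠ m)
    (hopp : n.1 + m.1 ≠ 2 * a.1 ∨ n.2 + m.2 ≠ 2 * a.2) (han : μ a n = 0) (ham : μ a m = 0) :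
    φ (faceOf a n) = φ (faceOf a m) := by
  obtain ⟨h1, h2, h3, h4⟩ := h.around a
  rcases hn.cases with rfl | rfl | rfl | rfl <;> rcases hm.cases with rfl | rfl | rfl | rfl <;>
    first | exact absurd rfl hnm | (exfalso; simp only at hopp; omega) |
    (simp only [faceOf_up, faceOf_right, faceOf_down, faceOf_left] <;>
     (simp only [han, ham, CharTwo.add_eq_zero] at h1 h2 h3 h4
      simp_all))

/-- Of three arms that leave the vertex `a`, exactly one lies between the other two. -/
theorem IsIndex.theta {φ ψ : Cell → ZMod 2} {μ ν : Cell → Cell → ZMod 2} (h : IsIndex φ μ)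
    (h' : IsIndex ψ ν) {a n f g : Cell} (hn : Nb a n) (hf : Nb a f) (hg : Nb a g) (hnf : n ≠ f)
    (hng : n ≠ g) (hfg : f ≠ g)
    (hμ : ∀ m, μ a m = (if m = f then 1 else 0) + (if m = n then 1 else 0))
    (hν : ∀ m, ν a m = (if m = g then 1 else 0) + (if m = n then 1 else 0)) :
    ψ (faceOf a f) + φ (faceOf a g) + (φ (faceOf a n) + ψ (faceOf a n)) = 1 := by
  obtain ⟨h1, h2, h3, h4⟩ := h.around a
  obtain ⟨k1, k2, k3, k4⟩ := h'.around a
  rw [hμ] at h1 h2 h3 h4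
  rw [hν] at k1 k2 k3 k4
  -- There are 24 placements of the three arms; each leaves linear equations over the field with two
  -- elements in the values of the two indices on the four faces around a.
  rcases hn.cases with rfl | rfl | rfl | rfl <;> rcases hf.cases with rfl | rfl | rfl | rfl <;>
    first | exact absurd rfl hnf |
    (rcases hg.cases with rfl | rfl | rfl | rfl <;>
      first | exact absurd rfl hng | exact absurd rfl hfg |
      (simp only [faceOf_up, faceOf_right, faceOf_down, faceOf_left]
       simp only [Prod.mk.injEq, and_false, and_true,
         if_false, if_true, and_self, add_zero, zero_add,
         show ∀ b : ℤ, ¬ (b = b - 1) by intro b; omega, show ∀ b : ℤ, ¬ (b = b + 1) by intro b; omega,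
         show ∀ b : ℤ, ¬ (b - 1 = b) by intro b; omega,
         show ∀ b : ℤ, ¬ (b + 1 = b) by intro b; omega,
         show ∀ b : ℤ, ¬ (b + 1 = b - 1) by intro b; omega,
         show ∀ b : ℤ, ¬ (b - 1 = b + 1) by intro b; omega] at h1 h2 h3 h4 k1 k2 k3 k4
       revert h1 h2 h3 h4 k1 k2 k3 k4
       generalize φ a = x1, φ (a.1 - 1, a.2) = x2, φ (a.1, a.2 - 1) = x3,
         φ (a.1 - 1, a.2 - 1) = x4, ψ a = y1, ψ (a.1 - 1, a.2) = y2, ψ (a.1, a.2 - 1) = y3,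
         ψ (a.1 - 1, a.2 - 1) = y4
       clear * -
       intro h1 h2 h3 h4 k1 k2 k3 k4
       grind))

/-- A path whose inner vertices avoid the curve stays on one side of it. The defaults of `headD` and
`getLastD` cover the path without inner vertices, where the first and the last edge coincide. -/
theorem IsIndex.transport {φ : Cell → ZMod 2} {μ : Cell → Cell → ZMod 2} (h : IsIndex φ μ)
    (r : List Cell) (x y : Cell) (hc : (x :: r ++ [y]).IsChain Nb)
    (hr : ∀ z ∈ r, ∀ n, μ z n = 0) :
    φ (faceOf x (r.headD y)) = φ (faceOf (r.getLastD x) y) ∧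
      ∀ z ∈ r, φ z = φ (faceOf x (r.headD y)) := by
  induction r generalizing x with
  | nil => simp
  | cons b r ih =>
    simp only [List.cons_append, List.isChain_cons_cons] at hc
    obtain ⟨h1, h2⟩ := ih b hc.2 fun z hz => hr z (List.mem_cons_of_mem _ hz)
    have hb := hr b (by simp)
    have e1 : φ (faceOf x b) = φ b := by
      rw [faceOf_comm]; exact h.face_eq_of_untouched hb hc.1.symm
    have hnb : Nb b (r.headD y) := by
      cases r with
      | nil => simpa using hc.2
      | cons c r => simp only [List.cons_append, List.isChain_cons_cons] at hc; exact hc.2.1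
    have e2 : φ (faceOf b (r.headD y)) = φ b := h.face_eq_of_untouched hb hnb
    simp only [List.headD_cons, List.getLastD_cons]
    refine ⟨by rw [e1, ← e2, h1], fun z hz => ?_⟩
    rcases List.mem_cons.1 hz with rfl | hz
    · exact e1.symm
    · rw [h2 z hz, e2, e1]

end Planar

/-! ### Paths in two trees, and the closed curves that they form -/

namespace Planar

/-- The vertex a occurs only once in the list, so only one suffix starts with it. -/
theorem suffix_eq_of_nodup {a : Cell} {s t l : List Cell} (hl : l.Nodup) (hs : a :: s <:+ l)
    (ht : a :: t <:+ l) : s = t := by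
  obtain ⟨u, rfl⟩ := hs
  obtain ⟨v, hv⟩ := ht
  rcases List.append_eq_append_iff.1 hv with ⟨c, h1, h2⟩ | ⟨c, h1, h2⟩
  · cases c with
    | nil => simpa using h2.symm
    | cons b c =>
      simp only [List.cons_append, List.cons.injEq] at h2
      subst h1
      obtain ⟨rfl, h2⟩ := h2
      simp [List.nodup_append, List.nodup_cons] at hl
  · cases c with
    | nil => simpa using h2
    | cons b c =>
      simp only [List.cons_append, List.cons.injEq] at h2
      obtain ⟨rfl, rfl⟩ := h2
      simp [List.nodup_append, List.nodup_cons] at hl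

/-- The paths `L x` from the vertices `x` of a tree to its root. -/
structure PathSys (root : Cell) (S : Set Cell) (L : Cell → List Cell) : Prop where
  head : ∀ x ∈ S, ∃ t, L x = x :: t
  last : ∀ x ∈ S, (L x).getLast? = some root
  chain : ∀ x ∈ S, (L x).IsChain Nb
  nodup : ∀ x ∈ S, (L x).Nodup
  suffix : ∀ x ∈ S, ∀ a ∈ L x, a ∈ S ∧ L a <:+ L x

theorem PathSys.self_mem {root : Cell} {S : Set Cell} {L : Cell → List Cell}
    (h : PathSys root S L) {x : Cell} (hx : x ∈ S) : x ∈ L x := by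
  obtain ⟨t, ht⟩ := h.head x hx; simp [ht]

theorem PathSys.root_mem {root : Cell} {S : Set Cell} {L : Cell → List Cell}
    (h : PathSys root S L) {x : Cell} (hx : x ∈ S) : root ∈ L x :=
  List.mem_of_getLast? (h.last x hx)

/-- The paths to the root of two vertices split at a vertex `a`. -/
theorem PathSys.branch {root : Cell} {S : Set Cell} {L : Cell → List Cell}
    (h : PathSys root S L) {x y : Cell} (hx : x ∈ S) (hy : y ∈ S) :
    ∃ a r r' s, L x = r ++ a :: s ∧ L y = r' ++ a :: s ∧ (∀ z ∈ r, z ∉ L y) ∧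
      (∀ z ∈ r', z ∉ L x) := by
  have key : ∀ l : List Cell, (∃ z ∈ l, z ∈ L y) →
      ∃ a r s, l = r ++ a :: s ∧ a ∈ L y ∧ ∀ z ∈ r, z ∉ L y := by
    intro l
    induction l with
    | nil => simp
    | cons b l ih =>
      intro hl
      by_cases hb : b ∈ L y
      · exact ⟨b, [], l, rfl, hb, by simp⟩
      · obtain ⟨a, r, s, h1, h2, h3⟩ := ih (by
          obtain ⟨z, hz, hz'⟩ := hl
          rcases List.mem_cons.1 hz with rfl | hz
          · exact absurd hz' hb
          · exact ⟨z, hz, hz'⟩)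
        exact ⟨a, b :: r, s, by simp [h1], h2, by simpa [hb] using h3⟩
  -- The first vertex of the path from x that also lies on the path from y; the root is a common
  -- vertex. From a on, both paths continue with the path of a itself.
  obtain ⟨a, r, s, h1, h2, h3⟩ := key (L x) ⟨root, h.root_mem hx, h.root_mem hy⟩
  have hax : a ∈ L x := by simp [h1]
  obtain ⟨t, ht⟩ := h.head a (h.suffix x hx a hax).1
  have hs : t = s := by
    refine suffix_eq_of_nodup (h.nodup x hx) (a := a) ?_ ⟨r, h1.symm⟩
    rw [← ht]; exact (h.suffix x hx a hax).2
  subst hs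
  obtain ⟨r', hr'⟩ := (h.suffix y hy a h2).2
  rw [ht] at hr'
  refine ⟨a, r, r', t, h1, hr'.symm, h3, fun z hz hzx => ?_⟩
  rw [h1, List.mem_append] at hzx
  rcases hzx with hzx | hzx
  · exact h3 z hzx (by rw [← hr']; exact List.mem_append_left _ hz)
  · have := h.nodup y hy
    rw [← hr', List.nodup_append] at this
    exact this.2.2 z hz z hzx rfl

theorem pairSum_isEdge_of_not_mem {x n : Cell} {l : List Cell} (h : x ∉ l) :
    pairSum (isEdge x n) l = 0 := by
  induction l with
  | nil => rfl
  | cons y l ih =>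
    cases l with
    | nil => rfl
    | cons z l =>
      simp only [pairSum]
      rw [ih (fun h' => h (List.mem_cons_of_mem _ h')), add_zero]
      simp only [List.mem_cons, not_or] at h
      unfold isEdge
      rw [if_neg]
      rintro (⟨rfl, -⟩ | ⟨-, rfl⟩)
      · exact h.1 rfl
      · exact h.2.1 rfl

theorem pairSum_isEdge_last {a n q : Cell} {r : List Cell} (h : a ∉ q :: r) :
    pairSum (isEdge a n) (q :: r ++ [a]) = if n = r.getLastD q then 1 else 0 := by
  induction r generalizing q with
  | nil =>
    have : q ≠ a := fun h' => h (by simp [h'])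
    simp [pairSum, isEdge, this, eq_comm]
  | cons b r ih =>
    simp only [List.cons_append, pairSum, List.getLastD_cons]
    have ih' := ih (q := b) (fun h' => h (List.mem_cons_of_mem _ h'))
    rw [List.cons_append] at ih'
    rw [ih']
    simp only [List.mem_cons, not_or] at h
    unfold isEdge
    rw [if_neg, zero_add]
    rintro (⟨rfl, -⟩ | ⟨-, rfl⟩)
    · exact h.1 rfl
    · exact h.2.1 rfl

theorem pairSum_isEdge_head {a n q : Cell} {s : List Cell} (h : a ∉ s ++ [q]) :
    pairSum (isEdge a n) (a :: (s ++ [q])) = if n = s.headD q then 1 else 0 := by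
  have : ∀ b l, a ∉ b :: l → pairSum (isEdge a n) (a :: b :: l) = if n = b then 1 else 0 := by
    intro b l hb
    simp only [pairSum]
    rw [pairSum_isEdge_of_not_mem hb, add_zero]
    have : b ≠ a := fun h' => hb (by simp [h'])
    simp [isEdge, this, eq_comm]
  cases s with
  | nil => exact this _ _ h
  | cons b s => exact this _ _ h

/-- Two trees with roots `p₀` and `q₀`, joined by the edge `p₀ q₀`. -/
structure Trees where
  p₀ : Cell
  q₀ : Cell
  S : Set Cell
  T : Set Cell
  L : Cell → List Cell
  M : Cell → List Cell
  hL : PathSys p₀ S L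
  hM : PathSys q₀ T M
  nb : Nb p₀ q₀

/-- The symmetry between the copies: a statement that is proved for the paths in the first tree
carries over to the second one, and the index of the curve is the same. -/
def Trees.swap (c : Trees) : Trees where
  p₀ := c.q₀
  q₀ := c.p₀
  S := c.T
  T := c.S
  L := c.M
  M := c.L
  hL := c.hM
  hM := c.hL
  nb := c.nb.symm

/-- The pair `f = (p, q)` is a second edge between the two trees, and the paths from `p` and from
`q` to the roots are disjoint. -/
structure Trees.Good (c : Trees) (f : Cell × Cell) : Prop where
  memS : f.1 ∈ c.S
  memT : f.2 ∈ c.T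
  nb : Nb f.1 f.2
  ne : f ≠ (c.p₀, c.q₀)
  disj : ∀ x ∈ c.L f.1, x ∉ c.M f.2

/-- Only the mixed pairs of paths are mentioned; the two paths that belong to the same edge are
disjoint by `Good.disj`. -/
def Trees.Comp (c : Trees) (f g : Cell × Cell) : Prop :=
  (∀ x ∈ c.L f.1, x ∉ c.M g.2) ∧ ∀ x ∈ c.L g.1, x ∉ c.M f.2

theorem Trees.Comp.symm {c : Trees} {f g : Cell × Cell} (h : c.Comp f g) : c.Comp g f :=
  ⟨h.2, h.1⟩

theorem Trees.Good.swap {c : Trees} {f : Cell × Cell} (h : c.Good f) : c.swap.Good f.swap where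
  memS := h.memT
  memT := h.memS
  nb := h.nb.symm
  ne := fun h' => h.ne (by
    have := congrArg Prod.swap h'
    simpa [Trees.swap] using this)
  disj := fun x hx hx' => h.disj x hx' hx

theorem Trees.Comp.swap {c : Trees} {f g : Cell × Cell} (h : c.Comp f g) :
    c.swap.Comp f.swap g.swap :=
  ⟨fun x hx hx' => h.2 x hx' hx, fun x hx hx' => h.1 x hx' hx⟩

/-- The sum of a function over the edges of the closed curve through `p₀ q₀` and `f`. -/
def Trees.around (c : Trees) (f : Cell × Cell) (w : Cell → Cell → ZMod 2) : ZMod 2 :=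
  pairSum w (c.L f.1) + pairSum w (c.M f.2) + w f.1 f.2 + w c.p₀ c.q₀

def Trees.idx (c : Trees) (f : Cell × Cell) (F : Cell) : ZMod 2 := c.around f (cross F)

def Trees.mult (c : Trees) (f : Cell × Cell) (x y : Cell) : ZMod 2 := c.around f (isEdge x y)

theorem Trees.around_swap (c : Trees) (f : Cell × Cell) (w : Cell → Cell → ZMod 2)
    (hw : ∀ x y, w x y = w y x) : c.swap.around f.swap w = c.around f w := by
  simp only [Trees.around, Trees.swap, Prod.fst_swap, Prod.snd_swap]
  rw [hw f.2, hw c.q₀]; ring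

theorem Trees.idx_swap (c : Trees) (f : Cell × Cell) (F : Cell) :
    c.swap.idx f.swap F = c.idx f F := c.around_swap f _ (cross_comm F)

/-- The curve as a walk from `q` along the first tree to `q₀`, and back along the second. -/
theorem Trees.Good.around_eq {c : Trees} {f : Cell × Cell} (h : c.Good f)
    (w : Cell → Cell → ZMod 2) (hw : ∀ x y, w x y = w y x) :
    c.around f w = pairSum w (f.2 :: c.L f.1 ++ [c.q₀]) + pairSum w (c.M f.2) := by
  obtain ⟨t, ht⟩ := c.hL.head _ h.memS
  obtain ⟨u, hu⟩ := List.getLast?_eq_some_iff.1 (c.hL.last _ h.memS)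
  have e1 : pairSum w (f.2 :: c.L f.1 ++ [c.q₀]) = w f.2 f.1 + pairSum w (c.L f.1 ++ [c.q₀]) := by
    rw [ht]; rfl
  have e2 : pairSum w (c.L f.1 ++ [c.q₀]) = pairSum w (c.L f.1) + w c.p₀ c.q₀ := by
    rw [hu, List.append_assoc, List.singleton_append, pairSum_append_cons]
    simp [pairSum]
  rw [e1, e2, hw f.2, Trees.around]; ring

/-- Adding up the local identities `cross_add_left` and `cross_add_below` along the curve shows that
the crossing parity jumps exactly across the edges of the curve. -/
theorem Trees.Good.isIndex {c : Trees} {f : Cell × Cell} (h : c.Good f) :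
    IsIndex (c.idx f) (c.mult f) := by
  have hadd : ∀ (u v w : Cell → Cell → ZMod 2), (∀ x y, Nb x y → u x y + v x y = w x y) →
      c.around f u + c.around f v = c.around f w := by
    intro u v w huv
    have h1 := pairSum_add huv _ (c.hL.chain _ h.memS)
    have h2 := pairSum_add huv _ (c.hM.chain _ h.memT)
    simp only [Trees.around]
    rw [← h1, ← h2, ← huv _ _ h.nb, ← huv _ _ c.nb]; ring
  -- Such sums telescope on the two paths, and the two connecting edges supply the missing ends, so
  -- every term occurs twice. This disposes of the correction term of `cross_add_below`.
  have hclosed : ∀ χ : Cell → ZMod 2, c.around f (fun x y => χ x + χ y) = 0 := by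
    intro χ
    have tele : ∀ {x r : Cell} {l : List Cell}, (∃ t, l = x :: t) → l.getLast? = some r →
        pairSum (fun x y => χ x + χ y) l = χ x + χ r := by
      rintro x r l ⟨t, rfl⟩ hr
      rw [pairSum_telescope]
      congr 2
      cases t with
      | nil => simpa using hr
      | cons y t =>
        rw [List.getLast?_cons_cons] at hr
        rw [List.getLastD_eq_getLast?, hr]; rfl
    simp only [Trees.around]
    rw [tele (c.hL.head _ h.memS) (c.hL.last _ h.memS),
      tele (c.hM.head _ h.memT) (c.hM.last _ h.memT)]
    have := fun x => zmod_add_self (χ x)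
    linear_combination this f.1 + this f.2 + this c.p₀ + this c.q₀
  refine ⟨fun a b => hadd _ _ _ (cross_add_left a b), fun a b => ?_, fun x y => ?_⟩
  · have h1 := hadd _ _ _ (cross_add_below a b)
    have h2 := hadd (isEdge (a, b) (a + 1, b)) (fun x y => (if x.2 = b ∧ a < x.1 then 1 else 0) +
        (if y.2 = b ∧ a < y.1 then 1 else 0)) _ (fun x y _ => rfl)
    rw [Trees.idx, Trees.idx, h1, ← h2, hclosed, add_zero]; rfl
  · have : isEdge x y = isEdge y x := by
      funext u v; unfold isEdge; congr 1; exact propext (by tauto)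
    rw [Trees.mult, Trees.mult, this]

theorem Trees.Good.mult_eq_zero {c : Trees} {f : Cell × Cell} (h : c.Good f) {x : Cell}
    (h1 : x ∉ c.L f.1) (h2 : x ∉ c.M f.2) (n : Cell) : c.mult f x n = 0 := by
  rw [Trees.mult, h.around_eq _ (isEdge_comm x n), pairSum_isEdge_of_not_mem,
    pairSum_isEdge_of_not_mem h2, add_zero]
  simp only [List.mem_append, List.mem_cons, List.not_mem_nil, or_false]
  rintro ((rfl | h') | rfl)
  · exact h2 (c.hM.self_mem h.memT)
  · exact h1 h'
  · exact h2 (c.hM.root_mem h.memT)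

/-- The edges of the curve at a vertex `a` of the first path. -/
theorem Trees.Good.mult_at {c : Trees} {f : Cell × Cell} (h : c.Good f) {a : Cell}
    {r s : List Cell} (hr : c.L f.1 = r ++ a :: s) (n : Cell) :
    c.mult f a n = (if n = r.getLastD f.2 then 1 else 0) + (if n = s.headD c.q₀ then 1 else 0) := by
  have ha : a ∈ c.L f.1 := by simp [hr]
  have hnd := c.hL.nodup _ h.memS
  rw [hr, List.nodup_append, List.nodup_cons] at hnd
  have haM := h.disj a ha
  have e : f.2 :: c.L f.1 ++ [c.q₀] = (f.2 :: r) ++ a :: (s ++ [c.q₀]) := by simp [hr]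
  rw [Trees.mult, h.around_eq _ (isEdge_comm a n), pairSum_isEdge_of_not_mem haM, add_zero, e,
    pairSum_append_cons, pairSum_isEdge_last, pairSum_isEdge_head]
  · simp only [List.mem_append, List.mem_cons, List.not_mem_nil, or_false]
    rintro (h' | rfl)
    · exact hnd.2.1.1 h'
    · exact haM (c.hM.root_mem h.memT)
  · simp only [List.mem_cons]
    rintro (rfl | h')
    · exact haM (c.hM.self_mem h.memT)
    · exact hnd.2.2 a h' a (by simp) rfl

/-- Edges at a vertex of the common part of two first paths are shared. -/
theorem Trees.Good.mult_add_eq_zero {c : Trees} {f g : Cell × Cell} (hf : c.Good f)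
    (hg : c.Good g) {a : Cell} {r r' s : List Cell}
    (hr : c.L f.1 = r ++ a :: s) (hr' : c.L g.1 = r' ++ a :: s) {x : Cell} (hx : x ∈ s)
    (n : Cell) : c.mult f x n + c.mult g x n = 0 := by
  -- The part of the walk before a does not pass through x, so the multiplicity depends on the
  -- common tail only and is the same for both curves.
  have key : ∀ {f : Cell × Cell} {r : List Cell}, c.Good f → c.L f.1 = r ++ a :: s →
      c.mult f x n = pairSum (isEdge x n) (a :: (s ++ [c.q₀])) := by
    intro f r h hr
    have hxL : x ∈ c.L f.1 := by simp [hr, hx]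
    have hnd := c.hL.nodup _ h.memS
    rw [hr, List.nodup_append, List.nodup_cons] at hnd
    have haM := h.disj x hxL
    have e : f.2 :: c.L f.1 ++ [c.q₀] = (f.2 :: r) ++ a :: (s ++ [c.q₀]) := by simp [hr]
    rw [Trees.mult, h.around_eq _ (isEdge_comm x n), pairSum_isEdge_of_not_mem haM, add_zero, e,
      pairSum_append_cons, pairSum_isEdge_of_not_mem, zero_add]
    simp only [List.mem_append, List.mem_cons, List.not_mem_nil, or_false]
    rintro ((rfl | h') | rfl)
    · exact haM (c.hM.self_mem h.memT)
    · exact hnd.2.2 x h' x (List.mem_cons_of_mem _ hx) rfl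
    · exact hnd.2.1.1 hx
  rw [key hf hr, key hg hr', zmod_add_self]

/-- `0` or `1`, according to whether `f` lies on the left of the curve through `g`. -/
def Trees.side (c : Trees) (g f : Cell × Cell) : ZMod 2 :=
  c.idx g (faceOf f.1 f.2) + c.idx g (faceOf c.p₀ c.q₀)

theorem Trees.Good.chain_first {c : Trees} {f : Cell × Cell} (h : c.Good f) {a : Cell}
    {r s : List Cell} (hr : c.L f.1 = r ++ a :: s) : (f.2 :: r ++ [a]).IsChain Nb := by
  obtain ⟨t, ht⟩ := c.hL.head _ h.memS
  have : (f.2 :: c.L f.1).IsChain Nb := by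
    have := c.hL.chain _ h.memS
    rw [ht] at this ⊢
    exact List.isChain_cons_cons.2 ⟨h.nb.symm, this⟩
  rw [hr] at this
  refine this.prefix ⟨s, by simp⟩

theorem Trees.Good.chain_last {c : Trees} {f : Cell × Cell} (h : c.Good f) {a : Cell}
    {r s : List Cell} (hr : c.L f.1 = r ++ a :: s) : (a :: s ++ [c.q₀]).IsChain Nb := by
  obtain ⟨u, hu⟩ := List.getLast?_eq_some_iff.1 (c.hL.last _ h.memS)
  have : (c.L f.1 ++ [c.q₀]).IsChain Nb := by
    have := c.hL.chain _ h.memS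
    rw [hu] at this ⊢
    rw [List.isChain_append] at this ⊢
    refine ⟨List.isChain_append.2 this, by simp, fun x hx y hy => ?_⟩
    simp at hx hy
    subst hx hy
    exact c.nb
  rw [hr] at this
  exact this.suffix ⟨r, by simp⟩

theorem nb_getLastD {q a : Cell} {r : List Cell} (h : (q :: r ++ [a]).IsChain Nb) :
    Nb a (r.getLastD q) := by
  induction r generalizing q with
  | nil => simp at h; exact h.symm
  | cons b r ih =>
    simp only [List.cons_append, List.isChain_cons_cons] at h
    rw [List.getLastD_cons]; exact ih h.2

theorem nb_headD {q a : Cell} {s : List Cell} (h : (a :: s ++ [q]).IsChain Nb) :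
    Nb a (s.headD q) := by
  cases s with
  | nil => simpa using h
  | cons b s =>
    simp only [List.cons_append, List.isChain_cons_cons] at h; exact h.1

theorem headD_last {f : Cell × Cell} {c : Trees} (h : c.Good f) {a : Cell}
    {r s : List Cell} (hr : c.L f.1 = r ++ a :: s) : s.getLastD a = c.p₀ := by
  have := c.hL.last _ h.memS
  rw [hr, List.getLast?_append, List.getLast?_cons] at this
  simpa [List.getLastD_eq_getLast?] using this

/-- The edge `f` seen from the vertex `a` of its first path. -/
theorem Trees.Good.idx_eq {c : Trees} {f : Cell × Cell} (h : c.Good f)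
    {φ : Cell → ZMod 2} {μ : Cell → Cell → ZMod 2} (hφ : IsIndex φ μ) {a : Cell}
    {r s : List Cell} (hr : c.L f.1 = r ++ a :: s) (hμ : ∀ z ∈ r, ∀ n, μ z n = 0) :
    φ (faceOf f.1 f.2) = φ (faceOf a (r.getLastD f.2)) ∧
      ∀ z ∈ r, φ z = φ (faceOf f.1 f.2) := by
  obtain ⟨h1, h2⟩ := hφ.transport r f.2 a (h.chain_first hr) hμ
  have : r.headD a = f.1 := by
    obtain ⟨t, ht⟩ := c.hL.head _ h.memS
    rw [hr] at ht
    cases r with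
    | nil => simp at ht; simp [ht.1]
    | cons b r => simp at ht; simp [ht.1]
  rw [this] at h1 h2
  rw [faceOf_comm f.1, faceOf_comm a]
  exact ⟨h1, h2⟩

/-- The root edge seen from the vertex `a` of a first path. -/
theorem Trees.Good.idx_root {c : Trees} {f : Cell × Cell} (h : c.Good f)
    {φ : Cell → ZMod 2} {μ : Cell → Cell → ZMod 2} (hφ : IsIndex φ μ) {a : Cell}
    {r s : List Cell} (hr : c.L f.1 = r ++ a :: s) (hμ : ∀ z ∈ s, ∀ n, μ z n = 0) :
    φ (faceOf a (s.headD c.q₀)) = φ (faceOf c.p₀ c.q₀) := by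
  rw [(hφ.transport s a c.q₀ (h.chain_last hr) hμ).1, headD_last h hr]

end Planar

/-! ### The left-right order of compatible edges -/

namespace Planar

theorem getLastD_mem_or (r : List Cell) (d : Cell) : (r = [] ∧ r.getLastD d = d) ∨
    r.getLastD d ∈ r := by
  rcases List.eq_nil_or_concat r with rfl | ⟨l, b, rfl⟩
  · simp
  · right; simp

theorem headD_mem_or (r : List Cell) (d : Cell) : (r = [] ∧ r.headD d = d) ∨ r.headD d ∈ r := by
  cases r <;> simp

/-- The curve does not turn back at a. If a is both the first and the last vertex of its path,
turning back would mean that f joins the two roots, which `Good.ne` excludes; in the other cases the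
paths would overlap or repeat a vertex. -/
theorem Trees.Good.next_ne_root {c : Trees} {f : Cell × Cell} (hf : c.Good f)
    {a : Cell} {r s : List Cell} (hr : c.L f.1 = r ++ a :: s) :
    s.headD c.q₀ ≠ r.getLastD f.2 := by
  have hnd := c.hL.nodup _ hf.memS
  rw [hr, List.nodup_append, List.nodup_cons] at hnd
  have hM : ∀ x ∈ r ++ a :: s, x ∉ c.M f.2 := by rw [← hr]; exact hf.disj
  have hq := c.hM.self_mem hf.memT
  have hq0 := c.hM.root_mem hf.memT
  rcases getLastD_mem_or r f.2 with ⟨h1, h2⟩ | h1 <;>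
    rcases headD_mem_or s c.q₀ with ⟨h3, h4⟩ | h3
  · rw [h2, h4]
    intro h
    subst h1 h3
    obtain ⟨t, ht⟩ := c.hL.head _ hf.memS
    have hl := c.hL.last _ hf.memS
    rw [hr] at hl ht
    simp at hl ht
    exact hf.ne (Prod.ext (by rw [← ht.1, hl]) h.symm)
  · rw [h2]; intro h
    rw [h] at h3
    exact hM _ (by simp [h3]) hq
  · rw [h4]; intro h
    rw [← h] at h1
    exact hM _ (by simp [h1]) hq0
  · intro h
    rw [h] at h3
    exact hnd.2.2 _ h1 _ (List.mem_cons_of_mem _ h3) rfl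

/-- At the vertex a where the first paths split, the curves leave through different edges. If both
paths start at a, this is the assumption that f and g differ; if one of them does, equality would
put an end of one edge on the path of the other, against compatibility. -/
theorem Trees.Good.next_ne {c : Trees} {f g : Cell × Cell} (hf : c.Good f) (hg : c.Good g)
    (hfg : c.Comp f g) (hne : f ≠ g) {a : Cell} {r r' s : List Cell}
    (hr : c.L f.1 = r ++ a :: s) (hr' : c.L g.1 = r' ++ a :: s) (h1 : ∀ z ∈ r, z ∉ c.L g.1) :
    r.getLastD f.2 ≠ r'.getLastD g.2 := by
  have hq := c.hM.self_mem hf.memT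
  have hq' := c.hM.self_mem hg.memT
  rcases getLastD_mem_or r f.2 with ⟨i1, i2⟩ | i1 <;>
    rcases getLastD_mem_or r' g.2 with ⟨j1, j2⟩ | j1
  · rw [i2, j2]
    intro h
    subst i1 j1
    obtain ⟨t, ht⟩ := c.hL.head _ hf.memS
    obtain ⟨t', ht'⟩ := c.hL.head _ hg.memS
    rw [hr] at ht
    rw [hr'] at ht'
    simp at ht ht'
    exact hne (Prod.ext (by rw [← ht.1, ht'.1]) h)
  · rw [i2]; intro h
    rw [← h] at j1
    exact hfg.2 _ (by simp [hr', j1]) hq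
  · rw [j2]; intro h
    rw [h] at i1
    exact hfg.1 _ (by simp [hr, i1]) hq'
  · intro h
    exact h1 _ i1 (by rw [h, hr']; exact List.mem_append_left _ j1)

theorem Trees.Good.untouched {c : Trees} {f g : Cell × Cell} (hg : c.Good g)
    (hfg : c.Comp f g) {a : Cell} {r s : List Cell} (hr : c.L f.1 = r ++ a :: s)
    (h1 : ∀ z ∈ r, z ∉ c.L g.1) : ∀ z ∈ r, ∀ n, c.mult g z n = 0 := fun z hz n =>
  hg.mult_eq_zero (h1 z hz) (hfg.1 z (by simp [hr, hz])) n

/-- Of two compatible edges, exactly one lies on the left of the curve through the other. -/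
theorem Trees.Good.side_add_side {c : Trees} {f g : Cell × Cell} (hf : c.Good f)
    (hg : c.Good g) (hfg : c.Comp f g) (hne : f ≠ g) : c.side g f + c.side f g = 1 := by
  obtain ⟨a, r, r', s, hr, hr', h1, h2⟩ := c.hL.branch hf.memS hg.memS
  have e1 := (hf.idx_eq hg.isIndex hr (hg.untouched hfg hr h1)).1
  have e2 := (hg.idx_eq hf.isIndex hr' (hf.untouched hfg.symm hr' h2)).1
  -- Along the common tail both curves use the same edges, so the sum of their indices has no jumps
  -- there, and the root edge can be exchanged for the edge from a towards the root. The three arms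
  -- at a then decide by `IsIndex.theta`.
  have e3 := hf.idx_root (hf.isIndex.add hg.isIndex) hr
    (fun z hz n => hf.mult_add_eq_zero hg hr hr' hz n)
  have := hf.isIndex.theta hg.isIndex (nb_headD (hf.chain_last hr))
    (nb_getLastD (hf.chain_first hr)) (nb_getLastD (hg.chain_first hr'))
    (hf.next_ne_root hr) (hg.next_ne_root hr') (hf.next_ne hg hfg hne hr hr' h1)
    (hf.mult_at hr) (hg.mult_at hr')
  rw [e3] at this
  rw [Trees.side, Trees.side, e1, e2, ← this]
  ring

/-- A vertex of the path of `f` off the path of `g` lies on the same side as `f`. -/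
theorem Trees.Good.idx_vertex {c : Trees} {f g : Cell × Cell} (hf : c.Good f) (hg : c.Good g)
    (hfg : c.Comp f g) {x : Cell} (hx : x ∈ c.L f.1) (hxg : x ∉ c.L g.1) :
    c.idx g x = c.idx g (faceOf f.1 f.2) := by
  obtain ⟨a, r, r', s, hr, hr', h1, h2⟩ := c.hL.branch hf.memS hg.memS
  refine (hf.idx_eq hg.isIndex hr (hg.untouched hfg hr h1)).2 x ?_
  rw [hr, List.mem_append] at hx
  refine hx.resolve_right fun h => hxg ?_
  rw [hr']; exact List.mem_append_right _ h

/-- A vertex common to the first path of f and the second path of h lies off both paths of g,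
because g is compatible with both edges. By `idx_vertex` it is on the side of f and on the side of h
of the curve through g, which are different. -/
theorem Trees.Good.disjoint_of_sides {c : Trees} {f g h : Cell × Cell} (hf : c.Good f)
    (hg : c.Good g) (hh : c.Good h) (hfg : c.Comp f g) (hgh : c.Comp g h)
    (hs : c.side g f ≠ c.side g h) : c.Comp f h := by
  have hs' : c.idx g (faceOf f.1 f.2) ≠ c.idx g (faceOf h.1 h.2) := fun e =>
    hs (by rw [Trees.side, Trees.side, e])
  have hM : ∀ {f : Cell × Cell}, c.Good f → c.Comp f g → ∀ x ∈ c.M f.2, x ∉ c.M g.2 →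
      c.idx g x = c.idx g (faceOf f.1 f.2) := by
    intro f hf hfg x hx hxg
    have := hf.swap.idx_vertex hg.swap hfg.swap hx hxg
    rw [Trees.idx_swap, Trees.idx_swap] at this
    rw [this, Prod.fst_swap, Prod.snd_swap, faceOf_comm]
  refine ⟨fun x hx hx' => ?_, fun x hx hx' => ?_⟩
  · have i1 : x ∉ c.L g.1 := fun h' => hgh.1 x h' hx'
    have i2 : x ∉ c.M g.2 := hfg.1 x hx
    exact hs' (by rw [← hf.idx_vertex hg hfg hx i1, hM hh hgh.symm x hx' i2])
  · have i1 : x ∉ c.L g.1 := fun h' => hfg.2 x h' hx'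
    have i2 : x ∉ c.M g.2 := hgh.2 x hx
    exact hs' (by rw [← hh.idx_vertex hg hgh.symm hx i1, hM hf hfg x hx' i2])

/-- The relation "to the left of" is transitive on pairwise compatible edges. -/
theorem Trees.Good.side_trans {c : Trees} {f g h : Cell × Cell} (hf : c.Good f)
    (hg : c.Good g) (hh : c.Good h) (hfg : c.Comp f g) (hgh : c.Comp g h) (hfh : c.Comp f h)
    (n2 : g ≠ h) (n3 : f ≠ h) (h1 : c.side g f = 0) (h2 : c.side h g = 0) :
    c.side h f = 0 := by
  have h3 : c.side g h = 1 := by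
    have := hg.side_add_side hh hgh n2; rw [h2, zero_add] at this; exact this
  obtain ⟨a, r, r', s, hr, hr', d1, d2⟩ := c.hL.branch hf.memS hh.memS
  have haf : a ∈ c.L f.1 := by simp [hr]
  have hah : a ∈ c.L h.1 := by simp [hr']
  have hs' : c.idx g (faceOf f.1 f.2) ≠ c.idx g (faceOf h.1 h.2) := fun e => by
    have : c.side g f = c.side g h := by rw [Trees.side, Trees.side, e]
    rw [h1, h3] at this
    exact absurd this (by decide)
  -- If the splitting vertex of the paths of f and h were off the path of g, it would be on the side
  -- of f and on the side of h.
  have hag : a ∈ c.L g.1 := by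
    by_contra hag
    exact hs' (by rw [← hf.idx_vertex hg hfg haf hag, hh.idx_vertex hg hgh.symm hah hag])
  obtain ⟨r'', hr''⟩ : ∃ r'', c.L g.1 = r'' ++ a :: s := by
    obtain ⟨t, ht⟩ := c.hL.head a (c.hL.suffix _ hf.memS a haf).1
    have : t = s := by
      refine suffix_eq_of_nodup (c.hL.nodup _ hf.memS) (a := a) ?_ ⟨r, hr.symm⟩
      rw [← ht]; exact (c.hL.suffix _ hf.memS a haf).2
    subst this
    obtain ⟨u, hu⟩ := (c.hL.suffix _ hg.memS a hag).2
    exact ⟨u, by rw [← hu, ht]⟩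
  -- two paths that leave `a` through different edges are disjoint before `a`
  have split : ∀ {f g : Cell × Cell} {r r' : List Cell}, c.Good f → c.Good g →
      c.L f.1 = r ++ a :: s → c.L g.1 = r' ++ a :: s → r.getLastD f.2 ≠ r'.getLastD g.2 →
      ∀ z ∈ r, z ∉ c.L g.1 := by
    intro f g r r' hf hg hr hr' hne z hz hzg
    have hnd := c.hL.nodup _ hf.memS
    have hnd' := c.hL.nodup _ hg.memS
    rw [hr, List.nodup_append] at hnd
    rw [hr'] at hzg
    rcases List.mem_append.1 hzg with hzr | hzs
    · obtain ⟨u, v, rfl⟩ := List.append_of_mem hz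
      obtain ⟨u', v', rfl⟩ := List.append_of_mem hzr
      have hzS : z ∈ c.L f.1 := by rw [hr]; simp
      obtain ⟨t, ht⟩ := c.hL.head z (c.hL.suffix _ hf.memS z hzS).1
      have e1 : t = v ++ a :: s := by
        refine suffix_eq_of_nodup (c.hL.nodup _ hf.memS) (a := z) ?_ ⟨u, by simp [hr]⟩
        rw [← ht]; exact (c.hL.suffix _ hf.memS z hzS).2
      have e2 : t = v' ++ a :: s := by
        refine suffix_eq_of_nodup (c.hL.nodup _ hg.memS) (a := z) ?_ ⟨u', by simp [hr']⟩
        rw [← ht]; exact (c.hL.suffix _ hg.memS z (by rw [hr']; simp)).2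
      have e3 : v = v' := List.append_cancel_right (e1.symm.trans e2)
      subst e3
      apply hne
      simp [List.getLastD_eq_getLast?, List.getLast?_append, List.getLast?_cons]
    · exact hnd.2.2 z hz z hzs rfl
  have nfh := hf.next_ne hh hfh n3 hr hr' d1
  have nf := hf.next_ne_root hr
  have ng := hg.next_ne_root hr''
  have nh := hh.next_ne_root hr'
  have bf := nb_getLastD (hf.chain_first hr)
  have bg := nb_getLastD (hg.chain_first hr'')
  have bh := nb_getLastD (hh.chain_first hr')
  have e1 := (hf.idx_eq hh.isIndex hr (hh.untouched hfh hr d1)).1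
  -- If g leaves a through the edge that f uses, then f and g are seen from a in the same face, so
  -- they lie on the same side of the curve through h.
  by_cases c1 : r''.getLastD g.2 = r.getLastD f.2
  · have d3 := split hg hh hr'' hr' (by rw [c1]; exact nfh)
    have e2 := (hg.idx_eq hh.isIndex hr'' (hh.untouched hgh hr'' d3)).1
    rw [← h2, Trees.side, Trees.side, e1, e2, c1]
  have d4 := split hf hg hr hr'' (Ne.symm c1)
  have e3 := (hf.idx_eq hg.isIndex hr (hg.untouched hfg hr d4)).1
  -- If g leaves a through the edge that h uses, the curves of g and h agree at a and from there to
  -- the root. The sum of their indices then takes the same value at f and at the root edge, so f is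
  -- on the same side of both curves.
  by_cases c2 : r''.getLastD g.2 = r'.getLastD h.2
  · have hmul : ∀ n, c.mult g a n + c.mult h a n = 0 := fun n => by
      rw [hg.mult_at hr'', hh.mult_at hr', c2, zmod_add_self]
    have e4 := hf.idx_root (hg.isIndex.add hh.isIndex) hr
      (fun z hz n => hg.mult_add_eq_zero hh hr'' hr' hz n)
    have e5 := (hg.isIndex.add hh.isIndex).face_eq_of_untouched hmul bf
    have e6 := (hg.isIndex.add hh.isIndex).face_eq_of_untouched hmul
      (nb_headD (hf.chain_last hr))
    have : c.side g f + c.side h f = 0 := by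
      rw [Trees.side, Trees.side, e1, e3]
      rw [e6] at e4
      rw [e4] at e5
      rw [← zmod_add_self (c.idx g (faceOf c.p₀ c.q₀) + c.idx h (faceOf c.p₀ c.q₀))]
      nth_rewrite 1 [← e5]
      ring
    rwa [h1, zero_add] at this
  have d5 := split hh hg hr' hr'' (Ne.symm c2)
  have d6 := split hg hh hr'' hr' c2
  have e4 := (hh.idx_eq hg.isIndex hr' (hg.untouched hgh.symm hr' d5)).1
  have e5 := (hg.idx_eq hh.isIndex hr'' (hh.untouched hgh hr'' d6)).1
  rw [e3, e4] at hs'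
  -- Now the four edges at a belong to f, g, h and the way to the root. The curve through g
  -- separates the edges of f and h; perpendicular edges off the curve would lie on one side, so
  -- these two are opposite. The edge of g is then perpendicular to that of f, and both lie on one
  -- side of the curve through h.
  have opp : ¬ ((r.getLastD f.2).1 + (r'.getLastD h.2).1 ≠ 2 * a.1 ∨
      (r.getLastD f.2).2 + (r'.getLastD h.2).2 ≠ 2 * a.2) := fun hopp =>
    hs' (hg.isIndex.face_eq_of_perp bf bh nfh hopp
      (by rw [hg.mult_at hr'', if_neg (Ne.symm c1), if_neg (Ne.symm nf), add_zero])
      (by rw [hg.mult_at hr'', if_neg (Ne.symm c2), if_neg (Ne.symm nh), add_zero]))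
  have key : c.idx h (faceOf a (r.getLastD f.2)) = c.idx h (faceOf a (r''.getLastD g.2)) := by
    refine hh.isIndex.face_eq_of_perp bf bg (Ne.symm c1) ?_
      (by rw [hh.mult_at hr', if_neg nfh, if_neg (Ne.symm nf), add_zero])
      (by rw [hh.mult_at hr', if_neg c2, if_neg (Ne.symm ng), add_zero])
    by_contra hopp
    apply c2
    push Not at opp hopp
    ext <;> omega
  rw [← h2, Trees.side, Trees.side, e1, e5, key]

/-- "`f` and `g` are compatible, and `f` is to the left of `g`." -/
def Trees.Lt (c : Trees) (f g : Cell × Cell) : Prop :=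
  f ≠ g ∧ c.Comp f g ∧ c.side g f = 0

/-- The edges f and h lie on different sides of g, so `disjoint_of_sides` supplies their
compatibility and `side_trans` the order. Because compatibility is part of the relation, it suffices
to check consecutive members of a chain. -/
theorem Trees.Lt.trans {c : Trees} {f g h : Cell × Cell} (hf : c.Good f)
    (hg : c.Good g) (hh : c.Good h) (h1 : c.Lt f g) (h2 : c.Lt g h) : c.Lt f h := by
  have h3 : c.side g h = 1 := by
    have := hg.side_add_side hh h2.2.1 h2.1; rw [h2.2.2, zero_add] at this; exact this
  have hne : f ≠ h := by
    rintro rfl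
    rw [h1.2.2] at h3
    exact absurd h3 (by decide)
  have hc := hf.disjoint_of_sides hg hh h1.2.1 h2.2.1 (by rw [h1.2.2, h3]; decide)
  exact ⟨hne, hc, hf.side_trans hg hh h1.2.1 h2.2.1 hc h2.1 hne h1.2.2 h2.2.2⟩

theorem Trees.lt_or_lt {c : Trees} {f g : Cell × Cell} (hf : c.Good f) (hg : c.Good g)
    (hne : f ≠ g) (hfg : c.Comp f g) : c.Lt f g ∨ c.Lt g f := by
  have := hf.side_add_side hg hfg hne
  have h01 : ∀ x : ZMod 2, x = 0 ∨ x = 1 := by decide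
  rcases h01 (c.side g f) with h | h
  · exact Or.inl ⟨hne, hfg, h⟩
  · refine Or.inr ⟨hne.symm, hfg.symm, ?_⟩
    rw [h] at this
    simpa using this

end Planar

namespace WordRAM

/-! ## Notation for expressions and formulas -/

instance : Add Expr := ⟨Expr.op .add⟩
instance : Sub Expr := ⟨Expr.op .sub⟩
instance : Mul Expr := ⟨Expr.op .mul⟩
instance (n : ℕ) : OfNat Expr n := ⟨Expr.const n⟩

@[simp] theorem Expr.val_add (s : State) (e f : Expr) : (e + f).val s = e.val s + f.val s := rfl
@[simp] theorem Expr.val_sub (s : State) (e f : Expr) : (e - f).val s = e.val s - f.val s := rfl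
@[simp] theorem Expr.val_mul (s : State) (e f : Expr) : (e * f).val s = e.val s * f.val s := rfl
@[simp] theorem Expr.val_ofNat (s : State) (n : ℕ) :
    (no_index (OfNat.ofNat n : Expr)).val s = n := rfl
@[simp] theorem Expr.val_zero (s : State) : (0 : Expr).val s = 0 := rfl
@[simp] theorem Expr.val_one (s : State) : (1 : Expr).val s = 1 := rfl
@[simp] theorem Expr.val_var (s : State) (x : ℕ) : (Expr.var x).val s = s.var x := rfl
@[simp] theorem Expr.val_get (s : State) (a : ℕ) (e : Expr) :
    (Expr.get a e).val s = s.arr a (e.val s) := rfl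

def Expr.beq (e f : Expr) : Expr := .op .eq e f
def Expr.blt (e f : Expr) : Expr := .op .lt e f

@[simp] theorem Expr.val_beq (s : State) (e f : Expr) :
    (e.beq f).val s = if e.val s = f.val s then 1 else 0 := rfl
@[simp] theorem Expr.val_blt (s : State) (e f : Expr) :
    (e.blt f).val s = if e.val s < f.val s then 1 else 0 := rfl

def Fml.eq (e f : Expr) : Fml := .atom (e.beq f)
def Fml.lt (e f : Expr) : Fml := .atom (e.blt f)
def Fml.or (φ ψ : Fml) : Fml := .not (.and φ.not ψ.not)
def Fml.all (x b : ℕ) (φ : Fml) : Fml := .not (.ex x b φ.not)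
def Fml.xor (φ ψ : Fml) : Fml := .not (.iff φ ψ)

@[simp] theorem Fml.den_not (s : State) (φ : Fml) : φ.not.den s ↔ ¬ φ.den s := Iff.rfl
@[simp] theorem Fml.den_and (s : State) (φ ψ : Fml) :
    (φ.and ψ).den s ↔ φ.den s ∧ ψ.den s := Iff.rfl
@[simp] theorem Fml.den_iff (s : State) (φ ψ : Fml) :
    (φ.iff ψ).den s ↔ (φ.den s ↔ ψ.den s) := Iff.rfl
@[simp] theorem Fml.den_ex (s : State) (x b : ℕ) (φ : Fml) :
    (Fml.ex x b φ).den s ↔ ∃ i < s.var b, φ.den (s.setVar x i) := Iff.rfl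
@[simp] theorem Fml.den_eq (s : State) (e f : Expr) :
    (Fml.eq e f).den s ↔ e.val s = f.val s := by simp [Fml.eq, Fml.den]
@[simp] theorem Fml.den_lt (s : State) (e f : Expr) :
    (Fml.lt e f).den s ↔ e.val s < f.val s := by simp [Fml.lt, Fml.den]
@[simp] theorem Fml.den_or (s : State) (φ ψ : Fml) :
    (φ.or ψ).den s ↔ φ.den s ∨ ψ.den s := by simp [Fml.or, Fml.den, or_iff_not_and_not]
@[simp] theorem Fml.den_all (s : State) (x b : ℕ) (φ : Fml) :
    (Fml.all x b φ).den s ↔ ∀ i < s.var b, φ.den (s.setVar x i) := by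
  simp [Fml.all, Fml.den]
@[simp] theorem Fml.den_xor (s : State) (φ ψ : Fml) :
    (φ.xor ψ).den s ↔ ¬ (φ.den s ↔ ψ.den s) := Iff.rfl

def Cmd.setIf (φ : Fml) (a : ℕ) (i : Expr) : Cmd := .ite φ (.put a i 1) (.put a i 0)

infixr:30 " ;; " => Cmd.seq

/-! ## The program

Variables: `0` is the answer, `1` the number `n` of cells, `3` the number `L` of bits of the
temperature, `4` the number of tile types, `5` is `4 * n`, `6` is `4`, `7` is `n + 1`, and `10` is
the number of glues. The sides of a tile are numbered `0` (north), `1` (east), `2` (south) and `3`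
(west), and side `d` of cell `i` is the slot `4 * i + d`. -/

namespace TreeUAV

local notation "v" => Expr.var

def xE (i : Expr) : Expr := .get 2 (6 * i)
def yE (i : Expr) : Expr := .get 2 (6 * i + 1)
def glueE (i d : Expr) : Expr := .get 2 (6 * i + 2 + d)
-- Displacements are increased by one, so that they and all comparisons of positions stay in the
-- natural numbers.
def dxE (d : Expr) : Expr := (1 + d.beq 1) - d.beq 3
def dyE (d : Expr) : Expr := (1 + d.beq 0) - d.beq 2
def oppE (d : Expr) : Expr := (d + 2) - 4 * Expr.blt 1 d

/-- The number of the pair of glues that meet if cell `j` is placed at side `d` of cell `i`. -/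
def pairE (i d j : Expr) : Expr := glueE i d * v 10 + glueE j (oppE d)
def posE (i d j : Expr) : Expr := .get 4 (pairE i d j)
def lenE (i d j : Expr) : Expr := .get 4 (pairE i d j + 1) - .get 4 (pairE i d j)

/-- The bond of cell `j` at side `d` of cell `i` is positive. -/
def bondF (i d j : Expr) : Fml := .lt 0 (lenE i d j)

/-- Cell `j` lies at side `d` of cell `i`. -/
def nextF (i d j : Expr) : Fml :=
  .and (.eq (xE j + 1) (xE i + dxE d)) (.eq (yE j + 1) (yE i + dyE d))

def sameF (i j : Expr) : Fml := .all 510 6 (.eq (glueE i (v 510)) (glueE j (v 510)))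

def tileF (i j : Expr) : Fml := .all 510 6 (.eq (.get 1 (4 * i + v 510)) (glueE j (v 510)))

/-- The tile types are those of the cells. -/
def tilesF : Fml :=
  .and (.all 500 4 (.ex 501 1 (tileF (v 500) (v 501))))
    (.all 501 1 (.ex 500 4 (tileF (v 500) (v 501))))

/-- Compare two binary numbers. -/
def cmpC (e f : Expr) : Cmd :=
  .assign 17 1 ;;
  .loop 16 3 (.ite (.eq e f) .skip (.assign 17 (f.blt e)))

def slotPairE (i d j : Expr) : Expr := (4 * i + d) * v 1 + j

/-- A strength with more bits than the temperature is replaced by the temperature; a shorter one is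
padded with zeros. Every tabulated weight thus has exactly L bits. -/
def bondC : Cmd :=
  .assign 14 (lenE (v 11) (v 12) (v 13)) ;;
  .assign 15 (posE (v 11) (v 12) (v 13)) ;;
  .loop 16 3 (.put 6 (slotPairE (v 11) (v 12) (v 13) * v 3 + v 16)
    ((v 16).blt (v 14) * Expr.get 5 (v 15 + v 16) * (1 - (v 3).blt (v 14)) +
      (v 3).blt (v 14) * Expr.get 3 (v 16))) ;;
  cmpC (.get 6 (slotPairE (v 11) (v 12) (v 13) * v 3 + v 16)) (.get 3 (v 16)) ;;
  .put 7 (slotPairE (v 11) (v 12) (v 13)) (v 17)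

/-- Tabulate the bonds (array 6) and whether they reach the temperature (array 7). -/
def bondsC : Cmd := .loop 11 1 (.loop 12 6 (.loop 13 1 bondC))

/-- Tabulate the bond graph (array 8). -/
def graphC : Cmd :=
  .loop 11 1 (.loop 13 1 (.setIf
    (.ex 500 6 (.and (nextF (v 11) (v 500) (v 13)) (bondF (v 11) (v 500) (v 13))))
    8 (v 11 * v 1 + v 13)))

/-- Tabulate the bonded upper neighbours (array 9). -/
def upC : Cmd :=
  .loop 11 1 (.put 9 (v 11) (v 1) ;;
    .loop 13 1 (.ite (.and (nextF (v 11) 0 (v 13)) (bondF (v 11) 0 (v 13)))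
      (.put 9 (v 11) (v 13)) .skip))

/-- All bonds reach the temperature. -/
def strongF : Fml :=
  .all 500 1 (.all 501 6 (.all 502 1 (.not (.and (.and (nextF (v 500) (v 501) (v 502))
    (bondF (v 500) (v 501) (v 502)))
      (.eq (.get 7 (slotPairE (v 500) (v 501) (v 502))) 0)))))

def reachIdxE (x p y : Expr) : Expr := (x * v 1 + p) * v 1 + y

/-- Mark the neighbours of the cells that have been reached. -/
def spreadC : Cmd :=
  .loop 11 1 (.loop 13 1 (.ite
    (.and (.eq (.get 10 (reachIdxE (v 18) (v 19) (v 11))) 1)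
      (.and (.eq (.get 8 (v 11 * v 1 + v 13)) 1) (.not (.eq (v 13) (v 18)))))
    (.put 10 (reachIdxE (v 18) (v 19) (v 13)) 1) .skip))

/-- Tabulate which cells can be reached from which others if a cell is removed (array 10); for
the index `n`, no cell is removed. -/
def reachC : Cmd :=
  .loop 18 7 (.loop 19 1 (
    .loop 20 1 (.setIf (.and (.eq (v 20) (v 19)) (.not (.eq (v 18) (v 19))))
      10 (reachIdxE (v 18) (v 19) (v 20))) ;;
    .loop 21 1 spreadC))

def connF : Fml := .all 500 1 (.eq (.get 10 (reachIdxE (v 1) 0 (v 500))) 1)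

/-- Cell `x` lies on the path from cell `p` to cell `y`. -/
def onF (p y x : Expr) : Fml := .eq (.get 10 (reachIdxE x p y)) 0

/-- The part of the assembly that remains connected with cell `22` if the cell at its side `23` is
removed embeds with a copy of tile `24` at that place. -/
def leafF : Fml :=
  .ex 500 1 (.and
    (.ex 501 1 (.and (nextF (v 500) (v 23) (v 501)) (sameF (v 501) (v 24))))
    (.all 502 1 (.or
      (.ex 503 1 (.and (nextF (v 22) (v 23) (v 503)) (onF (v 22) (v 502) (v 503))))
      (.ex 504 1 (.and (.and (.eq (xE (v 504) + xE (v 22)) (xE (v 502) + xE (v 500)))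
        (.eq (yE (v 504) + yE (v 22)) (yE (v 502) + yE (v 500))))
        (sameF (v 504) (v 502)))))))

/-- The coordinates of the two copies (arrays 11 to 14) if cell `24` of the second copy lies at
side `23` of cell `22` of the first copy. -/
def placeC : Cmd :=
  .loop 11 1 (
    .put 11 (v 11) (xE (v 11) + xE (v 24) + 1) ;;
    .put 12 (v 11) (yE (v 11) + yE (v 24) + 1) ;;
    .put 13 (v 11) (xE (v 11) + xE (v 22) + dxE (v 23)) ;;
    .put 14 (v 11) (yE (v 11) + yE (v 22) + dyE (v 23)))

/-- Tabulate the overlap of the copies (array 15). -/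
def overC : Cmd :=
  .loop 11 1 (.put 15 (v 11) (v 1) ;;
    .loop 13 1 (.ite (.and (.eq (.get 13 (v 13)) (.get 11 (v 11)))
      (.eq (.get 14 (v 13)) (.get 12 (v 11)))) (.put 15 (v 11) (v 13)) .skip))

/-- The path from the root to slot `f` in the first copy meets the path to the partner of slot `g`
in the second copy. -/
def confF (f g : Expr) : Fml :=
  .ex 500 1 (.and (.lt (.get 15 (v 500)) (v 1)) (.and (onF (v 22) (.get 19 f) (v 500))
    (onF (v 24) (.get 16 g) (.get 15 (v 500)))))

/-- Tabulate the bonds between the copies: the partner in the second copy (array 16; `n` if there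
is none), the incident face (arrays 17 and 18), the cell (array 19), and whether the bond is
vertical (array 20). -/
def slotC : Cmd :=
  .put 16 (4 * v 11 + v 12) (v 1) ;;
  .loop 13 1 (.ite (.and (.and (.eq (.get 13 (v 13) + 1) (.get 11 (v 11) + dxE (v 12)))
    (.eq (.get 14 (v 13) + 1) (.get 12 (v 11) + dyE (v 12))))
    (bondF (v 11) (v 12) (v 13))) (.put 16 (4 * v 11 + v 12) (v 13)) .skip) ;;
  .put 17 (4 * v 11 + v 12) (.get 11 (v 11) - (v 12).beq 3) ;;
  .put 18 (4 * v 11 + v 12) (.get 12 (v 11) - (v 12).beq 2) ;;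
  .put 19 (4 * v 11 + v 12) (v 11) ;;
  .put 20 (4 * v 11 + v 12) ((v 12).beq 0 + (v 12).beq 2) ;;
  -- The root itself, and bonds that cannot be present together with the root, are marked with n
  -- like slots without a partner.
  .ite (.or (.and (.eq (v 11) (v 22)) (.eq (v 12) (v 23)))
    (confF (4 * v 11 + v 12) (4 * v 11 + v 12))) (.put 16 (4 * v 11 + v 12) (v 1)) .skip

def slotsC : Cmd := .loop 11 1 (.loop 12 6 slotC)

/-- The vertical edge with lower end `(x, y)` crosses exactly one of the rays to the right that
leave the faces of the slots `f` and `g`. -/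
def crossF (x y f g : Expr) : Fml :=
  .xor (.and (.eq y (.get 18 f)) (.lt (.get 17 f) x))
    (.and (.eq y (.get 18 g)) (.lt (.get 17 g) x))

def rootE : Expr := 4 * v 22 + v 23

/-- The curve through the slot `g` separates the slot `f` from the root. -/
def sideF (g f : Expr) : Fml :=
  .xor (.xor
    (.par 501 1 (.and (.lt (.get 9 (v 501)) (v 1)) (.and (onF (v 22) (.get 19 g) (v 501)) (.and
      (onF (v 22) (.get 19 g) (.get 9 (v 501)))
      (crossF (.get 11 (v 501)) (.get 12 (v 501)) f rootE)))))
    (.par 501 1 (.and (.lt (.get 9 (v 501)) (v 1)) (.and (onF (v 24) (.get 16 g) (v 501)) (.and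
      (onF (v 24) (.get 16 g) (.get 9 (v 501)))
      (crossF (.get 13 (v 501)) (.get 14 (v 501)) f rootE))))))
    (.xor
      (.and (.eq (.get 20 g) 1) (crossF (.get 17 g) (.get 18 g) f rootE))
      (.and (.eq (.get 20 rootE) 1) (crossF (.get 17 rootE) (.get 18 rootE) f rootE)))

/-- Slot `g` may follow slot `f` in a chain of bonds. -/
def relF (f g : Expr) : Fml :=
  .and (.lt (.get 16 g) (v 1)) (.or (.eq f rootE)
    (.and (.lt (.get 16 f) (v 1)) (.and (.not (.eq f g)) (.and (.not (confF f g))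
      (.and (.not (confF g f)) (.not (sideF g f)))))))

def relC : Cmd := .loop 25 5 (.loop 26 5 (.setIf (relF (v 25) (v 26)) 21 (v 25 * v 5 + v 26)))

/-- Initialize the weights of the chains (array 24). -/
def initC : Cmd :=
  .loop 26 5 (.loop 16 3 (.put 24 (v 26 * v 3 + v 16) 0)) ;;
  .loop 16 3 (.put 24 (rootE * v 3 + v 16)
    (.get 6 (slotPairE (v 22) (v 23) (v 24) * v 3 + v 16)))

def chainBitE (f : Expr) : Expr := .get 24 (f * v 3 + v 16)
def slotBitE (g : Expr) : Expr := .get 6 ((g * v 1 + .get 16 g) * v 3 + v 16)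

/-- Add the bond of slot `26` to the weight of a chain that ends in slot `25` (array 23, with the
carry in variable 30). -/
def addC : Cmd :=
  .assign 30 0 ;;
  .loop 16 3 (
    .put 23 (v 16) (((chainBitE (v 25)).beq (slotBitE (v 26))).beq (v 30)) ;;
    .assign 30 (Expr.blt 1 (chainBitE (v 25) + slotBitE (v 26) + v 30)))

/-- A sum that reaches the temperature, recognized by its carry or by comparison, already settles
the answer. Only smaller sums are stored, so L bits suffice. -/
def relaxC : Cmd :=
  addC ;; cmpC (.get 23 (v 16)) (.get 3 (v 16)) ;;
  .ite (.or (.eq (v 30) 1) (.eq (v 17) 1)) (.assign 0 0)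
    (cmpC (chainBitE (v 26)) (.get 23 (v 16)) ;;
      .ite (.eq (v 17) 1) .skip
        (.loop 16 3 (.put 24 (v 26 * v 3 + v 16) (.get 23 (v 16)))))

/-- Since chains visit each slot at most once, 4n rounds of relaxing all pairs suffice, and the
order of the slots never has to be computed explicitly. -/
def chainsC : Cmd :=
  .loop 29 5 (.loop 26 5 (.loop 25 5
    (.ite (.eq (.get 21 (v 25 * v 5 + v 26)) 1) relaxC .skip)))

def rejectUnless (φ : Fml) : Cmd := .ite φ .skip (.assign 0 0)

/-- The leaf test concerns a single tile held by the root bond alone, so it matters only if this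
bond reaches the temperature. Chains are examined for every root bond of positive strength. -/
def rootC : Cmd :=
  .ite (.and (.eq (.get 7 (slotPairE (v 22) (v 23) (v 24))) 1) (.not leafF)) (.assign 0 0) .skip ;;
  placeC ;; overC ;; slotsC ;; relC ;; initC ;; chainsC

/-- There is no early exit: a failed test clears variable 0, and nothing sets it again. The later
stages then run on, and only their time matters. -/
def mainC : Cmd :=
  rejectUnless tilesF ;; bondsC ;; graphC ;; upC ;; rejectUnless strongF ;; reachC ;;
  rejectUnless connF ;;
  .loop 22 1 (.loop 23 6 (.loop 24 1 (.ite (bondF (v 22) (v 23) (v 24)) rootC .skip)))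

theorem mainC_wt : mainC.wt = true := by decide +kernel

/-- The exponent 5 is attained by the reachability table, with n + 1 removed cells, n sources, n
rounds and n² pairs, and by the chains, with 4n² roots, 4n rounds and 16n² pairs; the factor L comes
from the arithmetic on bits. -/
theorem mainC_poly : mainC.poly.2.1 ≤ 5 ∧ mainC.poly.2.2 ≤ 1 := by decide +kernel

end TreeUAV

end WordRAM

/-! ### Effects of commands, and numbers given by their bits -/

namespace WordRAM

/-- The states agree except on the variables `V` and the arrays `A`. -/
structure SameExcept (V A : List ℕ) (s s' : State) : Prop where
  var : ∀ x, x ∉ V → s'.var x = s.var x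
  arr : ∀ a, a ∉ A → s'.arr a = s.arr a

theorem SameExcept.refl (V A : List ℕ) (s : State) : SameExcept V A s s :=
  ⟨fun _ _ => rfl, fun _ _ => rfl⟩

theorem SameExcept.trans {V A : List ℕ} {s s' s'' : State} (h : SameExcept V A s s')
    (h' : SameExcept V A s' s'') : SameExcept V A s s'' :=
  ⟨fun x hx => (h'.var x hx).trans (h.var x hx), fun a ha => (h'.arr a ha).trans (h.arr a ha)⟩

theorem SameExcept.mono {V A V' A' : List ℕ} {s s' : State} (h : SameExcept V A s s')
    (hV : ∀ x ∈ V, x ∈ V') (hA : ∀ x ∈ A, x ∈ A') : SameExcept V' A' s s' :=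
  ⟨fun x hx => h.var x fun h' => hx (hV x h'), fun a ha => h.arr a fun h' => ha (hA a h')⟩

theorem Cmd.same (P : Cmd) (s : State) : SameExcept P.wv P.wa s (P.run s) :=
  ⟨fun _ hx => P.run_var s hx, fun _ ha => P.run_arr s ha⟩

theorem SameExcept.setVar {V A : List ℕ} {s s' : State} (h : SameExcept V A s s') {x : ℕ}
    (hx : x ∈ V) (i : ℕ) : SameExcept V A s (s'.setVar x i) :=
  ⟨fun y hy => by
    have : y ≠ x := fun h' => hy (h' ▸ hx)
    simp [this, h.var y hy], h.arr⟩

/-- The step may use that everything outside of the write sets of the loop is as it was at the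
start; this frame condition need not be repeated in the invariants. -/
theorem Cmd.loop_inv {x b : ℕ} {P : Cmd} {s : State} (N : ℕ) (hN : s.var b = N) (hx : x ∉ P.wv)
    (hb : b ∉ x :: P.wv) (I : ℕ → State → Prop) (h0 : I 0 (s.setVar x 0))
    (hstep : ∀ i s', i < N → I i s' → s'.var x = i → SameExcept (x :: P.wv) P.wa s s' →
      I (i + 1) ((P.run s').setVar x (i + 1))) :
    I N ((Cmd.loop x b P).run s) := by
  subst hN
  refine (Cmd.run_loop hx hb (fun i s' => I i s' ∧ SameExcept (x :: P.wv) P.wa s s')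
    ⟨h0, (SameExcept.refl _ _ s).setVar (by simp) 0⟩ ?_).1
  intro i s' hi hI hxi _
  exact ⟨hstep i s' hi hI.1 hxi hI.2, (hI.2.trans ((P.same s').mono
    (fun x hx => List.mem_cons_of_mem _ hx) fun _ h => h)).setVar (by simp) _⟩

@[simp] theorem Cmd.run_seq (P Q : Cmd) (s : State) : (Cmd.seq P Q).run s = Q.run (P.run s) := rfl
@[simp] theorem Cmd.run_skip (s : State) : Cmd.skip.run s = s := rfl
@[simp] theorem Cmd.run_assign (x : ℕ) (e : Expr) (s : State) :
    (Cmd.assign x e).run s = s.setVar x (e.val s) := rfl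
@[simp] theorem Cmd.run_put (a : ℕ) (i e : Expr) (s : State) :
    (Cmd.put a i e).run s = s.setArr a (i.val s) (e.val s) := rfl

open Classical in
theorem Cmd.run_ite (φ : Fml) (P Q : Cmd) (s : State) :
    (Cmd.ite φ P Q).run s = if φ.den s then P.run s else Q.run s := by
  simp only [Cmd.run]

theorem Cmd.run_setIf (φ : Fml) (a : ℕ) (i : Expr) (s : State) :
    (Cmd.setIf φ a i).run s = s.setArr a (i.val s) (ind01 (φ.den s)) := by
  rw [Cmd.setIf, Cmd.run_ite]
  split_ifs with h <;> simp [h]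

/-- The number with the bits `f 0, …, f (k - 1)`. -/
def bv (f : ℕ → ℕ) (k : ℕ) : ℕ := ∑ b ∈ Finset.range k, f b * 2 ^ b

theorem bv_succ (f : ℕ → ℕ) (k : ℕ) : bv f (k + 1) = bv f k + f k * 2 ^ k :=
  Finset.sum_range_succ _ _

theorem bv_lt {f : ℕ → ℕ} {k : ℕ} (hf : ∀ b < k, f b ≤ 1) : bv f k < 2 ^ k := by
  induction k with
  | zero => simp [bv]
  | succ k ih =>
    rw [bv_succ, pow_succ]
    have h1 := ih fun b hb => hf b (by omega)
    have h2 := hf k (by omega)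
    interval_cases f k <;> omega

theorem bv_congr {f g : ℕ → ℕ} {k : ℕ} (h : ∀ b < k, f b = g b) : bv f k = bv g k :=
  Finset.sum_congr rfl fun b hb => by rw [h b (Finset.mem_range.1 hb)]

end WordRAM

/-! ### The instance in memory, and the meaning of the basic formulas -/

namespace WordRAM.TreeUAV

local notation "v" => Expr.var

/-- The numerical data of an instance: the numbers of cells, of tile types, of bits of the
temperature and of glues; the coordinates and the glues of the cells; the glues of the tile types;
the strengths; strengths that are cut near the temperature; and the temperature. -/
structure Inst where
  n : ℕ
  T : ℕ
  L : ℕ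
  m : ℕ
  cx : ℕ → ℕ
  cy : ℕ → ℕ
  gl : ℕ → ℕ → ℕ
  tg : ℕ → ℕ → ℕ
  st : ℕ → ℕ → ℕ
  wc : ℕ → ℕ → ℕ
  temp : ℕ

/-- The horizontal displacement plus one, in order to avoid negative numbers. -/
def dx (d : ℕ) : ℕ := (1 + if d = 1 then 1 else 0) - if d = 3 then 1 else 0
def dy (d : ℕ) : ℕ := (1 + if d = 0 then 1 else 0) - if d = 2 then 1 else 0
def opp (d : ℕ) : ℕ := (d + 2) - 4 * if 1 < d then 1 else 0

theorem opp_lt {d : ℕ} (h : d < 4) : opp d < 4 := by unfold opp; split_ifs <;> omega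

/-- Cell `j` lies at side `d` of cell `i`. -/
def Inst.next (D : Inst) (i d j : ℕ) : Prop :=
  D.cx j + 1 = D.cx i + dx d ∧ D.cy j + 1 = D.cy i + dy d

/-- The strength of the bond between cell `i` and a copy of cell `j` at its side `d`. -/
def Inst.S (D : Inst) (i d j : ℕ) : ℕ := D.st (D.gl i d) (D.gl j (opp d))
def Inst.W (D : Inst) (i d j : ℕ) : ℕ := D.wc (D.gl i d) (D.gl j (opp d))

def Inst.same (D : Inst) (i j : ℕ) : Prop := ∀ d < 4, D.gl i d = D.gl j d

def Inst.E (D : Inst) (i j : ℕ) : Prop := ∃ d < 4, D.next i d j ∧ 0 < D.S i d j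

/-- Cell `y` can be reached from cell `p` if cell `x` is removed. -/
def Inst.Reach (D : Inst) (x p y : ℕ) : Prop :=
  p ≠ x ∧ Relation.ReflTransGen (fun i j => i < D.n ∧ j < D.n ∧ D.E i j ∧ j ≠ x) p y

/-- The bits of a strength, cut near the temperature, as computed by the program. -/
def capBit (s : State) (L k b : ℕ) : ℕ :=
  (if b < s.arr 4 (k + 1) - s.arr 4 k then 1 else 0) * s.arr 5 (s.arr 4 k + b) *
    (1 - if L < s.arr 4 (k + 1) - s.arr 4 k then 1 else 0) +
    (if L < s.arr 4 (k + 1) - s.arr 4 k then 1 else 0) * s.arr 3 b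

/-- The constants and input arrays in memory are those of the instance `D`. -/
structure Env (D : Inst) (s : State) : Prop where
  v1 : s.var 1 = D.n
  v3 : s.var 3 = D.L
  v4 : s.var 4 = D.T
  v5 : s.var 5 = 4 * D.n
  v6 : s.var 6 = 4
  v7 : s.var 7 = D.n + 1
  v10 : s.var 10 = D.m
  a1 : ∀ i < D.T, ∀ d < 4, s.arr 1 (4 * i + d) = D.tg i d
  ax : ∀ i < D.n, s.arr 2 (6 * i) = D.cx i
  ay : ∀ i < D.n, s.arr 2 (6 * i + 1) = D.cy i
  ag : ∀ i < D.n, ∀ d < 4, s.arr 2 (6 * i + 2 + d) = D.gl i d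
  a3 : ∀ b < D.L, s.arr 3 b ≤ 1
  temp : bv (s.arr 3) D.L = D.temp
  gm : ∀ i < D.n, ∀ d < 4, D.gl i d < D.m
  -- Binary expansions carry no superfluous zeros, so a strength is positive exactly if its stretch
  -- in the bit array is non-empty. Positivity can be tested in constant time.
  pos : ∀ g < D.m, ∀ h < D.m,
    (0 < s.arr 4 (g * D.m + h + 1) - s.arr 4 (g * D.m + h) ↔ 0 < D.st g h)
  bit : ∀ g < D.m, ∀ h < D.m, ∀ b < D.L, capBit s D.L (g * D.m + h) b ≤ 1
  cap : ∀ g < D.m, ∀ h < D.m, bv (capBit s D.L (g * D.m + h)) D.L = D.wc g h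

/-- The variables that may change without invalidating `Env`; the lemmas below check write sets
against this test by computation. -/
def freeVar (x : ℕ) : Bool := decide (x = 0) || decide (10 < x)

theorem Env.congr {D : Inst} {s s' : State} (h : Env D s) (hv : ∀ x, freeVar x = false →
    s'.var x = s.var x) (ha : ∀ a < 6, s'.arr a = s.arr a) : Env D s' := by
  have hb : capBit s' = capBit s := by
    funext L k b
    simp only [capBit, ha 3 (by norm_num), ha 4 (by norm_num), ha 5 (by norm_num)]
  refine ⟨?_, ?_, ?_, ?_, ?_, ?_, ?_, ?_, ?_, ?_, ?_, ?_, ?_, h.gm, ?_, hb ▸ h.bit, hb ▸ h.cap⟩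
  · rw [hv _ (by decide)]; exact h.v1
  · rw [hv _ (by decide)]; exact h.v3
  · rw [hv _ (by decide)]; exact h.v4
  · rw [hv _ (by decide)]; exact h.v5
  · rw [hv _ (by decide)]; exact h.v6
  · rw [hv _ (by decide)]; exact h.v7
  · rw [hv _ (by decide)]; exact h.v10
  · rw [ha _ (by norm_num)]; exact h.a1
  · rw [ha _ (by norm_num)]; exact h.ax
  · rw [ha _ (by norm_num)]; exact h.ay
  · rw [ha _ (by norm_num)]; exact h.ag
  · rw [ha _ (by norm_num)]; exact h.a3
  · rw [ha _ (by norm_num)]; exact h.temp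
  · rw [ha _ (by norm_num)]; exact h.pos

theorem Env.of_same {D : Inst} {s s' : State} {V A : List ℕ} (h : Env D s)
    (hs : SameExcept V A s s') (hV : V.all freeVar = true)
    (hA : A.all (fun a => decide (5 < a)) = true) : Env D s' := by
  refine h.congr (fun x hx => hs.var x fun hxV => ?_) fun a ha => hs.arr a fun haA => ?_
  · have := List.all_eq_true.1 hV x hxV
    rw [hx] at this; exact absurd this (by decide)
  · have := List.all_eq_true.1 hA a haA
    simp only [decide_eq_true_eq] at this; omega

theorem Env.setVar {D : Inst} {s : State} (h : Env D s) {x : ℕ} (hx : 10 < x) (i : ℕ) :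
    Env D (s.setVar x i) :=
  h.congr (fun y hy => by
    have : y ≠ x := by
      rintro rfl
      simp [freeVar, hx] at hy
    simp [this]) fun _ _ => rfl

theorem Env.setArr {D : Inst} {s : State} (h : Env D s) {a : ℕ} (ha : 5 < a) (i x : ℕ) :
    Env D (s.setArr a i x) :=
  h.congr (fun y hy => rfl) fun b hb => by
    funext j
    have : b ≠ a := by omega
    simp [this]

theorem Env.val_pairE {D : Inst} {s : State} (h : Env D s) {i d j : Expr} (hi : i.val s < D.n)
    (hd : d.val s < 4) (hj : j.val s < D.n) : (pairE i d j).val s =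
      D.gl (i.val s) (d.val s) * D.m + D.gl (j.val s) (opp (d.val s)) := by
  have e : (oppE d).val s = opp (d.val s) := rfl
  simp only [pairE, glueE, Expr.val_add, Expr.val_mul, Expr.val_get, Expr.val_ofNat, Expr.val_var,
    e, h.v10]
  rw [h.ag _ hi _ hd, h.ag _ hj _ (opp_lt hd)]

theorem Env.den_bondF {D : Inst} {s : State} (h : Env D s) {i d j : Expr} (hi : i.val s < D.n)
    (hd : d.val s < 4) (hj : j.val s < D.n) :
    (bondF i d j).den s ↔ 0 < D.S (i.val s) (d.val s) (j.val s) := by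
  simp only [bondF, Fml.den_lt, Expr.val_zero, lenE, Expr.val_sub, Expr.val_get, Expr.val_add,
    Expr.val_one, h.val_pairE hi hd hj]
  rw [h.pos _ (h.gm _ hi _ hd) _ (h.gm _ hj _ (opp_lt hd))]
  rfl

theorem val_dxE (d : Expr) (s : State) : (dxE d).val s = dx (d.val s) := rfl
theorem val_dyE (d : Expr) (s : State) : (dyE d).val s = dy (d.val s) := rfl

theorem Env.den_nextF {D : Inst} {s : State} (h : Env D s) {i d j : Expr} (hi : i.val s < D.n)
    (hj : j.val s < D.n) :
    (nextF i d j).den s ↔ D.next (i.val s) (d.val s) (j.val s) := by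
  simp only [nextF, Fml.den_and, Fml.den_eq, Expr.val_add, xE, yE, Expr.val_get,
    Expr.val_mul, Expr.val_ofNat, val_dxE, val_dyE, Inst.next]
  rw [h.ax _ hi, h.ax _ hj, h.ay _ hi, h.ay _ hj]

theorem Env.den_sameF {D : Inst} {s : State} (h : Env D s) {i j : Expr}
    (hi : i.val s < D.n) (hj : j.val s < D.n) (hi' : ∀ k, i.val (s.setVar 510 k) = i.val s)
    (hj' : ∀ k, j.val (s.setVar 510 k) = j.val s) :
    (sameF i j).den s ↔ D.same (i.val s) (j.val s) := by
  simp only [sameF, Fml.den_all, Fml.den_eq, glueE, Expr.val_get, Expr.val_add, Expr.val_mul,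
    Expr.val_ofNat, hi', hj', Expr.val_var, State.setVar_var, if_true, State.setVar_arr, h.v6,
    Inst.same]
  refine forall₂_congr fun d hd => ?_
  rw [h.ag _ hi _ hd, h.ag _ hj _ hd]

theorem Env.den_tileF {D : Inst} {s : State} (h : Env D s) {i j : Expr}
    (hi : i.val s < D.T) (hj : j.val s < D.n) (hi' : ∀ k, i.val (s.setVar 510 k) = i.val s)
    (hj' : ∀ k, j.val (s.setVar 510 k) = j.val s) :
    (tileF i j).den s ↔ ∀ d < 4, D.tg (i.val s) d = D.gl (j.val s) d := by
  simp only [tileF, Fml.den_all, Fml.den_eq, glueE, Expr.val_get, Expr.val_add, Expr.val_mul,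
    Expr.val_ofNat, hi', hj', Expr.val_var, State.setVar_var, if_true, State.setVar_arr, h.v6]
  refine forall₂_congr fun d hd => ?_
  rw [h.a1 _ hi _ hd, h.ag _ hj _ hd]

def Inst.Tiles (D : Inst) : Prop :=
  (∀ i < D.T, ∃ j < D.n, ∀ d < 4, D.tg i d = D.gl j d) ∧
    ∀ j < D.n, ∃ i < D.T, ∀ d < 4, D.tg i d = D.gl j d

theorem Env.den_tilesF {D : Inst} {s : State} (h : Env D s) : tilesF.den s ↔ D.Tiles := by
  simp only [tilesF, Fml.den_and, Fml.den_all, Fml.den_ex, State.setVar_var,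
    show (1 : ℕ) = 500 ↔ False by decide, show (4 : ℕ) = 501 ↔ False by decide, if_false, h.v1,
    h.v4, Inst.Tiles]
  refine and_congr (forall₂_congr fun i hi => exists_congr fun j => and_congr_right fun hj => ?_)
    (forall₂_congr fun j hj => exists_congr fun i => and_congr_right fun hi => ?_)
  · have := ((h.setVar (x := 500) (by norm_num) i).setVar (x := 501) (by norm_num) j).den_tileF
      (i := v 500) (j := v 501) (by simpa using hi) (by simpa using hj) (by simp) (by simp)
    simpa using this
  · have := ((h.setVar (x := 501) (by norm_num) j).setVar (x := 500) (by norm_num) i).den_tileF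
      (i := v 500) (j := v 501) (by simpa using hi) (by simpa using hj) (by simp) (by simp)
    simpa using this

/-! ## Comparison of binary numbers -/

/-- The bits are scanned from the least significant one, and a difference at a higher position
overrides all earlier ones, since the lower bits contribute less than that power of two. Equal
numbers keep the initial value 1. -/
theorem run_cmpC {e f : Expr} {s : State} {L : ℕ} (hL : s.var 3 = L) {X Y : ℕ → ℕ}
    (hXY : ∀ b < L, ∀ s' : State, SameExcept [16, 17] [] s s' → s'.var 16 = b →
      e.val s' = X b ∧ f.val s' = Y b)
    (hX : ∀ b < L, X b ≤ 1) (hY : ∀ b < L, Y b ≤ 1) :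
    ((cmpC e f).run s).var 17 = ind01 (bv Y L ≤ bv X L) := by
  rw [cmpC, Cmd.run_seq]
  refine Cmd.loop_inv L (by simpa using hL) (by simp [Cmd.wv]) (by simp [Cmd.wv])
    (fun b s' => s'.var 17 = ind01 (bv Y b ≤ bv X b)) (by simp [bv]) ?_
  intro b s' hb hI hx hs
  have hs' : SameExcept [16, 17] [] s s' :=
    (((SameExcept.refl [16, 17] [] s).setVar (x := 17) (by simp) _).trans
      (hs.mono (by simp [Cmd.wv]) (by simp [Cmd.wa])))
  obtain ⟨h1, h2⟩ := hXY b hb s' hs' hx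
  have i1 := bv_lt fun b' (hb' : b' < b) => hX b' (by omega)
  have i2 := bv_lt fun b' (hb' : b' < b) => hY b' (by omega)
  have j1 := hX b hb
  have j2 := hY b hb
  simp only [State.setVar_var, show (17 : ℕ) = 16 ↔ False by decide, if_false, Cmd.run_ite,
    Fml.den_eq, bv_succ]
  split_ifs with hxy
  · rw [Cmd.run_skip, hI]
    rw [h1, h2] at hxy
    rw [hxy]
    congr 1; exact propext ⟨fun h => by omega, fun h => by omega⟩
  · rw [h1, h2] at hxy
    rw [Cmd.run_assign, State.setVar_var, if_pos rfl, Expr.val_blt, h1, h2]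
    generalize X b = xb, Y b = yb, 2 ^ b = p at *
    have : (xb = 0 ∧ yb = 1) ∨ (xb = 1 ∧ yb = 0) := by omega
    rcases this with ⟨rfl, rfl⟩ | ⟨rfl, rfl⟩
    · rw [if_neg (by omega), ind01_false (by omega)]
    · rw [if_pos (by omega), ind01_true (by omega)]

end WordRAM.TreeUAV

/-! ### The tables of bonds and neighbours -/

namespace WordRAM.TreeUAV

local notation "v" => Expr.var

/-- For loops that fill tables, an invariant of the arrays is enough; the side conditions are
decidable statements about the write sets. -/
theorem Env.loop {D : Inst} {s : State} (h : Env D s) {x b : ℕ} {P : Cmd} (N : ℕ)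
    (hN : s.var b = N) (hx : x ∉ P.wv) (hb : b ∉ x :: P.wv) (hV : (x :: P.wv).all freeVar = true)
    (hA : P.wa.all (fun a => decide (5 < a)) = true) (G : ℕ → (ℕ → ℕ → ℕ) → Prop)
    (h0 : G 0 s.arr)
    (hstep : ∀ i s', i < N → Env D s' → s'.var x = i → SameExcept (x :: P.wv) P.wa s s' →
      G i s'.arr → G (i + 1) (P.run s').arr) :
    G N ((Cmd.loop x b P).run s).arr :=
  Cmd.loop_inv N hN hx hb (fun i s' => G i s'.arr) h0 fun i s' hi hG hxi hs =>
    hstep i s' hi (h.of_same hs hV hA) hxi hs hG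

/-- Reads the three indices off the linear position, so that the invariant of three nested loops
becomes a statement about an initial segment. -/
def Inst.Wc (D : Inst) (c : ℕ) : ℕ := D.W ((c / D.n) / 4) ((c / D.n) % 4) (c % D.n)

theorem Inst.Wc_eq (D : Inst) {i d j : ℕ} (hd : d < 4) (hj : j < D.n) :
    D.Wc ((4 * i + d) * D.n + j) = D.W i d j := by
  have h1 : ((4 * i + d) * D.n + j) / D.n = 4 * i + d := by
    rw [mul_comm, Nat.mul_add_div (by omega), Nat.div_eq_of_lt hj, add_zero]
  have h2 : ((4 * i + d) * D.n + j) % D.n = j := by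
    rw [mul_comm, Nat.mul_add_mod, Nat.mod_eq_of_lt hj]
  rw [Inst.Wc, h1, h2]
  congr 1 <;> omega

theorem Env.val_slotPairE {D : Inst} {s : State} (h : Env D s) (i d j : Expr) :
    (slotPairE i d j).val s = (4 * i.val s + d.val s) * D.n + j.val s := by
  simp [slotPairE, h.v1]

/-- The rows are filled in increasing order, so it is enough that positions before the current row
of array 6 are preserved. -/
theorem run_bondC {D : Inst} {s : State} (h : Env D s) {i d j c : ℕ} (hi : s.var 11 = i)
    (hd : s.var 12 = d) (hj : s.var 13 = j) (hin : i < D.n) (hd4 : d < 4) (hjn : j < D.n)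
    (hc : c = (4 * i + d) * D.n + j) :
    (∀ b < D.L, (bondC.run s).arr 6 (c * D.L + b) ≤ 1) ∧
    bv (fun b => (bondC.run s).arr 6 (c * D.L + b)) D.L = D.W i d j ∧
    (∀ k < c * D.L, (bondC.run s).arr 6 k = s.arr 6 k) ∧
    (bondC.run s).arr 7 c = ind01 (D.temp ≤ D.W i d j) ∧
    ∀ k, k ≠ c → (bondC.run s).arr 7 k = s.arr 7 k := by
  subst hi hd hj
  set k := D.gl (s.var 11) (s.var 12) * D.m + D.gl (s.var 13) (opp (s.var 12)) with hk
  have hpair : (pairE (v 11) (v 12) (v 13)).val s = k := h.val_pairE (by simpa) (by simpa) (by simpa)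
  set s2 := (s.setVar 14 ((lenE (v 11) (v 12) (v 13)).val s)).setVar 15
    ((posE (v 11) (v 12) (v 13)).val (s.setVar 14 ((lenE (v 11) (v 12) (v 13)).val s))) with hs2
  have e14 : s2.var 14 = s.arr 4 (k + 1) - s.arr 4 k := by
    simp [hs2, lenE, hpair]
  have e15 : s2.var 15 = s.arr 4 k := by
    rw [← hpair]; rfl
  have hE2 : Env D s2 := (h.setVar (by norm_num) _).setVar (by norm_num) _
  set P6 := Cmd.loop 16 3 (.put 6 (slotPairE (v 11) (v 12) (v 13) * v 3 + v 16)
    ((v 16).blt (v 14) * Expr.get 5 (v 15 + v 16) * (1 - (v 3).blt (v 14)) +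
      (v 3).blt (v 14) * Expr.get 3 (v 16))) with hP6
  have h3 : (∀ b < D.L, (P6.run s2).arr 6 (c * D.L + b) = capBit s D.L k b) ∧
      ∀ k' < c * D.L, (P6.run s2).arr 6 k' = s.arr 6 k' := by
    refine hE2.loop D.L hE2.v3 (by decide) (by decide) (by decide) (by decide)
      (fun b arr => (∀ b' < b, arr 6 (c * D.L + b') = capBit s D.L k b') ∧
        ∀ k' < c * D.L, arr 6 k' = s.arr 6 k') ⟨by simp, fun _ _ => rfl⟩ ?_
    intro b s' hb hE hx hs hG
    have v11 : s'.var 11 = s.var 11 := hs.var 11 (by decide)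
    have v12 : s'.var 12 = s.var 12 := hs.var 12 (by decide)
    have v13 : s'.var 13 = s.var 13 := hs.var 13 (by decide)
    have v14 : s'.var 14 = _ := (hs.var 14 (by decide)).trans e14
    have v15 : s'.var 15 = _ := (hs.var 15 (by decide)).trans e15
    have a5 : s'.arr 5 = s.arr 5 := hs.arr 5 (by decide)
    have a3 : s'.arr 3 = s.arr 3 := hs.arr 3 (by decide)
    rw [Cmd.run_put]
    have hidx : (slotPairE (v 11) (v 12) (v 13) * v 3 + v 16).val s' = c * D.L + b := by
      rw [Expr.val_add, Expr.val_mul, hE.val_slotPairE]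
      simp only [Expr.val_var, v11, v12, v13, hE.v3, hx, hc]
    have hval : ((v 16).blt (v 14) * Expr.get 5 (v 15 + v 16) * (1 - (v 3).blt (v 14)) +
        (v 3).blt (v 14) * Expr.get 3 (v 16)).val s' = capBit s D.L k b := by
      simp only [Expr.val_add, Expr.val_mul, Expr.val_sub, Expr.val_one, Expr.val_blt,
        Expr.val_get, Expr.val_var, v14, v15, hx, hE.v3, a5, a3, capBit]
    rw [hidx, hval]
    refine ⟨fun b' hb' => ?_, fun k' hk' => ?_⟩
    · rw [State.setArr_arr]
      split_ifs with hb2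
      · rw [show b' = b by omega]
      · exact hG.1 b' (by omega)
    · rw [State.setArr_arr, if_neg (by omega)]
      exact hG.2 k' hk'
  set s3 := P6.run s2 with hs3
  have hsame3 : SameExcept [16] [6] s2 s3 := P6.same s2
  have hE3 : Env D s3 := hE2.of_same hsame3 (by decide) (by decide)
  have hbit : ∀ b < D.L, capBit s D.L k b ≤ 1 := h.bit _ (h.gm _ hin _ hd4) _
    (h.gm _ hjn _ (opp_lt hd4))
  have hcap : bv (capBit s D.L k) D.L = D.W (s.var 11) (s.var 12) (s.var 13) :=
    h.cap _ (h.gm _ hin _ hd4) _ (h.gm _ hjn _ (opp_lt hd4))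
  set s4 := (cmpC (.get 6 (slotPairE (v 11) (v 12) (v 13) * v 3 + v 16)) (.get 3 (v 16))).run s3
    with hs4
  have hcmp : s4.var 17 = ind01 (D.temp ≤ D.W (s.var 11) (s.var 12) (s.var 13)) := by
    rw [hs4, ← hcap, ← h.temp]
    refine run_cmpC hE3.v3 (X := capBit s D.L k) (Y := s.arr 3) ?_ hbit h.a3
    intro b hb s' hs hx
    have hE : Env D s' := hE3.of_same hs (by decide) (by decide)
    have hs3' : ∀ x, x ≠ 14 → x ≠ 15 → x ≠ 16 → x ≠ 17 → s'.var x = s.var x := by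
      intro x h1 h2 h3 h4
      rw [hs.var x (by simp [h3, h4]), hsame3.var x (by simp [h3])]
      simp [hs2, h1, h2]
    constructor
    · rw [Expr.val_get, Expr.val_add, Expr.val_mul, hE.val_slotPairE]
      simp only [Expr.val_var, hE.v3, hx, hs3' 11 (by decide) (by decide) (by decide) (by decide),
        hs3' 12 (by decide) (by decide) (by decide) (by decide),
        hs3' 13 (by decide) (by decide) (by decide) (by decide), ← hc]
      rw [hs.arr 6 (by decide)]
      exact h3.1 b hb
    · rw [Expr.val_get, Expr.val_var, hx, hs.arr 3 (by decide), hsame3.arr 3 (by decide)]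
      rfl
  have hsame4 : SameExcept [17, 16] [] s3 s4 := (Cmd.same _ s3).mono
    (by simp [cmpC, Cmd.wv]) (by simp [cmpC, Cmd.wa])
  have hE4 : Env D s4 := hE3.of_same hsame4 (by decide) (by decide)
  have hrun : bondC.run s = s4.setArr 7 c (s4.var 17) := by
    have hidx : (slotPairE (v 11) (v 12) (v 13)).val s4 = c := by
      rw [hE4.val_slotPairE]
      simp only [Expr.val_var]
      rw [hsame4.var 11 (by decide), hsame3.var 11 (by decide), hsame4.var 12 (by decide),
        hsame3.var 12 (by decide), hsame4.var 13 (by decide), hsame3.var 13 (by decide), hc]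
      simp [hs2]
    rw [← hidx]; rfl
  have h6 : ∀ k', (bondC.run s).arr 6 k' = s3.arr 6 k' := fun k' => by
    rw [hrun, State.setArr_arr, if_neg (by simp), hsame4.arr 6 (by decide)]
  refine ⟨fun b hb => ?_, ?_, fun k' hk' => ?_, ?_, fun k' hk' => ?_⟩
  · rw [h6, h3.1 b hb]; exact hbit b hb
  · rw [← hcap]
    exact bv_congr fun b hb => by rw [h6, h3.1 b hb]
  · rw [h6, h3.2 k' hk']
  · rw [hrun, State.setArr_arr, if_pos ⟨rfl, rfl⟩, hcmp]
  · rw [hrun, State.setArr_arr, if_neg (by simp [hk']), hsame4.arr 7 (by decide),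
      hsame3.arr 7 (by decide)]
    rfl

theorem run_bondsC {D : Inst} {s : State} (h : Env D s) {i d j : ℕ} (hi : i < D.n) (hd : d < 4)
    (hj : j < D.n) :
    (∀ b < D.L, (bondsC.run s).arr 6 (((4 * i + d) * D.n + j) * D.L + b) ≤ 1) ∧
    bv (fun b => (bondsC.run s).arr 6 (((4 * i + d) * D.n + j) * D.L + b)) D.L = D.W i d j ∧
    (bondsC.run s).arr 7 ((4 * i + d) * D.n + j) = ind01 (D.temp ≤ D.W i d j) := by
  let G : ℕ → (ℕ → ℕ → ℕ) → Prop := fun k arr => ∀ c < k,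
    (∀ b < D.L, arr 6 (c * D.L + b) ≤ 1) ∧ bv (fun b => arr 6 (c * D.L + b)) D.L = D.Wc c ∧
    arr 7 c = ind01 (D.temp ≤ D.Wc c)
  have key : G (4 * D.n * D.n) (bondsC.run s).arr := by
    refine h.loop D.n h.v1 (by decide) (by decide) (by decide) (by decide)
      (fun i => G (4 * i * D.n)) (by intro c hc; omega) ?_
    intro i s1 hi h1 x1 _ hG1
    have := h1.loop 4 h1.v6 (x := 12) (P := .loop 13 1 bondC) (by decide) (by decide) (by decide)
      (by decide) (fun d => G ((4 * i + d) * D.n)) (by simpa using hG1) ?_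
    · rw [show 4 * (i + 1) * D.n = (4 * i + 4) * D.n by ring]; exact this
    intro d s2 hd h2 x2 hs2 hG2
    have := h2.loop D.n h2.v1 (x := 13) (P := bondC) (by decide) (by decide) (by decide)
      (by decide) (fun j => G ((4 * i + d) * D.n + j)) (by simpa using hG2) ?_
    · rw [show (4 * i + (d + 1)) * D.n = (4 * i + d) * D.n + D.n by ring]; exact this
    intro j s3 hj h3 x3 hs3 hG3
    obtain ⟨b1, b2, b3, b4, b5⟩ := run_bondC h3 (i := i) (d := d) (j := j)
      (by rw [hs3.var 11 (by decide), hs2.var 11 (by decide), x1])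
      (by rw [hs3.var 12 (by decide), x2]) x3 hi hd hj rfl
    intro c hc
    rcases (Nat.lt_succ_iff_lt_or_eq (m := c) (n := (4 * i + d) * D.n + j)).1 hc with hc | rfl
    · have hlt : ∀ b < D.L, c * D.L + b < ((4 * i + d) * D.n + j) * D.L := by
        intro b hb
        have : (c + 1) * D.L ≤ ((4 * i + d) * D.n + j) * D.L := Nat.mul_le_mul_right _ hc
        rw [Nat.add_mul] at this
        omega
      obtain ⟨c1, c2, c3⟩ := hG3 c hc
      refine ⟨fun b hb => ?_, ?_, ?_⟩
      · rw [b3 _ (hlt b hb)]; exact c1 b hb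
      · rw [← c2]; exact bv_congr fun b hb => b3 _ (hlt b hb)
      · rw [b5 c (by omega)]; exact c3
    · rw [D.Wc_eq hd hj]
      exact ⟨b1, b2, b4⟩
  have hlt : (4 * i + d) * D.n + j < 4 * D.n * D.n := by
    have : (4 * i + d + 1) * D.n ≤ 4 * D.n * D.n := Nat.mul_le_mul_right _ (by omega)
    rw [Nat.add_mul] at this
    omega
  have := key _ hlt
  rwa [D.Wc_eq hd hj] at this

theorem div_add {n i j : ℕ} (hj : j < n) : (i * n + j) / n = i := by
  rw [mul_comm, Nat.mul_add_div (by omega), Nat.div_eq_of_lt hj, add_zero]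

theorem mod_add {n i j : ℕ} (hj : j < n) : (i * n + j) % n = j := by
  rw [mul_comm, Nat.mul_add_mod, Nat.mod_eq_of_lt hj]

theorem add_lt_mul {n m i j : ℕ} (hi : i < m) (hj : j < n) : i * n + j < m * n := by
  have : (i + 1) * n ≤ m * n := Nat.mul_le_mul_right _ hi
  rw [Nat.add_mul] at this
  omega

/-- A table with two indices is filled by two nested loops. -/
theorem Env.fill {D : Inst} {s : State} (h : Env D s) {x y b b' a N N' : ℕ} {φ : Fml}
    (hN : s.var b = N) (hN' : s.var b' = N') (hxy : x ≠ y) (hb : b ≠ x) (hb2 : b ≠ y)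
    (hb' : b' ≠ x) (hby : b' ≠ y) (hx0 : freeVar x = true)
    (hy0 : freeVar y = true) (ha : 5 < a) (F : ℕ → ℕ → Prop)
    (hF : ∀ s', Env D s' → SameExcept [x, y] [a] s s' → s'.var x < N → s'.var y < N' →
      (φ.den s' ↔ F (s'.var x) (s'.var y))) {i j : ℕ} (hi : i < N) (hj : j < N') :
    ((Cmd.loop x b (.loop y b' (.setIf φ a (v x * v b' + v y)))).run s).arr a (i * N' + j) =
      ind01 (F i j) := by
  let G : ℕ → (ℕ → ℕ → ℕ) → Prop := fun k arr => ∀ c < k, arr a c = ind01 (F (c / N') (c % N'))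
  have key : G (N * N')
      ((Cmd.loop x b (.loop y b' (.setIf φ a (v x * v b' + v y)))).run s).arr := by
    refine h.loop N hN (by simp [Cmd.wv, Cmd.setIf, hxy]) (by simp [Cmd.wv, Cmd.setIf, hb, hb2])
      (by simp [Cmd.wv, Cmd.setIf, hx0, hy0]) (by simp [Cmd.wa, Cmd.setIf, ha])
      (fun i => G (i * N')) (by intro c hc; simp at hc) ?_
    intro i s1 hi h1 x1 hs1 hG1
    have := h1.loop N' (x := y) (P := .setIf φ a (v x * v b' + v y)) (b := b')
      (by rw [hs1.var b' (by simp [Cmd.wv, Cmd.setIf, hb', hby]), hN'])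
      (by simp [Cmd.wv, Cmd.setIf]) (by simp [Cmd.wv, Cmd.setIf, hby])
      (by simp [Cmd.wv, Cmd.setIf, hy0]) (by simp [Cmd.wa, Cmd.setIf, ha])
      (fun j => G (i * N' + j)) (by simpa using hG1) ?_
    · rw [Nat.add_mul, one_mul]; exact this
    intro j s2 hj h2 x2 hs2 hG2
    rw [Cmd.run_setIf]
    have xx : s2.var x = i := by rw [hs2.var x (by simp [Cmd.wv, Cmd.setIf, hxy]), x1]
    have hb2' : s2.var b' = N' := by
      rw [hs2.var b' (by simp [Cmd.wv, Cmd.setIf, hby]),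
        hs1.var b' (by simp [Cmd.wv, Cmd.setIf, hb', hby]), hN']
    have hs : SameExcept [x, y] [a] s s2 :=
      (hs1.mono (by simp [Cmd.wv, Cmd.setIf]) (by simp [Cmd.wa, Cmd.setIf])).trans
        (hs2.mono (by simp [Cmd.wv, Cmd.setIf]) (by simp [Cmd.wa, Cmd.setIf]))
    have hden := hF s2 h2 hs (by omega) (by omega)
    rw [xx, x2] at hden
    intro c hc
    rw [State.setArr_arr]
    simp only [Expr.val_add, Expr.val_mul, Expr.val_var, xx, hb2', x2, true_and]
    split_ifs with hcc
    · rw [hcc, div_add hj, mod_add hj]; congr 1; exact propext hden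
    · exact hG2 c (by omega)
  have := key _ (add_lt_mul hi hj)
  rwa [div_add hj, mod_add hj] at this

theorem run_graphC {D : Inst} {s : State} (h : Env D s) {i j : ℕ} (hi : i < D.n) (hj : j < D.n) :
    (graphC.run s).arr 8 (i * D.n + j) = ind01 (D.E i j) := by
  refine h.fill h.v1 h.v1 (by decide) (by decide) (by decide) (by decide) (by decide) rfl rfl
    (by decide) D.E ?_ hi hj
  intro s' h' _ hx hy
  simp only [Fml.den_ex, h'.v6, Fml.den_and, Inst.E]
  refine exists_congr fun d => and_congr_right fun hd => ?_
  have h2 := h'.setVar (x := 500) (by norm_num) d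
  refine and_congr ?_ ?_
  · have := h2.den_nextF (i := v 11) (d := v 500) (j := v 13) (by simpa using hx) (by simpa using hy)
    simpa using this
  · have := h2.den_bondF (i := v 11) (d := v 500) (j := v 13) (by simpa using hx) (by simpa using hd)
      (by simpa using hy)
    simpa using this

/-- A search loop stores an index below `N` with the property `F`, or `N` if there is none. -/
theorem Env.search {D : Inst} {s : State} (h : Env D s) {x a : ℕ} {e : Expr} {φ : Fml}
    (hx0 : freeVar x = true) (ha : 5 < a) (F : ℕ → Prop) (k : ℕ) (hk : e.val s = k)
    (hke : ∀ s', SameExcept [x] [a] s s' → e.val s' = k)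
    (hF : ∀ s', Env D s' → SameExcept [x] [a] s s' → s'.var x < D.n →
      (φ.den s' ↔ F (s'.var x))) (hx1 : x ≠ 1) :
    let s' := ((Cmd.put a e (v 1)).seq
      (Cmd.loop x 1 (.ite φ (.put a e (v x)) .skip))).run s
    ((s'.arr a k < D.n ∧ F (s'.arr a k)) ∨ (s'.arr a k = D.n ∧ ∀ j < D.n, ¬ F j)) ∧
      ∀ k', k' ≠ k → s'.arr a k' = s.arr a k' := by
  intro s'
  have h1 : Env D ((Cmd.put a e (v 1)).run s) := h.setArr ha _ _
  have key := h1.loop D.n (x := x) (b := 1) (P := .ite φ (.put a e (v x)) .skip) h1.v1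
    (by simp [Cmd.wv]) (by simp [Cmd.wv, Ne.symm hx1]) (by simp [Cmd.wv, hx0]) (by simp [Cmd.wa, ha])
    (fun i arr => ((arr a k < D.n ∧ F (arr a k)) ∨ (arr a k = D.n ∧ ∀ j < i, ¬ F j)) ∧
      ∀ k', k' ≠ k → arr a k' = s.arr a k')
    ⟨Or.inr ⟨by simp [hk, h.v1], by simp⟩, fun k' hk' => by
      rw [Cmd.run_put, State.setArr_arr, if_neg (by simp [hk, hk'])]⟩ ?_
  · exact key
  intro i s2 hi h2 x2 hs2 hG
  have hsame : SameExcept [x] [a] s s2 :=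
    ((Cmd.same _ s).mono (V' := [x]) (A' := [a]) (by simp [Cmd.wv]) (by simp [Cmd.wa])).trans
      (hs2.mono (by simp [Cmd.wv]) (by simp [Cmd.wa]))
  have hden := hF s2 h2 hsame (by omega)
  rw [x2] at hden
  rw [Cmd.run_ite]
  split_ifs with hφ
  · simp only [Cmd.run_put, hke s2 hsame]
    refine ⟨Or.inl ?_, fun k' hk' => ?_⟩
    · rw [State.setArr_arr, if_pos ⟨rfl, rfl⟩, Expr.val_var, x2]
      exact ⟨hi, hden.1 hφ⟩
    · rw [State.setArr_arr, if_neg (by simp [hk'])]; exact hG.2 k' hk'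
  · rw [Cmd.run_skip]
    refine ⟨hG.1.imp_right fun hG => ⟨hG.1, fun j hj => ?_⟩, hG.2⟩
    rcases Nat.lt_succ_iff_lt_or_eq.1 hj with hj | rfl
    · exact hG.2 j hj
    · exact fun hF' => hφ (hden.2 hF')

theorem run_upC {D : Inst} {s : State} (h : Env D s) {i : ℕ} (hi : i < D.n) :
    ((upC.run s).arr 9 i < D.n ∧ D.next i 0 ((upC.run s).arr 9 i) ∧
      0 < D.S i 0 ((upC.run s).arr 9 i)) ∨
    ((upC.run s).arr 9 i = D.n ∧ ∀ j < D.n, ¬ (D.next i 0 j ∧ 0 < D.S i 0 j)) := by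
  let G : ℕ → (ℕ → ℕ → ℕ) → Prop := fun k arr => ∀ i < k,
    (arr 9 i < D.n ∧ D.next i 0 (arr 9 i) ∧ 0 < D.S i 0 (arr 9 i)) ∨
    (arr 9 i = D.n ∧ ∀ j < D.n, ¬ (D.next i 0 j ∧ 0 < D.S i 0 j))
  have key : G D.n (upC.run s).arr := by
    refine h.loop D.n h.v1 (by decide) (by decide) (by decide) (by decide) G
      (by intro c hc; omega) ?_
    intro i s1 hi h1 x1 hs1 hG
    have hF : ∀ s', Env D s' → SameExcept [13] [9] s1 s' → s'.var 13 < D.n →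
        ((Fml.and (nextF (v 11) 0 (v 13)) (bondF (v 11) 0 (v 13))).den s' ↔
          D.next i 0 (s'.var 13) ∧ 0 < D.S i 0 (s'.var 13)) := by
      intro s' h' hs' hx
      have e11 : s'.var 11 = i := by rw [hs'.var 11 (by decide), x1]
      have a1 := h'.den_nextF (i := v 11) (d := 0) (j := v 13) (by simpa [e11] using hi)
        (by simpa using hx)
      have a2 := h'.den_bondF (i := v 11) (d := 0) (j := v 13) (by simpa [e11] using hi) (by simp)
        (by simpa using hx)
      simp only [Expr.val_var, Expr.val_zero, e11] at a1 a2
      rw [Fml.den_and, a1, a2]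
    obtain ⟨k1, k2⟩ := h1.search (x := 13) (a := 9) (e := v 11)
      (φ := .and (nextF (v 11) 0 (v 13)) (bondF (v 11) 0 (v 13))) rfl (by norm_num)
      (fun j => D.next i 0 j ∧ 0 < D.S i 0 j) i (by simp [x1])
      (fun s' hs' => by rw [Expr.val_var, hs'.var 11 (by decide), x1]) hF (by decide)
    intro c hc
    rcases Nat.lt_succ_iff_lt_or_eq.1 hc with hc | rfl
    · have := hG c hc
      rw [← k2 c (by omega)] at this
      exact this
    · exact k1
  exact key i hi

end WordRAM.TreeUAV

/-! ### Reachability after the removal of a cell -/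

namespace WordRAM.TreeUAV

local notation "v" => Expr.var

theorem _root_.WordRAM.Cmd.run_ite_cases {φ : Fml} {P Q : Cmd} {s : State} {p : Prop} (h : φ.den s ↔ p)
    (C : State → Prop) (h1 : p → C (P.run s)) (h2 : ¬ p → C (Q.run s)) :
    C ((Cmd.ite φ P Q).run s) := by
  rw [Cmd.run_ite]
  split_ifs with hφ
  · exact h1 (h.1 hφ)
  · exact h2 fun hp => hφ (h.2 hp)

theorem Env.den_strongF {D : Inst} {s : State} (h : Env D s)
    (h7 : ∀ i < D.n, ∀ d < 4, ∀ j < D.n, s.arr 7 ((4 * i + d) * D.n + j) =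
      ind01 (D.temp ≤ D.W i d j)) :
    strongF.den s ↔
      ∀ i < D.n, ∀ d < 4, ∀ j < D.n, D.next i d j → 0 < D.S i d j → D.temp ≤ D.W i d j := by
  simp only [strongF, Fml.den_all, State.setVar_var, show (1 : ℕ) = 500 ↔ False by decide,
    show (6 : ℕ) = 500 ↔ False by decide, show (1 : ℕ) = 501 ↔ False by decide, if_false, h.v1,
    h.v6]
  refine forall₂_congr fun i hi => forall₂_congr fun d hd => forall₂_congr fun j hj => ?_
  have h3 := ((h.setVar (x := 500) (by norm_num) i).setVar (x := 501) (by norm_num) d).setVar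
    (x := 502) (by norm_num) j
  have a1 := h3.den_nextF (i := v 500) (d := v 501) (j := v 502) (by simpa using hi)
    (by simpa using hj)
  have a2 := h3.den_bondF (i := v 500) (d := v 501) (j := v 502) (by simpa using hi)
    (by simpa using hd) (by simpa using hj)
  rw [Fml.den_not, Fml.den_and, Fml.den_and, a1, a2, Fml.den_eq, Expr.val_get, h3.val_slotPairE]
  simp [h7 i hi d hd j hj]

/-- The cells that are marked in the row of array 10 that starts at position `k`. -/
def marked (D : Inst) (arr : ℕ → ℕ → ℕ) (k : ℕ) : Finset ℕ :=
  (Finset.range D.n).filter fun y => arr 10 (k + y) = 1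

theorem Inst.Reach.step {D : Inst} {x p y z : ℕ} (h : D.Reach x p y) (hy : y < D.n) (hz : z < D.n)
    (hE : D.E y z) (hzx : z ≠ x) : D.Reach x p z :=
  ⟨h.1, h.2.tail ⟨hy, hz, hE, hzx⟩⟩

/-- The pass works in place and may go on from cells that it has just marked. Hence two facts are
kept apart: all marks are sound, and the neighbours of the cells marked at the start are marked at
the end. -/
theorem run_spreadC {D : Inst} {s : State} (h : Env D s)
    (h8 : ∀ i < D.n, ∀ j < D.n, s.arr 8 (i * D.n + j) = ind01 (D.E i j)) {x p k : ℕ}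
    (hx : s.var 18 = x) (hp : s.var 19 = p) (hk : k = (x * D.n + p) * D.n)
    (h01 : ∀ y < D.n, s.arr 10 (k + y) = 0 ∨ s.arr 10 (k + y) = 1 ∧ D.Reach x p y) :
    (∀ y < D.n, s.arr 10 (k + y) = 1 → (spreadC.run s).arr 10 (k + y) = 1) ∧
    (∀ y < D.n, (spreadC.run s).arr 10 (k + y) = 0 ∨
      (spreadC.run s).arr 10 (k + y) = 1 ∧ D.Reach x p y) ∧
    (∀ k' < k, (spreadC.run s).arr 10 k' = s.arr 10 k') ∧
    ∀ i < D.n, ∀ j < D.n, s.arr 10 (k + i) = 1 → D.E i j → j ≠ x →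
      (spreadC.run s).arr 10 (k + j) = 1 := by
  let G : ℕ → ℕ → (ℕ → ℕ → ℕ) → Prop := fun i0 j0 arr =>
    (∀ y < D.n, s.arr 10 (k + y) = 1 → arr 10 (k + y) = 1) ∧
    (∀ y < D.n, arr 10 (k + y) = 0 ∨ arr 10 (k + y) = 1 ∧ D.Reach x p y) ∧
    (∀ k' < k, arr 10 k' = s.arr 10 k') ∧
    ∀ i < D.n, ∀ j < D.n, (i < i0 ∨ i = i0 ∧ j < j0) → s.arr 10 (k + i) = 1 → D.E i j → j ≠ x →
      arr 10 (k + j) = 1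
  have key : G D.n 0 (spreadC.run s).arr := by
    refine h.loop D.n h.v1 (by decide) (by decide) (by decide) (by decide) (fun i => G i 0)
      ⟨fun _ _ h => h, h01, fun _ _ => rfl, fun i _ j _ h => by omega⟩ ?_
    intro i s1 hi h1 x1 hs1 hG1
    have := h1.loop D.n h1.v1 (x := 13) (P := .ite
      (.and (.eq (.get 10 (reachIdxE (v 18) (v 19) (v 11))) 1)
      (.and (.eq (.get 8 (v 11 * v 1 + v 13)) 1) (.not (.eq (v 13) (v 18)))))
      (.put 10 (reachIdxE (v 18) (v 19) (v 13)) 1) .skip) (by decide) (by decide) (by decide)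
      (by decide) (G i) hG1 ?_
    · refine ⟨this.1, this.2.1, this.2.2.1, fun i' hi' j hj hlt => this.2.2.2 i' hi' j hj ?_⟩
      omega
    intro j s2 hj h2 x2 hs2 hG2
    obtain ⟨g1, g2, g3, g4⟩ := hG2
    have e11 : s2.var 11 = i := (hs2.var 11 (by decide)).trans x1
    have e18 : s2.var 18 = x := (hs2.var 18 (by decide)).trans ((hs1.var 18 (by decide)).trans hx)
    have e19 : s2.var 19 = p := (hs2.var 19 (by decide)).trans ((hs1.var 19 (by decide)).trans hp)
    have a8 : s2.arr 8 = s.arr 8 := (hs2.arr 8 (by decide)).trans (hs1.arr 8 (by decide))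
    have hden : (Fml.and (.eq (.get 10 (reachIdxE (v 18) (v 19) (v 11))) 1)
        (.and (.eq (.get 8 (v 11 * v 1 + v 13)) 1) (.not (.eq (v 13) (v 18))))).den s2 ↔
        s2.arr 10 (k + i) = 1 ∧ D.E i j ∧ j ≠ x := by
      simp only [Fml.den_and, Fml.den_eq, Fml.den_not, reachIdxE, Expr.val_get, Expr.val_add,
        Expr.val_mul, Expr.val_var, Expr.val_one, e11, e18, e19, h2.v1, x2, a8, ← hk, h8 i hi j hj,
        ind01_eq_one, ne_eq]
    refine Cmd.run_ite_cases hden (fun s' => G i (j + 1) s'.arr) (fun hc => ?_) fun hc => ?_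
    · obtain ⟨c1, c2, c3⟩ := hc
      have hR : D.Reach x p j := by
        rcases g2 i hi with h0 | ⟨-, hR⟩
        · omega
        · exact hR.step hi hj c2 c3
      have hnew : ∀ k', ((Cmd.put 10 (reachIdxE (v 18) (v 19) (v 13)) 1).run s2).arr 10 k' =
          if k' = k + j then 1 else s2.arr 10 k' := by
        intro k'
        rw [Cmd.run_put, State.setArr_arr]
        simp only [reachIdxE, Expr.val_add, Expr.val_mul, Expr.val_var, e18, e19, h2.v1, x2, ← hk, true_and,
          Expr.val_one]
      refine ⟨fun y hy hy1 => ?_, fun y hy => ?_, fun k' hk' => ?_, fun i' hi' j' hj' hlt a b c => ?_⟩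
      · rw [hnew]; split_ifs
        · rfl
        · exact g1 y hy hy1
      · rw [hnew]
        split_ifs with hyj
        · have : y = j := by omega
          exact Or.inr ⟨rfl, this ▸ hR⟩
        · exact g2 y hy
      · rw [hnew, if_neg (by omega)]; exact g3 k' hk'
      · rw [hnew]; split_ifs with hyj
        · rfl
        · exact g4 i' hi' j' hj' (by omega) a b c
    · rw [Cmd.run_skip]
      refine ⟨g1, g2, g3, fun i' hi' j' hj' hlt a b c => ?_⟩
      by_cases hij : i' = i ∧ j' = j
      · obtain ⟨rfl, rfl⟩ := hij
        exact absurd ⟨g1 i' hi a, b, c⟩ hc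
      · exact g4 i' hi' j' hj' (by omega) a b c
  exact ⟨key.1, key.2.1, key.2.2.1, fun i hi j hj => key.2.2.2 i hi j hj (Or.inl hi)⟩

def reachRowC : Cmd :=
  .loop 20 1 (.setIf (.and (.eq (v 20) (v 19)) (.not (.eq (v 18) (v 19))))
      10 (reachIdxE (v 18) (v 19) (v 20))) ;;
    .loop 21 1 spreadC

/-- As long as some reachable cell is unmarked, every pass marks a further cell. After n passes
either the marking is complete or all n cells are marked, which is also complete. -/
theorem run_reachRowC {D : Inst} {s : State} (h : Env D s)
    (h8 : ∀ i < D.n, ∀ j < D.n, s.arr 8 (i * D.n + j) = ind01 (D.E i j)) {x p k : ℕ}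
    (hx : s.var 18 = x) (hp : s.var 19 = p) (hpn : p < D.n) (hk : k = (x * D.n + p) * D.n) :
    (∀ y < D.n, (reachRowC.run s).arr 10 (k + y) = ind01 (D.Reach x p y)) ∧
    ∀ k' < k, (reachRowC.run s).arr 10 k' = s.arr 10 k' := by
  set P1 := Cmd.loop 20 1 (.setIf (.and (.eq (v 20) (v 19)) (.not (.eq (v 18) (v 19))))
      10 (reachIdxE (v 18) (v 19) (v 20))) with hP1
  have hs1 : SameExcept [20] [10] s (P1.run s) := (Cmd.same P1 s).mono
    (by simp [hP1, Cmd.wv, Cmd.setIf]) (by simp [hP1, Cmd.wa, Cmd.setIf])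
  set s1 := P1.run s with hs1'
  have h1 : Env D s1 := h.of_same hs1 (by decide) (by decide)
  have first : (∀ y < D.n, s1.arr 10 (k + y) = ind01 (y = p ∧ x ≠ p)) ∧
      ∀ k' < k, s1.arr 10 k' = s.arr 10 k' := by
    refine h.loop D.n h.v1 (by decide) (by decide) (by decide) (by decide)
      (fun y0 arr => (∀ y < y0, arr 10 (k + y) = ind01 (y = p ∧ x ≠ p)) ∧
        ∀ k' < k, arr 10 k' = s.arr 10 k') ⟨by simp, fun _ _ => rfl⟩ ?_
    intro y s2 hy h2 x2 hs2 hG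
    have e18 : s2.var 18 = x := (hs2.var 18 (by decide)).trans hx
    have e19 : s2.var 19 = p := (hs2.var 19 (by decide)).trans hp
    rw [Cmd.run_setIf]
    simp only [Fml.den_and, Fml.den_eq, Fml.den_not, reachIdxE, Expr.val_add,
      Expr.val_mul, Expr.val_var, e18, e19, h2.v1, x2, ← hk]
    refine ⟨fun y' hy' => ?_, fun k' hk' => ?_⟩
    · rw [State.setArr_arr]
      split_ifs with hyy
      · rw [show y' = y by omega]
      · exact hG.1 y' (by omega)
    · rw [State.setArr_arr, if_neg (by omega)]; exact hG.2 k' hk'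
  have key : (∀ y < D.n, (reachRowC.run s).arr 10 (k + y) = 0 ∨
      (reachRowC.run s).arr 10 (k + y) = 1 ∧ D.Reach x p y) ∧
      (∀ k' < k, (reachRowC.run s).arr 10 k' = s.arr 10 k') ∧
      (x ≠ p → (reachRowC.run s).arr 10 (k + p) = 1) ∧
      ((∀ y < D.n, D.Reach x p y → (reachRowC.run s).arr 10 (k + y) = 1) ∨
        D.n ≤ (marked D (reachRowC.run s).arr k).card) := by
    refine h1.loop D.n h1.v1 (by decide) (by decide) (by decide) (by decide)
      (fun r arr => (∀ y < D.n, arr 10 (k + y) = 0 ∨ arr 10 (k + y) = 1 ∧ D.Reach x p y) ∧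
      (∀ k' < k, arr 10 k' = s.arr 10 k') ∧ (x ≠ p → arr 10 (k + p) = 1) ∧
      ((∀ y < D.n, D.Reach x p y → arr 10 (k + y) = 1) ∨ r ≤ (marked D arr k).card)) ?_ ?_
    · refine ⟨fun y hy => ?_, first.2, fun hxp => ?_, Or.inr (Nat.zero_le _)⟩
      · rw [first.1 y hy]
        by_cases hc : y = p ∧ x ≠ p
        · right
          rw [ind01_true hc, hc.1]
          exact ⟨rfl, Ne.symm hc.2, Relation.ReflTransGen.refl⟩
        · left; rw [ind01_false hc]
      · rw [first.1 p hpn]; simp [hxp]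
    · rintro r s2 hr h2 x2 hs2 ⟨g1, g2, g3, g4⟩
      have e18 : s2.var 18 = x := (hs2.var 18 (by decide)).trans ((hs1.var 18 (by decide)).trans hx)
      have e19 : s2.var 19 = p := (hs2.var 19 (by decide)).trans ((hs1.var 19 (by decide)).trans hp)
      have a8 : s2.arr 8 = s.arr 8 := (hs2.arr 8 (by decide)).trans (hs1.arr 8 (by decide))
      obtain ⟨k1, k2, k3, k4⟩ := run_spreadC h2 (by rw [a8]; exact h8) e18 e19 hk g1
      refine ⟨k2, fun k' hk' => (k3 k' hk').trans (g2 k' hk'), fun hxp => k1 p hpn (g3 hxp), ?_⟩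
      by_cases hall : ∀ y < D.n, D.Reach x p y → s2.arr 10 (k + y) = 1
      · exact Or.inl fun y hy hR => k1 y hy (hall y hy hR)
      · right
        have hcard := g4.resolve_left hall
        -- A marked set that contains the source and is closed under allowed steps would contain
        -- every reachable cell. So some step leaves it, and the pass gains the target of that step.
        have hclosed : ¬ ∀ i < D.n, ∀ j < D.n, s2.arr 10 (k + i) = 1 → D.E i j → j ≠ x →
            s2.arr 10 (k + j) = 1 := by
          intro hcl
          refine hall fun y hy hR => ?_
          have : y < D.n ∧ s2.arr 10 (k + y) = 1 := by
            have h0 := g3 (Ne.symm hR.1)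
            clear hy
            obtain ⟨-, hR⟩ := hR
            induction hR with
            | refl => exact ⟨hpn, h0⟩
            | tail _ hs ih => exact ⟨hs.2.1, hcl _ ih.1 _ hs.2.1 ih.2 hs.2.2.1 hs.2.2.2⟩
          exact this.2
        push Not at hclosed
        obtain ⟨i, hi, j, hj, c1, c2, c3, c4⟩ := hclosed
        have hlt : (marked D s2.arr k) ⊂ (marked D (spreadC.run s2).arr k) := by
          refine Finset.ssubset_iff_of_subset (fun y hy => ?_) |>.2 ⟨j, ?_, ?_⟩
          · simp only [marked, Finset.mem_filter, Finset.mem_range] at hy ⊢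
            exact ⟨hy.1, k1 y hy.1 hy.2⟩
          · simp only [marked, Finset.mem_filter, Finset.mem_range]
            exact ⟨hj, k4 i hi j hj c1 c2 c3⟩
          · simp only [marked, Finset.mem_filter, Finset.mem_range]
            exact fun h => c4 h.2
        have := Finset.card_lt_card hlt
        omega
  obtain ⟨g1, g2, g3, g4⟩ := key
  refine ⟨fun y hy => ?_, g2⟩
  have hall : ∀ y < D.n, D.Reach x p y → (reachRowC.run s).arr 10 (k + y) = 1 := by
    rcases g4 with g4 | g4
    · exact g4
    · have : marked D (reachRowC.run s).arr k = Finset.range D.n :=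
        Finset.eq_of_subset_of_card_le (Finset.filter_subset _ _) (by simpa using g4)
      intro y hy _
      have hy' : y ∈ marked D (reachRowC.run s).arr k := by rw [this]; simpa using hy
      exact (Finset.mem_filter.1 hy').2
  rcases g1 y hy with h0 | ⟨h1, hR⟩
  · rw [h0, ind01_false]
    intro hR
    have := hall y hy hR
    omega
  · rw [h1, ind01_true hR]

theorem run_reachC {D : Inst} {s : State} (h : Env D s)
    (h8 : ∀ i < D.n, ∀ j < D.n, s.arr 8 (i * D.n + j) = ind01 (D.E i j)) {x p y : ℕ}
    (hx : x ≤ D.n) (hp : p < D.n) (hy : y < D.n) :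
    (reachC.run s).arr 10 ((x * D.n + p) * D.n + y) = ind01 (D.Reach x p y) := by
  let G : ℕ → (ℕ → ℕ → ℕ) → Prop := fun k arr => ∀ c < k, ∀ y < D.n,
    arr 10 (c * D.n + y) = ind01 (D.Reach (c / D.n) (c % D.n) y)
  have key : G ((D.n + 1) * D.n) (reachC.run s).arr := by
    refine h.loop (D.n + 1) h.v7 (by decide) (by decide) (by decide) (by decide)
      (fun x => G (x * D.n)) (by intro c hc; omega) ?_
    intro x s1 hx h1 x1 hs1 hG1
    have := h1.loop D.n h1.v1 (x := 19) (P := reachRowC) (by decide) (by decide) (by decide)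
      (by decide) (fun p => G (x * D.n + p)) (by simpa using hG1) ?_
    · rw [Nat.add_mul, one_mul]; exact this
    intro p s2 hp h2 x2 hs2 hG2
    have a8 : s2.arr 8 = s.arr 8 := (hs2.arr 8 (by decide)).trans (hs1.arr 8 (by decide))
    obtain ⟨r1, r2⟩ := run_reachRowC h2 (by rw [a8]; exact h8)
      ((hs2.var 18 (by decide)).trans x1) x2 hp rfl
    intro c hc y hy
    rcases (Nat.lt_succ_iff_lt_or_eq (m := c) (n := x * D.n + p)).1 hc with hc | rfl
    · rw [r2 _ (add_lt_mul hc hy)]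
      exact hG2 c hc y hy
    · rw [div_add hp, mod_add hp]
      exact r1 y hy
  have := key _ (add_lt_mul (Nat.lt_succ_of_le hx) hp) y hy
  rwa [div_add hp, mod_add hp] at this

/-- The tables that the program computes before it turns to the pairs of copies. -/
structure Tab (D : Inst) (s : State) : Prop extends Env D s where
  bit6 : ∀ i < D.n, ∀ d < 4, ∀ j < D.n, ∀ b < D.L, s.arr 6 (((4 * i + d) * D.n + j) * D.L + b) ≤ 1
  val6 : ∀ i < D.n, ∀ d < 4, ∀ j < D.n,
    bv (fun b => s.arr 6 (((4 * i + d) * D.n + j) * D.L + b)) D.L = D.W i d j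
  ge : ∀ i < D.n, ∀ d < 4, ∀ j < D.n,
    s.arr 7 ((4 * i + d) * D.n + j) = ind01 (D.temp ≤ D.W i d j)
  up : ∀ i < D.n, (s.arr 9 i < D.n ∧ D.next i 0 (s.arr 9 i) ∧ 0 < D.S i 0 (s.arr 9 i)) ∨
    (s.arr 9 i = D.n ∧ ∀ j < D.n, ¬ (D.next i 0 j ∧ 0 < D.S i 0 j))
  reach : ∀ x ≤ D.n, ∀ p < D.n, ∀ y < D.n,
    s.arr 10 ((x * D.n + p) * D.n + y) = ind01 (D.Reach x p y)

def tabArr (a : ℕ) : Bool := decide (a = 8) || decide (10 < a)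

theorem Tab.of_same {D : Inst} {s s' : State} {V A : List ℕ} (h : Tab D s)
    (hs : SameExcept V A s s') (hV : V.all freeVar = true) (hA : A.all tabArr = true) :
    Tab D s' := by
  have ha : ∀ a, tabArr a = false → s'.arr a = s.arr a := fun a ha => hs.arr a fun h' => by
    have := List.all_eq_true.1 hA a h'
    rw [ha] at this; exact absurd this (by decide)
  refine ⟨h.toEnv.of_same hs hV ?_, ?_, ?_, ?_, ?_, ?_⟩
  · rw [List.all_eq_true] at hA ⊢
    intro a h'
    have := hA a h'
    simp only [tabArr, Bool.or_eq_true, decide_eq_true_eq] at this ⊢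
    omega
  · rw [ha 6 rfl]; exact h.bit6
  · rw [ha 6 rfl]; exact h.val6
  · rw [ha 7 rfl]; exact h.ge
  · rw [ha 9 rfl]; exact h.up
  · rw [ha 10 rfl]; exact h.reach

theorem Tab.setVar {D : Inst} {s : State} (h : Tab D s) {x : ℕ} (hx : 10 < x) (i : ℕ) :
    Tab D (s.setVar x i) :=
  h.of_same (V := [x]) (A := []) ((SameExcept.refl _ _ s).setVar (by simp) i)
    (by simp [freeVar, hx]) (by simp)

/-- The row with index n of the table removes no cell, because the cells are numbered below n. -/
theorem Env.den_connF {D : Inst} {s : State} (h : Env D s) (hn : 0 < D.n)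
    (h10 : ∀ x ≤ D.n, ∀ p < D.n, ∀ y < D.n,
      s.arr 10 ((x * D.n + p) * D.n + y) = ind01 (D.Reach x p y)) :
    connF.den s ↔ ∀ y < D.n, D.Reach D.n 0 y := by
  simp only [connF, Fml.den_all, h.v1, Fml.den_eq, Expr.val_one, Expr.val_get, reachIdxE,
    Expr.val_add, Expr.val_mul, Expr.val_var, Expr.val_zero, State.setVar_var,
    show (1 : ℕ) = 500 ↔ False by decide, if_false, if_true, State.setVar_arr]
  refine forall₂_congr fun y hy => ?_
  rw [h10 _ le_rfl 0 hn y hy, ind01_eq_one]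

end WordRAM.TreeUAV

/-! ### Two copies at a root bond: positions, overlaps and slots -/

namespace WordRAM.TreeUAV

local notation "v" => Expr.var

/-- The second copy is placed such that its cell `q` lies at side `d` of cell `p` of the first
copy. -/
structure Root where
  p : ℕ
  d : ℕ
  q : ℕ

namespace Inst

variable (D : Inst) (R : Root)

/-! The coordinates of the cells of the first and of the second copy. -/

def ax (i : ℕ) : ℕ := D.cx i + D.cx R.q + 1
def ay (i : ℕ) : ℕ := D.cy i + D.cy R.q + 1
def bx (i : ℕ) : ℕ := D.cx i + D.cx R.p + dx R.d
def by' (i : ℕ) : ℕ := D.cy i + D.cy R.p + dy R.d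

/-- A face that is incident to the slot `f`. -/
def fx (f : ℕ) : ℕ := D.ax R (f / 4) - if f % 4 = 3 then 1 else 0
def fy (f : ℕ) : ℕ := D.ay R (f / 4) - if f % 4 = 2 then 1 else 0

def Ov (x y : ℕ) : Prop := D.bx R y = D.ax R x ∧ D.by' R y = D.ay R x

/-- The path to cell `i` in the first copy meets the path to cell `j` in the second copy. -/
def Conf (i j : ℕ) : Prop :=
  ∃ x < D.n, ∃ y < D.n, D.Ov R x y ∧ ¬ D.Reach x R.p i ∧ ¬ D.Reach y R.q j

/-- Cell `j` of the second copy has a bond with slot `f` of the first copy. -/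
def Meets (f j : ℕ) : Prop :=
  (D.bx R j + 1 = D.ax R (f / 4) + dx (f % 4) ∧ D.by' R j + 1 = D.ay R (f / 4) + dy (f % 4)) ∧
    0 < D.S (f / 4) (f % 4) j

/-- The bonds that can be present together with the root. The root slot is left out because its
weight is always counted separately. -/
def Valid (f j : ℕ) : Prop :=
  j < D.n ∧ D.Meets R f j ∧ ¬ (f / 4 = R.p ∧ f % 4 = R.d) ∧ ¬ D.Conf R (f / 4) j

-- The value n stands for a slot without a usable bond. As different cells have different positions,
-- the choice is from at most one candidate.
open Classical in
noncomputable def nbr (f : ℕ) : ℕ := if h : ∃ j, D.Valid R f j then h.choose else D.n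

def CrossP (x y f g : ℕ) : Prop :=
  ¬ ((y = D.fy R f ∧ D.fx R f < x) ↔ (y = D.fy R g ∧ D.fx R g < x))

def Vert (f : ℕ) : Prop := f % 4 = 0 ∨ f % 4 = 2

def Up (y z : ℕ) : Prop := z < D.n ∧ D.next y 0 z ∧ 0 < D.S y 0 z

def root (R : Root) : ℕ := 4 * R.p + R.d

/-- Only vertical edges cross a horizontal ray, and each is named by its lower cell y. A cell lies
on the path exactly if its removal cuts off the target, hence the negated reachability. -/
noncomputable def Odd1 (f g : ℕ) : Prop :=
  Odd (∑ y ∈ Finset.range D.n, ind01 (∃ z, D.Up y z ∧ ¬ D.Reach y R.p (g / 4) ∧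
    ¬ D.Reach z R.p (g / 4) ∧ D.CrossP R (D.ax R y) (D.ay R y) f (root R)))

noncomputable def Odd2 (f g : ℕ) : Prop :=
  Odd (∑ y ∈ Finset.range D.n, ind01 (∃ z, D.Up y z ∧ ¬ D.Reach y R.q (D.nbr R g) ∧
    ¬ D.Reach z R.q (D.nbr R g) ∧ D.CrossP R (D.bx R y) (D.by' R y) f (root R)))

/-- The closed curve through the slot `g` and the root separates the faces of the slot `f` and of
the root. -/
def Side (g f : ℕ) : Prop :=
  ¬ (¬ (D.Odd1 R f g ↔ D.Odd2 R f g) ↔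
    ¬ ((Vert g ∧ D.CrossP R (D.fx R g) (D.fy R g) f (root R)) ↔
      (Vert (root R) ∧ D.CrossP R (D.fx R (root R)) (D.fy R (root R)) f (root R))))

/-- Slot `g` may follow slot `f` in a chain of bonds. -/
def Rel (f g : ℕ) : Prop :=
  D.nbr R g < D.n ∧ (f = root R ∨ (D.nbr R f < D.n ∧ f ≠ g ∧ ¬ D.Conf R (f / 4) (D.nbr R g) ∧
    ¬ D.Conf R (g / 4) (D.nbr R f) ∧ ¬ D.Side R g f))

def Inj : Prop := ∀ i < D.n, ∀ j < D.n, D.cx i = D.cx j → D.cy i = D.cy j → i = j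

end Inst

theorem Inst.Inj.meets {D : Inst} (h : D.Inj) {R : Root} {f i j : ℕ} (hi : i < D.n) (hj : j < D.n)
    (hfi : D.Meets R f i) (hfj : D.Meets R f j) : i = j := by
  have h1 := hfi.1
  have h2 := hfj.1
  simp only [Inst.bx, Inst.by'] at h1 h2
  exact h i hi j hj (by omega) (by omega)

theorem Inst.Inj.ov {D : Inst} (h : D.Inj) {R : Root} {f i j : ℕ} (hi : i < D.n) (hj : j < D.n)
    (hfi : D.Ov R f i) (hfj : D.Ov R f j) : i = j := by
  simp only [Inst.Ov, Inst.bx, Inst.by'] at hfi hfj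
  exact h i hi j hj (by omega) (by omega)

theorem Inst.nbr_spec (D : Inst) (R : Root) (f : ℕ) :
    D.Valid R f (D.nbr R f) ∨ (D.nbr R f = D.n ∧ ∀ j, ¬ D.Valid R f j) := by
  unfold Inst.nbr
  split_ifs with h
  · exact Or.inl h.choose_spec
  · exact Or.inr ⟨rfl, not_exists.1 h⟩

theorem Inst.Inj.nbr_eq {D : Inst} (h : D.Inj) {R : Root} {f j : ℕ} (hj : D.Valid R f j) :
    D.nbr R f = j := by
  rcases D.nbr_spec R f with h1 | ⟨-, h1⟩
  · exact h.meets h1.1 hj.1 h1.2.1 hj.2.1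
  · exact absurd hj (h1 j)

structure Placed (D : Inst) (R : Root) (s : State) : Prop extends Tab D s where
  v22 : s.var 22 = R.p
  v23 : s.var 23 = R.d
  v24 : s.var 24 = R.q
  hp : R.p < D.n
  hd : R.d < 4
  hq : R.q < D.n
  a11 : ∀ i < D.n, s.arr 11 i = D.ax R i
  a12 : ∀ i < D.n, s.arr 12 i = D.ay R i
  a13 : ∀ i < D.n, s.arr 13 i = D.bx R i
  a14 : ∀ i < D.n, s.arr 14 i = D.by' R i

def plArr (a : ℕ) : Bool := decide (14 < a)
def rtVar (x : ℕ) : Bool :=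
  freeVar x && decide (x ≠ 22) && decide (x ≠ 23) && decide (x ≠ 24)

theorem Placed.of_same {D : Inst} {R : Root} {s s' : State} {V A : List ℕ} (h : Placed D R s)
    (hs : SameExcept V A s s') (hV : V.all rtVar = true) (hA : A.all plArr = true) :
    Placed D R s' := by
  have hv : ∀ x, rtVar x = false → s'.var x = s.var x := fun x hx => hs.var x fun h' => by
    have := List.all_eq_true.1 hV x h'
    rw [hx] at this; exact absurd this (by decide)
  have ha : ∀ a, plArr a = false → s'.arr a = s.arr a := fun a ha => hs.arr a fun h' => by
    have := List.all_eq_true.1 hA a h'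
    rw [ha] at this; exact absurd this (by decide)
  refine ⟨h.toTab.of_same hs ?_ ?_, ?_, ?_, ?_, h.hp, h.hd, h.hq, ?_, ?_, ?_, ?_⟩
  · rw [List.all_eq_true] at hV ⊢
    intro a h'
    have := hV a h'
    simp only [rtVar, Bool.and_eq_true] at this
    exact this.1.1.1
  · rw [List.all_eq_true] at hA ⊢
    intro a h'
    have := hA a h'
    simp only [tabArr, plArr, Bool.or_eq_true, decide_eq_true_eq] at this ⊢
    omega
  · rw [hv 22 rfl]; exact h.v22
  · rw [hv 23 rfl]; exact h.v23
  · rw [hv 24 rfl]; exact h.v24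
  · rw [ha 11 rfl]; exact h.a11
  · rw [ha 12 rfl]; exact h.a12
  · rw [ha 13 rfl]; exact h.a13
  · rw [ha 14 rfl]; exact h.a14

theorem Placed.setVar {D : Inst} {R : Root} {s : State} (h : Placed D R s) {x : ℕ} (hx : 24 < x)
    (i : ℕ) : Placed D R (s.setVar x i) :=
  h.of_same (V := [x]) (A := []) ((SameExcept.refl _ _ s).setVar (by simp) i)
    (by simp [rtVar, freeVar]; omega) (by simp)

theorem run_placeC {D : Inst} {R : Root} {s : State} (h : Tab D s) (h22 : s.var 22 = R.p)
    (h23 : s.var 23 = R.d) (h24 : s.var 24 = R.q) (hp : R.p < D.n) (hd : R.d < 4)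
    (hq : R.q < D.n) : Placed D R (placeC.run s) := by
  have hs := Cmd.same placeC s
  have ht : Tab D (placeC.run s) := h.of_same hs (by decide) (by decide)
  have key : ∀ i < D.n, (placeC.run s).arr 11 i = D.ax R i ∧ (placeC.run s).arr 12 i = D.ay R i ∧
      (placeC.run s).arr 13 i = D.bx R i ∧ (placeC.run s).arr 14 i = D.by' R i := by
    refine h.toEnv.loop D.n h.v1 (by decide) (by decide) (by decide) (by decide)
      (fun k arr => ∀ i < k, arr 11 i = D.ax R i ∧ arr 12 i = D.ay R i ∧ arr 13 i = D.bx R i ∧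
        arr 14 i = D.by' R i) (by intro i hi; omega) ?_
    intro k s' hk h' hx hs' hG i hi
    have e22 : s'.var 22 = _ := (hs'.var 22 (by decide)).trans h22
    have e23 : s'.var 23 = _ := (hs'.var 23 (by decide)).trans h23
    have e24 : s'.var 24 = _ := (hs'.var 24 (by decide)).trans h24
    simp only [Cmd.run_seq, Cmd.run_put, State.setArr_arr, State.setArr_var, Expr.val_add,
      Expr.val_var, xE, yE, Expr.val_get, Expr.val_mul, Expr.val_ofNat, e22, e23,
      e24, hx, true_and, val_dxE, val_dyE, show (11 : ℕ) = 12 ↔ False by decide,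
      show (11 : ℕ) = 13 ↔ False by decide, show (11 : ℕ) = 14 ↔ False by decide,
      show (12 : ℕ) = 11 ↔ False by decide, show (12 : ℕ) = 13 ↔ False by decide,
      show (12 : ℕ) = 14 ↔ False by decide, show (13 : ℕ) = 11 ↔ False by decide,
      show (13 : ℕ) = 12 ↔ False by decide, show (13 : ℕ) = 14 ↔ False by decide,
      show (14 : ℕ) = 11 ↔ False by decide, show (14 : ℕ) = 12 ↔ False by decide,
      show (14 : ℕ) = 13 ↔ False by decide, show (2 : ℕ) = 11 ↔ False by decide,
      show (2 : ℕ) = 12 ↔ False by decide, show (2 : ℕ) = 13 ↔ False by decide, false_and,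
      if_false]
    rw [h'.ax k hk, h'.ay k hk, h'.ax _ hq, h'.ay _ hq, h'.ax _ hp, h'.ay _ hp]
    split_ifs with hik
    · subst hik; exact ⟨rfl, rfl, rfl, rfl⟩
    · exact hG i (by omega)
  exact ⟨ht, (hs.var 22 (by decide)).trans h22, (hs.var 23 (by decide)).trans h23,
    (hs.var 24 (by decide)).trans h24, hp, hd, hq, fun i hi => (key i hi).1,
    fun i hi => (key i hi).2.1, fun i hi => (key i hi).2.2.1, fun i hi => (key i hi).2.2.2⟩

def OverSpec (D : Inst) (R : Root) (s : State) : Prop :=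
  ∀ i < D.n, (s.arr 15 i < D.n ∧ D.Ov R i (s.arr 15 i)) ∨
    (s.arr 15 i = D.n ∧ ∀ j < D.n, ¬ D.Ov R i j)

theorem run_overC {D : Inst} {R : Root} {s : State} (h : Placed D R s) :
    OverSpec D R (overC.run s) := by
  let G : ℕ → (ℕ → ℕ → ℕ) → Prop := fun k arr => ∀ i < k,
    (arr 15 i < D.n ∧ D.Ov R i (arr 15 i)) ∨ (arr 15 i = D.n ∧ ∀ j < D.n, ¬ D.Ov R i j)
  have key : G D.n (overC.run s).arr := by
    refine h.toEnv.loop D.n h.v1 (by decide) (by decide) (by decide) (by decide) G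
      (by intro c hc; omega) ?_
    intro i s1 hi h1 x1 hs1 hG
    have hP1 : Placed D R s1 := h.of_same hs1 (by decide) (by decide)
    have hF : ∀ s', Env D s' → SameExcept [13] [15] s1 s' → s'.var 13 < D.n →
        ((Fml.and (.eq (.get 13 (v 13)) (.get 11 (v 11)))
          (.eq (.get 14 (v 13)) (.get 12 (v 11)))).den s' ↔ D.Ov R i (s'.var 13)) := by
      intro s' _ hs' hx
      have hP' : Placed D R s' := hP1.of_same hs' (by decide) (by decide)
      have e11 : s'.var 11 = i := by rw [hs'.var 11 (by decide), x1]
      simp only [Fml.den_and, Fml.den_eq, Expr.val_get, Expr.val_var, e11, hP'.a11 i hi,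
        hP'.a12 i hi, hP'.a13 _ hx, hP'.a14 _ hx, Inst.Ov]
    obtain ⟨k1, k2⟩ := h1.search (x := 13) (a := 15) (e := v 11)
      (φ := .and (.eq (.get 13 (v 13)) (.get 11 (v 11))) (.eq (.get 14 (v 13)) (.get 12 (v 11))))
      rfl (by norm_num) (fun j => D.Ov R i j) i (by simp [x1])
      (fun s' hs' => by rw [Expr.val_var, hs'.var 11 (by decide), x1]) hF (by decide)
    intro c hc
    rcases (Nat.lt_succ_iff_lt_or_eq (m := c) (n := i)).1 hc with hc | rfl
    · have := hG c hc
      rw [← k2 c (by omega)] at this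
      exact this
    · exact k1
  exact key

theorem Tab.den_onF {D : Inst} {s : State} (h : Tab D s) {p y x : Expr} (hx : x.val s ≤ D.n)
    (hp : p.val s < D.n) (hy : y.val s < D.n) :
    (onF p y x).den s ↔ ¬ D.Reach (x.val s) (p.val s) (y.val s) := by
  simp only [onF, Fml.den_eq, reachIdxE, Expr.val_get, Expr.val_add, Expr.val_mul, Expr.val_var,
    h.v1, Expr.val_zero]
  rw [h.reach _ hx _ hp _ hy, ind01_eq_zero]

theorem Placed.den_confF {D : Inst} (hI : D.Inj) {R : Root} {s : State} (h : Placed D R s)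
    (hO : OverSpec D R s) {f g : Expr} {i j : ℕ} (hf : ∀ k, s.arr 19 (f.val (s.setVar 500 k)) = i)
    (hg : ∀ k, s.arr 16 (g.val (s.setVar 500 k)) = j) (hi : i < D.n) (hj : j < D.n) :
    (confF f g).den s ↔ D.Conf R i j := by
  simp only [confF, Fml.den_ex, h.v1, Inst.Conf]
  refine exists_congr fun x => and_congr_right fun hx => ?_
  have h2 := h.setVar (x := 500) (by norm_num) x
  have e1 := h2.toTab.den_onF (p := v 22) (y := .get 19 f) (x := v 500) (by simp; omega)
    (by simp [h.v22, h.hp]) (by simp [hf, hi])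
  simp only [Expr.val_var, Expr.val_get, State.setVar_arr, hf, State.setVar_var, if_true,
    show (22 : ℕ) = 500 ↔ False by decide, if_false, h.v22] at e1
  simp only [Fml.den_and, Fml.den_lt, Expr.val_get, Expr.val_var, State.setVar_var,
    State.setVar_arr, if_true, show (1 : ℕ) = 500 ↔ False by decide, if_false, h.v1, e1]
  constructor
  · rintro ⟨h1, h3, h4⟩
    rcases hO x hx with ⟨o1, o2⟩ | ⟨o1, -⟩
    · refine ⟨_, o1, o2, h3, ?_⟩
      have := (h2.toTab.den_onF (p := v 24) (y := .get 16 g) (x := .get 15 (v 500))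
        (by simpa using o1.le) (by simp [h.v24, h.hq]) (by simp [hg, hj])).1 h4
      simpa [h.v24, hg] using this
    · omega
  · rintro ⟨y, hy, hov, h3, h4⟩
    rcases hO x hx with ⟨o1, o2⟩ | ⟨-, o2⟩
    · have : s.arr 15 x = y := hI.ov o1 hy o2 hov
      refine ⟨o1, h3, (h2.toTab.den_onF (p := v 24) (y := .get 16 g) (x := .get 15 (v 500))
        (by simpa using o1.le) (by simp [h.v24, h.hq]) (by simp [hg, hj])).2 ?_⟩
      simpa [h.v24, hg, this] using h4
    · exact absurd hov (o2 y hy)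

structure Slots (D : Inst) (R : Root) (N : ℕ) (arr : ℕ → ℕ → ℕ) : Prop where
  nb : ∀ f < N, arr 16 f = D.nbr R f
  fx : ∀ f < N, arr 17 f = D.fx R f
  fy : ∀ f < N, arr 18 f = D.fy R f
  cell : ∀ f < N, arr 19 f = f / 4
  vert : ∀ f < N, arr 20 f = ind01 (Inst.Vert f)

/-- The search finds the only cell whose bond can meet the slot; the final test discards it if the
slot is the root or its own two paths overlap. -/
theorem run_slotC {D : Inst} (hI : D.Inj) {R : Root} {s : State} (h : Placed D R s)
    (hO : OverSpec D R s) {f : ℕ} (hf : f = 4 * s.var 11 + s.var 12) (hi : s.var 11 < D.n)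
    (hd : s.var 12 < 4) (hS : Slots D R f s.arr) : Slots D R (f + 1) (slotC.run s).arr := by
  have f4 : f / 4 = s.var 11 := by omega
  have fm : f % 4 = s.var 12 := by omega
  have hF : ∀ s', Env D s' → SameExcept [13] [16] s s' → s'.var 13 < D.n →
      ((Fml.and (.and (.eq (.get 13 (v 13) + 1) (.get 11 (v 11) + dxE (v 12)))
        (.eq (.get 14 (v 13) + 1) (.get 12 (v 11) + dyE (v 12))))
        (bondF (v 11) (v 12) (v 13))).den s' ↔ D.Meets R f (s'.var 13)) := by
    intro s' hE hs' hx
    have hP' : Placed D R s' := h.of_same hs' (by decide) (by decide)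
    have e11 : s'.var 11 = s.var 11 := hs'.var 11 (by decide)
    have e12 : s'.var 12 = s.var 12 := hs'.var 12 (by decide)
    have hb := hE.den_bondF (i := v 11) (d := v 12) (j := v 13) (by simpa [e11]) (by simpa [e12])
      (by simpa)
    rw [Fml.den_and, hb]
    simp only [Fml.den_and, Fml.den_eq, Expr.val_get, Expr.val_add, Expr.val_var, Expr.val_one,
      val_dxE, val_dyE, e11, e12, hP'.a11 _ hi, hP'.a12 _ hi, hP'.a13 _ hx, hP'.a14 _ hx,
      Inst.Meets, f4, fm]
  obtain ⟨k1, k2⟩ := h.toEnv.search (x := 13) (a := 16) (e := 4 * v 11 + v 12) rfl (by norm_num)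
    (fun j => D.Meets R f j) f (by simp [hf]) (fun s' hs' => by
      simp [hs'.var 11 (by decide), hs'.var 12 (by decide), hf]) hF (by decide)
  set P1 := ((Cmd.put 16 (4 * v 11 + v 12) (v 1)).seq (Cmd.loop 13 1 (.ite
    (.and (.and (.eq (.get 13 (v 13) + 1) (.get 11 (v 11) + dxE (v 12)))
        (.eq (.get 14 (v 13) + 1) (.get 12 (v 11) + dyE (v 12))))
        (bondF (v 11) (v 12) (v 13))) (.put 16 (4 * v 11 + v 12) (v 13)) .skip))) with hP1
  have hs1 : SameExcept [13] [16] s (P1.run s) := (Cmd.same P1 s).mono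
    (by simp [hP1, Cmd.wv]) (by simp [hP1, Cmd.wa])
  set s1 := P1.run s with hs1'
  have e11 : s1.var 11 = s.var 11 := hs1.var 11 (by decide)
  have e12 : s1.var 12 = s.var 12 := hs1.var 12 (by decide)
  have hPl1 : Placed D R s1 := h.of_same hs1 (by decide) (by decide)
  set P2 := (Cmd.put 17 (4 * v 11 + v 12) (.get 11 (v 11) - (v 12).beq 3) ;;
    .put 18 (4 * v 11 + v 12) (.get 12 (v 11) - (v 12).beq 2) ;;
    .put 19 (4 * v 11 + v 12) (v 11) ;;
    .put 20 (4 * v 11 + v 12) ((v 12).beq 0 + (v 12).beq 2)) with hP2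
  have hs2 : SameExcept [] [17, 18, 19, 20] s1 (P2.run s1) := (Cmd.same P2 s1).mono
    (by simp [hP2, Cmd.wv]) (by simp [hP2, Cmd.wa])
  set s2 := P2.run s1 with hs2'
  have g11 : s2.var 11 = s.var 11 := (hs2.var 11 (by decide)).trans e11
  have g12 : s2.var 12 = s.var 12 := (hs2.var 12 (by decide)).trans e12
  have hPl2 : Placed D R s2 := hPl1.of_same hs2 (by decide) (by decide)
  have hO2 : OverSpec D R s2 := by
    unfold OverSpec
    rw [hs2.arr 15 (by decide), hs1.arr 15 (by decide)]; exact hO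
  have q17 : ∀ k, s2.arr 17 k = if k = f then D.fx R f else s.arr 17 k := by
    intro k
    rw [hs2', hP2]
    simp only [Cmd.run_seq, Cmd.run_put, State.setArr_arr, State.setArr_var, Expr.val_add,
      Expr.val_var, Expr.val_get, Expr.val_mul, Expr.val_ofNat, Expr.val_sub, Expr.val_beq, e11,
      e12, ← hf, show (17 : ℕ) = 18 ↔ False by decide, show (17 : ℕ) = 19 ↔ False by decide,
      show (17 : ℕ) = 20 ↔ False by decide, false_and, if_false, true_and, hs1.arr 17 (by decide),
      hPl1.a11 _ hi, Inst.fx, f4, fm]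
  have q18 : ∀ k, s2.arr 18 k = if k = f then D.fy R f else s.arr 18 k := by
    intro k
    rw [hs2', hP2]
    simp only [Cmd.run_seq, Cmd.run_put, State.setArr_arr, State.setArr_var, Expr.val_add,
      Expr.val_var, Expr.val_get, Expr.val_mul, Expr.val_ofNat, Expr.val_sub, Expr.val_beq, e11,
      e12, ← hf, show (18 : ℕ) = 17 ↔ False by decide, show (18 : ℕ) = 19 ↔ False by decide,
      show (18 : ℕ) = 20 ↔ False by decide, show (12 : ℕ) = 17 ↔ False by decide, false_and,
      if_false, true_and, hs1.arr 18 (by decide), hPl1.a12 _ hi, Inst.fy, f4, fm]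
  have q19 : ∀ k, s2.arr 19 k = if k = f then f / 4 else s.arr 19 k := by
    intro k
    rw [hs2', hP2]
    simp only [Cmd.run_seq, Cmd.run_put, State.setArr_arr, State.setArr_var, Expr.val_add,
      Expr.val_var, Expr.val_get, Expr.val_mul, Expr.val_ofNat, Expr.val_sub, Expr.val_beq, e11,
      e12, ← hf, show (19 : ℕ) = 17 ↔ False by decide, show (19 : ℕ) = 18 ↔ False by decide,
      show (19 : ℕ) = 20 ↔ False by decide, false_and, if_false, true_and, hs1.arr 19 (by decide),
      f4]
  have q20 : ∀ k, s2.arr 20 k = if k = f then ind01 (Inst.Vert f) else s.arr 20 k := by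
    intro k
    rw [hs2', hP2]
    simp only [Cmd.run_seq, Cmd.run_put, State.setArr_arr, State.setArr_var, Expr.val_add,
      Expr.val_var, Expr.val_get, Expr.val_mul, Expr.val_ofNat, Expr.val_sub, Expr.val_beq, e11,
      e12, ← hf, show (20 : ℕ) = 17 ↔ False by decide, show (20 : ℕ) = 18 ↔ False by decide,
      show (20 : ℕ) = 19 ↔ False by decide, false_and, if_false, true_and, hs1.arr 20 (by decide),
      Expr.val_zero]
    congr 1
    unfold Inst.Vert ind01
    rw [fm]
    by_cases h0 : s.var 12 = 0
    · simp [h0]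
    · by_cases h2 : s.var 12 = 2 <;> simp [h0, h2]
  have q16 : s2.arr 16 = s1.arr 16 := hs2.arr 16 (by decide)
  have hrun : slotC.run s = (Cmd.ite (.or (.and (.eq (v 11) (v 22)) (.eq (v 12) (v 23)))
    (confF (4 * v 11 + v 12) (4 * v 11 + v 12))) (.put 16 (4 * v 11 + v 12) (v 1)) .skip).run s2 :=
    rfl
  have hs3 : SameExcept [] [16] s2 (slotC.run s) := by
    rw [hrun]; exact (Cmd.same _ s2).mono (by simp [Cmd.wv]) (by simp [Cmd.wa])
  have fin : ∀ k, (slotC.run s).arr 16 k = if k = f then D.nbr R f else s.arr 16 k := by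
    have hoth : ∀ k, k ≠ f → s2.arr 16 k = s.arr 16 k := fun k hk => by rw [q16]; exact k2 k hk
    have hput : ∀ k, ((Cmd.put 16 (4 * v 11 + v 12) (v 1)).run s2).arr 16 k =
        if k = f then D.n else s2.arr 16 k := by
      intro k
      simp only [Cmd.run_put, State.setArr_arr, Expr.val_add, Expr.val_mul, Expr.val_ofNat,
        Expr.val_var, g11, g12, hPl2.v1, ← hf, true_and]
    intro k
    rw [hrun]
    by_cases hk : k = f
    · rw [if_pos hk, hk]
      rw [← q16] at k1
      rcases k1 with ⟨j1, j2⟩ | ⟨j1, j2⟩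
      · have hden : (Fml.or (.and (.eq (v 11) (v 22)) (.eq (v 12) (v 23)))
            (confF (4 * v 11 + v 12) (4 * v 11 + v 12))).den s2 ↔
            (f / 4 = R.p ∧ f % 4 = R.d) ∨ D.Conf R (f / 4) (s2.arr 16 f) := by
          rw [Fml.den_or, hPl2.den_confF hI hO2 (i := f / 4) (j := s2.arr 16 f) ?_ ?_ (by omega) j1]
          · simp only [Fml.den_and, Fml.den_eq, Expr.val_var, g11, g12, hPl2.v22, hPl2.v23, f4, fm]
          · intro k
            simp [g11, g12, ← hf, q19]
          · intro k
            simp [g11, g12, ← hf]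
        refine Cmd.run_ite_cases hden (fun s' => s'.arr 16 f = D.nbr R f) (fun hc => ?_)
          fun hc => ?_
        · rw [hput, if_pos rfl]
          rcases D.nbr_spec R f with hV | ⟨hV, -⟩
          · exfalso
            have : D.nbr R f = s2.arr 16 f := hI.meets hV.1 j1 hV.2.1 j2
            rw [← this] at hc
            exact hc.elim hV.2.2.1 hV.2.2.2
          · exact hV.symm
        · rw [Cmd.run_skip]
          rw [not_or] at hc
          exact (hI.nbr_eq ⟨j1, j2, hc.1, hc.2⟩).symm
      · have hn : D.nbr R f = D.n := by
          rcases D.nbr_spec R f with hV | ⟨hV, -⟩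
          · exact absurd hV.2.1 (j2 _ hV.1)
          · exact hV
        refine Cmd.run_ite_cases Iff.rfl (fun s' => s'.arr 16 f = D.nbr R f) (fun _ => ?_)
          fun _ => ?_
        · rw [hput, if_pos rfl, hn]
        · rw [Cmd.run_skip, j1, hn]
    · rw [if_neg hk]
      refine Cmd.run_ite_cases Iff.rfl (fun s' => s'.arr 16 k = s.arr 16 k) (fun _ => ?_)
          fun _ => ?_
      · rw [hput, if_neg hk]; exact hoth k hk
      · exact hoth k hk
  refine ⟨fun k hk => ?_, fun k hk => ?_, fun k hk => ?_, fun k hk => ?_, fun k hk => ?_⟩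
  · rw [fin]; split_ifs with hkf
    · rw [hkf]
    · exact hS.nb k (by omega)
  · rw [hs3.arr 17 (by decide), q17]; split_ifs with hkf
    · rw [hkf]
    · exact hS.fx k (by omega)
  · rw [hs3.arr 18 (by decide), q18]; split_ifs with hkf
    · rw [hkf]
    · exact hS.fy k (by omega)
  · rw [hs3.arr 19 (by decide), q19]; split_ifs with hkf
    · rw [hkf]
    · exact hS.cell k (by omega)
  · rw [hs3.arr 20 (by decide), q20]; split_ifs with hkf
    · rw [hkf]
    · exact hS.vert k (by omega)

theorem run_slotsC {D : Inst} (hI : D.Inj) {R : Root} {s : State} (h : Placed D R s)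
    (hO : OverSpec D R s) : Slots D R (4 * D.n) (slotsC.run s).arr := by
  refine h.toEnv.loop D.n h.v1 (by decide) (by decide) (by decide) (by decide)
    (fun i arr => Slots D R (4 * i) arr) ⟨by simp, by simp, by simp, by simp, by simp⟩ ?_
  intro i s1 hi h1 x1 hs1 hG
  refine h1.loop 4 h1.v6 (x := 12) (by decide) (by decide) (by decide) (by decide)
    (fun d arr => Slots D R (4 * i + d) arr) hG ?_
  intro d s2 hd h2 x2 hs2 hG2
  have e11 : s2.var 11 = i := (hs2.var 11 (by decide)).trans x1
  have hP2 : Placed D R s2 :=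
    (h.of_same hs1 (by decide) (by decide)).of_same hs2 (by decide) (by decide)
  have hO2 : OverSpec D R s2 := by
    unfold OverSpec
    rw [hs2.arr 15 (by decide), hs1.arr 15 (by decide)]; exact hO
  exact run_slotC hI hP2 hO2 (by rw [e11, x2]; rfl) (by omega) (by omega) hG2

end WordRAM.TreeUAV

/-! ### The side test and the relation between slots -/

namespace WordRAM.TreeUAV

local notation "v" => Expr.var

structure Ready (D : Inst) (R : Root) (s : State) : Prop extends Placed D R s where
  overlap : OverSpec D R s
  slots : Slots D R (4 * D.n) s.arr

def rdArr (a : ℕ) : Bool := decide (a = 21) || decide (22 < a)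

theorem Ready.of_same {D : Inst} {R : Root} {s s' : State} {V A : List ℕ} (h : Ready D R s)
    (hs : SameExcept V A s s') (hV : V.all rtVar = true) (hA : A.all rdArr = true) :
    Ready D R s' := by
  have ha : ∀ a, rdArr a = false → s'.arr a = s.arr a := fun a ha => hs.arr a fun h' => by
    have := List.all_eq_true.1 hA a h'
    rw [ha] at this; exact absurd this (by decide)
  refine ⟨h.toPlaced.of_same hs hV ?_, ?_, ?_, ?_, ?_, ?_, ?_⟩
  · rw [List.all_eq_true] at hA ⊢
    intro a h'
    have := hA a h'
    simp only [plArr, rdArr, Bool.or_eq_true, decide_eq_true_eq] at this ⊢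
    omega
  · unfold OverSpec; rw [ha 15 rfl]; exact h.overlap
  · rw [ha 16 rfl]; exact h.slots.nb
  · rw [ha 17 rfl]; exact h.slots.fx
  · rw [ha 18 rfl]; exact h.slots.fy
  · rw [ha 19 rfl]; exact h.slots.cell
  · rw [ha 20 rfl]; exact h.slots.vert

theorem Ready.setVar {D : Inst} {R : Root} {s : State} (h : Ready D R s) {x : ℕ} (hx : 24 < x)
    (i : ℕ) : Ready D R (s.setVar x i) :=
  h.of_same (V := [x]) (A := []) ((SameExcept.refl _ _ s).setVar (by simp) i)
    (by simp [rtVar, freeVar]; omega) (by simp)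

theorem Ready.val_rootE {D : Inst} {R : Root} {s : State} (h : Ready D R s) :
    rootE.val s = Inst.root R := by
  simp [rootE, h.v22, h.v23, Inst.root]

theorem Ready.root_lt {D : Inst} {R : Root} {s : State} (h : Ready D R s) :
    Inst.root R < 4 * D.n := by
  have := h.hp; have := h.hd
  unfold Inst.root; omega

theorem Ready.den_crossF {D : Inst} {R : Root} {s : State} (h : Ready D R s) {x y f g : Expr}
    (hf : f.val s < 4 * D.n) (hg : g.val s < 4 * D.n) :
    (crossF x y f g).den s ↔ D.CrossP R (x.val s) (y.val s) (f.val s) (g.val s) := by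
  simp only [crossF, Fml.den_xor, Fml.den_and, Fml.den_eq, Fml.den_lt, Expr.val_get,
    h.slots.fx _ hf, h.slots.fy _ hf, h.slots.fx _ hg, h.slots.fy _ hg, Inst.CrossP]

/-- A cell has at most one upper neighbour, so the quantifier is replaced by a look at the table.
This keeps the side test linear in n. -/
theorem Tab.up_iff {D : Inst} (hI : D.Inj) {s : State} (h : Tab D s) {y : ℕ} (hy : y < D.n)
    (P : ℕ → Prop) : (∃ z, D.Up y z ∧ P z) ↔ s.arr 9 y < D.n ∧ P (s.arr 9 y) := by
  constructor
  · rintro ⟨z, ⟨hz, hn, hS⟩, hP⟩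
    rcases h.up y hy with ⟨u1, u2, u3⟩ | ⟨-, u2⟩
    · have hn' := hn
      simp only [Inst.next] at hn' u2
      have : z = s.arr 9 y := hI z hz _ u1 (by omega) (by omega)
      rw [← this]
      exact ⟨hz, hP⟩
    · exact absurd ⟨hn, hS⟩ (u2 z hz)
  · rintro ⟨h1, hP⟩
    rcases h.up y hy with ⟨u1, u2, u3⟩ | ⟨u1, -⟩
    · exact ⟨_, ⟨u1, u2, u3⟩, hP⟩
    · omega

theorem Fml.den_par_iff {s : State} {x b N : ℕ} (hN : s.var b = N) {φ : Fml} {F : ℕ → Prop}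
    (h : ∀ y < N, (φ.den (s.setVar x y) ↔ F y)) :
    (Fml.par x b φ).den s ↔ Odd (∑ y ∈ Finset.range N, ind01 (F y)) := by
  simp only [Fml.den, hN]
  rw [Finset.sum_congr rfl fun y hy => by rw [propext (h y (Finset.mem_range.1 hy))]]

theorem Ready.den_sideF {D : Inst} (hI : D.Inj) {R : Root} {s : State} (h : Ready D R s)
    {x y f g : ℕ} (hx : s.var x = f) (hy : s.var y = g) (hxv : x ≠ 501) (hyv : y ≠ 501)
    (hf : f < 4 * D.n) (hg : g < 4 * D.n)
    (hng : D.nbr R g < D.n) : (sideF (v y) (v x)).den s ↔ D.Side R g f := by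
  have hroot := h.root_lt
  have c19 : s.arr 19 g = g / 4 := h.slots.cell g hg
  have c16 : s.arr 16 g = D.nbr R g := h.slots.nb g hg
  simp only [sideF, Fml.den_xor, Inst.Side]
  refine not_congr (iff_congr (not_congr (iff_congr ?_ ?_)) (not_congr (iff_congr ?_ ?_)))
  · refine Fml.den_par_iff h.v1 fun i hi => ?_
    have h2 := h.setVar (x := 501) (by norm_num) i
    rw [h.toTab.up_iff hI hi (fun z => ¬ D.Reach i R.p (g / 4) ∧ ¬ D.Reach z R.p (g / 4) ∧
      D.CrossP R (D.ax R i) (D.ay R i) f (Inst.root R))]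
    rw [Fml.den_and, Fml.den_and, Fml.den_and]
    simp only [Fml.den_lt, Expr.val_get, Expr.val_var, State.setVar_arr, State.setVar_var, if_true,
      show (1 : ℕ) = 501 ↔ False by decide, if_false, h.v1]
    refine and_congr_right fun hu => and_congr ?_ (and_congr ?_ ?_)
    · have := h2.toTab.den_onF (p := v 22) (y := .get 19 (v y)) (x := v 501) (by simp; omega)
        (by simp [h.v22, h.hp]) (by simp [hyv, hy, c19]; omega)
      simpa [h.v22, hyv, hy, c19] using this
    · have := h2.toTab.den_onF (p := v 22) (y := .get 19 (v y)) (x := .get 9 (v 501))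
        (by simp; omega) (by simp [h.v22, h.hp]) (by simp [hyv, hy, c19]; omega)
      simpa [h.v22, hyv, hy, c19] using this
    · rw [h2.den_crossF (by simpa [hxv, hx] using hf) (by rw [h2.val_rootE]; exact hroot),
        h2.val_rootE]
      simp [hxv, hx, h.a11 i hi, h.a12 i hi]
  · refine Fml.den_par_iff h.v1 fun i hi => ?_
    have h2 := h.setVar (x := 501) (by norm_num) i
    rw [h.toTab.up_iff hI hi (fun z => ¬ D.Reach i R.q (D.nbr R g) ∧
      ¬ D.Reach z R.q (D.nbr R g) ∧ D.CrossP R (D.bx R i) (D.by' R i) f (Inst.root R))]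
    rw [Fml.den_and, Fml.den_and, Fml.den_and]
    simp only [Fml.den_lt, Expr.val_get, Expr.val_var, State.setVar_arr, State.setVar_var, if_true,
      show (1 : ℕ) = 501 ↔ False by decide, if_false, h.v1]
    refine and_congr_right fun hu => and_congr ?_ (and_congr ?_ ?_)
    · have := h2.toTab.den_onF (p := v 24) (y := .get 16 (v y)) (x := v 501) (by simp; omega)
        (by simp [h.v24, h.hq]) (by simp [hyv, hy, c16]; omega)
      simpa [h.v24, hyv, hy, c16] using this
    · have := h2.toTab.den_onF (p := v 24) (y := .get 16 (v y)) (x := .get 9 (v 501))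
        (by simp; omega) (by simp [h.v24, h.hq]) (by simp [hyv, hy, c16]; omega)
      simpa [h.v24, hyv, hy, c16] using this
    · rw [h2.den_crossF (by simpa [hxv, hx] using hf) (by rw [h2.val_rootE]; exact hroot),
        h2.val_rootE]
      simp [hxv, hx, h.a13 i hi, h.a14 i hi]
  · rw [Fml.den_and, h.den_crossF (by simpa [hx] using hf) (by rw [h.val_rootE]; exact hroot),
      h.val_rootE]
    simp only [Fml.den_eq, Expr.val_get, Expr.val_var, hy, hx, h.slots.vert g hg,
      h.slots.fx g hg, h.slots.fy g hg, Expr.val_one, ind01_eq_one]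
  · rw [Fml.den_and, h.den_crossF (by simpa [hx] using hf) (by rw [h.val_rootE]; exact hroot)]
    simp only [Fml.den_eq, Expr.val_get, Expr.val_var, hx, h.val_rootE, h.slots.vert _ hroot,
      h.slots.fx _ hroot, h.slots.fy _ hroot, Expr.val_one, ind01_eq_one]

theorem Ready.den_relF {D : Inst} (hI : D.Inj) {R : Root} {s : State} (h : Ready D R s)
    {f g : ℕ} (hx : s.var 25 = f) (hy : s.var 26 = g) (hf : f < 4 * D.n) (hg : g < 4 * D.n) :
    (relF (v 25) (v 26)).den s ↔ D.Rel R f g := by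
  simp only [relF, Fml.den_and, Fml.den_or, Fml.den_not, Fml.den_lt, Fml.den_eq, Expr.val_get,
    Expr.val_var, hx, hy, h.v1, h.val_rootE, h.slots.nb f hf, h.slots.nb g hg, Inst.Rel]
  refine and_congr_right fun h1 => or_congr Iff.rfl (and_congr_right fun h2 =>
    and_congr_right fun h3 => ?_)
  rw [h.den_sideF hI (x := 25) (y := 26) hx hy (by decide) (by decide) hf hg h1]
  refine and_congr (not_congr ?_) (and_congr (not_congr ?_) Iff.rfl)
  · exact h.toPlaced.den_confF hI h.overlap (by intro k; simp [hx, h.slots.cell f hf])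
      (by intro k; simp [hy, h.slots.nb g hg]) (by omega) h1
  · exact h.toPlaced.den_confF hI h.overlap (by intro k; simp [hy, h.slots.cell g hg])
      (by intro k; simp [hx, h.slots.nb f hf]) (by omega) h2

theorem run_relC {D : Inst} (hI : D.Inj) {R : Root} {s : State} (h : Ready D R s) {f g : ℕ}
    (hf : f < 4 * D.n) (hg : g < 4 * D.n) :
    (relC.run s).arr 21 (f * (4 * D.n) + g) = ind01 (D.Rel R f g) := by
  refine h.toEnv.fill h.v5 h.v5 (by decide) (by decide) (by decide) (by decide) (by decide) rfl rfl
    (by decide) (D.Rel R) ?_ hf hg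
  intro s' _ hs hx hy
  exact (h.of_same hs (by decide) (by decide)).den_relF hI rfl rfl hx hy

/-! ## Heaviest chains -/

/-- The weight of the bond at slot `g`. -/
noncomputable def Inst.slotW (D : Inst) (R : Root) (g : ℕ) : ℕ := D.W (g / 4) (g % 4) (D.nbr R g)

/-- There is a chain of bonds from the root to the slot `f` with `r` steps and total weight `w`. -/
inductive Inst.Chain (D : Inst) (R : Root) : ℕ → ℕ → ℕ → Prop
  | nil : Inst.Chain D R (Inst.root R) 0 (D.W R.p R.d R.q)
  | snoc {f g r w : ℕ} (h : Inst.Chain D R f r w) (hg : g < 4 * D.n) (hfg : D.Rel R f g) :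
      Inst.Chain D R g (r + 1) (w + D.slotW R g)

/-- At least one step is required: only together with a second bond does the root bond close a
cycle. -/
def Inst.Bad (D : Inst) (R : Root) : Prop := ∃ f r w, D.Chain R f (r + 1) w ∧ D.temp ≤ w

/-- The weight of a chain that is stored for slot `g`. -/
def Inst.V (D : Inst) (arr : ℕ → ℕ → ℕ) (g : ℕ) : ℕ := bv (fun b => arr 24 (g * D.L + b)) D.L

/-- The soundness half of the dynamic program: a stored weight never exceeds the weight of some
actual chain, and the answer is cleared only if there is a bad chain. -/
structure DP (D : Inst) (R : Root) (s0 s : State) : Prop where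
  bits : ∀ g < 4 * D.n, ∀ b < D.L, s.arr 24 (g * D.L + b) ≤ 1
  sound : ∀ f < 4 * D.n, (f = Inst.root R ∨ D.nbr R f < D.n) → ∃ r w, D.Chain R f r w ∧
    D.V s.arr f ≤ w
  ans : s.var 0 = s0.var 0 ∨ s.var 0 = 0 ∧ D.Bad R

theorem bv_zero {f : ℕ → ℕ} {k : ℕ} (h : ∀ b < k, f b = 0) : bv f k = 0 :=
  Finset.sum_eq_zero fun b hb => by rw [h b (Finset.mem_range.1 hb), zero_mul]

theorem run_initC {D : Inst} {R : Root} {s : State} (h : Ready D R s) :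
    DP D R s (initC.run s) ∧ D.V (initC.run s).arr (Inst.root R) = D.W R.p R.d R.q := by
  set P1 := Cmd.loop 26 5 (.loop 16 3 (.put 24 (v 26 * v 3 + v 16) 0)) with hP1
  have hs1 : SameExcept [26, 16] [24] s (P1.run s) := (Cmd.same P1 s).mono
    (by simp [hP1, Cmd.wv]) (by simp [hP1, Cmd.wa])
  have first : ∀ c < 4 * D.n * D.L, (P1.run s).arr 24 c = 0 := by
    refine h.toEnv.loop (4 * D.n) h.v5 (by decide) (by decide) (by decide) (by decide)
      (fun g arr => ∀ c < g * D.L, arr 24 c = 0) (by intro c hc; simp at hc) ?_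
    intro g s1 hg h1 x1 hs1 hG
    have := h1.loop D.L h1.v3 (x := 16) (P := .put 24 (v 26 * v 3 + v 16) 0) (by decide)
      (by decide) (by decide) (by decide)
      (fun b arr => ∀ c < g * D.L + b, arr 24 c = 0) (by simpa using hG) ?_
    · rw [Nat.add_mul, one_mul]; exact this
    intro b s2 hb h2 x2 hs2 hG2 c hc
    have e26 : s2.var 26 = g := (hs2.var 26 (by decide)).trans x1
    simp only [Cmd.run_put, State.setArr_arr, Expr.val_add, Expr.val_mul, Expr.val_var, e26,
      h2.v3, x2, true_and, Expr.val_zero]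
    split_ifs with hcc
    · rfl
    · exact hG2 c (by omega)
  set s1 := P1.run s with hs1'
  have hR1 : Ready D R s1 := h.of_same hs1 (by decide) (by decide)
  have hroot := h.root_lt
  have second : (∀ b < D.L, (initC.run s).arr 24 (Inst.root R * D.L + b) =
      s.arr 6 (((4 * R.p + R.d) * D.n + R.q) * D.L + b)) ∧
      ∀ c, (∀ b < D.L, c ≠ Inst.root R * D.L + b) → (initC.run s).arr 24 c = s1.arr 24 c := by
    refine hR1.toEnv.loop D.L hR1.v3 (by decide) (by decide) (by decide) (by decide)
      (fun b0 arr => (∀ b < b0, arr 24 (Inst.root R * D.L + b) =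
        s.arr 6 (((4 * R.p + R.d) * D.n + R.q) * D.L + b)) ∧
        ∀ c, (∀ b < D.L, c ≠ Inst.root R * D.L + b) → arr 24 c = s1.arr 24 c)
      ⟨by simp, fun _ _ => rfl⟩ ?_
    intro b s2 hb h2 x2 hs2 hG
    have hR2 : Ready D R s2 := hR1.of_same hs2 (by decide) (by decide)
    have a6 : s2.arr 6 = s.arr 6 := (hs2.arr 6 (by decide)).trans (hs1.arr 6 (by decide))
    have hw : ∀ c, ((Cmd.put 24 (rootE * v 3 + v 16)
        (.get 6 (slotPairE (v 22) (v 23) (v 24) * v 3 + v 16))).run s2).arr 24 c =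
        if c = Inst.root R * D.L + b then s.arr 6 (((4 * R.p + R.d) * D.n + R.q) * D.L + b)
        else s2.arr 24 c := by
      intro c
      simp only [Cmd.run_put, State.setArr_arr, Expr.val_add, Expr.val_mul, Expr.val_var,
        hR2.val_rootE, h2.v3, x2, true_and, Expr.val_get, h2.val_slotPairE, hR2.v22, hR2.v23,
        hR2.v24, a6]
    refine ⟨fun b' hb' => ?_, fun c hc => ?_⟩
    · rw [hw]; split_ifs with hbb
      · rw [show b' = b by omega]
      · exact hG.1 b' (by omega)
    · rw [hw, if_neg (hc b hb)]; exact hG.2 c hc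
  have hother : ∀ g < 4 * D.n, g ≠ Inst.root R → ∀ b < D.L,
      (initC.run s).arr 24 (g * D.L + b) = 0 := by
    intro g hg hgr b hb
    rw [second.2 _ ?_, first _ (add_lt_mul hg hb)]
    intro b' hb' he
    have := congrArg (· / D.L) he
    simp only [div_add hb, div_add hb'] at this
    exact hgr this
  have hV : D.V (initC.run s).arr (Inst.root R) = D.W R.p R.d R.q := by
    rw [← h.val6 _ h.hp _ h.hd _ h.hq]
    exact bv_congr second.1
  refine ⟨⟨fun g hg b hb => ?_, fun f hf hfr => ?_, Or.inl ?_⟩, hV⟩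
  · by_cases hgr : g = Inst.root R
    · rw [hgr, second.1 b hb]
      exact h.bit6 _ h.hp _ h.hd _ h.hq b hb
    · rw [hother g hg hgr b hb]; omega
  · by_cases hgr : f = Inst.root R
    · exact ⟨0, _, hgr ▸ Inst.Chain.nil, by rw [hgr, hV]⟩
    -- The root may be followed by every slot with a partner, so the initial weight 0 is below the
    -- weight of a chain with one step.
    · refine ⟨_, _, Inst.Chain.snoc Inst.Chain.nil hf ⟨hfr.resolve_left hgr, Or.inl rfl⟩, ?_⟩
      rw [Inst.V, bv_zero fun b hb => hother f hf hgr b hb]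
      exact Nat.zero_le _
  · exact (Cmd.same initC s).var 0 (by decide)

/-- Addition with a carry: for bits, the iterated equality test in the program computes the sum of
three bits modulo 2. The final carry stands for 2 ^ L. -/
theorem run_addC {D : Inst} {R : Root} {s : State} (h : Ready D R s) {f g : ℕ}
    (hx : s.var 25 = f) (hy : s.var 26 = g) (hg : g < 4 * D.n)
    (hng : D.nbr R g < D.n) (hb : ∀ b < D.L, s.arr 24 (f * D.L + b) ≤ 1) :
    (∀ b < D.L, (addC.run s).arr 23 b ≤ 1) ∧ (addC.run s).var 30 ≤ 1 ∧
      bv ((addC.run s).arr 23) D.L + (addC.run s).var 30 * 2 ^ D.L =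
        D.V s.arr f + D.slotW R g := by
  have hg4 : g = 4 * (g / 4) + g % 4 := by omega
  have hbit := h.bit6 (g / 4) (by omega) (g % 4) (by omega) _ hng
  have hval := h.val6 (g / 4) (by omega) (g % 4) (by omega) _ hng
  rw [← hg4] at hbit hval
  rw [Inst.V, Inst.slotW, ← hval]
  set X := fun b => s.arr 24 (f * D.L + b) with hX
  set Y := fun b => s.arr 6 ((g * D.n + D.nbr R g) * D.L + b) with hY
  have hs0 : SameExcept [30] [] s (s.setVar 30 0) := (SameExcept.refl _ _ s).setVar (by simp) 0
  refine Cmd.loop_inv (s := s.setVar 30 0) D.L (by simpa using h.v3) (by decide) (by decide)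
    (fun b s' => (∀ b' < b, s'.arr 23 b' ≤ 1) ∧ s'.var 30 ≤ 1 ∧
      bv (s'.arr 23) b + s'.var 30 * 2 ^ b = bv X b + bv Y b)
    ⟨by simp, by simp, by simp [bv]⟩ ?_
  rintro b s' hbL ⟨g1, g2, g3⟩ h16 hs
  have hss : SameExcept [30, 16] [23] s s' := (hs0.mono (by simp) (by simp)).trans
    (hs.mono (by simp [Cmd.wv]) (by simp [Cmd.wa]))
  have h' : Ready D R s' := h.of_same hss (by decide) (by decide)
  have e25 : s'.var 25 = f := (hss.var 25 (by decide)).trans hx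
  have e26 : s'.var 26 = g := (hss.var 26 (by decide)).trans hy
  have xx : (chainBitE (v 25)).val s' = X b := by
    simp only [chainBitE, Expr.val_get, Expr.val_add, Expr.val_mul, Expr.val_var, e25, h'.v3, h16,
      hss.arr 24 (by decide), hX]
  have yy : (slotBitE (v 26)).val s' = Y b := by
    simp only [slotBitE, Expr.val_get, Expr.val_add, Expr.val_mul, Expr.val_var, e26, h'.v3, h16,
      hss.arr 6 (by decide), hY, h'.v1, h'.slots.nb g hg]
  set z := if (if X b = Y b then 1 else 0) = s'.var 30 then 1 else 0 with hz
  set s2 := s'.setArr 23 b z with hs2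
  have xx2 : (chainBitE (v 25)).val s2 = X b := xx
  have yy2 : (slotBitE (v 26)).val s2 = Y b := by
    rw [← yy]; simp [slotBitE, hs2]
  have hput : (Cmd.put 23 (v 16)
      (((chainBitE (v 25)).beq (slotBitE (v 26))).beq (v 30))).run s' = s2 := by
    rw [Cmd.run_put, hs2, Expr.val_beq, Expr.val_beq, xx, yy, Expr.val_var, Expr.val_var, h16]
  have hcar : (Expr.blt 1 (chainBitE (v 25) + slotBitE (v 26) + v 30)).val s2 =
      if 1 < X b + Y b + s'.var 30 then 1 else 0 := by
    have e : (chainBitE (v 25) + slotBitE (v 26) + v 30).val s2 = X b + Y b + s'.var 30 := by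
      rw [Expr.val_add, Expr.val_add, xx2, yy2]; rfl
    rw [Expr.val_blt, e]; rfl
  rw [Cmd.run_seq, hput, Cmd.run_assign, hcar]
  simp only [State.setVar_arr, State.setVar_var,
    show (30 : ℕ) = 16 ↔ False by decide, if_false, if_true]
  have a23 : ∀ k, s2.arr 23 k = if k = b then z else s'.arr 23 k := by
    intro k; simp [hs2]
  have hz1 : z ≤ 1 := by rw [hz]; split_ifs <;> omega
  refine ⟨fun b' hb' => ?_, by split_ifs <;> omega, ?_⟩
  · rw [a23]; split_ifs with hbb
    · exact hz1
    · exact g1 b' (by omega)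
  · rw [bv_succ, bv_succ, bv_succ, bv_congr (g := s'.arr 23) (f := s2.arr 23) (fun b' hb' => by
      rw [a23, if_neg (by omega)]), a23, if_pos rfl]
    have hxb : X b ≤ 1 := hb b hbL
    have hyb : Y b ≤ 1 := hbit b hbL
    rw [hz, pow_succ]
    revert g3
    generalize bv (s'.arr 23) b = A, bv X b = B, bv Y b = C, 2 ^ b = p
    intro g3
    generalize X b = xb at *
    generalize Y b = yb at *
    generalize s'.var 30 = c at *
    interval_cases xb <;> interval_cases yb <;> interval_cases c <;> simp at g3 ⊢ <;> omega

end WordRAM.TreeUAV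

/-! ### Relaxation rounds -/

namespace WordRAM.TreeUAV

local notation "v" => Expr.var

theorem run_copyC {D : Inst} {R : Root} {s : State} (h : Ready D R s) {g : ℕ}
    (hy : s.var 26 = g) :
    let s' := (Cmd.loop 16 3 (.put 24 (v 26 * v 3 + v 16) (.get 23 (v 16)))).run s
    (∀ b < D.L, s'.arr 24 (g * D.L + b) = s.arr 23 b) ∧
      ∀ c, (∀ b < D.L, c ≠ g * D.L + b) → s'.arr 24 c = s.arr 24 c := by
  refine h.toEnv.loop D.L h.v3 (by decide) (by decide) (by decide) (by decide)
      (fun b0 arr => (∀ b < b0, arr 24 (g * D.L + b) = s.arr 23 b) ∧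
        ∀ c, (∀ b < D.L, c ≠ g * D.L + b) → arr 24 c = s.arr 24 c)
      ⟨by simp, fun _ _ => rfl⟩ ?_
  intro b s2 hb h2 x2 hs2 hG
  have hw : ∀ c, ((Cmd.put 24 (v 26 * v 3 + v 16) (.get 23 (v 16))).run s2).arr 24 c =
      if c = g * D.L + b then s.arr 23 b else s2.arr 24 c := by
    intro c
    simp only [Cmd.run_put, State.setArr_arr, Expr.val_add, Expr.val_mul, Expr.val_var,
      (hs2.var 26 (by decide)).trans hy, h2.v3, x2, true_and, Expr.val_get,
      hs2.arr 23 (by decide)]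
  refine ⟨fun b' hb' => ?_, fun c hc => ?_⟩
  · rw [hw]; split_ifs with hbb
    · rw [show b' = b by omega]
    · exact hG.1 b' (by omega)
  · rw [hw, if_neg (hc b hb)]; exact hG.2 c hc

/-- Soundness follows by extending, by the slot g, the chain that justifies the weight stored for f;
that same extended chain is bad if the sum reaches the temperature. -/
theorem run_relaxC {D : Inst} {R : Root} {s0 s : State} (h : Ready D R s) {f g : ℕ}
    (hx : s.var 25 = f) (hy : s.var 26 = g) (hf : f < 4 * D.n) (hg : g < 4 * D.n)
    (hfg : D.Rel R f g) (hD : DP D R s0 s) :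
    DP D R s0 (relaxC.run s) ∧ (∀ k < 4 * D.n, D.V s.arr k ≤ D.V (relaxC.run s).arr k) ∧
    (s.var 0 = 0 → (relaxC.run s).var 0 = 0) ∧ ((relaxC.run s).var 0 = 0 ∨
      D.V s.arr f + D.slotW R g ≤ D.V (relaxC.run s).arr g ∧
        D.V s.arr f + D.slotW R g < D.temp) := by
  have hng := hfg.1
  obtain ⟨z1, z2, z3⟩ := run_addC h hx hy hg hng (hD.bits f hf)
  have hs1 := Cmd.same addC s
  set s1 := addC.run s with hs1'
  have h1 : Ready D R s1 := h.of_same hs1 (by decide) (by decide)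
  have a24 : s1.arr 24 = s.arr 24 := hs1.arr 24 (by decide)
  obtain ⟨r, w, hch, hw⟩ := hD.sound f hf (hfg.2.imp id fun h => h.1)
  set sum := D.V s.arr f + D.slotW R g with hsum
  have hch' : D.Chain R g (r + 1) (w + D.slotW R g) := hch.snoc hg hfg
  have hcmp1 : ((cmpC (.get 23 (v 16)) (.get 3 (v 16))).run s1).var 17 =
      ind01 (D.temp ≤ bv (s1.arr 23) D.L) := by
    rw [← h1.temp]
    refine run_cmpC h1.v3 (fun b hb s' hs' h16 => ?_) z1 h1.a3
    simp [h16, hs'.arr 23 (by decide), hs'.arr 3 (by decide)]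
  have hs2 := Cmd.same (cmpC (.get 23 (v 16)) (.get 3 (v 16))) s1
  set s2 := (cmpC (.get 23 (v 16)) (.get 3 (v 16))).run s1 with hs2'
  have h2 : Ready D R s2 := h1.of_same hs2 (by decide) (by decide)
  have b24 : s2.arr 24 = s.arr 24 := (hs2.arr 24 (by decide)).trans a24
  have b23 : s2.arr 23 = s1.arr 23 := hs2.arr 23 (by decide)
  have b0 : s2.var 0 = s.var 0 := (hs2.var 0 (by decide)).trans (hs1.var 0 (by decide))
  have b26 : s2.var 26 = g := (hs2.var 26 (by decide)).trans ((hs1.var 26 (by decide)).trans hy)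
  have b30 : s2.var 30 = s1.var 30 := hs2.var 30 (by decide)
  have hZ := bv_lt z1
  have hT : D.temp < 2 ^ D.L := by rw [← h.temp]; exact bv_lt h.a3
  -- A carry means that the sum is at least 2 ^ L, which exceeds the temperature; without a carry
  -- the stored bits are the sum itself.
  have hden : (Fml.or (.eq (v 30) 1) (.eq (v 17) 1)).den s2 ↔ D.temp ≤ sum := by
    rw [Fml.den_or, Fml.den_eq, Fml.den_eq, Expr.val_var, Expr.val_var, hcmp1, b30, Expr.val_one,
      ind01_eq_one]
    generalize s1.var 30 = c at *
    interval_cases c <;> simp only [zero_mul, one_mul] at z3 <;> omega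
  have hsum1 : sum < D.temp → bv (s1.arr 23) D.L = sum := by
    intro hlt
    generalize s1.var 30 = c at *
    interval_cases c <;> simp only [zero_mul, one_mul] at z3 <;> omega
  refine Cmd.run_ite_cases (s := s2) hden (fun s' => DP D R s0 s' ∧
    (∀ k < 4 * D.n, D.V s.arr k ≤ D.V s'.arr k) ∧ (s.var 0 = 0 → s'.var 0 = 0) ∧ (s'.var 0 = 0 ∨
      sum ≤ D.V s'.arr g ∧ sum < D.temp)) (fun hc => ?_) fun hc => ?_
  · have e0 : ((Cmd.assign 0 0).run s2).var 0 = 0 := by simp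
    have e24 : ((Cmd.assign 0 0).run s2).arr 24 = s.arr 24 := by simp [b24]
    refine ⟨⟨?_, ?_, Or.inr ⟨e0, ⟨g, r, _, hch', by omega⟩⟩⟩, ?_, fun _ => e0, Or.inl e0⟩
    · rw [e24]; exact hD.bits
    · unfold Inst.V; rw [e24]; exact hD.sound
    · unfold Inst.V; rw [e24]; exact fun _ _ => le_rfl
  · rw [not_le] at hc
    have hZs := hsum1 hc
    have hcmp2 : ((cmpC (chainBitE (v 26)) (.get 23 (v 16))).run s2).var 17 =
        ind01 (sum ≤ D.V s.arr g) := by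
      rw [← hZs, Inst.V]
      refine run_cmpC h2.v3 (fun b hb s' hs' h16 => ?_) (hD.bits g hg) z1
      have h' : Ready D R s' := h2.of_same hs' (by decide) (by decide)
      simp [chainBitE, h16, hs'.arr 23 (by decide), hs'.arr 24 (by decide), b23, b24, h'.v3,
        hs'.var 26 (by decide), b26]
    rw [Cmd.run_seq]
    have hs3 := Cmd.same (cmpC (chainBitE (v 26)) (.get 23 (v 16))) s2
    set s3 := (cmpC (chainBitE (v 26)) (.get 23 (v 16))).run s2 with hs3'
    have h3 : Ready D R s3 := h2.of_same hs3 (by decide) (by decide)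
    have c24 : s3.arr 24 = s.arr 24 := (hs3.arr 24 (by decide)).trans b24
    have c23 : s3.arr 23 = s1.arr 23 := (hs3.arr 23 (by decide)).trans b23
    have c0 : s3.var 0 = s.var 0 := (hs3.var 0 (by decide)).trans b0
    have c26 : s3.var 26 = g := (hs3.var 26 (by decide)).trans b26
    have hden2 : (Fml.eq (v 17) 1).den s3 ↔ sum ≤ D.V s.arr g := by
      rw [Fml.den_eq, Expr.val_var, hcmp2, Expr.val_one, ind01_eq_one]
    refine Cmd.run_ite_cases hden2 (fun s' => DP D R s0 s' ∧
      (∀ k < 4 * D.n, D.V s.arr k ≤ D.V s'.arr k) ∧ (s.var 0 = 0 → s'.var 0 = 0) ∧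
      (s'.var 0 = 0 ∨ sum ≤ D.V s'.arr g ∧ sum < D.temp)) (fun hle => ?_) fun hle => ?_
    · rw [Cmd.run_skip]
      have hV : D.V s3.arr = D.V s.arr := by unfold Inst.V; rw [c24]
      rw [hV, c0]
      refine ⟨⟨?_, ?_, ?_⟩, fun _ _ => le_rfl, id, Or.inr ⟨hle, hc⟩⟩
      · rw [c24]; exact hD.bits
      · rw [hV]; exact hD.sound
      · rw [c0]; exact hD.ans
    · obtain ⟨k1, k2⟩ := run_copyC h3 c26
      have hs4 := Cmd.same (Cmd.loop 16 3 (.put 24 (v 26 * v 3 + v 16) (.get 23 (v 16)))) s3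
      set s4 := (Cmd.loop 16 3 (.put 24 (v 26 * v 3 + v 16) (.get 23 (v 16)))).run s3 with hs4'
      have d0 : s4.var 0 = s.var 0 := (hs4.var 0 (by decide)).trans c0
      have hVg : D.V s4.arr g = sum := by
        rw [← hZs, Inst.V]
        exact bv_congr fun b hb => by rw [k1 b hb, c23]
      have hoth : ∀ k, k ≠ g → ∀ b < D.L, s4.arr 24 (k * D.L + b) = s.arr 24 (k * D.L + b) := by
        intro k hk b hb
        rw [k2 _ ?_, c24]
        intro b' hb' he
        have := congrArg (· / D.L) he
        simp only [div_add hb, div_add hb'] at this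
        exact hk this
      have hVk : ∀ k, k ≠ g → D.V s4.arr k = D.V s.arr k := fun k hk => bv_congr (hoth k hk)
      refine ⟨⟨fun k hk b hb => ?_, fun k hk hkr => ?_, ?_⟩, fun k hk => ?_, fun h => ?_,
        Or.inr ⟨hVg.ge, hc⟩⟩
      · by_cases hkg : k = g
        · rw [hkg, k1 b hb, c23]; exact z1 b hb
        · rw [hoth k hkg b hb]; exact hD.bits k hk b hb
      · by_cases hkg : k = g
        · subst hkg
          exact ⟨_, _, hch', by rw [hVg]; omega⟩
        · rw [hVk k hkg]; exact hD.sound k hk hkr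
      · rw [d0]; exact hD.ans
      · by_cases hkg : k = g
        · rw [hkg, hVg]; omega
        · rw [hVk k hkg]
      · rw [d0]; exact h

theorem Ready.loop {D : Inst} {R : Root} {s : State} (h : Ready D R s) {x b : ℕ} {P : Cmd} (N : ℕ)
    (hN : s.var b = N) (hx : x ∉ P.wv) (hb : b ∉ x :: P.wv) (hV : (x :: P.wv).all rtVar = true)
    (hA : P.wa.all rdArr = true) (hx0 : 0 ≠ x) (G : ℕ → ℕ → (ℕ → ℕ → ℕ) → Prop)
    (h0 : G 0 (s.var 0) s.arr)
    (hstep : ∀ i s', i < N → Ready D R s' → s'.var x = i → SameExcept (x :: P.wv) P.wa s s' →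
      G i (s'.var 0) s'.arr → G (i + 1) ((P.run s').var 0) (P.run s').arr) :
    G N (((Cmd.loop x b P).run s).var 0) ((Cmd.loop x b P).run s).arr :=
  Cmd.loop_inv N hN hx hb (fun i s' => G i (s'.var 0) s'.arr) (by simpa [hx0] using h0)
    fun i s' hi hG hxi hs => by
      have := hstep i s' hi (h.of_same hs hV hA) hxi hs (by simpa using hG)
      simpa [hx0] using this

/-- The content of `DP` in terms of the answer and the arrays only, the form in which `Ready.loop`
states invariants. -/
structure DPa (D : Inst) (R : Root) (a0 a : ℕ) (arr : ℕ → ℕ → ℕ) : Prop where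
  bits : ∀ g < 4 * D.n, ∀ b < D.L, arr 24 (g * D.L + b) ≤ 1
  sound : ∀ f < 4 * D.n, (f = Inst.root R ∨ D.nbr R f < D.n) → ∃ r w, D.Chain R f r w ∧
    D.V arr f ≤ w
  ans : a = a0 ∨ a = 0 ∧ D.Bad R

theorem Inst.Chain.lt {D : Inst} {R : Root} (hroot : Inst.root R < 4 * D.n) {f r w : ℕ}
    (h : D.Chain R f r w) : f < 4 * D.n := by
  cases h with
  | nil => exact hroot
  | snoc _ hg _ => exact hg

/-- After k rounds, unless the answer has been cleared, the stored weights dominate all chains with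
at most k steps, and those with at least one step weigh less than the temperature. That no chain has
more than 4n steps is a geometric fact, proved later. -/
theorem run_chainsC {D : Inst} {R : Root} {s : State} (h : Ready D R s)
    (h21 : ∀ f < 4 * D.n, ∀ g < 4 * D.n, s.arr 21 (f * (4 * D.n) + g) = ind01 (D.Rel R f g))
    {s0 : State} (hD : DP D R s0 s) (hV : D.V s.arr (Inst.root R) = D.W R.p R.d R.q) :
    ((chainsC.run s).var 0 = s0.var 0 ∨ (chainsC.run s).var 0 = 0 ∧ D.Bad R) ∧
    (s.var 0 = 0 → (chainsC.run s).var 0 = 0) ∧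
    ((chainsC.run s).var 0 = 0 ∨ ∀ f r w, r ≤ 4 * D.n → D.Chain R f r w → r ≠ 0 → w < D.temp) := by
  have hroot := h.root_lt
  have key : DPa D R (s0.var 0) ((chainsC.run s).var 0) (chainsC.run s).arr ∧
      (s.var 0 = 0 → (chainsC.run s).var 0 = 0) ∧ ((chainsC.run s).var 0 = 0 ∨
        ∀ f r w, r ≤ 4 * D.n → D.Chain R f r w →
          w ≤ D.V (chainsC.run s).arr f ∧ (r ≠ 0 → w < D.temp)) := by
    refine h.loop (4 * D.n) h.v5 (by decide) (by decide) (by decide) (by decide) (by decide)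
      (fun k a arr => DPa D R (s0.var 0) a arr ∧ (s.var 0 = 0 → a = 0) ∧ (a = 0 ∨
        ∀ f r w, r ≤ k → D.Chain R f r w → w ≤ D.V arr f ∧ (r ≠ 0 → w < D.temp)))
      ⟨⟨hD.bits, hD.sound, hD.ans⟩, id, Or.inr ?_⟩ ?_
    · intro f r w hr hch
      cases hch with
      | nil => exact ⟨hV.ge, fun h => absurd rfl h⟩
      | snoc => omega
    rintro k sB hk hB - hsB ⟨gB, gB0, gBc⟩
    -- The stored weights only grow during a round, so it is enough to compare with their values
    -- `sB` at its start: each pair passed so far has been relaxed at least with these.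
    set Q := fun (g0 f0 a : ℕ) (arr : ℕ → ℕ → ℕ) => DPa D R (s0.var 0) a arr ∧
      (sB.var 0 = 0 → a = 0) ∧ (∀ k < 4 * D.n, D.V sB.arr k ≤ D.V arr k) ∧ (a = 0 ∨
        ∀ f < 4 * D.n, ∀ g < 4 * D.n, D.Rel R f g → (g < g0 ∨ g = g0 ∧ f < f0) →
          D.V sB.arr f + D.slotW R g ≤ D.V arr g ∧ D.V sB.arr f + D.slotW R g < D.temp) with hQ
    have hround : Q (4 * D.n) 0 ((Cmd.run (.loop 26 5 (.loop 25 5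
        (.ite (.eq (.get 21 (v 25 * v 5 + v 26)) 1) relaxC .skip))) sB).var 0)
        (Cmd.run (.loop 26 5 (.loop 25 5
        (.ite (.eq (.get 21 (v 25 * v 5 + v 26)) 1) relaxC .skip))) sB).arr := by
      refine hB.loop (4 * D.n) hB.v5 (by decide) (by decide) (by decide) (by decide) (by decide)
        (fun g => Q g 0) ⟨gB, id, fun _ _ => le_rfl, Or.inr fun _ _ _ _ _ h => by omega⟩ ?_
      intro g sg hg hSg xg hsg hQg
      have := hSg.loop (4 * D.n) hSg.v5 (x := 25)
        (P := .ite (.eq (.get 21 (v 25 * v 5 + v 26)) 1) relaxC .skip) (by decide) (by decide)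
        (by decide) (by decide) (by decide) (Q g) hQg ?_
      · refine ⟨this.1, this.2.1, this.2.2.1, this.2.2.2.imp_right fun H f hf g' hg' hr hlt =>
          H f hf g' hg' hr (by omega)⟩
      rintro f sf hf hSf xf hsf ⟨q1, q2, q3, q4⟩
      have e26 : sf.var 26 = g := (hsf.var 26 (by decide)).trans xg
      have e21 : sf.arr 21 = s.arr 21 := (hsf.arr 21 (by decide)).trans
        ((hsg.arr 21 (by decide)).trans (hsB.arr 21 (by decide)))
      have hden : (Fml.eq (.get 21 (v 25 * v 5 + v 26)) 1).den sf ↔ D.Rel R f g := by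
        simp only [Fml.den_eq, Expr.val_get, Expr.val_add, Expr.val_mul, Expr.val_var, xf, e26,
          hSf.v5, e21, h21 f hf g hg, Expr.val_one, ind01_eq_one]
      refine Cmd.run_ite_cases hden (fun s' => Q g (f + 1) (s'.var 0) s'.arr) (fun hrel => ?_)
        fun hrel => ?_
      · obtain ⟨r1, r2, r3, r4⟩ := run_relaxC hSf xf e26 hf hg hrel
          (s0 := s0) ⟨q1.bits, q1.sound, q1.ans⟩
        refine ⟨⟨r1.bits, r1.sound, r1.ans⟩, fun h => r3 (q2 h),
          fun k hk => (q3 k hk).trans (r2 k hk), ?_⟩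
        rcases r4 with r4 | ⟨r4, r5⟩
        · exact Or.inl r4
        rcases q4 with q4 | q4
        · exact Or.inl (r3 q4)
        right
        intro f' hf' g' hg' hrel' hlt
        by_cases hcur : g' = g ∧ f' = f
        · obtain ⟨rfl, rfl⟩ := hcur
          have := q3 f' hf
          exact ⟨by omega, by omega⟩
        · obtain ⟨u1, u2⟩ := q4 f' hf' g' hg' hrel' (by omega)
          exact ⟨u1.trans (r2 g' hg'), u2⟩
      · rw [Cmd.run_skip]
        refine ⟨q1, q2, q3, q4.imp_right fun H f' hf' g' hg' hrel' hlt => H f' hf' g' hg' hrel' ?_⟩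
        by_cases hcur : g' = g ∧ f' = f
        · obtain ⟨rfl, rfl⟩ := hcur
          exact absurd hrel' hrel
        · omega
    obtain ⟨q1, q2, q3, q4⟩ := hround
    refine ⟨q1, fun h => q2 (gB0 h), ?_⟩
    rcases gBc with gBc | gBc
    · exact Or.inl (q2 gBc)
    refine q4.imp_right fun H f r w hr hch => ?_
    have hfn := hch.lt hroot
    cases hch with
    | nil =>
      exact ⟨((gBc _ 0 _ (Nat.zero_le _) Inst.Chain.nil).1).trans (q3 _ hfn),
        fun h => absurd rfl h⟩
    | snoc hch hg hfg =>
      obtain ⟨u1, -⟩ := gBc _ _ _ (by omega) hch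
      obtain ⟨t1, t2⟩ := H _ (hch.lt hroot) _ hg hfg (by omega)
      exact ⟨by omega, fun _ => by omega⟩
  obtain ⟨k1, k2, k3⟩ := key
  exact ⟨k1.ans, k2, k3.imp_right fun H f r w hr hch h0 => (H f r w hr hch).2 h0⟩

/-! ## The part for one root bond, and the whole program -/

/-- The cell p' is the image of p under the wanted translation. A cell y imposes a condition only if
it remains connected with p when the cell at side d of p, if there is one, is removed. -/
def Inst.Leaf (D : Inst) (R : Root) : Prop :=
  ∃ p' < D.n, (∃ z < D.n, D.next p' R.d z ∧ D.same z R.q) ∧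
    ∀ y < D.n, (∃ x < D.n, D.next R.p R.d x ∧ ¬ D.Reach x R.p y) ∨
      ∃ z < D.n, (D.cx z + D.cx R.p = D.cx y + D.cx p' ∧ D.cy z + D.cy R.p = D.cy y + D.cy p') ∧
        D.same z y

theorem Tab.den_leafF {D : Inst} {R : Root} {s : State} (h : Tab D s) (h22 : s.var 22 = R.p)
    (h23 : s.var 23 = R.d) (h24 : s.var 24 = R.q) (hp : R.p < D.n)
    (hq : R.q < D.n) : leafF.den s ↔ D.Leaf R := by
  simp only [leafF, Fml.den_ex, Fml.den_and, Fml.den_all, Fml.den_or, h.v1, State.setVar_var,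
    show (1 : ℕ) = 500 ↔ False by decide, show (1 : ℕ) = 502 ↔ False by decide, if_false,
    Inst.Leaf]
  refine exists_congr fun p' => and_congr_right fun hp' => and_congr
    (exists_congr fun z => and_congr_right fun hz => ?_) (forall₂_congr fun y hy => or_congr
    (exists_congr fun x => and_congr_right fun hx => ?_)
    (exists_congr fun z => and_congr_right fun hz => ?_))
  · have h2 := (h.setVar (x := 500) (by norm_num) p').setVar (x := 501) (by norm_num) z
    refine and_congr ?_ ?_
    · have := h2.den_nextF (i := v 500) (d := v 23) (j := v 501) (by simpa) (by simpa)
      simpa [h23] using this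
    · have := h2.den_sameF (i := v 501) (j := v 24) (by simpa) (by simpa [h24]) (by simp) (by simp)
      simpa [h24] using this
  · have h2 := ((h.setVar (x := 500) (by norm_num) p').setVar (x := 502) (by norm_num) y).setVar
      (x := 503) (by norm_num) x
    refine and_congr ?_ ?_
    · have := h2.den_nextF (i := v 22) (d := v 23) (j := v 503) (by simpa [h22]) (by simpa)
      simpa [h22, h23] using this
    · have := h2.den_onF (p := v 22) (y := v 502) (x := v 503) (by simpa using hx.le)
        (by simpa [h22]) (by simpa)
      simpa [h22] using this
  · have h2 := ((h.setVar (x := 500) (by norm_num) p').setVar (x := 502) (by norm_num) y).setVar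
      (x := 504) (by norm_num) z
    refine and_congr ?_ ?_
    · simp [xE, yE, h22, h.ax _ hz, h.ax _ hp, h.ax _ hy, h.ax _ hp', h.ay _ hz, h.ay _ hp,
        h.ay _ hy, h.ay _ hp']
    · have := h2.den_sameF (i := v 504) (j := v 502) (by simpa) (by simpa) (by simp) (by simp)
      simpa using this

/-- The root bond admits a wrong leaf, or a wrong combination of two copies. -/
def Inst.Rogue (D : Inst) (R : Root) : Prop :=
  (D.temp ≤ D.W R.p R.d R.q ∧ ¬ D.Leaf R) ∨ D.Bad R

/-- Chains are short. -/
def Inst.Short (D : Inst) : Prop :=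
  ∀ R : Root, R.p < D.n → R.d < 4 → R.q < D.n → 0 < D.S R.p R.d R.q →
    ∀ f r w, D.Chain R f r w → r ≤ 4 * D.n

/-- The bound on the length of chains is needed only while the answer is still 1, that is, after the
connectivity test has succeeded; a cleared answer stays cleared whatever the chains are. -/
theorem run_rootC {D : Inst} (hI : D.Inj) {R : Root} {s : State} (hS : s.var 0 = 1 → D.Short)
    (h : Tab D s)
    (h22 : s.var 22 = R.p) (h23 : s.var 23 = R.d) (h24 : s.var 24 = R.q) (hp : R.p < D.n)
    (hd : R.d < 4) (hq : R.q < D.n) (hpos : 0 < D.S R.p R.d R.q) (h0 : s.var 0 ≤ 1) :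
    (rootC.run s).var 0 ≤ 1 ∧ ((rootC.run s).var 0 = 1 ↔ s.var 0 = 1 ∧ ¬ D.Rogue R) := by
  set s1 := (Cmd.ite (.and (.eq (.get 7 (slotPairE (v 22) (v 23) (v 24))) 1) (.not leafF))
    (.assign 0 0) .skip).run s with hs1'
  have hs1 : SameExcept [0] [] s s1 := (Cmd.same _ s).mono (by simp [Cmd.wv]) (by simp [Cmd.wa])
  have hden : (Fml.and (.eq (.get 7 (slotPairE (v 22) (v 23) (v 24))) 1) (.not leafF)).den s ↔
      D.temp ≤ D.W R.p R.d R.q ∧ ¬ D.Leaf R := by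
    rw [Fml.den_and, Fml.den_not, h.den_leafF h22 h23 h24 hp hq, Fml.den_eq, Expr.val_get,
      h.val_slotPairE]
    simp only [Expr.val_var, h22, h23, h24, h.ge _ hp _ hd _ hq, Expr.val_one, ind01_eq_one]
  have k1 : s1.var 0 ≤ 1 ∧ (s1.var 0 = 1 ↔ s.var 0 = 1 ∧
      ¬ (D.temp ≤ D.W R.p R.d R.q ∧ ¬ D.Leaf R)) := by
    refine Cmd.run_ite_cases hden (fun s' => s'.var 0 ≤ 1 ∧ (s'.var 0 = 1 ↔ s.var 0 = 1 ∧
      ¬ (D.temp ≤ D.W R.p R.d R.q ∧ ¬ D.Leaf R))) (fun hc => ?_) fun hc => ?_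
    · have e0 : ((Cmd.assign 0 0).run s).var 0 = 0 := by simp
      rw [e0]; simp [hc]
    · rw [Cmd.run_skip]; exact ⟨h0, by simp only [hc, not_false_iff, and_true]⟩
  have t1 : Tab D s1 := h.of_same hs1 (by decide) (by decide)
  have t2 : Placed D R (placeC.run s1) := run_placeC t1 ((hs1.var 22 (by decide)).trans h22)
    ((hs1.var 23 (by decide)).trans h23) ((hs1.var 24 (by decide)).trans h24) hp hd hq
  set s2 := placeC.run s1 with hs2'
  have hs3 := Cmd.same overC s2
  have o3 := run_overC t2
  set s3 := overC.run s2 with hs3'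
  have t3 : Placed D R s3 := t2.of_same hs3 (by decide) (by decide)
  have hs4 := Cmd.same slotsC s3
  have o4 := run_slotsC hI t3 o3
  set s4 := slotsC.run s3 with hs4'
  have t4 : Ready D R s4 := ⟨t3.of_same hs4 (by decide) (by decide), by
    unfold OverSpec; rw [hs4.arr 15 (by decide)]; exact o3, o4⟩
  have hs5 := Cmd.same relC s4
  have o5 := fun f hf g hg => run_relC hI t4 (f := f) (g := g) hf hg
  set s5 := relC.run s4 with hs5'
  have t5 : Ready D R s5 := t4.of_same hs5 (by decide) (by decide)
  have hs6 := Cmd.same initC s5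
  obtain ⟨d6, w6⟩ := run_initC t5
  set s6 := initC.run s5 with hs6'
  have t6 : Ready D R s6 := t5.of_same hs6 (by decide) (by decide)
  have e5 : s5.var 0 = s1.var 0 := by
    rw [hs5.var 0 (by decide), hs4.var 0 (by decide), hs3.var 0 (by decide), hs2',
      (Cmd.same placeC s1).var 0 (by decide)]
  have e6 : s6.var 0 = s1.var 0 := (hs6.var 0 (by decide)).trans e5
  obtain ⟨r1, r2, r3⟩ := run_chainsC t6 (by
    rw [hs6.arr 21 (by decide)]; exact o5) d6 w6
  have hfin : rootC.run s = chainsC.run s6 := rfl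
  rw [hfin]
  rw [e5] at r1
  rw [e6] at r2
  have hbad : (chainsC.run s6).var 0 = 0 ∨ ¬ D.Bad R := by
    by_cases h1 : s.var 0 = 1
    swap
    · exact Or.inl (r2 (by have := k1.1; have := k1.2; omega))
    refine r3.imp_right fun H ⟨f, r, w, hch, hw⟩ => ?_
    have := H f (r + 1) w (hS h1 R hp hd hq hpos f _ w hch) hch (by omega)
    omega
  have hR : ¬ D.Rogue R ↔ ¬ (D.temp ≤ D.W R.p R.d R.q ∧ ¬ D.Leaf R) ∧ ¬ D.Bad R := not_or
  rw [hR, ← and_assoc, ← k1.2]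
  constructor
  · rcases r1 with r1 | ⟨r1, -⟩ <;> omega
  constructor
  · intro h1
    have hnb : ¬ D.Bad R := hbad.resolve_left (by omega)
    refine ⟨?_, hnb⟩
    rcases r1 with r1 | ⟨r1, -⟩ <;> omega
  · rintro ⟨h1, hnb⟩
    rcases r1 with r1 | ⟨-, r1⟩
    · omega
    · exact absurd r1 hnb

/-- The condition that the program tests. -/
def Inst.Crit (D : Inst) : Prop :=
  D.Tiles ∧
  (∀ i < D.n, ∀ d < 4, ∀ j < D.n, D.next i d j → 0 < D.S i d j → D.temp ≤ D.W i d j) ∧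
  (∀ y < D.n, D.Reach D.n 0 y) ∧
  ∀ p < D.n, ∀ d < 4, ∀ q < D.n, 0 < D.S p d q → ¬ D.Rogue ⟨p, d, q⟩

theorem run_rejectUnless {φ : Fml} {s : State} {p : Prop} (h : φ.den s ↔ p) (h0 : s.var 0 ≤ 1) :
    ((rejectUnless φ).run s).var 0 ≤ 1 ∧
      (((rejectUnless φ).run s).var 0 = 1 ↔ s.var 0 = 1 ∧ p) := by
  refine Cmd.run_ite_cases h (fun s' => s'.var 0 ≤ 1 ∧ (s'.var 0 = 1 ↔ s.var 0 = 1 ∧ p))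
    (fun hp => ?_) fun hp => ?_
  · rw [Cmd.run_skip]; exact ⟨h0, by simp [hp]⟩
  · have e0 : ((Cmd.assign 0 0).run s).var 0 = 0 := by simp
    rw [e0]; simp [hp]

theorem Tab.loop {D : Inst} {s : State} (h : Tab D s) {x b : ℕ} {P : Cmd} (N : ℕ)
    (hN : s.var b = N) (hx : x ∉ P.wv) (hb : b ∉ x :: P.wv) (hV : (x :: P.wv).all freeVar = true)
    (hA : P.wa.all tabArr = true) (hx0 : 0 ≠ x) (G : ℕ → ℕ → Prop) (h0 : G 0 (s.var 0))
    (hstep : ∀ i s', i < N → Tab D s' → s'.var x = i → SameExcept (x :: P.wv) P.wa s s' →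
      G i (s'.var 0) → G (i + 1) ((P.run s').var 0)) :
    G N (((Cmd.loop x b P).run s).var 0) :=
  Cmd.loop_inv N hN hx hb (fun i s' => G i (s'.var 0)) (by simpa [hx0] using h0)
    fun i s' hi hG hxi hs => by
      have := hstep i s' hi (h.of_same hs hV hA) hxi hs hG
      simpa [hx0] using this

theorem run_mainC {D : Inst} (hI : D.Inj) (hn : 0 < D.n) {s : State} (h : Env D s)
    (hS : (∀ y < D.n, D.Reach D.n 0 y) → D.Short)
    (h0 : s.var 0 = 1) : (D.Crit → (mainC.run s).var 0 = 1) ∧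
      (¬ D.Crit → (mainC.run s).var 0 = 0) := by
  obtain ⟨b1, c1⟩ := run_rejectUnless h.den_tilesF h0.le
  have hs1 := Cmd.same (rejectUnless tilesF) s
  set s1 := (rejectUnless tilesF).run s with hs1'
  have t1 : Env D s1 := h.of_same hs1 (by decide) (by decide)
  have hs2 := Cmd.same bondsC s1
  have o2 := fun i (hi : i < D.n) d (hd : d < 4) j (hj : j < D.n) => run_bondsC t1 hi hd hj
  set s2 := bondsC.run s1 with hs2'
  have t2 : Env D s2 := t1.of_same hs2 (by decide) (by decide)
  have hs3 := Cmd.same graphC s2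
  have o3 := fun i (hi : i < D.n) j (hj : j < D.n) => run_graphC t2 hi hj
  set s3 := graphC.run s2 with hs3'
  have t3 : Env D s3 := t2.of_same hs3 (by decide) (by decide)
  have hs4 := Cmd.same upC s3
  have o4 := fun i (hi : i < D.n) => run_upC t3 hi
  set s4 := upC.run s3 with hs4'
  have t4 : Env D s4 := t3.of_same hs4 (by decide) (by decide)
  have e0 : s4.var 0 = s1.var 0 := by
    rw [hs4.var 0 (by decide), hs3.var 0 (by decide), hs2.var 0 (by decide)]
  have a6 : s4.arr 6 = s2.arr 6 := by rw [hs4.arr 6 (by decide), hs3.arr 6 (by decide)]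
  have a7 : s4.arr 7 = s2.arr 7 := by rw [hs4.arr 7 (by decide), hs3.arr 7 (by decide)]
  have h7 : ∀ i < D.n, ∀ d < 4, ∀ j < D.n, s4.arr 7 ((4 * i + d) * D.n + j) =
      ind01 (D.temp ≤ D.W i d j) := fun i hi d hd j hj => by
    rw [a7]; exact (o2 i hi d hd j hj).2.2
  obtain ⟨b5, c5⟩ := run_rejectUnless (t4.den_strongF h7) (by rw [e0]; exact b1)
  have hs5 := Cmd.same (rejectUnless strongF) s4
  set s5 := (rejectUnless strongF).run s4 with hs5'
  have t5 : Env D s5 := t4.of_same hs5 (by decide) (by decide)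
  have hs6 := Cmd.same reachC s5
  have o6 := fun x (hx : x ≤ D.n) p (hp : p < D.n) y (hy : y < D.n) => run_reachC t5
    (by rw [hs5.arr 8 (by decide), hs4.arr 8 (by decide)]; exact o3) hx hp hy
  set s6 := reachC.run s5 with hs6'
  have t6 : Env D s6 := t5.of_same hs6 (by decide) (by decide)
  have e6 : s6.var 0 = s5.var 0 := hs6.var 0 (by decide)
  obtain ⟨b7, c7⟩ := run_rejectUnless (t6.den_connF hn o6) (by rw [e6]; exact b5)
  have hs7 := Cmd.same (rejectUnless connF) s6
  set s7 := (rejectUnless connF).run s6 with hs7'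
  have aa : ∀ a, (a = 6 ∨ a = 7 ∨ a = 9) → s7.arr a = s4.arr a := by
    rintro a (rfl | rfl | rfl) <;>
      rw [hs7.arr _ (by decide), hs6.arr _ (by decide), hs5.arr _ (by decide)]
  have t7 : Tab D s7 := by
    refine ⟨t6.of_same hs7 (by decide) (by decide), ?_, ?_, ?_, ?_, ?_⟩
    · rw [aa 6 (by simp), a6]; exact fun i hi d hd j hj => (o2 i hi d hd j hj).1
    · rw [aa 6 (by simp), a6]; exact fun i hi d hd j hj => (o2 i hi d hd j hj).2.1
    · rw [aa 7 (by simp)]; exact h7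
    · rw [aa 9 (by simp)]; exact o4
    · rw [hs7.arr _ (by decide)]; exact o6
  rw [e6, c5, e0, c1] at c7
  have hS7 : s7.var 0 = 1 → D.Short := fun h1 => hS (c7.1 h1).2
  -- The roots that precede (i, j, k) in lexicographic order have been examined.
  let G : ℕ → ℕ → ℕ → ℕ → Prop := fun i j k a => a ≤ 1 ∧ (a = 1 ↔ s7.var 0 = 1 ∧
    ∀ p < D.n, ∀ d < 4, ∀ q < D.n, (p < i ∨ p = i ∧ (d < j ∨ d = j ∧ q < k)) → 0 < D.S p d q →
      ¬ D.Rogue ⟨p, d, q⟩)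
  have hfin : G D.n 0 0 ((mainC.run s).var 0) := by
    refine t7.loop D.n t7.v1 (by decide) (by decide) (by decide) (by decide) (by decide)
      (fun i => G i 0 0) ⟨b7, by simp⟩ ?_
    intro i sa hi ha xa hsa ga
    have := ha.loop 4 ha.v6 (x := 23) (P := .loop 24 1 (.ite (bondF (v 22) (v 23) (v 24)) rootC
      .skip)) (by decide) (by decide) (by decide) (by decide) (by decide)
      (fun j => G i j 0) ga ?_
    · refine ⟨this.1, this.2.trans (and_congr_right fun _ => ?_)⟩
      refine forall₂_congr fun p hp => forall₂_congr fun d hd => forall₂_congr fun q hq => ?_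
      exact imp_congr_left (by omega)
    intro j sb hj hb xb hsb gb
    have := hb.loop D.n hb.v1 (x := 24) (P := .ite (bondF (v 22) (v 23) (v 24)) rootC .skip)
      (by decide) (by decide) (by decide) (by decide) (by decide)
      (fun k => G i j k) gb ?_
    · refine ⟨this.1, this.2.trans (and_congr_right fun _ => ?_)⟩
      refine forall₂_congr fun p hp => forall₂_congr fun d hd => forall₂_congr fun q hq => ?_
      exact imp_congr_left (by omega)
    intro k sc hk hc xc hsc gc
    have e22 : sc.var 22 = i := by rw [hsc.var 22 (by decide), hsb.var 22 (by decide), xa]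
    have e23 : sc.var 23 = j := by rw [hsc.var 23 (by decide), xb]
    have hden : (bondF (v 22) (v 23) (v 24)).den sc ↔ 0 < D.S i j k := by
      have := hc.den_bondF (i := v 22) (d := v 23) (j := v 24) (by simpa [e22]) (by simpa [e23])
        (by simpa [xc])
      simpa [e22, e23, xc] using this
    have hsplit : (∀ p < D.n, ∀ d < 4, ∀ q < D.n,
        (p < i ∨ p = i ∧ (d < j ∨ d = j ∧ q < k + 1)) → 0 < D.S p d q → ¬ D.Rogue ⟨p, d, q⟩) ↔
        (∀ p < D.n, ∀ d < 4, ∀ q < D.n,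
        (p < i ∨ p = i ∧ (d < j ∨ d = j ∧ q < k)) → 0 < D.S p d q → ¬ D.Rogue ⟨p, d, q⟩) ∧
        (0 < D.S i j k → ¬ D.Rogue ⟨i, j, k⟩) := by
      constructor
      · exact fun H => ⟨fun p hp d hd q hq hlt => H p hp d hd q hq (by omega),
          H i hi j hj k hk (by omega)⟩
      · rintro ⟨H1, H2⟩ p hp d hd q hq hlt
        by_cases hcur : p = i ∧ d = j ∧ q = k
        · obtain ⟨rfl, rfl, rfl⟩ := hcur; exact H2
        · exact H1 p hp d hd q hq (by omega)
    refine Cmd.run_ite_cases hden (fun s' => G i j (k + 1) (s'.var 0)) (fun hpos => ?_)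
      fun hpos => ?_
    · obtain ⟨r1, r2⟩ := run_rootC hI (R := ⟨i, j, k⟩) (fun h1 => hS7 (gc.2.1 h1).1) hc e22 e23 xc
        hi hj hk hpos gc.1
      refine ⟨r1, ?_⟩
      rw [r2, gc.2, hsplit, and_assoc]
      exact and_congr_right fun _ => and_congr_right fun _ => ⟨fun h _ => h, fun h => h hpos⟩
    · rw [Cmd.run_skip]
      refine ⟨gc.1, ?_⟩
      rw [gc.2, hsplit]
      exact and_congr_right fun _ => ⟨fun h => ⟨h, fun h => absurd h hpos⟩, fun h => h.1⟩
  have hcrit : (mainC.run s).var 0 = 1 ↔ D.Crit := by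
    rw [hfin.2, c7, Inst.Crit]
    constructor
    · rintro ⟨⟨⟨⟨-, h1⟩, h2⟩, h3⟩, h4⟩
      exact ⟨h1, h2, h3, fun p hp d hd q hq => h4 p hp d hd q hq (Or.inl hp)⟩
    · rintro ⟨h1, h2, h3, h4⟩
      exact ⟨⟨⟨⟨h0, h1⟩, h2⟩, h3⟩, fun p hp d hd q hq _ => h4 p hp d hd q hq⟩
  refine ⟨hcrit.2, fun hnc => ?_⟩
  have := hfin.1
  have h1 : (mainC.run s).var 0 ≠ 1 := fun h => hnc (hcrit.1 h)
  omega

end WordRAM.TreeUAV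

namespace TwoHAM

variable {G : Type}

/-! ## Operations on configurations -/

theorem Config.ext_tile {A B : Config G} (h : ∀ p, A.tile p = B.tile p) : A = B := by
  have h1 : A.tile = B.tile := funext h
  refine Config.ext h1 (Finset.ext fun p => ?_)
  rw [A.mem_dom, B.mem_dom, h]

theorem Config.tile_eq_none {A : Config G} {p : ℤ × ℤ} (h : p ∉ A.dom) : A.tile p = none := by
  rw [A.mem_dom] at h; simpa using h

theorem Config.mem_dom_of_tile {A : Config G} {p : ℤ × ℤ} {t : Tile G} (h : A.tile p = some t) :
    p ∈ A.dom := by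
  rw [A.mem_dom, h]; rfl

theorem Config.exists_tile {A : Config G} {p : ℤ × ℤ} (h : p ∈ A.dom) :
    ∃ t, A.tile p = some t := by
  rw [A.mem_dom] at h; exact Option.isSome_iff_exists.1 h

open Classical in
/-- The part of a configuration on a set of cells. -/
noncomputable def Config.restrict (A : Config G) (S : Finset (ℤ × ℤ)) : Config G where
  tile p := if p ∈ S then A.tile p else none
  dom := A.dom.filter (· ∈ S)
  mem_dom p := by
    rw [Finset.mem_filter, A.mem_dom]
    split_ifs with h <;> simp [h]

/-- The translation of a configuration by `u`. -/
def Config.shift (A : Config G) (u : ℤ × ℤ) : Config G where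
  tile p := A.tile (p - u)
  dom := A.dom.map (Equiv.addRight u).toEmbedding
  mem_dom p := by
    rw [← A.mem_dom, Finset.mem_map_equiv]
    simp [sub_eq_add_neg]

open Classical in
noncomputable def Config.union (A B : Config G) : Config G where
  tile p := if p ∈ A.dom then A.tile p else B.tile p
  dom := A.dom ∪ B.dom
  mem_dom p := by
    rw [Finset.mem_union, B.mem_dom]
    by_cases h : p ∈ A.dom
    · simp [h, (A.mem_dom p).1 h]
    · simp [h]

theorem Config.assembly_eq_iff {A B : Config G} :
    A.assembly = B.assembly ↔ ∃ u : ℤ × ℤ, ∀ p, A.tile p = B.tile (p + u) :=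
  ⟨fun h => (Quotient.exact h.symm : (Config.setoid G).r B A), fun h =>
    (Quotient.sound (show (Config.setoid G).r B A from h)).symm⟩

theorem Config.shift_assembly (A : Config G) (u : ℤ × ℤ) : (A.shift u).assembly = A.assembly :=
  Config.assembly_eq_iff.2 ⟨-u, fun p => by simp [Config.shift, sub_eq_add_neg]⟩

theorem Config.mem_shift_dom {A : Config G} {u p : ℤ × ℤ} :
    p ∈ (A.shift u).dom ↔ p - u ∈ A.dom := by
  rw [Config.mem_dom, Config.mem_dom]; rfl

theorem Config.eq_shift_of_assembly_eq {A B : Config G} (h : A.assembly = B.assembly) :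
    ∃ u, A = B.shift u := by
  obtain ⟨u, hu⟩ := Config.assembly_eq_iff.1 h
  exact ⟨-u, Config.ext_tile fun p => by rw [hu]; simp [Config.shift]⟩

theorem Config.restrict_dom {A : Config G} {S : Finset (ℤ × ℤ)} (h : S ⊆ A.dom) :
    (A.restrict S).dom = S := by
  ext p
  simp only [Config.restrict, Finset.mem_filter]
  exact ⟨fun h => h.2, fun hp => ⟨h hp, hp⟩⟩

theorem Config.restrict_tile {A : Config G} {S : Finset (ℤ × ℤ)} {p : ℤ × ℤ} (hp : p ∈ S) :
    (A.restrict S).tile p = A.tile p := by simp [Config.restrict, hp]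

theorem Config.restrict_tile_eq_some {A : Config G} {S : Finset (ℤ × ℤ)} {p : ℤ × ℤ} {t : Tile G} :
    (A.restrict S).tile p = some t ↔ p ∈ S ∧ A.tile p = some t := by
  simp only [Config.restrict]
  split_ifs with h <;> simp [h]

theorem Config.restrict_self (A : Config G) : A.restrict A.dom = A :=
  Config.ext_tile fun p => by
    simp only [Config.restrict]
    split_ifs with h
    · rfl
    · exact (Config.tile_eq_none h).symm

/-- `C` is the union of `A` and `B`. -/
def Config.IsUnion (C A B : Config G) : Prop :=
  ∀ p t, C.tile p = some t ↔ A.tile p = some t ∨ B.tile p = some t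

theorem Config.isUnion_union {A B : Config G} (h : Disjoint A.dom B.dom) :
    (A.union B).IsUnion A B := by
  intro p t
  simp only [Config.union]
  split_ifs with hp
  · have : B.tile p = none := Config.tile_eq_none (Finset.disjoint_left.1 h hp)
    simp [this]
  · have : A.tile p = none := Config.tile_eq_none hp
    simp [this]

theorem Config.IsUnion.dom [DecidableEq (ℤ × ℤ)] {C A B : Config G} (h : C.IsUnion A B) :
    C.dom = A.dom ∪ B.dom := by
  ext p
  simp only [Config.mem_dom, Finset.mem_union, Option.isSome_iff_exists, h p, exists_or]

/-! ## Bonds -/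

/-- The bond between the tiles `s` and `t` if `t` is placed at displacement `w` from `s`. -/
def System.link (Γ : System G) (s t : Tile G) (w : ℤ × ℤ) : ℕ :=
  if w = (1, 0) then Γ.str s.east t.west
  else if w = (-1, 0) then Γ.str s.west t.east
  else if w = (0, 1) then Γ.str s.north t.south
  else if w = (0, -1) then Γ.str s.south t.north
  else 0

variable {Γ : System G}

theorem System.bond_eq_link {A : Config G} {p q : ℤ × ℤ} {s t : Tile G} (hs : A.tile p = some s)
    (ht : A.tile q = some t) : Γ.bond A p q = Γ.link s t (q - p) := by
  unfold System.bond System.link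
  rw [hs, ht]
  obtain ⟨p1, p2⟩ := p
  obtain ⟨q1, q2⟩ := q
  simp only [Prod.mk_add_mk, Prod.mk.injEq, Prod.mk_sub_mk]
  congr 1
  · exact propext (by omega)
  congr 1
  · exact propext (by omega)
  congr 1
  · exact propext (by omega)
  congr 1
  · exact propext (by omega)

theorem System.bond_pos_mem {A : Config G} {p q : ℤ × ℤ} (h : 0 < Γ.bond A p q) :
    p ∈ A.dom ∧ q ∈ A.dom := by
  unfold System.bond at h
  rw [A.mem_dom, A.mem_dom]
  split at h
  · rename_i h1 h2; simp [h1, h2]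
  · omega

theorem System.bond_congr {A B : Config G} {p q u : ℤ × ℤ} (hp : A.tile p = B.tile (p + u))
    (hq : A.tile q = B.tile (q + u)) : Γ.bond A p q = Γ.bond B (p + u) (q + u) := by
  by_cases h : p ∈ A.dom ∧ q ∈ A.dom
  · obtain ⟨s, hs⟩ := Config.exists_tile h.1
    obtain ⟨t, ht⟩ := Config.exists_tile h.2
    rw [System.bond_eq_link hs ht, System.bond_eq_link (hp ▸ hs) (hq ▸ ht)]
    simp
  · have e1 : Γ.bond A p q = 0 := by
      by_contra hne; exact h (System.bond_pos_mem (Nat.pos_of_ne_zero hne))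
    have e2 : Γ.bond B (p + u) (q + u) = 0 := by
      by_contra hne
      have := System.bond_pos_mem (Nat.pos_of_ne_zero hne)
      rw [B.mem_dom, B.mem_dom, ← hp, ← hq, ← A.mem_dom, ← A.mem_dom] at this
      exact h this
    rw [e1, e2]

theorem System.bond_congr' {A B : Config G} {p q : ℤ × ℤ} (hp : A.tile p = B.tile p)
    (hq : A.tile q = B.tile q) : Γ.bond A p q = Γ.bond B p q := by
  have := System.bond_congr (Γ := Γ) (A := A) (B := B) (p := p) (q := q) (u := 0) (by simpa)
    (by simpa)
  simpa using this

theorem System.bond_shift (A : Config G) (u p q : ℤ × ℤ) :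
    Γ.bond (A.shift u) p q = Γ.bond A (p - u) (q - u) := by
  have := System.bond_congr (Γ := Γ) (A := A.shift u) (B := A) (p := p) (q := q) (u := -u)
    (by simp [Config.shift, sub_eq_add_neg]) (by simp [Config.shift, sub_eq_add_neg])
  simpa [sub_eq_add_neg] using this

/-- Every bond of `A` is at least as strong as the temperature. -/
def System.Strong (Γ : System G) (A : Config G) : Prop :=
  ∀ p q, 0 < Γ.bond A p q → Γ.temp ≤ Γ.bond A p q

/-- The bond graph of `A` is connected. -/
def System.Conn (Γ : System G) (A : Config G) : Prop :=
  A.dom.Nonempty ∧ ∀ p ∈ A.dom, ∀ q ∈ A.dom,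
    Relation.ReflTransGen (fun x y => 0 < Γ.bond A x y) p q

theorem rtg_map {α β : Type*} {R : α → α → Prop} {S : β → β → Prop} (f : α → β)
    (h : ∀ a b, R a b → S (f a) (f b)) {p q : α} (hpq : Relation.ReflTransGen R p q) :
    Relation.ReflTransGen S (f p) (f q) := by
  induction hpq with
  | refl => exact .refl
  | tail _ hbc ih => exact ih.tail (h _ _ hbc)

theorem System.conn_iff {A : Config G} : Γ.Conn A ↔ (Γ.bondGraph A).Connected := by
  constructor
  · rintro ⟨⟨p, hp⟩, h⟩
    have : Nonempty {p // p ∈ A.dom} := ⟨⟨p, hp⟩⟩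
    refine ⟨fun x y => ?_⟩
    have key : ∀ z, Relation.ReflTransGen (fun x y => 0 < Γ.bond A x y) x.1 z →
        ∃ hz : z ∈ A.dom, (Γ.bondGraph A).Reachable x ⟨z, hz⟩ := by
      intro z hz
      induction hz with
      | refl => exact ⟨x.2, SimpleGraph.Reachable.refl _⟩
      | tail _ hbc ih =>
        obtain ⟨hb, hr⟩ := ih
        refine ⟨(System.bond_pos_mem hbc).2, hr.trans (SimpleGraph.Adj.reachable ?_)⟩
        exact hbc
    exact (key y.1 (h x.1 x.2 y.1 y.2)).2
  · intro h
    obtain ⟨⟨p, hp⟩⟩ := h.nonempty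
    refine ⟨⟨p, hp⟩, fun x hx y hy => ?_⟩
    have := (SimpleGraph.reachable_iff_reflTransGen _ _).1 (h.preconnected ⟨x, hx⟩ ⟨y, hy⟩)
    exact rtg_map (S := fun x y => 0 < Γ.bond A x y) (fun z : {p // p ∈ A.dom} => z.1)
      (fun a b hab => hab) this

theorem exists_step_of_reflTransGen {α : Type*} {R : α → α → Prop} {S : α → Prop} {p q : α}
    (h : Relation.ReflTransGen R p q) (hp : S p) (hq : ¬ S q) : ∃ x y, S x ∧ ¬ S y ∧ R x y := by
  induction h with
  | refl => exact absurd hp hq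
  | @tail b c _ hbc ih =>
    by_cases hb : S b
    · exact ⟨_, _, hb, hq, hbc⟩
    · exact ih hb

/-- As long as the set is not everything, a path from p to a missing cell leaves it through some
bond, and the cell behind that bond is added. -/
theorem System.Conn.induction {A : Config G} (h : Γ.Conn A) (P : Finset (ℤ × ℤ) → Prop)
    {p : ℤ × ℤ} (hp : p ∈ A.dom) (h0 : P {p})
    (hstep : ∀ T ⊆ A.dom, P T → ∀ x ∈ T, ∀ y ∈ A.dom, y ∉ T → 0 < Γ.bond A x y →
      P (insert y T)) : P A.dom := by
  classical
  have key : ∀ k, k + 1 ≤ A.dom.card → ∃ T ⊆ A.dom, p ∈ T ∧ P T ∧ T.card = k + 1 := by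
    intro k
    induction k with
    | zero => exact fun _ => ⟨{p}, by simpa using hp, by simp, h0, by simp⟩
    | succ k ih =>
      intro hk
      obtain ⟨T, hT, hpT, hPT, hc⟩ := ih (by omega)
      obtain ⟨q, hq, hqT⟩ : ∃ q ∈ A.dom, q ∉ T := by
        by_contra hcon
        push Not at hcon
        have := Finset.card_le_card (show A.dom ⊆ T from hcon)
        omega
      obtain ⟨x, y, hx, hy, hxy⟩ := exists_step_of_reflTransGen (S := (· ∈ T)) (h.2 p hp q hq)
        hpT hqT
      have hyA := (System.bond_pos_mem hxy).2
      refine ⟨insert y T, Finset.insert_subset hyA hT, Finset.mem_insert_of_mem hpT,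
        hstep T hT hPT x hx y hyA hy hxy, ?_⟩
      rw [Finset.card_insert_of_notMem hy, hc]
  have hpos : 0 < A.dom.card := Finset.card_pos.2 ⟨p, hp⟩
  obtain ⟨T, hT, -, hPT, hc⟩ := key (A.dom.card - 1) (by omega)
  rwa [← Finset.eq_of_subset_of_card_le hT (by omega)]

theorem System.bond_restrict {A : Config G} {S : Finset (ℤ × ℤ)} {p q : ℤ × ℤ} (hp : p ∈ S)
    (hq : q ∈ S) : Γ.bond (A.restrict S) p q = Γ.bond A p q :=
  System.bond_congr' (Config.restrict_tile hp) (Config.restrict_tile hq)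

theorem System.bond_restrict_pos {A : Config G} {S : Finset (ℤ × ℤ)} {p q : ℤ × ℤ}
    (h : 0 < Γ.bond (A.restrict S) p q) : p ∈ S ∧ q ∈ S ∧ 0 < Γ.bond A p q := by
  obtain ⟨h1, h2⟩ := System.bond_pos_mem h
  simp only [Config.restrict, Finset.mem_filter] at h1 h2
  exact ⟨h1.2, h2.2, by rwa [System.bond_restrict h1.2 h2.2] at h⟩

theorem System.Conn.of_center {A : Config G} {p : ℤ × ℤ} (hp : p ∈ A.dom)
    (h : ∀ q ∈ A.dom, Relation.ReflTransGen (fun x y => 0 < Γ.bond A x y) p q) : Γ.Conn A := by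
  refine ⟨⟨p, hp⟩, fun x hx y hy => Relation.ReflTransGen.trans ?_ (h y hy)⟩
  have hsym : ∀ a b, Relation.ReflTransGen (fun x y => 0 < Γ.bond A x y) a b →
      Relation.ReflTransGen (fun x y => 0 < Γ.bond A x y) b a := by
    intro a b hab
    induction hab with
    | refl => exact .refl
    | tail _ hbc ih => exact .head (by rwa [Γ.bond_comm]) ih
  exact hsym _ _ (h x hx)

theorem System.conn_restrict_insert {A : Config G} {T : Finset (ℤ × ℤ)} (hT : T ⊆ A.dom)
    (h : Γ.Conn (A.restrict T)) {x y : ℤ × ℤ} (hx : x ∈ T) (hy : y ∈ A.dom)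
    (hxy : 0 < Γ.bond A x y) : Γ.Conn (A.restrict (insert y T)) := by
  have hT' : insert y T ⊆ A.dom := Finset.insert_subset hy hT
  have hd := Config.restrict_dom hT
  have hd' := Config.restrict_dom hT'
  have mono : ∀ q, Relation.ReflTransGen (fun x y => 0 < Γ.bond (A.restrict T) x y) x q →
      Relation.ReflTransGen (fun a b => 0 < Γ.bond (A.restrict (insert y T)) a b) x q :=
    fun q => rtg_map (fun z => z) fun a b hab => by
      obtain ⟨h1, h2, h3⟩ := System.bond_restrict_pos hab
      rwa [System.bond_restrict (Finset.mem_insert_of_mem h1) (Finset.mem_insert_of_mem h2)]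
  refine System.Conn.of_center (p := x) (by rw [hd']; exact Finset.mem_insert_of_mem hx) ?_
  intro q hq
  rw [hd'] at hq
  rcases Finset.mem_insert.1 hq with rfl | hq
  · refine Relation.ReflTransGen.single ?_
    rwa [System.bond_restrict (Finset.mem_insert_of_mem hx) (Finset.mem_insert_self _ _)]
  · exact mono q (h.2 x (by rwa [hd]) q (by rwa [hd]))

theorem System.conn_restrict_singleton {A : Config G} {p : ℤ × ℤ} (hp : p ∈ A.dom) :
    Γ.Conn (A.restrict {p}) := by
  have hd := Config.restrict_dom (A := A) (S := {p}) (by simpa using hp)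
  refine System.Conn.of_center (p := p) (by rw [hd]; simp) fun q hq => ?_
  rw [hd, Finset.mem_singleton] at hq
  rw [hq]

theorem System.Strong.restrict {A : Config G} (h : Γ.Strong A) (T : Finset (ℤ × ℤ)) :
    Γ.Strong (A.restrict T) := by
  intro p q hpq
  obtain ⟨h1, h2, h3⟩ := System.bond_restrict_pos hpq
  rw [System.bond_restrict h1 h2]
  exact h p q h3

/-! ## Stability -/

theorem System.Stable.conn {A : Config G} (h : Γ.Stable A) : Γ.Conn A := System.conn_iff.2 h.1

/-- Every cut of a connected graph contains an edge, and each single edge already reaches the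
temperature. -/
theorem System.Conn.stable {A : Config G} (h : Γ.Conn A) (hs : Γ.Strong A) : Γ.Stable A := by
  refine ⟨System.conn_iff.1 h, fun S hS ⟨p, hp⟩ hne => ?_⟩
  obtain ⟨q, hq, hqS⟩ : ∃ q ∈ A.dom, q ∉ S := by
    by_contra hcon
    push Not at hcon
    exact hne (Finset.Subset.antisymm hS hcon)
  obtain ⟨x, y, hx, hy, hxy⟩ := exists_step_of_reflTransGen (S := (· ∈ S)) (h.2 p (hS hp) q hq)
    hp hqS
  have hyA := (System.bond_pos_mem hxy).2
  calc Γ.temp ≤ Γ.bond A x y := hs x y hxy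
    _ ≤ ∑ y ∈ A.dom \ S, Γ.bond A x y :=
      Finset.single_le_sum (f := fun y => Γ.bond A x y) (fun _ _ => Nat.zero_le _)
        (Finset.mem_sdiff.2 ⟨hyA, hy⟩)
    _ ≤ _ := Finset.single_le_sum (f := fun x => ∑ y ∈ A.dom \ S, Γ.bond A x y)
        (fun _ _ => Nat.zero_le _) hx

theorem Config.IsUnion.left {C A B : Config G} (h : C.IsUnion A B) {p : ℤ × ℤ} (hp : p ∈ A.dom) :
    C.tile p = A.tile p := by
  obtain ⟨t, ht⟩ := Config.exists_tile hp
  rw [ht]; exact (h p t).2 (Or.inl ht)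

theorem Config.IsUnion.symm {C A B : Config G} (h : C.IsUnion A B) : C.IsUnion B A :=
  fun p t => (h p t).trans or_comm

/-- A cut of the union that splits one of the two parts is heavy inside that part. The only other
cut separates the parts from each other, and its weight is the sum in `hsum`. -/
theorem System.Stable.union {A B C : Config G} (hA : Γ.Stable A) (hB : Γ.Stable B)
    (hC : C.IsUnion A B) (hdis : Disjoint A.dom B.dom)
    (hsum : Γ.temp ≤ ∑ p ∈ A.dom, ∑ q ∈ B.dom, Γ.bond C p q) : Γ.Stable C := by
  have hdom := hC.dom
  have bA : ∀ p ∈ A.dom, ∀ q ∈ A.dom, Γ.bond C p q = Γ.bond A p q := fun p hp q hq =>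
    System.bond_congr' (hC.left hp) (hC.left hq)
  have bB : ∀ p ∈ B.dom, ∀ q ∈ B.dom, Γ.bond C p q = Γ.bond B p q := fun p hp q hq =>
    System.bond_congr' (hC.symm.left hp) (hC.symm.left hq)
  have mA : ∀ p q, Relation.ReflTransGen (fun x y => 0 < Γ.bond A x y) p q →
      Relation.ReflTransGen (fun x y => 0 < Γ.bond C x y) p q := fun p q =>
    rtg_map (fun z => z) fun a b hab => by
      obtain ⟨h1, h2⟩ := System.bond_pos_mem hab
      rwa [bA a h1 b h2]
  have mB : ∀ p q, Relation.ReflTransGen (fun x y => 0 < Γ.bond B x y) p q →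
      Relation.ReflTransGen (fun x y => 0 < Γ.bond C x y) p q := fun p q =>
    rtg_map (fun z => z) fun a b hab => by
      obtain ⟨h1, h2⟩ := System.bond_pos_mem hab
      rwa [bB a h1 b h2]
  obtain ⟨p, hp, q, hq, hpq⟩ : ∃ p ∈ A.dom, ∃ q ∈ B.dom, 0 < Γ.bond C p q := by
    by_contra hcon
    push Not at hcon
    have : ∑ p ∈ A.dom, ∑ q ∈ B.dom, Γ.bond C p q = 0 :=
      Finset.sum_eq_zero fun p hp => Finset.sum_eq_zero fun q hq => by
        have := hcon p hp q hq; omega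
    have := Γ.temp_pos
    omega
  refine ⟨System.conn_iff.1 (System.Conn.of_center (p := p) (by rw [hdom]; simp [hp])
    fun r hr => ?_), fun S hS hne hSne => ?_⟩
  · rw [hdom, Finset.mem_union] at hr
    rcases hr with hr | hr
    · exact mA _ _ (hA.conn.2 p hp r hr)
    · exact (mB _ _ (hB.conn.2 q hq r hr)).head hpq
  · have part : ∀ (X : Config G), Γ.Stable X → X.dom ⊆ C.dom →
        (∀ p ∈ X.dom, ∀ q ∈ X.dom, Γ.bond C p q = Γ.bond X p q) →
        (S ∩ X.dom).Nonempty → ¬ X.dom ⊆ S →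
        Γ.temp ≤ ∑ p ∈ S, ∑ q ∈ C.dom \ S, Γ.bond C p q := by
      intro X hX hXC hb h1 h2
      refine (hX.2 (S ∩ X.dom) Finset.inter_subset_right h1 fun h => h2 ?_).trans ?_
      · rw [← h]; exact Finset.inter_subset_left
      · calc ∑ p ∈ S ∩ X.dom, ∑ q ∈ X.dom \ (S ∩ X.dom), Γ.bond X p q
            = ∑ p ∈ S ∩ X.dom, ∑ q ∈ X.dom \ (S ∩ X.dom), Γ.bond C p q := by
              refine Finset.sum_congr rfl fun p hp => Finset.sum_congr rfl fun q hq => ?_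
              rw [hb p (Finset.mem_inter.1 hp).2 q (Finset.mem_sdiff.1 hq).1]
          _ ≤ ∑ p ∈ S ∩ X.dom, ∑ q ∈ C.dom \ S, Γ.bond C p q := by
              refine Finset.sum_le_sum fun p hp => Finset.sum_le_sum_of_subset fun q hq => ?_
              obtain ⟨h3, h4⟩ := Finset.mem_sdiff.1 hq
              exact Finset.mem_sdiff.2 ⟨hXC h3, fun h5 => h4 (Finset.mem_inter.2 ⟨h5, h3⟩)⟩
          _ ≤ _ := Finset.sum_le_sum_of_subset Finset.inter_subset_left
    have hAC : A.dom ⊆ C.dom := by rw [hdom]; exact Finset.subset_union_left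
    have hBC : B.dom ⊆ C.dom := by rw [hdom]; exact Finset.subset_union_right
    by_cases h1 : (S ∩ A.dom).Nonempty ∧ ¬ A.dom ⊆ S
    · exact part A hA hAC bA h1.1 h1.2
    by_cases h2 : (S ∩ B.dom).Nonempty ∧ ¬ B.dom ⊆ S
    · exact part B hB hBC bB h2.1 h2.2
    have c1 : S ∩ A.dom = ∅ ∨ A.dom ⊆ S := by
      by_contra hcon
      push Not at hcon
      exact h1 hcon
    have c2 : S ∩ B.dom = ∅ ∨ B.dom ⊆ S := by
      by_contra hcon
      push Not at hcon
      exact h2 hcon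
    rcases c1 with c1 | c1 <;> rcases c2 with c2 | c2
    · exfalso
      obtain ⟨x, hx⟩ := hne
      have := hS hx
      rw [hdom, Finset.mem_union] at this
      rcases this with h | h
      · exact Finset.notMem_empty x (c1 ▸ Finset.mem_inter.2 ⟨hx, h⟩)
      · exact Finset.notMem_empty x (c2 ▸ Finset.mem_inter.2 ⟨hx, h⟩)
    · have e1 : S = B.dom := by
        refine Finset.Subset.antisymm (fun x hx => ?_) c2
        have := hS hx
        rw [hdom, Finset.mem_union] at this
        exact this.resolve_left fun h =>
          Finset.notMem_empty x (c1 ▸ Finset.mem_inter.2 ⟨hx, h⟩)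
      have e2 : C.dom \ S = A.dom := by
        rw [hdom, e1]; exact Finset.union_sdiff_cancel_right hdis
      rw [e2, e1, Finset.sum_comm]
      refine hsum.trans (le_of_eq (Finset.sum_congr rfl fun p _ => Finset.sum_congr rfl
        fun q _ => Γ.bond_comm _ _ _))
    · have e1 : S = A.dom := by
        refine Finset.Subset.antisymm (fun x hx => ?_) c1
        have := hS hx
        rw [hdom, Finset.mem_union] at this
        exact this.resolve_right fun h =>
          Finset.notMem_empty x (c2 ▸ Finset.mem_inter.2 ⟨hx, h⟩)
      have e2 : C.dom \ S = B.dom := by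
        rw [hdom, e1]; exact Finset.union_sdiff_cancel_left hdis
      rw [e2, e1]; exact hsum
    · exact absurd (Finset.Subset.antisymm hS (by rw [hdom]; exact Finset.union_subset c1 c2)) hSne

end TwoHAM

namespace TwoHAM

variable {G : Type} {Γ : System G}

/-! ## Embeddings and producible configurations -/

/-- The translation of `b` by `u` is a part of `a`. -/
def Config.Emb (b a : Config G) (u : ℤ × ℤ) : Prop :=
  ∀ p t, b.tile p = some t → a.tile (p + u) = some t

theorem Config.isSubassembly_iff {b a : Config G} :
    b.assembly.IsSubassembly a.assembly ↔ ∃ u, b.Emb a u := by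
  constructor
  · rintro ⟨b', a', hb, ha, h⟩
    obtain ⟨u, hu⟩ := Config.assembly_eq_iff.1 hb.symm
    obtain ⟨v, hv⟩ := Config.assembly_eq_iff.1 ha
    refine ⟨u + v, fun p t hp => ?_⟩
    rw [← add_assoc, ← hv]
    exact h _ _ (by rw [← hu]; exact hp)
  · rintro ⟨u, hu⟩
    refine ⟨b.shift u, a, b.shift_assembly u, rfl, fun p t hp => ?_⟩
    have := hu (p - u) t hp
    simpa using this

theorem Config.Emb.bond {b a : Config G} {u : ℤ × ℤ} (h : b.Emb a u) {p q : ℤ × ℤ}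
    (hp : p ∈ b.dom) (hq : q ∈ b.dom) : Γ.bond b p q = Γ.bond a (p + u) (q + u) := by
  obtain ⟨s, hs⟩ := Config.exists_tile hp
  obtain ⟨t, ht⟩ := Config.exists_tile hq
  exact System.bond_congr (by rw [hs, h p s hs]) (by rw [ht, h q t ht])

theorem System.Conn.shift {a : Config G} (h : Γ.Conn a) (u : ℤ × ℤ) : Γ.Conn (a.shift u) := by
  obtain ⟨⟨p, hp⟩, h⟩ := h
  refine ⟨⟨p + u, Config.mem_shift_dom.2 (by simpa)⟩, fun x hx y hy => ?_⟩
  have := rtg_map (S := fun x y => 0 < Γ.bond (a.shift u) x y) (fun z => z + u)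
    (fun x y hxy => by simpa [System.bond_shift] using hxy)
    (h _ (Config.mem_shift_dom.1 hx) _ (Config.mem_shift_dom.1 hy))
  simpa using this

theorem System.Stable.shift {a : Config G} (h : Γ.Stable a) (u : ℤ × ℤ) :
    Γ.Stable (a.shift u) := by
  refine ⟨System.conn_iff.1 (h.conn.shift u), fun S hS hne hSne => ?_⟩
  set e : (ℤ × ℤ) ↪ (ℤ × ℤ) := (Equiv.addRight u).toEmbedding with he
  obtain ⟨S', hS', rfl⟩ : ∃ S' ⊆ a.dom, S = S'.map e := by
    refine ⟨S.map (Equiv.addRight (-u)).toEmbedding, fun x hx => ?_, ?_⟩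
    · rw [Finset.mem_map_equiv] at hx
      have := Config.mem_shift_dom.1 (hS hx)
      simpa using this
    · ext x
      rw [he, Finset.mem_map_equiv, Finset.mem_map_equiv]
      simp
  have hdom : (a.shift u).dom = a.dom.map e := rfl
  rw [hdom, ← Finset.map_sdiff, Finset.sum_map]
  simp only [Finset.sum_map]
  refine (h.2 S' hS' (by simpa using hne) fun h => hSne (by rw [h, hdom])).trans (le_of_eq ?_)
  refine Finset.sum_congr rfl fun x _ => Finset.sum_congr rfl fun y _ => ?_
  rw [System.bond_shift]
  simp [he]

/-- Passes from classes of translates to configurations: for a property that is invariant under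
translation, a combination may be taken to be a literal disjoint union. -/
theorem System.Producible.induction (P : Config G → Prop)
    (hshift : ∀ b u, P b → P (b.shift u)) (hsingle : ∀ t ∈ Γ.tiles, P (Config.single t))
    (hcomb : ∀ a b c, Γ.Producible a.assembly → Γ.Producible b.assembly → P a → P b →
      c.IsUnion a b → Disjoint a.dom b.dom → Γ.Stable c → P c) {b : Config G}
    (h : Γ.Producible b.assembly) : P b := by
  have key : ∀ B, Γ.Producible B → ∀ b : Config G, b.assembly = B → P b := by
    intro B hB
    induction hB with
    | tile t ht =>
      intro b hb
      obtain ⟨u, rfl⟩ := Config.eq_shift_of_assembly_eq hb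
      exact hshift _ _ (hsingle t ht)
    | combine A B C hA hB hC ihA ihB =>
      intro b hb
      obtain ⟨a', b', c, rfl, rfl, hc, hu, hdis, hst⟩ := hC
      obtain ⟨u, rfl⟩ := Config.eq_shift_of_assembly_eq (hb.trans hc.symm)
      exact hshift _ _ (hcomb a' b' c hA hB (ihA a' rfl) (ihB b' rfl) hu hdis hst)
  exact key _ h b rfl

theorem System.stable_single (Γ : System G) (t : Tile G) : Γ.Stable (Config.single t) := by
  have h0 : ∀ p, p ∈ (Config.single t).dom ↔ p = 0 := by simp [Config.single]
  have hc : Γ.Conn (Config.single t) := System.Conn.of_center (p := 0) ((h0 0).2 rfl) fun q hq => by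
    rw [(h0 q).1 hq]
  refine hc.stable fun p q h => ?_
  obtain ⟨h1, h2⟩ := System.bond_pos_mem h
  rw [(h0 p).1 h1, (h0 q).1 h2, Γ.bond_self] at h
  omega

theorem System.Producible.stable {b : Config G} (h : Γ.Producible b.assembly) : Γ.Stable b :=
  h.induction (fun b => Γ.Stable b) (fun _ u hb => hb.shift u) (fun t _ => Γ.stable_single t)
    fun _ _ _ _ _ _ _ _ _ h => h

theorem System.Producible.tiles {b : Config G} (h : Γ.Producible b.assembly) :
    ∀ p t, b.tile p = some t → t ∈ Γ.tiles := by
  refine h.induction (fun b => ∀ p t, b.tile p = some t → t ∈ Γ.tiles)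
    (fun b u hb p t => hb _ t) (fun t ht p t' h' => ?_) fun a b c _ _ ha hb hu _ _ p t hc =>
      ((hu p t).1 hc).elim (ha p t) (hb p t)
  simp only [Config.single] at h'
  split_ifs at h'
  rwa [← Option.some.inj h']

theorem System.Producible.union {a b c : Config G} (ha : Γ.Producible a.assembly)
    (hb : Γ.Producible b.assembly) (hu : c.IsUnion a b) (hd : Disjoint a.dom b.dom)
    (hc : Γ.Stable c) : Γ.Producible c.assembly :=
  .combine _ _ _ ha hb ⟨a, b, c, rfl, rfl, rfl, hu, hd, hc⟩

theorem Config.restrict_singleton {a : Config G} {p : ℤ × ℤ} {t : Tile G}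
    (h : a.tile p = some t) : a.restrict {p} = (Config.single t).shift p :=
  Config.ext_tile fun q => by
    simp only [Config.restrict, Config.shift, Config.single, Finset.mem_singleton, sub_eq_zero]
    split_ifs with hq
    · rw [hq, h]
    · rfl

theorem Config.isUnion_insert [DecidableEq (ℤ × ℤ)] (a : Config G) (T : Finset (ℤ × ℤ)) (y : ℤ × ℤ) :
    (a.restrict (insert y T)).IsUnion (a.restrict T) (a.restrict {y}) := by
  intro p t
  simp only [Config.restrict_tile_eq_some, Finset.mem_insert, Finset.mem_singleton]
  tauto

/-- The configuration grows cell by cell, and each new tile is held by a bond that alone reaches the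
temperature. -/
theorem System.Conn.producible {a : Config G} (h : Γ.Conn a) (hs : Γ.Strong a)
    (ht : ∀ p t, a.tile p = some t → t ∈ Γ.tiles) : Γ.Producible a.assembly := by
  obtain ⟨p, hp⟩ := h.1
  have single : ∀ y ∈ a.dom, Γ.Producible (a.restrict {y}).assembly := by
    intro y hy
    obtain ⟨t, hyt⟩ := Config.exists_tile hy
    rw [Config.restrict_singleton hyt, Config.shift_assembly]
    exact .tile t (ht y t hyt)
  have := h.induction (fun T => Γ.Conn (a.restrict T) ∧ Γ.Producible (a.restrict T).assembly) hp
    ⟨System.conn_restrict_singleton hp, single p hp⟩ ?_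
  · rw [Config.restrict_self] at this; exact this.2
  rintro T hT ⟨h1, h2⟩ x hx y hy hyT hxy
  have h3 := System.conn_restrict_insert hT h1 hx hy hxy
  refine ⟨h3, h2.union (single y hy) (a.isUnion_insert T y) ?_ (h3.stable (hs.restrict _))⟩
  rw [Config.restrict_dom hT, Config.restrict_dom (by simpa using hy)]
  simpa using hyT

/-- Cell `y` can be reached from cell `p` if cell `x` is removed. -/
def System.ReachAvoid (Γ : System G) (a : Config G) (x p y : ℤ × ℤ) : Prop :=
  p ≠ x ∧ Relation.ReflTransGen (fun i j => 0 < Γ.bond a i j ∧ j ≠ x) p y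

/-- If a tile can be attached at a cell beside `p`, the part of `a` that remains connected with `p`
if that cell is removed embeds together with the tile. -/
def System.LeafClosed (Γ : System G) (a : Config G) : Prop :=
  ∀ p w s t, a.tile p = some s → (∃ q, a.tile q = some t) → Γ.temp ≤ Γ.link s t w →
    ∃ u, a.tile (p + w + u) = some t ∧ ∀ y, Γ.ReachAvoid a (p + w) p y → a.tile (y + u) = a.tile y

/-- The configuration is embedded tile by tile. A new tile may fail to fit at the current place, but
`LeafClosed` moves the part embedded so far, together with the new tile, to another place in `a`. -/
theorem System.LeafClosed.emb {a c : Config G} (h : Γ.LeafClosed a) (hc : Γ.Conn c)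
    (hs : Γ.Strong c) (ht : ∀ p t, c.tile p = some t → ∃ q, a.tile q = some t) :
    ∃ u, c.Emb a u := by
  obtain ⟨p, hp⟩ := hc.1
  have := hc.induction (fun T => Γ.Conn (c.restrict T) ∧ ∃ u, (c.restrict T).Emb a u) hp
    ⟨System.conn_restrict_singleton hp, ?_⟩ ?_
  · rw [Config.restrict_self] at this; exact this.2
  · obtain ⟨t, hpt⟩ := Config.exists_tile hp
    obtain ⟨q, hq⟩ := ht p t hpt
    refine ⟨q - p, fun x t' hx => ?_⟩
    rw [Config.restrict_tile_eq_some, Finset.mem_singleton] at hx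
    obtain ⟨rfl, hx⟩ := hx
    rw [add_sub_cancel, hq, ← hpt, hx]
  · rintro T hT ⟨h1, u, hu⟩ x hx y hy hyT hxy
    refine ⟨System.conn_restrict_insert hT h1 hx hy hxy, ?_⟩
    obtain ⟨s, hxs⟩ := Config.exists_tile (hT hx)
    obtain ⟨t, hyt⟩ := Config.exists_tile hy
    have hd := Config.restrict_dom hT
    obtain ⟨u', hu1, hu2⟩ := h (x + u) (y - x) s t
      (hu x s (Config.restrict_tile_eq_some.2 ⟨hx, hxs⟩)) (ht y t hyt) (by
        rw [← System.bond_eq_link hxs hyt]; exact hs x y hxy)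
    have hyu : x + u + (y - x) = y + u := by abel
    rw [hyu] at hu1 hu2
    refine ⟨u + u', fun z t' hz => ?_⟩
    rw [Config.restrict_tile_eq_some, Finset.mem_insert] at hz
    rw [← add_assoc]
    obtain ⟨rfl | hzT, hz2⟩ := hz
    · rw [hu1, ← hyt, hz2]
    · rw [hu2]
      · exact hu z t' (Config.restrict_tile_eq_some.2 ⟨hzT, hz2⟩)
      -- The image of T is connected and misses the cell at which the new tile is attached, so it
      -- lies in the part of `a` that the translation preserves.
      · refine ⟨fun he => hyT (by rw [← add_right_cancel he]; exact hx), ?_⟩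
        refine rtg_map (S := fun i j => 0 < Γ.bond a i j ∧ j ≠ y + u) (fun z => z + u) ?_
          (h1.2 x (by rwa [hd]) z (by rwa [hd]))
        intro i j hij
        obtain ⟨m1, m2⟩ := System.bond_pos_mem hij
        refine ⟨by rwa [← hu.bond m1 m2], fun he => hyT ?_⟩
        rw [hd] at m2
        rw [← add_right_cancel he]; exact m2

/-! ## Two copies -/

/-- The bond between cell `x` of a configuration and cell `y` of a second copy that is translated
by `v`. -/
def System.crossBond (Γ : System G) (a : Config G) (v x y : ℤ × ℤ) : ℕ :=
  match a.tile x, a.tile y with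
  | some s, some t => Γ.link s t (y + v - x)
  | _, _ => 0

theorem System.crossBond_eq {a : Config G} {v x y : ℤ × ℤ} {s t : Tile G} (hx : a.tile x = some s)
    (hy : a.tile y = some t) : Γ.crossBond a v x y = Γ.link s t (y + v - x) := by
  simp only [System.crossBond, hx, hy]

/-- Parts of two copies of `a` can be combined, with two bonds or more. -/
def System.Rogue (Γ : System G) (a : Config G) : Prop :=
  ∃ v, ∃ S ⊆ a.dom, ∃ T ⊆ a.dom, Γ.Conn (a.restrict S) ∧ Γ.Conn (a.restrict T) ∧
    (∀ x ∈ S, ∀ y ∈ T, x ≠ y + v) ∧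
    Γ.temp ≤ ∑ x ∈ S, ∑ y ∈ T, Γ.crossBond a v x y ∧
    ∃ x ∈ S, ∃ y ∈ T, ∃ x' ∈ S, ∃ y' ∈ T, ¬ (x = x' ∧ y = y') ∧ 0 < Γ.crossBond a v x y ∧
      0 < Γ.crossBond a v x' y'

theorem Config.Emb.restrict_eq {b a : Config G} {u : ℤ × ℤ} (h : b.Emb a u) :
    a.restrict (b.shift u).dom = b.shift u :=
  Config.ext_tile fun p => by
    by_cases hp : p ∈ (b.shift u).dom
    · rw [Config.restrict_tile hp]
      obtain ⟨t, ht⟩ := Config.exists_tile (Config.mem_shift_dom.1 hp)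
      have := h _ t ht
      rw [sub_add_cancel] at this
      rw [this]; exact ht.symm
    · rw [Config.tile_eq_none hp]
      simp [Config.restrict, hp]

theorem Config.Emb.shift_dom_subset {b a : Config G} {u : ℤ × ℤ} (h : b.Emb a u) :
    (b.shift u).dom ⊆ a.dom := by
  intro p hp
  obtain ⟨t, ht⟩ := Config.exists_tile (Config.mem_shift_dom.1 hp)
  have := h _ t ht
  rw [sub_add_cancel] at this
  exact Config.mem_dom_of_tile this

/-- Two producible parts that embed into `a` are parts of two copies of `a` placed against each
other, so a combination with two bonds or more would be rogue. -/
theorem System.Producible.emb {a : Config G} (hstr : Γ.Strong a)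
    (ht : ∀ t ∈ Γ.tiles, ∃ p, a.tile p = some t) (hleaf : Γ.LeafClosed a) (hrog : ¬ Γ.Rogue a)
    {b : Config G} (h : Γ.Producible b.assembly) : ∃ u, b.Emb a u := by
  refine h.induction (fun b => ∃ u, b.Emb a u) ?_ ?_ ?_
  · rintro b u ⟨v, hv⟩
    refine ⟨v - u, fun p t hp => ?_⟩
    have := hv _ t hp
    rwa [show p + (v - u) = p - u + v by abel]
  · intro t htT
    obtain ⟨p, hp⟩ := ht t htT
    refine ⟨p, fun q t' hq => ?_⟩
    simp only [Config.single] at hq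
    split_ifs at hq with h0
    rw [h0, zero_add, hp, hq]
  · rintro b₁ b₂ c hp1 hp2 ⟨u₁, hu₁⟩ ⟨u₂, hu₂⟩ hu hdis hst
    classical
    have hdom := hu.dom
    have hsum : Γ.temp ≤ ∑ p ∈ b₁.dom, ∑ q ∈ b₂.dom, Γ.bond c p q := by
      have e : c.dom \ b₁.dom = b₂.dom := by
        rw [hdom]; exact Finset.union_sdiff_cancel_left hdis
      rw [← e]
      refine hst.2 _ (by rw [hdom]; exact Finset.subset_union_left) hp1.stable.conn.1 fun h => ?_
      obtain ⟨x, hx⟩ := hp2.stable.conn.1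
      have hx' : x ∈ b₁.dom := by rw [h, hdom]; exact Finset.mem_union_right _ hx
      exact Finset.disjoint_left.1 hdis hx' hx
    have hcb : ∀ x ∈ b₁.dom, ∀ y ∈ b₂.dom,
        Γ.crossBond a (u₁ - u₂) (x + u₁) (y + u₂) = Γ.bond c x y := by
      intro x hx y hy
      obtain ⟨s, hs⟩ := Config.exists_tile hx
      obtain ⟨t, ht⟩ := Config.exists_tile hy
      rw [System.crossBond_eq (hu₁ x s hs) (hu₂ y t ht),
        System.bond_eq_link ((hu x s).2 (Or.inl hs)) ((hu y t).2 (Or.inr ht))]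
      congr 1; abel
    by_cases htwo : ∃ x ∈ b₁.dom, ∃ y ∈ b₂.dom, ∃ x' ∈ b₁.dom, ∃ y' ∈ b₂.dom,
        ¬ (x = x' ∧ y = y') ∧ 0 < Γ.bond c x y ∧ 0 < Γ.bond c x' y'
    · exfalso
      obtain ⟨x, hx, y, hy, x', hx', y', hy', hne, h1, h2⟩ := htwo
      refine hrog ⟨u₁ - u₂, (b₁.shift u₁).dom, hu₁.shift_dom_subset, (b₂.shift u₂).dom,
        hu₂.shift_dom_subset, ?_, ?_, ?_, ?_, ?_⟩
      · rw [hu₁.restrict_eq]; exact hp1.stable.conn.shift _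
      · rw [hu₂.restrict_eq]; exact hp2.stable.conn.shift _
      · rintro x hx y hy rfl
        have h1 := Config.mem_shift_dom.1 hx
        have h2 := Config.mem_shift_dom.1 hy
        rw [show y + (u₁ - u₂) - u₁ = y - u₂ by abel] at h1
        exact Finset.disjoint_left.1 hdis h1 h2
      · refine hsum.trans (le_of_eq ?_)
        simp only [Config.shift, Finset.sum_map, Equiv.coe_toEmbedding, Equiv.coe_addRight]
        exact Finset.sum_congr rfl fun x hx => Finset.sum_congr rfl fun y hy => (hcb x hx y hy).symm
      · refine ⟨x + u₁, Config.mem_shift_dom.2 (by simpa), y + u₂, Config.mem_shift_dom.2 (by simpa),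
          x' + u₁, Config.mem_shift_dom.2 (by simpa), y' + u₂, Config.mem_shift_dom.2 (by simpa),
          by simpa using hne, ?_, ?_⟩
        · rwa [hcb x hx y hy]
        · rwa [hcb x' hx' y' hy']
    -- With at most one bond between the parts, that bond carries the whole cut and so reaches the
    -- temperature; all other bonds are bonds of `a`. The union is therefore connected with strong
    -- bonds.
    · refine hleaf.emb hst.conn ?_ ?_
      · have hcross : ∀ x ∈ b₁.dom, ∀ y ∈ b₂.dom, 0 < Γ.bond c x y → Γ.temp ≤ Γ.bond c x y := by
          intro x hx y hy hxy
          have hz : ∀ x' ∈ b₁.dom, ∀ y' ∈ b₂.dom, ¬ (x = x' ∧ y = y') → Γ.bond c x' y' = 0 := by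
            intro x' hx' y' hy' hne
            by_contra h0
            exact htwo ⟨x, hx, y, hy, x', hx', y', hy', hne, hxy, Nat.pos_of_ne_zero h0⟩
          rw [Finset.sum_eq_single x, Finset.sum_eq_single y] at hsum
          · exact hsum
          · exact fun y' hy' hne => hz x hx y' hy' fun h => hne h.2.symm
          · exact fun h => absurd hy h
          · exact fun x' hx' hne => Finset.sum_eq_zero fun y' hy' =>
              hz x' hx' y' hy' fun h => hne h.1.symm
          · exact fun h => absurd hx h
        intro x y hxy
        obtain ⟨mx, my⟩ := System.bond_pos_mem hxy
        rw [hdom, Finset.mem_union] at mx my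
        rcases mx with mx | mx <;> rcases my with my | my
        · have e : Γ.bond c x y = Γ.bond a (x + u₁) (y + u₁) := by
            rw [← hu₁.bond mx my]; exact System.bond_congr' (hu.left mx) (hu.left my)
          rw [e] at hxy ⊢; exact hstr _ _ hxy
        · exact hcross x mx y my hxy
        · rw [Γ.bond_comm] at hxy ⊢; exact hcross y my x mx hxy
        · have e : Γ.bond c x y = Γ.bond a (x + u₂) (y + u₂) := by
            rw [← hu₂.bond mx my]; exact System.bond_congr' (hu.symm.left mx) (hu.symm.left my)
          rw [e] at hxy ⊢; exact hstr _ _ hxy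
      · exact fun p t hp => ((hu p t).1 hp).elim (fun h => ⟨_, hu₁ p t h⟩) fun h => ⟨_, hu₂ p t h⟩

theorem Config.Emb.card_le {b a : Config G} {u : ℤ × ℤ} (h : b.Emb a u) :
    b.dom.card ≤ a.dom.card := by
  have := Finset.card_le_card h.shift_dom_subset
  simpa [Config.shift] using this

theorem Config.Emb.eq_of_card {b a : Config G} {u : ℤ × ℤ} (h : b.Emb a u)
    (hc : a.dom.card ≤ b.dom.card) : b.assembly = a.assembly := by
  have hd : (b.shift u).dom = a.dom := Finset.eq_of_subset_of_card_le h.shift_dom_subset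
    (by simpa [Config.shift] using hc)
  have := h.restrict_eq
  rw [hd, Config.restrict_self] at this
  rw [this, Config.shift_assembly]

/-- Every producible assembly embeds into `a`. For reasons of size `a` cannot grow any further,
while a part with fewer cells has a bond to a missing cell of `a`, whose single tile can be
attached. -/
theorem System.uniquelyProduces_of {a : Config G} (hconn : Γ.Conn a) (hstr : Γ.Strong a)
    (ht : ∀ t, t ∈ Γ.tiles ↔ ∃ p, a.tile p = some t) (hleaf : Γ.LeafClosed a)
    (hrog : ¬ Γ.Rogue a) : Γ.UniquelyProduces a.assembly := by
  have hemb : ∀ b : Config G, Γ.Producible b.assembly → ∃ u, b.Emb a u := fun b hb =>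
    hb.emb hstr (fun t h => (ht t).1 h) hleaf hrog
  have hprod : Γ.Producible a.assembly := hconn.producible hstr fun p t h => (ht t).2 ⟨p, h⟩
  have hterm : Γ.Terminal a.assembly := by
    refine ⟨hprod, fun B C hB hcomb => ?_⟩
    have hC := System.Producible.combine _ _ _ hprod hB hcomb
    obtain ⟨a', b', c, ha, rfl, rfl, hu, hdis, -⟩ := hcomb
    obtain ⟨u, hu'⟩ := hemb c hC
    have h1 := hu'.card_le
    classical
    rw [Config.IsUnion.dom hu, Finset.card_union_of_disjoint hdis] at h1
    obtain ⟨v, rfl⟩ := Config.eq_shift_of_assembly_eq ha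
    have h2 : 0 < b'.dom.card := Finset.card_pos.2 hB.stable.conn.1
    simp only [Config.shift, Finset.card_map] at h1
    omega
  refine ⟨Set.Subset.antisymm (fun B hB => ?_) (by simpa using hterm), fun B hB => ?_⟩
  · obtain ⟨b, rfl⟩ := Quotient.exists_rep B
    obtain ⟨hB1, hB2⟩ : Γ.Terminal b.assembly := hB
    change b.assembly = a.assembly
    obtain ⟨u, hu⟩ := hemb b hB1
    by_contra hne
    have hlt : ¬ a.dom.card ≤ b.dom.card := fun h => hne (hu.eq_of_card h)
    set S := (b.shift u).dom with hS
    have hScard : S.card = b.dom.card := by simp [hS, Config.shift]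
    have hSa : S ⊆ a.dom := hu.shift_dom_subset
    obtain ⟨p, hp⟩ : S.Nonempty := by
      obtain ⟨p, hp⟩ := hB1.stable.conn.1
      exact ⟨p + u, Config.mem_shift_dom.2 (by simpa)⟩
    obtain ⟨q, hq, hqS⟩ : ∃ q ∈ a.dom, q ∉ S := by
      by_contra hcon
      push Not at hcon
      have := Finset.card_le_card (show a.dom ⊆ S from hcon)
      omega
    obtain ⟨x, y, hx, hy, hxy⟩ := exists_step_of_reflTransGen (S := (· ∈ S))
      (hconn.2 p (hSa hp) q hq) hp hqS
    have hya := (System.bond_pos_mem hxy).2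
    have hSconn : Γ.Conn (a.restrict S) := by
      rw [hS, hu.restrict_eq]; exact hB1.stable.conn.shift u
    have hins := System.conn_restrict_insert hSa hSconn hx hya hxy
    obtain ⟨t, hyt⟩ := Config.exists_tile hya
    refine hB2 (a.restrict {y}).assembly (a.restrict (insert y S)).assembly ?_
      ⟨a.restrict S, a.restrict {y}, a.restrict (insert y S), ?_, rfl, rfl, a.isUnion_insert S y, ?_,
        hins.stable (hstr.restrict _)⟩
    · rw [Config.restrict_singleton hyt, Config.shift_assembly]
      exact .tile t ((ht t).2 ⟨y, hyt⟩)
    · rw [hS, hu.restrict_eq, Config.shift_assembly]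
    · rw [Config.restrict_dom hSa, Config.restrict_dom (by simpa using hya)]
      simpa using hy
  · obtain ⟨b, rfl⟩ := Quotient.exists_rep B
    exact Config.isSubassembly_iff.2 (hemb b hB)

/-! ## Tree-bonded assemblies -/

theorem System.TreeBonded.bridge {a : Config G} (h : Γ.TreeBonded a) {p q : ℤ × ℤ}
    (hpq : 0 < Γ.bond a p q) : ¬ Relation.ReflTransGen
      (fun x y => 0 < Γ.bond a x y ∧ ¬ (x = p ∧ y = q) ∧ ¬ (x = q ∧ y = p)) p q := by
  intro hr
  obtain ⟨hp, hq⟩ := System.bond_pos_mem hpq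
  have hadj : (Γ.bondGraph a).Adj ⟨p, hp⟩ ⟨q, hq⟩ := hpq
  have hb := SimpleGraph.isAcyclic_iff_forall_adj_isBridge.1 h hadj
  rw [SimpleGraph.isBridge_iff] at hb
  refine hb ?_
  have key : ∀ z, Relation.ReflTransGen
      (fun x y => 0 < Γ.bond a x y ∧ ¬ (x = p ∧ y = q) ∧ ¬ (x = q ∧ y = p)) p z →
      ∃ hz : z ∈ a.dom, ((Γ.bondGraph a).deleteEdges {s(⟨p, hp⟩, ⟨q, hq⟩)}).Reachable ⟨p, hp⟩
        ⟨z, hz⟩ := by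
    intro z hz
    induction hz with
    | refl => exact ⟨hp, SimpleGraph.Reachable.refl _⟩
    | tail _ hbc ih =>
      obtain ⟨hb, hr⟩ := ih
      refine ⟨(System.bond_pos_mem hbc.1).2, hr.trans (SimpleGraph.Adj.reachable ?_)⟩
      rw [SimpleGraph.deleteEdges_adj]
      refine ⟨hbc.1, ?_⟩
      simp only [Set.mem_singleton_iff, Sym2.eq_iff, Subtype.mk.injEq]
      tauto
  exact (key q hr).2

/-- Each bond is a bridge, and the cut between the two sides of a bridge has the weight of that one
bond. -/
theorem System.TreeBonded.strong {a : Config G} (h : Γ.TreeBonded a) (hst : Γ.Stable a) :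
    Γ.Strong a := by
  classical
  intro p q hpq
  obtain ⟨hp, hq⟩ := System.bond_pos_mem hpq
  set R := fun x y => 0 < Γ.bond a x y ∧ ¬ (x = p ∧ y = q) ∧ ¬ (x = q ∧ y = p) with hR
  set S := a.dom.filter fun x => Relation.ReflTransGen R p x with hS
  have hpS : p ∈ S := by simp [hS, hp, Relation.ReflTransGen.refl]
  have hqS : q ∉ S := fun h' => h.bridge hpq (Finset.mem_filter.1 h').2
  have hz : ∀ x ∈ S, ∀ y ∈ a.dom \ S, ¬ (x = p ∧ y = q) → Γ.bond a x y = 0 := by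
    intro x hx y hy hne
    by_contra h0
    obtain ⟨hy1, hy2⟩ := Finset.mem_sdiff.1 hy
    refine hy2 (Finset.mem_filter.2 ⟨hy1, (Finset.mem_filter.1 hx).2.tail
      ⟨Nat.pos_of_ne_zero h0, hne, ?_⟩⟩)
    rintro ⟨rfl, rfl⟩
    exact hqS hx
  have := hst.2 S (Finset.filter_subset _ _) ⟨p, hpS⟩ fun h => hqS (h ▸ hq)
  rwa [Finset.sum_eq_single p, Finset.sum_eq_single q] at this
  · exact fun y hy hne => hz p hpS y hy fun h => hne h.2
  · exact fun h => absurd (Finset.mem_sdiff.2 ⟨hq, hqS⟩) h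
  · exact fun x hx hne => Finset.sum_eq_zero fun y hy => hz x hx y hy fun h => hne h.1
  · exact fun h => absurd hpS h

theorem System.UniquelyProduces.emb {a : Config G} (h : Γ.UniquelyProduces a.assembly)
    {b : Config G} (hb : Γ.Producible b.assembly) : ∃ u, b.Emb a u :=
  Config.isSubassembly_iff.1 (h.2 _ hb)

theorem System.UniquelyProduces.producible {a : Config G} (h : Γ.UniquelyProduces a.assembly) :
    Γ.Producible a.assembly := by
  have : a.assembly ∈ {B | Γ.Terminal B} := by rw [h.1]; rfl
  exact this.1

theorem System.UniquelyProduces.mem_tiles_iff {a : Config G} (h : Γ.UniquelyProduces a.assembly)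
    (t : Tile G) : t ∈ Γ.tiles ↔ ∃ p, a.tile p = some t := by
  constructor
  · intro ht
    obtain ⟨u, hu⟩ := h.emb (.tile t ht)
    exact ⟨_, hu 0 t (by simp [Config.single])⟩
  · rintro ⟨p, hp⟩
    exact h.producible.tiles p t hp

theorem System.link_zero (s t : Tile G) : Γ.link s t 0 = 0 := by
  simp [System.link, Prod.ext_iff]

/-- The cells reached from p form a connected part of `a`, which is producible, and the tile
attaches to it by a single bond of sufficient strength. The result is producible, so it embeds; the
embedding is the required translation. -/
theorem System.UniquelyProduces.leafClosed {a : Config G} (h : Γ.UniquelyProduces a.assembly)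
    (hstr : Γ.Strong a) : Γ.LeafClosed a := by
  classical
  intro p w s t hs ht hlink
  have hw : w ≠ 0 := by
    rintro rfl
    rw [System.link_zero] at hlink
    have := Γ.temp_pos; omega
  have hpw : p ≠ p + w := fun he => hw (by simpa using he)
  set D := a.dom.filter fun y => Γ.ReachAvoid a (p + w) p y with hD
  have hDa : D ⊆ a.dom := Finset.filter_subset _ _
  have hpD : p ∈ D := by
    simp [hD, Config.mem_dom_of_tile hs, System.ReachAvoid, hw, Relation.ReflTransGen.refl]
  have hdom := Config.restrict_dom hDa
  have hconn : Γ.Conn (a.restrict D) := by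
    refine System.Conn.of_center (p := p) (by rwa [hdom]) fun q hq => ?_
    rw [hdom] at hq
    obtain ⟨-, -, hr⟩ := Finset.mem_filter.1 hq
    clear hq
    have : Relation.ReflTransGen (fun x y => 0 < Γ.bond (a.restrict D) x y) p q ∧ q ∈ D := by
      induction hr with
      | refl => exact ⟨.refl, hpD⟩
      | @tail b c hb hbc ih =>
        have hcD : c ∈ D := Finset.mem_filter.2 ⟨(System.bond_pos_mem hbc.1).2, hpw, hb.tail hbc⟩
        refine ⟨ih.1.tail ?_, hcD⟩
        rw [System.bond_restrict ih.2 hcD]; exact hbc.1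
    exact this.1
  have hDp : Γ.Producible (a.restrict D).assembly := hconn.producible (hstr.restrict _)
    fun x t' hx => (h.mem_tiles_iff t').2 ⟨x, (Config.restrict_tile_eq_some.1 hx).2⟩
  have hSp : Γ.Producible ((Config.single t).shift (p + w)).assembly := by
    rw [Config.shift_assembly]; exact .tile t ((h.mem_tiles_iff t).2 ht)
  have hSdom : ∀ x, x ∈ ((Config.single t).shift (p + w)).dom ↔ x = p + w := fun x => by
    rw [Config.mem_shift_dom]; simp [Config.single, sub_eq_zero]
  have hdis : Disjoint (a.restrict D).dom ((Config.single t).shift (p + w)).dom := by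
    rw [Finset.disjoint_left]
    intro x hx hx'
    rw [hdom] at hx
    rw [hSdom] at hx'
    obtain ⟨-, -, hr⟩ := Finset.mem_filter.1 hx
    rcases Relation.ReflTransGen.cases_tail hr with h | ⟨y, -, hy⟩
    · exact hpw (h.symm.trans hx')
    · exact hy.2 hx'
  have hu := Config.isUnion_union hdis
  set c := (a.restrict D).union ((Config.single t).shift (p + w)) with hc
  have hct : c.tile (p + w) = some t := (hu _ _).2 (Or.inr (by simp [Config.shift, Config.single]))
  have hcD : ∀ x ∈ D, c.tile x = a.tile x := fun x hx => by
    rw [hu.left (by rwa [hdom]), Config.restrict_tile hx]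
  have hst : Γ.Stable c := by
    refine hDp.stable.union hSp.stable hu hdis ?_
    calc Γ.temp ≤ Γ.bond c p (p + w) := by
          rw [System.bond_eq_link ((hcD p hpD).trans hs) hct, add_sub_cancel_left]; exact hlink
      _ ≤ ∑ q ∈ ((Config.single t).shift (p + w)).dom, Γ.bond c p q :=
        Finset.single_le_sum (f := fun q => Γ.bond c p q) (fun _ _ => Nat.zero_le _)
          ((hSdom _).2 rfl)
      _ ≤ _ := Finset.single_le_sum
          (f := fun x => ∑ q ∈ ((Config.single t).shift (p + w)).dom, Γ.bond c x q)
          (fun _ _ => Nat.zero_le _) (by rwa [hdom])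
  obtain ⟨u, hemb⟩ := h.emb (hDp.union hSp hu hdis hst)
  refine ⟨u, hemb _ _ hct, fun y hy => ?_⟩
  have hya : y ∈ a.dom := by
    rcases Relation.ReflTransGen.cases_tail hy.2 with h | ⟨z, -, hz⟩
    · rw [h]; exact Config.mem_dom_of_tile hs
    · exact (System.bond_pos_mem hz.1).2
  obtain ⟨t', ht'⟩ := Config.exists_tile hya
  rw [ht']
  exact hemb y t' ((hcD y (Finset.mem_filter.2 ⟨hya, hy⟩)).trans ht')

/-- The union of the two parts would be producible and hence embed into `a`, but its two bonds,
joined through the connected parts, close a cycle. -/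
theorem System.UniquelyProduces.not_rogue {a : Config G} (h : Γ.UniquelyProduces a.assembly)
    (htree : Γ.TreeBonded a) (hstr : Γ.Strong a) : ¬ Γ.Rogue a := by
  rintro ⟨v, S, hS, T, hT, hSc, hTc, hdisj, hsum, x, hx, y, hy, x', hx', y', hy', hne, h1, h2⟩
  have part : ∀ U ⊆ a.dom, Γ.Conn (a.restrict U) → Γ.Producible (a.restrict U).assembly :=
    fun U hU hc => hc.producible (hstr.restrict _)
      fun x t' hx => (h.mem_tiles_iff t').2 ⟨x, (Config.restrict_tile_eq_some.1 hx).2⟩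
  have hSp := part S hS hSc
  have hTp : Γ.Producible ((a.restrict T).shift v).assembly := by
    rw [Config.shift_assembly]; exact part T hT hTc
  have dS := Config.restrict_dom hS
  have dT : ∀ z, z ∈ ((a.restrict T).shift v).dom ↔ z - v ∈ T := fun z => by
    rw [Config.mem_shift_dom, Config.restrict_dom hT]
  have hdis : Disjoint (a.restrict S).dom ((a.restrict T).shift v).dom := by
    rw [Finset.disjoint_left]
    intro z hz hz'
    rw [dS] at hz
    rw [dT] at hz'
    exact hdisj z hz _ hz' (by simp)
  have hu := Config.isUnion_union hdis
  set c := (a.restrict S).union ((a.restrict T).shift v) with hc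
  have cb : ∀ x ∈ S, ∀ y ∈ T, Γ.bond c x (y + v) = Γ.crossBond a v x y := by
    intro x hx y hy
    obtain ⟨s, hs⟩ := Config.exists_tile (hS hx)
    obtain ⟨t, ht⟩ := Config.exists_tile (hT hy)
    rw [System.crossBond_eq hs ht]
    refine System.bond_eq_link ((hu _ _).2 (Or.inl (Config.restrict_tile_eq_some.2 ⟨hx, hs⟩)))
      ((hu _ _).2 (Or.inr ?_))
    simp only [Config.shift, add_sub_cancel_right]
    exact Config.restrict_tile_eq_some.2 ⟨hy, ht⟩
  have hst : Γ.Stable c := by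
    refine hSp.stable.union hTp.stable hu hdis (hsum.trans (le_of_eq ?_))
    rw [dS]
    have hTdom : ((a.restrict T).shift v).dom = T.map (Equiv.addRight v).toEmbedding := by
      ext z; rw [dT, Finset.mem_map_equiv]; simp [sub_eq_add_neg]
    rw [hTdom]
    simp only [Finset.sum_map, Equiv.coe_toEmbedding, Equiv.coe_addRight]
    exact Finset.sum_congr rfl fun x hx => Finset.sum_congr rfl fun y hy => (cb x hx y hy).symm
  obtain ⟨u, hemb⟩ := h.emb (hSp.union hTp hu hdis hst)
  have hb1 : 0 < Γ.bond c x (y + v) := by rwa [cb x hx y hy]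
  have hb2 : 0 < Γ.bond c x' (y' + v) := by rwa [cb x' hx' y' hy']
  obtain ⟨m1, m2⟩ := System.bond_pos_mem hb1
  have hmap : ∀ {i j}, 0 < Γ.bond c i j → 0 < Γ.bond a (i + u) (j + u) := fun hij => by
    obtain ⟨k1, k2⟩ := System.bond_pos_mem hij
    rwa [← hemb.bond k1 k2]
  -- The detour around the first bond: through the first part, across the second bond, and back
  -- through the second part.
  refine htree.bridge (hmap hb1) ?_
  have yS : ∀ z ∈ S, z ≠ y + v := fun z hz => hdisj z hz y hy
  have xT : ∀ z, z - v ∈ T → z ≠ x := fun z hz he => hdisj x hx _ hz (by simp [he])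
  set R := fun i j => 0 < Γ.bond a i j ∧ ¬ (i = x + u ∧ j = y + v + u) ∧
    ¬ (i = y + v + u ∧ j = x + u) with hR
  have p1 : Relation.ReflTransGen R (x + u) (x' + u) := by
    refine rtg_map (S := R) (fun z => z + u) (fun i j hij => ?_) (hSc.2 x (by rwa [dS]) x' (by rwa [dS]))
    obtain ⟨k1, k2, k3⟩ := System.bond_restrict_pos hij
    have e : Γ.bond c i j = Γ.bond a i j := by
      rw [← System.bond_restrict (A := a) k1 k2]
      exact System.bond_congr' (hu.left (by rwa [dS])) (hu.left (by rwa [dS]))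
    refine ⟨hmap (by rwa [e]), fun h => ?_, fun h => ?_⟩
    · exact yS j k2 (add_right_cancel h.2)
    · exact yS i k1 (add_right_cancel h.1)
  have p2 : R (x' + u) (y' + v + u) := by
    refine ⟨hmap hb2, fun h => hne ?_, fun h => ?_⟩
    · exact ⟨(add_right_cancel h.1).symm, (add_right_cancel (add_right_cancel h.2)).symm⟩
    · exact yS x' hx' (add_right_cancel h.1)
  have p3 : Relation.ReflTransGen R (y' + v + u) (y + v + u) := by
    have hTc' := hTc.shift v
    refine rtg_map (S := R) (fun z => z + u) (fun i j hij => ?_)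
      (hTc'.2 (y' + v) ((dT _).2 (by simpa)) (y + v) ((dT _).2 (by simpa)))
    obtain ⟨k1, k2⟩ := System.bond_pos_mem hij
    have e : Γ.bond c i j = Γ.bond ((a.restrict T).shift v) i j :=
      System.bond_congr' (hu.symm.left k1) (hu.symm.left k2)
    refine ⟨hmap (by rwa [e]), fun h => ?_, fun h => ?_⟩
    · exact xT i ((dT i).1 k1) (add_right_cancel h.1)
    · exact xT j ((dT j).1 k2) (add_right_cancel h.2)
  exact (p1.tail p2).trans p3

/-- Acyclicity enters only from left to right: it makes the bonds strong and excludes rogue pairs.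
The right side speaks about cells and parts of `a` alone, which is what makes it decidable in
polynomial time. -/
theorem System.uniquelyProduces_iff {a : Config G} (htree : Γ.TreeBonded a) :
    Γ.UniquelyProduces a.assembly ↔ Γ.Conn a ∧ Γ.Strong a ∧
      (∀ t, t ∈ Γ.tiles ↔ ∃ p, a.tile p = some t) ∧ Γ.LeafClosed a ∧ ¬ Γ.Rogue a := by
  constructor
  · intro h
    have hst := h.producible.stable
    have hstr := htree.strong hst
    exact ⟨hst.conn, hstr, h.mem_tiles_iff, h.leafClosed hstr, h.not_rogue htree hstr⟩
  · rintro ⟨h1, h2, h3, h4, h5⟩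
    exact System.uniquelyProduces_of h1 h2 h3 h4 h5

end TwoHAM

/-! ### Numerical data as models of a system and a configuration -/

namespace TwoHAM

variable {G : Type} {Γ : System G}

/-- The glue of a tile at the side `d`: north, east, south, west. -/
def Tile.glue (t : Tile G) (d : ℕ) : G :=
  if d = 0 then t.north else if d = 1 then t.east else if d = 2 then t.south else t.west

theorem Tile.ext_glue {s t : Tile G} (h : ∀ d < 4, s.glue d = t.glue d) : s = t := by
  have h0 := h 0 (by norm_num)
  have h1 := h 1 (by norm_num)
  have h2 := h 2 (by norm_num)
  have h3 := h 3 (by norm_num)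
  simp [Tile.glue] at h0 h1 h2 h3
  exact Tile.ext h0 h1 h2 h3

end TwoHAM

namespace WordRAM.TreeUAV

open TwoHAM

/-- The displacement from a cell to its neighbour at side `d`. -/
def dirZ (d : ℕ) : ℤ × ℤ := ((dx d : ℤ) - 1, (dy d : ℤ) - 1)

theorem link_dirZ {G : Type} (Γ : System G) (s t : Tile G) {d : ℕ} (hd : d < 4) :
    Γ.link s t (dirZ d) = Γ.str (s.glue d) (t.glue (opp d)) := by
  interval_cases d <;> simp [System.link, dirZ, dx, dy, opp, Tile.glue]

theorem exists_dirZ_of_link {G : Type} {Γ : System G} {s t : Tile G} {w : ℤ × ℤ}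
    (h : 0 < Γ.link s t w) : ∃ d < 4, w = dirZ d := by
  unfold System.link at h
  split_ifs at h with h1 h2 h3 h4
  · exact ⟨1, by norm_num, by simp [h1, dirZ, dx, dy]⟩
  · exact ⟨3, by norm_num, by simp [h2, dirZ, dx, dy]⟩
  · exact ⟨0, by norm_num, by simp [h3, dirZ, dx, dy]⟩
  · exact ⟨2, by norm_num, by simp [h4, dirZ, dx, dy]⟩
  · exact absurd h (lt_irrefl _)

theorem dirZ_ne_zero {d : ℕ} (hd : d < 4) : dirZ d ≠ 0 := by
  interval_cases d <;> simp [dirZ, dx, dy]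

theorem dirZ_inj {d e : ℕ} (hd : d < 4) (he : e < 4) (h : dirZ d = dirZ e) : d = e := by
  interval_cases d <;> interval_cases e <;> simp [dirZ, dx, dy] at h ⊢

def Inst.cell (D : Inst) (i : ℕ) : ℤ × ℤ := (D.cx i, D.cy i)

/-- The numerical data `D` describe the system `Γ` and the configuration `a`; the cells carry the
tiles `t`. -/
structure Model {m : ℕ} (Γ : System (Fin m)) (a : Config (Fin m)) (D : Inst)
    (t : ℕ → Tile (Fin m)) : Prop where
  tile : ∀ i < D.n, a.tile (D.cell i) = some (t i)
  surj : ∀ p ∈ a.dom, ∃ i < D.n, D.cell i = p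
  inj : D.Inj
  gl : ∀ i < D.n, ∀ d < 4, D.gl i d = (t i).glue d
  st : ∀ g h : Fin m, D.st g h = Γ.str g h
  -- A cut strength may differ from the true one only if both reach the temperature; comparisons of
  -- sums with the temperature do not notice the difference.
  wc : ∀ g h : Fin m, D.wc g h = Γ.str g h ∨ (Γ.temp ≤ D.wc g h ∧ Γ.temp ≤ Γ.str g h)
  temp : D.temp = Γ.temp
  tiles : ∀ t ∈ Γ.tiles, ∃ k < D.T, ∀ d < 4, D.tg k d = t.glue d
  tg : ∀ k < D.T, ∃ t ∈ Γ.tiles, ∀ d < 4, D.tg k d = t.glue d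

variable {m : ℕ} {Γ : System (Fin m)} {a : Config (Fin m)} {D : Inst} {t : ℕ → Tile (Fin m)}

namespace Model

theorem mem (h : Model Γ a D t) {i : ℕ} (hi : i < D.n) : D.cell i ∈ a.dom :=
  Config.mem_dom_of_tile (h.tile i hi)

theorem cell_inj (h : Model Γ a D t) {i j : ℕ} (hi : i < D.n) (hj : j < D.n)
    (e : D.cell i = D.cell j) : i = j := by
  simp only [Inst.cell, Prod.mk.injEq, Nat.cast_inj] at e
  exact h.inj i hi j hj e.1 e.2

theorem cell_eq_iff (h : Model Γ a D t) {i j : ℕ} (hi : i < D.n) (hj : j < D.n) :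
    D.cell i = D.cell j ↔ i = j :=
  ⟨h.cell_inj hi hj, fun e => e ▸ rfl⟩

theorem exists_cell (h : Model Γ a D t) {p : ℤ × ℤ} {s : Tile (Fin m)} (hp : a.tile p = some s) :
    ∃ i < D.n, D.cell i = p ∧ t i = s := by
  obtain ⟨i, hi, rfl⟩ := h.surj p (Config.mem_dom_of_tile hp)
  exact ⟨i, hi, rfl, Option.some_inj.1 ((h.tile i hi).symm.trans hp)⟩

theorem S_eq (h : Model Γ a D t) {i d j : ℕ} (hi : i < D.n) (hd : d < 4) (hj : j < D.n) :
    D.S i d j = Γ.link (t i) (t j) (dirZ d) := by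
  rw [link_dirZ _ _ _ hd, Inst.S, h.gl i hi d hd, h.gl j hj _ (opp_lt hd), h.st]

theorem W_cases (h : Model Γ a D t) {i d j : ℕ} (hi : i < D.n) (hd : d < 4) (hj : j < D.n) :
    D.W i d j = D.S i d j ∨ (D.temp ≤ D.W i d j ∧ D.temp ≤ D.S i d j) := by
  rw [Inst.S, Inst.W, h.gl i hi d hd, h.gl j hj _ (opp_lt hd), h.st, h.temp]
  exact h.wc _ _

theorem le_W_iff (h : Model Γ a D t) {i d j : ℕ} (hi : i < D.n) (hd : d < 4) (hj : j < D.n) :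
    D.temp ≤ D.W i d j ↔ D.temp ≤ D.S i d j := by
  rcases h.W_cases hi hd hj with e | ⟨h1, h2⟩
  · rw [e]
  · exact iff_of_true h1 h2

theorem _root_.WordRAM.TreeUAV.next_iff {D : Inst} {i d j : ℕ} :
    D.next i d j ↔ D.cell j = D.cell i + dirZ d := by
  simp only [Inst.next, Inst.cell, dirZ, Prod.mk_add_mk, Prod.mk.injEq]
  constructor <;> rintro ⟨h1, h2⟩ <;> constructor <;> omega

theorem same_iff (h : Model Γ a D t) {i j : ℕ} (hi : i < D.n) (hj : j < D.n) :
    D.same i j ↔ t i = t j := by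
  constructor
  · intro e
    refine Tile.ext_glue fun d hd => ?_
    have := e d hd
    rw [h.gl i hi d hd, h.gl j hj d hd] at this
    exact Fin.ext this
  · intro e d hd
    rw [h.gl i hi d hd, h.gl j hj d hd, e]

theorem bond_eq (h : Model Γ a D t) {i j : ℕ} (hi : i < D.n) (hj : j < D.n) :
    Γ.bond a (D.cell i) (D.cell j) = Γ.link (t i) (t j) (D.cell j - D.cell i) :=
  System.bond_eq_link (h.tile i hi) (h.tile j hj)

theorem bond_next (h : Model Γ a D t) {i d j : ℕ} (hi : i < D.n) (hj : j < D.n) (hd : d < 4)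
    (hn : D.next i d j) : Γ.bond a (D.cell i) (D.cell j) = D.S i d j := by
  rw [h.bond_eq hi hj, h.S_eq hi hd hj, next_iff.1 hn, add_sub_cancel_left]

theorem E_iff (h : Model Γ a D t) {i j : ℕ} (hi : i < D.n) (hj : j < D.n) :
    D.E i j ↔ 0 < Γ.bond a (D.cell i) (D.cell j) := by
  constructor
  · rintro ⟨d, hd, hn, hS⟩
    rwa [h.bond_next hi hj hd hn]
  · intro hb
    have hb' := hb
    rw [h.bond_eq hi hj] at hb'
    obtain ⟨d, hd, hw⟩ := exists_dirZ_of_link hb'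
    have hn : D.next i d j := next_iff.2 (by rw [← hw]; ring)
    exact ⟨d, hd, hn, by rwa [h.bond_next hi hj hd hn] at hb⟩

theorem rtg_iff (h : Model Γ a D t) {P : ℤ × ℤ → Prop} {Q : ℕ → Prop}
    (hPQ : ∀ j < D.n, Q j ↔ P (D.cell j)) {p y : ℕ} (hp : p < D.n) (hy : y < D.n) :
    Relation.ReflTransGen (fun i j => i < D.n ∧ j < D.n ∧ D.E i j ∧ Q j) p y ↔
      Relation.ReflTransGen (fun i j => 0 < Γ.bond a i j ∧ P j) (D.cell p) (D.cell y) := by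
  constructor
  · intro hr
    refine rtg_map D.cell (fun i j hij => ?_) hr
    exact ⟨(h.E_iff hij.1 hij.2.1).1 hij.2.2.1, (hPQ j hij.2.1).1 hij.2.2.2⟩
  · intro hr
    have key : ∀ z, Relation.ReflTransGen (fun i j => 0 < Γ.bond a i j ∧ P j) (D.cell p) z →
        ∀ k < D.n, D.cell k = z →
        Relation.ReflTransGen (fun i j => i < D.n ∧ j < D.n ∧ D.E i j ∧ Q j) p k := by
      intro z hz
      induction hz with
      | refl =>
        intro k hk e
        rw [h.cell_inj hk hp e]
      | tail _ hbc ih =>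
        intro k hk e
        obtain ⟨l, hl, e'⟩ := h.surj _ (System.bond_pos_mem hbc.1).1
        refine (ih l hl e').tail ⟨hl, hk, ?_, ?_⟩
        · rw [h.E_iff hl hk, e, e']; exact hbc.1
        · rw [hPQ k hk, e]; exact hbc.2
    exact key _ hr y hy rfl

theorem reach_iff (h : Model Γ a D t) {x p y : ℕ} (hx : x < D.n) (hp : p < D.n) (hy : y < D.n) :
    D.Reach x p y ↔ Γ.ReachAvoid a (D.cell x) (D.cell p) (D.cell y) := by
  unfold Inst.Reach System.ReachAvoid
  rw [Ne, Ne, h.cell_eq_iff hp hx]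
  refine and_congr_right fun _ => ?_
  exact h.rtg_iff (P := fun z => z ≠ D.cell x) (Q := fun j => j ≠ x)
    (fun j hj => by rw [Ne, Ne, h.cell_eq_iff hj hx]) hp hy

theorem reach_n_iff (h : Model Γ a D t) {p y : ℕ} (hp : p < D.n) (hy : y < D.n) :
    D.Reach D.n p y ↔
      Relation.ReflTransGen (fun i j => 0 < Γ.bond a i j) (D.cell p) (D.cell y) := by
  unfold Inst.Reach
  have := h.rtg_iff (P := fun _ => True) (Q := fun j => j ≠ D.n)
    (fun j hj => by simp; omega) hp hy
  rw [this]
  simp only [and_true, ne_eq, and_iff_right_iff_imp]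
  intro _; omega

theorem conn_iff (h : Model Γ a D t) (hn : 0 < D.n) :
    (∀ y < D.n, D.Reach D.n 0 y) ↔ Γ.Conn a := by
  constructor
  · intro hr
    refine System.Conn.of_center (h.mem hn) fun y hy => ?_
    obtain ⟨i, hi, rfl⟩ := h.surj y hy
    exact (h.reach_n_iff hn hi).1 (hr i hi)
  · intro hc y hy
    exact (h.reach_n_iff hn hy).2 (hc.2 _ (h.mem hn) _ (h.mem hy))

theorem strong_iff (h : Model Γ a D t) :
    (∀ i < D.n, ∀ d < 4, ∀ j < D.n, D.next i d j → 0 < D.S i d j → D.temp ≤ D.W i d j) ↔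
      Γ.Strong a := by
  constructor
  · intro hs p q hb
    obtain ⟨hp, hq⟩ := System.bond_pos_mem hb
    obtain ⟨i, hi, rfl⟩ := h.surj p hp
    obtain ⟨j, hj, rfl⟩ := h.surj q hq
    obtain ⟨d, hd, hn, hS⟩ := (h.E_iff hi hj).2 hb
    have := (h.le_W_iff hi hd hj).1 (hs i hi d hd j hj hn hS)
    rwa [h.bond_next hi hj hd hn, ← h.temp]
  · intro hs i hi d hd j hj hn hS
    rw [h.le_W_iff hi hd hj, ← h.bond_next hi hj hd hn, h.temp]
    exact hs _ _ (by rwa [h.bond_next hi hj hd hn])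

theorem tiles_iff (h : Model Γ a D t) :
    D.Tiles ↔ ∀ s, s ∈ Γ.tiles ↔ ∃ p, a.tile p = some s := by
  constructor
  · rintro ⟨h1, h2⟩ s
    constructor
    · intro hs
      obtain ⟨k, hk, e⟩ := h.tiles s hs
      obtain ⟨j, hj, e'⟩ := h1 k hk
      refine ⟨D.cell j, ?_⟩
      rw [h.tile j hj, Option.some_inj]
      refine Tile.ext_glue fun d hd => Fin.ext ?_
      rw [← h.gl j hj d hd, ← e' d hd, e d hd]
    · rintro ⟨p, hp⟩
      obtain ⟨j, hj, rfl, rfl⟩ := h.exists_cell hp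
      obtain ⟨k, hk, e⟩ := h2 j hj
      obtain ⟨s, hs, e'⟩ := h.tg k hk
      have : t j = s := Tile.ext_glue fun d hd => Fin.ext (by
        rw [← h.gl j hj d hd, ← e d hd, e' d hd])
      rwa [this]
  · intro hs
    constructor
    · intro k hk
      obtain ⟨s, hs', e⟩ := h.tg k hk
      obtain ⟨p, hp⟩ := (hs s).1 hs'
      obtain ⟨j, hj, rfl, rfl⟩ := h.exists_cell hp
      exact ⟨j, hj, fun d hd => by rw [e d hd, h.gl j hj d hd]⟩
    · intro j hj
      obtain ⟨k, hk, e⟩ := h.tiles (t j) ((hs _).2 ⟨_, h.tile j hj⟩)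
      exact ⟨k, hk, fun d hd => by rw [e d hd, h.gl j hj d hd]⟩

/-- The translation and the cell p' determine each other: p is never removed, so its image must be a
cell of `a` with the same tile. -/
theorem leaf_iff (h : Model Γ a D t) (hc : Γ.Conn a) :
    (∀ p < D.n, ∀ d < 4, ∀ q < D.n, 0 < D.S p d q → D.temp ≤ D.W p d q → D.Leaf ⟨p, d, q⟩) ↔
      Γ.LeafClosed a := by
  have sub : ∀ {x y u v : ℕ}, (D.cx x + D.cx y = D.cx u + D.cx v ∧
      D.cy x + D.cy y = D.cy u + D.cy v) ↔ D.cell x = D.cell u + (D.cell v - D.cell y) := by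
    intro x y u v
    simp only [Inst.cell, Prod.mk_sub_mk, Prod.mk_add_mk, Prod.mk.injEq]
    constructor <;> rintro ⟨h1, h2⟩ <;> constructor <;> omega
  constructor
  · intro hL p w s t' hp ⟨q, hq⟩ hle
    obtain ⟨i, hi, rfl, rfl⟩ := h.exists_cell hp
    obtain ⟨j, hj, rfl, rfl⟩ := h.exists_cell hq
    have hpos : 0 < Γ.link (t i) (t j) w := lt_of_lt_of_le Γ.temp_pos hle
    obtain ⟨d, hd, rfl⟩ := exists_dirZ_of_link hpos
    rw [← h.S_eq hi hd hj] at hpos hle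
    rw [← h.temp] at hle
    obtain ⟨p', hp', ⟨z, hz, hnz, hzq⟩, hall⟩ :=
      hL i hi d hd j hj hpos ((h.le_W_iff hi hd hj).2 hle)
    refine ⟨D.cell p' - D.cell i, ?_, ?_⟩
    · have : D.cell i + dirZ d + (D.cell p' - D.cell i) = D.cell z := by
        rw [next_iff.1 hnz]; ring
      rw [this, h.tile z hz, (h.same_iff hz hj).1 hzq]
    · intro y hy
      have hyd : y ∈ a.dom := by
        rcases Relation.ReflTransGen.cases_tail hy.2 with e | ⟨b, _, hb⟩
        · rw [e]; exact h.mem hi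
        · exact (System.bond_pos_mem hb.1).2
      obtain ⟨k, hk, rfl⟩ := h.surj y hyd
      rcases hall k hk with ⟨x, hx, hnx, hr⟩ | ⟨z', hz', e, hs⟩
      · exact absurd ((h.reach_iff hx hi hk).2 (by rwa [next_iff.1 hnx])) hr
      · rw [← sub.1 e, h.tile z' hz', h.tile k hk, (h.same_iff hz' hk).1 hs]
  · intro hL p hp d hd q hq hpos hle
    rw [h.le_W_iff hp hd hq, h.S_eq hp hd hq, h.temp] at hle
    obtain ⟨u, hu, hall⟩ := hL _ _ _ _ (h.tile p hp) ⟨_, h.tile q hq⟩ hle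
    have hpp := hall (D.cell p) ⟨by simpa using dirZ_ne_zero hd, .refl⟩
    rw [h.tile p hp] at hpp
    obtain ⟨p', hp', e, _⟩ := h.exists_cell hpp
    have hu' : u = D.cell p' - D.cell p := by rw [e]; ring
    refine ⟨p', hp', ?_, ?_⟩
    · obtain ⟨z, hz, e', e''⟩ := h.exists_cell hu
      exact ⟨z, hz, next_iff.2 (by rw [e', e]; ring), (h.same_iff hz hq).2 e''⟩
    · intro y hy
      by_cases hra : Γ.ReachAvoid a (D.cell p + dirZ d) (D.cell p) (D.cell y)
      · right
        have := hall _ hra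
        rw [h.tile y hy] at this
        obtain ⟨z, hz, e', e''⟩ := h.exists_cell this
        exact ⟨z, hz, sub.2 (by rw [e', hu']), (h.same_iff hz hy).2 e''⟩
      · left
        -- Were this cell empty, its removal would change nothing, and by connectivity every cell
        -- would be reached. So a cell y that is not reached is cut off by an actual cell x.
        have hd' : D.cell p + dirZ d ∈ a.dom := by
          by_contra hnd
          refine hra ⟨by simpa using dirZ_ne_zero hd, ?_⟩
          refine rtg_map id (fun x z hxz => ⟨hxz, ?_⟩) (hc.2 _ (h.mem hp) _ (h.mem hy))
          rintro rfl
          exact hnd (System.bond_pos_mem hxz).2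
        obtain ⟨x, hx, e'⟩ := h.surj _ hd'
        refine ⟨x, hx, next_iff.2 e', ?_⟩
        rw [h.reach_iff hx hp hy, e']
        exact hra

end Model

end WordRAM.TreeUAV

/-! ### Paths in the bond tree -/

namespace TwoHAM

open Planar

variable {G : Type} {Γ : System G} {a : Config G}

/-- If the new first vertex already occurs on the path, the loop up to that occurrence is cut off.
-/
theorem exists_chain_of_rtg {α : Type*} {R : α → α → Prop} {x r : α}
    (h : Relation.ReflTransGen R x r) :
    ∃ t, (x :: t).getLast? = some r ∧ (x :: t).IsChain R ∧ (x :: t).Nodup := by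
  classical
  induction h using Relation.ReflTransGen.head_induction_on with
  | refl => exact ⟨[], by simp, by simp, by simp⟩
  | @head x z hxz _ ih =>
    obtain ⟨t, h1, h2, h3⟩ := ih
    by_cases hx : x ∈ z :: t
    · obtain ⟨u, s, hs⟩ := List.append_of_mem hx
      refine ⟨s, ?_, ?_, ?_⟩
      · rw [hs] at h1; simpa using h1
      · rw [hs] at h2; exact (List.isChain_append.1 h2).2.1
      · rw [hs] at h3; exact (List.nodup_append.1 h3).2.1
    · refine ⟨z :: t, by simpa using h1, ?_, List.nodup_cons.2 ⟨hx, h3⟩⟩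
      rw [List.isChain_cons_cons]
      exact ⟨hxz, h2⟩

theorem rtg_of_chain {α : Type*} {R : α → α → Prop} {P : α → Prop} {x z : α} {l : List α}
    (h : (x :: l).IsChain R) (hP : ∀ y ∈ x :: l, P y) (hz : z ∈ x :: l) :
    Relation.ReflTransGen (fun i j => R i j ∧ P i ∧ P j) x z := by
  induction l generalizing x with
  | nil => rw [List.mem_singleton.1 hz]
  | cons y l ih =>
    rw [List.isChain_cons_cons] at h
    rcases List.mem_cons.1 hz with rfl | hz
    · exact .refl
    · exact .head ⟨h.1, hP _ (by simp), hP _ (by simp)⟩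
        (ih h.2 (fun y hy => hP y (List.mem_cons_of_mem _ hy)) hz)

theorem rtg_symm {α : Type*} {R : α → α → Prop} (hR : ∀ i j, R i j → R j i) {x y : α}
    (h : Relation.ReflTransGen R x y) : Relation.ReflTransGen R y x := by
  induction h with
  | refl => exact .refl
  | tail _ hbc ih => exact .head (hR _ _ hbc) ih

/-- `l` is a path from `x` to `r` in the bond graph. -/
structure System.BondPath (Γ : System G) (a : Config G) (r x : ℤ × ℤ) (l : List (ℤ × ℤ)) :
    Prop where
  head : ∃ t, l = x :: t
  last : l.getLast? = some r
  chain : l.IsChain fun i j => 0 < Γ.bond a i j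
  nodup : l.Nodup

/-- If two paths left x through different bonds, both would go on to r without returning to x.
Together they bypass the first bond, which is a bridge. -/
theorem System.BondPath.unique (htree : Γ.TreeBonded a) {r x : ℤ × ℤ} {l l' : List (ℤ × ℤ)}
    (h : Γ.BondPath a r x l) (h' : Γ.BondPath a r x l') : l = l' := by
  obtain ⟨t, rfl⟩ := h.head
  obtain ⟨t', rfl⟩ := h'.head
  have nil_of : ∀ {t : List (ℤ × ℤ)} {x}, (x :: t).getLast? = some x → (x :: t).Nodup →
      t = [] := by
    intro t x h1 h2
    cases t with
    | nil => rfl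
    | cons y t =>
      rw [List.getLast?_cons_cons] at h1
      exact absurd (List.mem_of_getLast? h1) (List.nodup_cons.1 h2).1
  induction t generalizing x t' with
  | nil =>
    have hr := h.last
    simp only [List.getLast?_singleton, Option.some_inj] at hr
    subst hr
    rw [nil_of h'.last h'.nodup]
  | cons y t ih =>
    cases t' with
    | nil =>
      have hr := h'.last
      simp only [List.getLast?_singleton, Option.some_inj] at hr
      subst hr
      exact absurd (nil_of h.last h.nodup) (by simp)
    | cons y' t' =>
      have c := h.chain
      have c' := h'.chain
      have nd := List.nodup_cons.1 h.nodup
      have nd' := List.nodup_cons.1 h'.nodup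
      rw [List.isChain_cons_cons] at c c'
      have l1 := h.last
      have l2 := h'.last
      rw [List.getLast?_cons_cons] at l1 l2
      have hyy : y = y' := by
        by_contra hne
        have symm : ∀ i j, (0 < Γ.bond a i j ∧ i ≠ x ∧ j ≠ x) → 0 < Γ.bond a j i ∧ j ≠ x ∧ i ≠ x :=
          fun i j hij => ⟨by rw [Γ.bond_comm]; exact hij.1, hij.2.2, hij.2.1⟩
        have r1 := rtg_of_chain (P := fun z => z ≠ x) c.2
          (fun z hz e => nd.1 (e ▸ hz)) (List.mem_of_getLast? l1)
        have r2 := rtg_symm symm (rtg_of_chain (P := fun z => z ≠ x) c'.2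
          (fun z hz e => nd'.1 (e ▸ hz)) (List.mem_of_getLast? l2))
        have hyx : 0 < Γ.bond a y x := by rw [Γ.bond_comm]; exact c.1
        refine htree.bridge hyx (Relation.ReflTransGen.tail (rtg_map id ?_ (r1.trans r2))
          (b := y') ⟨by rw [Γ.bond_comm]; exact c'.1, fun e => hne e.1.symm, fun e => ?_⟩)
        · intro i j hij
          exact ⟨hij.1, fun e => hij.2.2 e.2, fun e => hij.2.1 e.1⟩
        · exact nd'.1 (by simp [e.1])
      subst hyy
      rw [ih ⟨⟨_, rfl⟩, l1, c.2, nd.2⟩ _ ⟨⟨_, rfl⟩, l2, c'.2, nd'.2⟩]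

theorem System.BondPath.suffix {r x z : ℤ × ℤ} {u s : List (ℤ × ℤ)}
    (h : Γ.BondPath a r x (u ++ z :: s)) : Γ.BondPath a r z (z :: s) where
  head := ⟨s, rfl⟩
  last := by have := h.last; simpa using this
  chain := (List.isChain_append.1 h.chain).2.1
  nodup := (List.nodup_append.1 h.nodup).2.1

theorem System.nb_of_bond {p q : ℤ × ℤ} (h : 0 < Γ.bond a p q) : Nb p q := by
  obtain ⟨hp, hq⟩ := System.bond_pos_mem h
  obtain ⟨s, hs⟩ := Config.exists_tile hp
  obtain ⟨t, ht⟩ := Config.exists_tile hq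
  unfold System.bond at h
  rw [hs, ht] at h
  simp only at h
  unfold Nb
  obtain ⟨p1, p2⟩ := p
  obtain ⟨q1, q2⟩ := q
  simp only [Prod.mk_add_mk, Prod.mk.injEq] at h ⊢
  split_ifs at h <;> omega

open Classical in
/-- The path from `x` to `r` in the bond graph. -/
noncomputable def System.treePath (Γ : System G) (a : Config G) (r x : ℤ × ℤ) : List (ℤ × ℤ) :=
  if h : ∃ l, Γ.BondPath a r x l then h.choose else []

theorem System.BondPath.eq_treePath (htree : Γ.TreeBonded a) {r x : ℤ × ℤ} {l : List (ℤ × ℤ)}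
    (h : Γ.BondPath a r x l) : l = Γ.treePath a r x := by
  have h' : ∃ l, Γ.BondPath a r x l := ⟨l, h⟩
  rw [System.treePath, dif_pos h']
  exact h.unique htree h'.choose_spec

theorem System.Conn.bondPath (hc : Γ.Conn a) {r x : ℤ × ℤ} (hr : r ∈ a.dom) (hx : x ∈ a.dom) :
    Γ.BondPath a r x (Γ.treePath a r x) := by
  have h' : ∃ l, Γ.BondPath a r x l := by
    obtain ⟨t, h1, h2, h3⟩ := exists_chain_of_rtg (hc.2 x hx r hr)
    exact ⟨_, ⟨t, rfl⟩, h1, h2, h3⟩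
  rw [System.treePath, dif_pos h']
  exact h'.choose_spec

theorem System.treePath_suffix (htree : Γ.TreeBonded a) (hc : Γ.Conn a) {r x z : ℤ × ℤ}
    (hr : r ∈ a.dom) (hx : x ∈ a.dom) (hz : z ∈ Γ.treePath a r x) :
    Γ.treePath a r z <:+ Γ.treePath a r x := by
  have h := hc.bondPath hr hx
  obtain ⟨u, s, hs⟩ := List.append_of_mem hz
  rw [hs] at h ⊢
  rw [← h.suffix.eq_treePath htree]
  exact List.suffix_append _ _

/-- A connected part contains some path between its cells, and by uniqueness this is the path in the
tree. Hence the paths to the cells used by the bonds form the smallest possible parts. -/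
theorem System.treePath_subset (htree : Γ.TreeBonded a) {S : Finset (ℤ × ℤ)}
    (hS : Γ.Conn (a.restrict S)) (hSa : S ⊆ a.dom) {r x : ℤ × ℤ} (hr : r ∈ S) (hx : x ∈ S) :
    ∀ z ∈ Γ.treePath a r x, z ∈ S := by
  rw [← Config.restrict_dom hSa] at hr hx
  obtain ⟨t, h1, h2, h3⟩ := exists_chain_of_rtg (hS.2 x hx r hr)
  have hb : Γ.BondPath a r x (x :: t) := ⟨⟨t, rfl⟩, h1, h2.imp fun i j hij =>
    (System.bond_restrict_pos hij).2.2, h3⟩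
  rw [← hb.eq_treePath htree]
  intro z hz
  have h4 := rtg_of_chain (P := fun _ => True) h2 (by simp) hz
  rw [Config.restrict_dom hSa] at hx
  rcases Relation.ReflTransGen.cases_tail h4 with e | ⟨w, _, hw⟩
  · rwa [e]
  · exact (System.bond_restrict_pos hw.1).2.1

theorem System.mem_dom_of_mem_treePath (htree : Γ.TreeBonded a) (hc : Γ.Conn a) {r x z : ℤ × ℤ}
    (hr : r ∈ a.dom) (hx : x ∈ a.dom) (hz : z ∈ Γ.treePath a r x) : z ∈ a.dom :=
  System.treePath_subset htree (S := a.dom) (by rwa [Config.restrict_self]) (subset_refl _) hr hx z hz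

/-- A cell lies on the unique path exactly if every connection passes through it. The program can
thus test membership in paths with its reachability table and never has to store a path. -/
theorem System.mem_treePath_iff (htree : Γ.TreeBonded a) (hc : Γ.Conn a) {r x z : ℤ × ℤ}
    (hr : r ∈ a.dom) (hx : x ∈ a.dom) : z ∈ Γ.treePath a r x ↔ ¬ Γ.ReachAvoid a z r x := by
  have h := hc.bondPath hr hx
  constructor
  · rintro hz ⟨hne, hra⟩
    have hra' := rtg_symm (R := fun i j => 0 < Γ.bond a i j ∧ i ≠ z ∧ j ≠ z)
      (fun i j hij => ⟨by rw [Γ.bond_comm]; exact hij.1, hij.2.2, hij.2.1⟩)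
      (x := r) (y := x) (by
        clear hz h hx
        induction hra with
        | refl => exact .refl
        | @tail b c hb hbc ih =>
          refine ih.tail ⟨hbc.1, ?_, hbc.2⟩
          rcases Relation.ReflTransGen.cases_tail hb with e | ⟨w, _, hw⟩
          · rwa [e]
          · exact hw.2)
    obtain ⟨t, h1, h2, h3⟩ := exists_chain_of_rtg hra'
    have hb : Γ.BondPath a r x (x :: t) := ⟨⟨t, rfl⟩, h1, h2.imp fun i j hij => hij.1, h3⟩
    rw [← hb.eq_treePath htree] at hz
    have h4 := rtg_symm (R := fun i j => 0 < Γ.bond a i j ∧ i ≠ z ∧ j ≠ z)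
      (fun i j hij => ⟨by rw [Γ.bond_comm]; exact hij.1, hij.2.2, hij.2.1⟩)
      (rtg_map id (S := fun i j => 0 < Γ.bond a i j ∧ i ≠ z ∧ j ≠ z)
      (fun i j hij => hij.1) (rtg_of_chain (P := fun _ => True) h2 (by simp) hz))
    simp only [id] at h4
    rcases Relation.ReflTransGen.cases_head h4 with e | ⟨w, hw, _⟩
    · subst e
      rcases Relation.ReflTransGen.cases_tail hra with e | ⟨w, _, hw⟩
      · exact hne e.symm
      · exact hw.2 rfl
    · exact hw.2.1 rfl
  · intro hna
    by_contra hz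
    refine hna ⟨fun e => hz (e ▸ List.mem_of_getLast? h.last), ?_⟩
    obtain ⟨t, ht⟩ := h.head
    have hl := h.last
    have hch := h.chain
    rw [ht] at hz hl hch
    refine rtg_map id ?_ (rtg_symm (fun i j hij => ⟨?_, hij.2.2, hij.2.1⟩)
      (rtg_of_chain (P := fun y => y ≠ z) hch (fun y hy e => hz (e ▸ hy))
        (List.mem_of_getLast? hl)))
    · exact fun i j hij => ⟨hij.1, hij.2.2⟩
    · rw [Γ.bond_comm]; exact hij.1

theorem System.pathSys_treePath (htree : Γ.TreeBonded a) (hc : Γ.Conn a) {r : ℤ × ℤ}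
    (hr : r ∈ a.dom) : PathSys r {x | x ∈ a.dom} (Γ.treePath a r) where
  head _ hx := (hc.bondPath hr hx).head
  last _ hx := (hc.bondPath hr hx).last
  chain _ hx := (hc.bondPath hr hx).chain.imp fun _ _ => System.nb_of_bond
  nodup _ hx := (hc.bondPath hr hx).nodup
  suffix _ hx _ hz := ⟨System.mem_dom_of_mem_treePath htree hc hr hx hz,
    System.treePath_suffix htree hc hr hx hz⟩

open Classical in
/-- A sum over the edges of a path, in terms of the vertical bonds between its cells. -/
theorem System.BondPath.pairSum_eq (htree : Γ.TreeBonded a) {r x : ℤ × ℤ} {l : List (ℤ × ℤ)}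
    (h : Γ.BondPath a r x l) {w : ℤ × ℤ → ℤ × ℤ → ZMod 2} (hsymm : ∀ x y, w x y = w y x)
    (hw : ∀ x y, x.1 ≠ y.1 → w x y = 0) :
    pairSum w l = ∑ c ∈ a.dom, if c ∈ l ∧ c + (0, 1) ∈ l ∧ 0 < Γ.bond a c (c + (0, 1)) then
      w c (c + (0, 1)) else 0 := by
  obtain ⟨t, rfl⟩ := h.head
  have hne : ∀ c : ℤ × ℤ, c + (0, 1) ≠ c := fun c e => by simp at e
  induction t generalizing x with
  | nil =>
    rw [pairSum, eq_comm]
    refine Finset.sum_eq_zero fun c _ => if_neg ?_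
    rintro ⟨h1, h2, _⟩
    rw [List.mem_singleton] at h1 h2
    exact hne c (h2.trans h1.symm)
  | cons y t ih =>
    have hch := h.chain
    rw [List.isChain_cons_cons] at hch
    obtain ⟨hx, hnd⟩ := List.nodup_cons.1 h.nodup
    have hl := h.last
    rw [List.getLast?_cons_cons] at hl
    have hyt : Γ.BondPath a r y (y :: t) := ⟨⟨t, rfl⟩, hl, hch.2, hnd⟩
    -- A bond from x to a later cell of the path would be a shortcut, hence a second path to the
    -- root. So bonded cells of a path are consecutive, and its edges are recovered from its set of
    -- cells.
    have snd : ∀ z ∈ y :: t, 0 < Γ.bond a x z → z = y := by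
      intro z hz hb
      obtain ⟨u, s, hs⟩ := List.append_of_mem hz
      have hz' := hyt
      rw [hs] at hz'
      have : Γ.BondPath a r x (x :: z :: s) := ⟨⟨_, rfl⟩, by
        rw [List.getLast?_cons_cons]; exact hz'.suffix.last, by
        rw [List.isChain_cons_cons]; exact ⟨hb, hz'.suffix.chain⟩, List.nodup_cons.2
        ⟨fun hm => hx (by rw [hs]; exact List.mem_append_right _ hm), hz'.suffix.nodup⟩⟩
      have e := this.unique htree h
      simp only [List.cons.injEq, true_and] at e
      exact e.1
    rw [pairSum, ih hyt]
    have hxd := (System.bond_pos_mem hch.1).1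
    have hyd := (System.bond_pos_mem hch.1).2
    have key : ∀ c ∈ a.dom, (if c ∈ x :: y :: t ∧ c + (0, 1) ∈ x :: y :: t ∧
        0 < Γ.bond a c (c + (0, 1)) then w c (c + (0, 1)) else 0) =
        (if c = x then (if y = x + (0, 1) then w x y else 0) else 0) +
        (if c = y then (if x = y + (0, 1) then w x y else 0) else 0) +
        (if c ∈ y :: t ∧ c + (0, 1) ∈ y :: t ∧ 0 < Γ.bond a c (c + (0, 1)) then
          w c (c + (0, 1)) else 0) := by
      intro c _
      by_cases hcx : c = x
      · subst hcx
        have hcy : c ≠ y := fun e => hx (by simp [e])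
        rw [if_neg (fun hh : c ∈ y :: t ∧ _ => hx hh.1), if_pos rfl, if_neg hcy, add_zero, add_zero]
        by_cases hyc : y = c + (0, 1)
        · rw [if_pos hyc, if_pos ⟨by simp, by simp [hyc], hyc ▸ hch.1⟩, hyc]
        · rw [if_neg hyc, if_neg]
          rintro ⟨-, h2, h3⟩
          rcases List.mem_cons.1 h2 with h2 | h2
          · exact hne c h2
          · exact hyc (snd _ h2 h3).symm
      · by_cases hcx' : c + (0, 1) = x
        · rw [if_neg (fun hh : c ∈ y :: t ∧ _ => hx (by rw [← hcx']; exact hh.2.1)), if_neg hcx]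
          by_cases hcy : c = y
          · subst hcy
            have hb : 0 < Γ.bond a c (c + (0, 1)) := by rw [hcx', Γ.bond_comm]; exact hch.1
            rw [if_pos rfl, if_pos hcx'.symm, if_pos ⟨by simp, by simp [hcx'], hb⟩, hcx', hsymm,
              zero_add, add_zero]
          · rw [if_neg hcy, if_neg]
            · ring
            · rintro ⟨h1, -, h3⟩
              rcases List.mem_cons.1 h1 with h1 | h1
              · exact hcx h1
              · refine hcy (snd _ h1 ?_)
                rw [← hcx', Γ.bond_comm]; exact h3
        · have e1 : c ∈ x :: y :: t ↔ c ∈ y :: t := by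
            rw [List.mem_cons]; exact or_iff_right hcx
          have e2 : c + (0, 1) ∈ x :: y :: t ↔ c + (0, 1) ∈ y :: t := by
            rw [List.mem_cons]; exact or_iff_right hcx'
          simp only [if_neg hcx, e1, e2]
          by_cases hcy : c = y
          · subst hcy
            rw [if_pos rfl, if_neg (fun e : x = c + (0, 1) => hcx' e.symm), add_zero, zero_add]
          · rw [if_neg hcy, add_zero, zero_add]
    rw [Finset.sum_congr rfl key, Finset.sum_add_distrib, Finset.sum_add_distrib,
      Finset.sum_ite_eq' a.dom x (fun _ => if y = x + (0, 1) then w x y else 0),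
      Finset.sum_ite_eq' a.dom y (fun _ => if x = y + (0, 1) then w x y else 0),
      if_pos hxd, if_pos hyd]
    congr 1
    have hnb := System.nb_of_bond hch.1
    by_cases h1 : x.1 = y.1
    · have hxy : y = x + (0, 1) ∨ x = y + (0, 1) := by
        obtain ⟨x1, x2⟩ := x
        obtain ⟨y1, y2⟩ := y
        simp only [Nb, Prod.mk_add_mk, Prod.mk.injEq] at hnb h1 ⊢
        omega
      rcases hxy with e | e
      · have e' : x ≠ y + (0, 1) := fun e' => by
          rw [e'] at e; simp [add_assoc] at e
        rw [if_pos e, if_neg e', add_zero]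
      · have e' : y ≠ x + (0, 1) := fun e' => by
          rw [e] at e'; simp [add_assoc] at e'
        rw [if_neg e', if_pos e, zero_add]
    · rw [hw x y h1]; simp

end TwoHAM

/-! ### Translation of path sums and path systems -/

namespace Planar

theorem pairSum_map (w : Cell → Cell → ZMod 2) (e : Cell → Cell) (l : List Cell) :
    pairSum w (l.map e) = pairSum (fun x y => w (e x) (e y)) l := by
  induction l with
  | nil => rfl
  | cons x l ih =>
    cases l with
    | nil => rfl
    | cons y l =>
      simp only [List.map_cons, pairSum] at ih ⊢
      rw [ih]

theorem pairSum_add_apply (w w' : Cell → Cell → ZMod 2) (l : List Cell) :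
    pairSum w l + pairSum w' l = pairSum (fun x y => w x y + w' x y) l :=
  pairSum_add (R := fun _ _ => True) (fun _ _ _ => rfl) l
    (by induction l with
        | nil => simp
        | cons x l ih => cases l <;> simp_all)

theorem PathSys.translate {root : Cell} {S : Set Cell} {L : Cell → List Cell}
    (h : PathSys root S L) (o : Cell) :
    PathSys (root + o) {x | x - o ∈ S} (fun x => (L (x - o)).map (· + o)) where
  head _ hx := by
    obtain ⟨t, ht⟩ := h.head _ hx
    exact ⟨t.map (· + o), by simp [ht]⟩
  last _ hx := by
    rw [List.getLast?_map, h.last _ hx]; rfl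
  chain _ hx := by
    rw [List.isChain_map]
    refine (h.chain _ hx).imp fun y z hyz => ?_
    simp only [Nb, Prod.fst_add, Prod.snd_add] at hyz ⊢
    omega
  nodup _ hx := (h.nodup _ hx).map (add_left_injective o)
  suffix _ hx z hz := by
    obtain ⟨y, hy, rfl⟩ := List.mem_map.1 hz
    obtain ⟨h1, h2⟩ := h.suffix _ hx y hy
    simp only [add_sub_cancel_right, Set.mem_ofPred_eq]
    exact ⟨h1, h2.map _⟩

end Planar

/-! ### The two copies as trees in the plane -/

namespace WordRAM.TreeUAV

open TwoHAM Planar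

open Classical in
/-- A proposition as a bit. -/
noncomputable def par (P : Prop) : ZMod 2 := if P then 1 else 0

theorem par_xor (P Q : Prop) : par (¬ (P ↔ Q)) = par P + par Q := by
  unfold par
  by_cases hP : P <;> by_cases hQ : Q <;> simp [hP, hQ]; decide

theorem par_eq_zero {P : Prop} : par P = 0 ↔ ¬ P := by
  unfold par
  by_cases hP : P <;> simp [hP]

theorem par_odd_sum (n : ℕ) (P : ℕ → Prop) :
    par (Odd (∑ y ∈ Finset.range n, ind01 (P y))) = ∑ y ∈ Finset.range n, par (P y) := by
  have h : ∀ N : ℕ, par (Odd N) = (N : ZMod 2) := by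
    intro N
    unfold par
    split_ifs with hN
    · exact (ZMod.natCast_eq_one_iff_odd.2 hN).symm
    · exact ((ZMod.natCast_eq_zero_iff_even).2 (Nat.not_odd_iff_even.1 hN)).symm
  rw [h, Nat.cast_sum]
  refine Finset.sum_congr rfl fun y _ => ?_
  unfold par ind01
  split_ifs <;> simp

theorem faceOf_dirZ (P : Cell) {e : ℕ} (he : e < 4) :
    faceOf P (P + dirZ e) = (P.1 - (if e = 3 then 1 else 0), P.2 - (if e = 2 then 1 else 0)) := by
  interval_cases e <;> simp [faceOf, dirZ, dx, dy, sub_eq_add_neg]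

theorem nb_dirZ (P : Cell) {e : ℕ} (he : e < 4) : Nb P (P + dirZ e) := by
  interval_cases e <;> simp [Nb, dirZ, dx, dy]

variable {m : ℕ} {Γ : System (Fin m)} {a : Config (Fin m)} {D : Inst} {t : ℕ → Tile (Fin m)}

/-- The positions of the cells of the two copies. -/
def Inst.pos₁ (D : Inst) (R : Root) (i : ℕ) : Cell := (D.ax R i, D.ay R i)
def Inst.pos₂ (D : Inst) (R : Root) (j : ℕ) : Cell := (D.bx R j, D.by' R j)

/-- Each copy is moved by the position of the root cell of the other copy. This puts the root cells
side by side without subtractions, and the extra (1, 1) leaves room for the decrements in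
displacements and faces. -/
def Inst.off₁ (D : Inst) (R : Root) : Cell := D.cell R.q + (1, 1)
def Inst.off₂ (D : Inst) (R : Root) : Cell := D.cell R.p + dirZ R.d + (1, 1)

theorem Inst.pos₁_eq (D : Inst) (R : Root) (i : ℕ) : D.pos₁ R i = D.cell i + D.off₁ R := by
  simp only [Inst.pos₁, Inst.off₁, Inst.ax, Inst.ay, Inst.cell, Prod.mk_add_mk, Prod.mk.injEq]
  constructor <;> push_cast <;> ring

theorem Inst.pos₂_eq (D : Inst) (R : Root) (i : ℕ) : D.pos₂ R i = D.cell i + D.off₂ R := by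
  simp only [Inst.pos₂, Inst.off₂, Inst.bx, Inst.by', Inst.cell, dirZ, Prod.mk_add_mk,
    Prod.mk.injEq]
  constructor <;> push_cast <;> ring

theorem Inst.pos₂_q (D : Inst) (R : Root) : D.pos₂ R R.q = D.pos₁ R R.p + dirZ R.d := by
  rw [Inst.pos₁_eq, Inst.pos₂_eq, Inst.off₁, Inst.off₂]; ring

/-- The edge at a slot. -/
noncomputable def Inst.edge (D : Inst) (R : Root) (f : ℕ) : Cell × Cell :=
  (D.pos₁ R (f / 4), D.pos₂ R (D.nbr R f))

theorem Inst.meets_coord_iff {D : Inst} {R : Root} {f j : ℕ} :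
    (D.bx R j + 1 = D.ax R (f / 4) + dx (f % 4) ∧ D.by' R j + 1 = D.ay R (f / 4) + dy (f % 4)) ↔
      D.pos₂ R j = D.pos₁ R (f / 4) + dirZ (f % 4) := by
  simp only [Inst.pos₁, Inst.pos₂, dirZ, Prod.mk_add_mk, Prod.mk.injEq]
  constructor <;> rintro ⟨h1, h2⟩ <;> constructor <;> omega

theorem Inst.ov_iff {D : Inst} {R : Root} {x y : ℕ} : D.Ov R x y ↔ D.pos₂ R y = D.pos₁ R x := by
  simp only [Inst.Ov, Inst.pos₁, Inst.pos₂, Prod.mk.injEq, Nat.cast_inj]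

/-- The truncated subtractions are exact, because the coordinates of the first copy are at least 1.
-/
theorem Inst.face_eq {D : Inst} {R : Root} (f : ℕ) :
    faceOf (D.pos₁ R (f / 4)) (D.pos₁ R (f / 4) + dirZ (f % 4)) =
      ((D.fx R f : ℤ), (D.fy R f : ℤ)) := by
  rw [faceOf_dirZ _ (Nat.mod_lt _ (by norm_num))]
  simp only [Inst.pos₁, Inst.fx, Inst.fy, Inst.ax, Inst.ay, Prod.mk.injEq]
  constructor <;> split_ifs <;> push_cast <;> omega

theorem Inst.root_div {R : Root} (hd : R.d < 4) : Inst.root R / 4 = R.p := by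
  unfold Inst.root; omega

theorem Inst.root_mod {R : Root} (hd : R.d < 4) : Inst.root R % 4 = R.d := by
  unfold Inst.root; omega

/-- The path trees of the two copies. -/
noncomputable def Inst.trees (D : Inst) (R : Root) (htree : Γ.TreeBonded a) (hc : Γ.Conn a)
    (hp : D.cell R.p ∈ a.dom) (hq : D.cell R.q ∈ a.dom) (hd : R.d < 4) : Trees where
  p₀ := D.cell R.p + D.off₁ R
  q₀ := D.cell R.q + D.off₂ R
  S := {x | x - D.off₁ R ∈ {x | x ∈ a.dom}}
  T := {x | x - D.off₂ R ∈ {x | x ∈ a.dom}}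
  L x := (Γ.treePath a (D.cell R.p) (x - D.off₁ R)).map (· + D.off₁ R)
  M x := (Γ.treePath a (D.cell R.q) (x - D.off₂ R)).map (· + D.off₂ R)
  hL := (System.pathSys_treePath htree hc hp).translate _
  hM := (System.pathSys_treePath htree hc hq).translate _
  nb := by
    rw [← Inst.pos₁_eq, ← Inst.pos₂_eq, Inst.pos₂_q]
    exact nb_dirZ _ hd

namespace Model

-- By `BondPath.pairSum_eq` only the vertical bonds of the path contribute, and each is counted at
-- its lower cell; the conditions are those in the sums of `Odd1` and `Odd2`.
open Classical in
theorem pairSum_treePath (h : Model Γ a D t) (htree : Γ.TreeBonded a) (hc : Γ.Conn a) {r i : ℕ}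
    (hr : r < D.n) (hi : i < D.n) (o : Cell) {w : Cell → Cell → ZMod 2}
    (hsymm : ∀ x y, w x y = w y x) (hw : ∀ x y, x.1 ≠ y.1 → w x y = 0) :
    pairSum w ((Γ.treePath a (D.cell r) (D.cell i)).map (· + o)) =
      ∑ y ∈ Finset.range D.n, if ∃ z, D.Up y z ∧ ¬ D.Reach y r i ∧ ¬ D.Reach z r i then
        w (D.cell y + o) (D.cell y + o + (0, 1)) else 0 := by
  have hmem : ∀ {x}, x ∈ Γ.treePath a (D.cell r) (D.cell i) ↔ _ := fun {x} =>
    System.mem_treePath_iff htree hc (h.mem hr) (h.mem hi)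
  rw [pairSum_map, (hc.bondPath (h.mem hr) (h.mem hi)).pairSum_eq htree
    (fun x y => hsymm _ _) (fun x y hxy => hw _ _ (by simpa using hxy))]
  have himg : a.dom = (Finset.range D.n).image D.cell := by
    ext p
    rw [Finset.mem_image]
    constructor
    · intro hp
      obtain ⟨j, hj, rfl⟩ := h.surj p hp
      exact ⟨j, Finset.mem_range.2 hj, rfl⟩
    · rintro ⟨j, hj, rfl⟩
      exact h.mem (Finset.mem_range.1 hj)
  rw [himg, Finset.sum_image fun x hx y hy e =>
    h.cell_inj (Finset.mem_range.1 hx) (Finset.mem_range.1 hy) e]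
  refine Finset.sum_congr rfl fun y hy => ?_
  have hy := Finset.mem_range.1 hy
  have e0 : dirZ 0 = (0, 1) := by simp [dirZ, dx, dy]
  have hiff : (D.cell y ∈ Γ.treePath a (D.cell r) (D.cell i) ∧
      D.cell y + (0, 1) ∈ Γ.treePath a (D.cell r) (D.cell i) ∧
      0 < Γ.bond a (D.cell y) (D.cell y + (0, 1))) ↔
      ∃ z, D.Up y z ∧ ¬ D.Reach y r i ∧ ¬ D.Reach z r i := by
    constructor
    · rintro ⟨h1, h2, h3⟩
      obtain ⟨z, hz, e⟩ := h.surj _ (System.bond_pos_mem h3).2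
      have hn : D.next y 0 z := next_iff.2 (by rw [e, e0])
      rw [← e] at h2 h3
      rw [h.bond_next hy hz (by norm_num) hn] at h3
      rw [hmem, ← h.reach_iff hy hr hi] at h1
      rw [hmem, ← h.reach_iff hz hr hi] at h2
      exact ⟨z, ⟨hz, hn, h3⟩, h1, h2⟩
    · rintro ⟨z, ⟨hz, hn, h3⟩, h1, h2⟩
      rw [← h.bond_next hy hz (by norm_num) hn] at h3
      rw [h.reach_iff hy hr hi, ← hmem] at h1
      rw [h.reach_iff hz hr hi, ← hmem] at h2
      have e := next_iff.1 hn
      rw [e0] at e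
      rw [e] at h2 h3
      exact ⟨h1, h2, h3⟩
  rw [add_right_comm]
  by_cases hh : ∃ z, D.Up y z ∧ ¬ D.Reach y r i ∧ ¬ D.Reach z r i
  · rw [if_pos hh, if_pos (hiff.2 hh)]
  · rw [if_neg hh, if_neg (fun h' => hh (hiff.1 h'))]

end Model

end WordRAM.TreeUAV

/-! ### The computed relation is the geometric one -/

namespace WordRAM.TreeUAV

open TwoHAM Planar

variable {m : ℕ} {Γ : System (Fin m)} {a : Config (Fin m)} {D : Inst} {t : ℕ → Tile (Fin m)}
  {R : Root}

/-- Two copies of a connected tree-bonded configuration, placed such that the cells of the root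
have a bond. -/
structure Docking {m : ℕ} (Γ : System (Fin m)) (a : Config (Fin m)) (D : Inst)
    (t : ℕ → Tile (Fin m)) (R : Root) : Prop extends Model Γ a D t where
  tree : Γ.TreeBonded a
  conn : Γ.Conn a
  p_lt : R.p < D.n
  q_lt : R.q < D.n
  d_lt : R.d < 4
  pos : 0 < D.S R.p R.d R.q

namespace Docking

noncomputable def trees (h : Docking Γ a D t R) : Trees :=
  D.trees R h.tree h.conn (h.mem h.p_lt) (h.mem h.q_lt) h.d_lt

theorem trees_p (h : Docking Γ a D t R) : h.trees.p₀ = D.pos₁ R R.p := (D.pos₁_eq R _).symm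

theorem trees_q (h : Docking Γ a D t R) : h.trees.q₀ = D.pos₂ R R.q := (D.pos₂_eq R _).symm

theorem trees_L (h : Docking Γ a D t R) (i : ℕ) : h.trees.L (D.pos₁ R i) =
    (Γ.treePath a (D.cell R.p) (D.cell i)).map (· + D.off₁ R) := by
  simp only [trees, Inst.trees]
  rw [D.pos₁_eq, add_sub_cancel_right]

theorem trees_M (h : Docking Γ a D t R) (i : ℕ) : h.trees.M (D.pos₂ R i) =
    (Γ.treePath a (D.cell R.q) (D.cell i)).map (· + D.off₂ R) := by
  simp only [trees, Inst.trees]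
  rw [D.pos₂_eq, add_sub_cancel_right]

theorem mem_S (h : Docking Γ a D t R) {i : ℕ} (hi : i < D.n) : D.pos₁ R i ∈ h.trees.S := by
  simp only [trees, Inst.trees, Set.mem_ofPred_eq]
  rw [D.pos₁_eq, add_sub_cancel_right]
  exact h.mem hi

theorem mem_T (h : Docking Γ a D t R) {i : ℕ} (hi : i < D.n) : D.pos₂ R i ∈ h.trees.T := by
  simp only [trees, Inst.trees, Set.mem_ofPred_eq]
  rw [D.pos₂_eq, add_sub_cancel_right]
  exact h.mem hi

theorem pos₁_inj (h : Docking Γ a D t R) {i j : ℕ} (hi : i < D.n) (hj : j < D.n)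
    (e : D.pos₁ R i = D.pos₁ R j) : i = j := by
  rw [D.pos₁_eq, D.pos₁_eq, add_left_inj] at e
  exact h.cell_inj hi hj e

theorem pos₂_inj (h : Docking Γ a D t R) {i j : ℕ} (hi : i < D.n) (hj : j < D.n)
    (e : D.pos₂ R i = D.pos₂ R j) : i = j := by
  rw [D.pos₂_eq, D.pos₂_eq, add_left_inj] at e
  exact h.cell_inj hi hj e

theorem mem_path_iff (h : Model Γ a D t) (htree : Γ.TreeBonded a) (hc : Γ.Conn a) {r i : ℕ}
    (hr : r < D.n) (hi : i < D.n) (o z : Cell) :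
    z ∈ (Γ.treePath a (D.cell r) (D.cell i)).map (· + o) ↔
      ∃ x < D.n, z = D.cell x + o ∧ ¬ D.Reach x r i := by
  rw [List.mem_map]
  constructor
  · rintro ⟨y, hy, rfl⟩
    obtain ⟨x, hx, rfl⟩ := h.surj y
      (System.mem_dom_of_mem_treePath htree hc (h.mem hr) (h.mem hi) hy)
    rw [System.mem_treePath_iff htree hc (h.mem hr) (h.mem hi), ← h.reach_iff hx hr hi] at hy
    exact ⟨x, hx, rfl, hy⟩
  · rintro ⟨x, hx, rfl, hr'⟩
    refine ⟨_, ?_, rfl⟩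
    rwa [System.mem_treePath_iff htree hc (h.mem hr) (h.mem hi), ← h.reach_iff hx hr hi]

theorem mem_L_iff (h : Docking Γ a D t R) {i : ℕ} (hi : i < D.n) {z : Cell} :
    z ∈ h.trees.L (D.pos₁ R i) ↔ ∃ x < D.n, z = D.pos₁ R x ∧ ¬ D.Reach x R.p i := by
  rw [h.trees_L, mem_path_iff h.toModel h.tree h.conn h.p_lt hi]
  simp only [Inst.pos₁_eq]

theorem mem_M_iff (h : Docking Γ a D t R) {i : ℕ} (hi : i < D.n) {z : Cell} :
    z ∈ h.trees.M (D.pos₂ R i) ↔ ∃ x < D.n, z = D.pos₂ R x ∧ ¬ D.Reach x R.q i := by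
  rw [h.trees_M, mem_path_iff h.toModel h.tree h.conn h.q_lt hi]
  simp only [Inst.pos₂_eq]

/-- Overlap of cells in the two numberings is equality of positions in the plane, and membership in
a path is negated reachability. -/
theorem not_conf_iff (h : Docking Γ a D t R) {i j : ℕ} (hi : i < D.n) (hj : j < D.n) :
    ¬ D.Conf R i j ↔ ∀ x ∈ h.trees.L (D.pos₁ R i), x ∉ h.trees.M (D.pos₂ R j) := by
  constructor
  · intro hn z hz hz'
    obtain ⟨x, hx, rfl, hr⟩ := (h.mem_L_iff hi).1 hz
    obtain ⟨y, hy, e, hr'⟩ := (h.mem_M_iff hj).1 hz'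
    exact hn ⟨x, hx, y, hy, Inst.ov_iff.2 e.symm, hr, hr'⟩
  · rintro hn ⟨x, hx, y, hy, ho, hr, hr'⟩
    exact hn _ ((h.mem_L_iff hi).2 ⟨x, hx, rfl, hr⟩)
      ((h.mem_M_iff hj).2 ⟨y, hy, (Inst.ov_iff.1 ho).symm, hr'⟩)

theorem valid {f : ℕ} (hf : D.nbr R f < D.n) : D.Valid R f (D.nbr R f) :=
  (D.nbr_spec R f).resolve_right fun h' => by omega

theorem edge_snd {f : ℕ} (hf : D.nbr R f < D.n) :
    D.pos₂ R (D.nbr R f) = D.pos₁ R (f / 4) + dirZ (f % 4) :=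
  Inst.meets_coord_iff.1 (valid hf).2.1.1

theorem edge_inj (h : Docking Γ a D t R) {f g : ℕ} (hf : f < 4 * D.n) (hg : g < 4 * D.n)
    (hf' : D.nbr R f < D.n) (hg' : D.nbr R g < D.n) (e : D.edge R f = D.edge R g) : f = g := by
  simp only [Inst.edge, Prod.mk.injEq] at e
  have e1 := h.pos₁_inj (by omega) (by omega) e.1
  rw [edge_snd hf', edge_snd hg', e1, add_right_inj] at e
  have e2 := dirZ_inj (Nat.mod_lt _ (by norm_num)) (Nat.mod_lt _ (by norm_num)) e.2
  omega

theorem good (h : Docking Γ a D t R) {f : ℕ} (hf : f < 4 * D.n) (hf' : D.nbr R f < D.n) :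
    h.trees.Good (D.edge R f) where
  memS := h.mem_S (by omega)
  memT := h.mem_T hf'
  nb := by
    simp only [Inst.edge]
    rw [edge_snd hf']
    exact nb_dirZ _ (Nat.mod_lt _ (by norm_num))
  ne := by
    intro e
    rw [h.trees_p, h.trees_q] at e
    simp only [Inst.edge, Prod.mk.injEq] at e
    have e1 := h.pos₁_inj (by omega) h.p_lt e.1
    rw [edge_snd hf', D.pos₂_q, e1, add_right_inj] at e
    exact (valid hf').2.2.1 ⟨e1, dirZ_inj (Nat.mod_lt _ (by norm_num)) h.d_lt e.2⟩
  disj := (h.not_conf_iff (by omega) hf').1 (valid hf').2.2.2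

theorem face {f : ℕ} (hf' : D.nbr R f < D.n) :
    faceOf (D.edge R f).1 (D.edge R f).2 = ((D.fx R f : ℤ), (D.fy R f : ℤ)) := by
  simp only [Inst.edge]
  rw [edge_snd hf', Inst.face_eq]

theorem face_root (h : Docking Γ a D t R) : faceOf h.trees.p₀ h.trees.q₀ =
    ((D.fx R (Inst.root R) : ℤ), (D.fy R (Inst.root R) : ℤ)) := by
  rw [h.trees_p, h.trees_q, ← Inst.face_eq, Inst.root_div h.d_lt, Inst.root_mod h.d_lt, D.pos₂_q]

/-- The parity of the crossings of an edge with the rays from the faces of the slots `f`, `g`. -/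
noncomputable def crossing (D : Inst) (R : Root) (f g : ℕ) (x y : Cell) : ZMod 2 :=
  cross ((D.fx R f : ℤ), (D.fy R f : ℤ)) x y + cross ((D.fx R g : ℤ), (D.fy R g : ℤ)) x y

theorem crossing_up (f g x y : ℕ) (e : ℤ × ℤ) (he : e = (0, 1)) :
    crossing D R f g ((x : ℤ), (y : ℤ)) (((x : ℤ), (y : ℤ)) + e) = par (D.CrossP R x y f g) := by
  subst he
  rw [Inst.CrossP, par_xor]
  simp only [crossing, cross, par, Prod.mk_add_mk, add_zero, true_and]
  have : min (y : ℤ) (y + 1) = y := by omega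
  rw [this]
  simp only [Nat.cast_inj, Nat.cast_lt]
  congr 1 <;> split_ifs <;> rfl

theorem crossing_comm (f g : ℕ) (x y : Cell) : crossing D R f g x y = crossing D R f g y x := by
  rw [crossing, crossing, cross_comm, cross_comm _ x y]

theorem crossing_ne (f g : ℕ) {x y : Cell} (h : x.1 ≠ y.1) : crossing D R f g x y = 0 := by
  simp [crossing, cross, h]

/-- The incident face of a vertical edge is named by the lower end of the edge, so the face
coordinates of a slot double as the end point that the crossing test needs. Horizontal edges cross
no ray. -/
theorem crossing_dirZ (f g e : ℕ) (P : Cell) (he : e < 4) (X Y : ℕ)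
    (hXY : faceOf P (P + dirZ e) = ((X : ℤ), (Y : ℤ))) :
    crossing D R f g P (P + dirZ e) = par ((e = 0 ∨ e = 2) ∧ D.CrossP R X Y f g) := by
  by_cases hv : e = 0 ∨ e = 2
  · simp only [hv, true_and]
    rw [← crossing_up f g X Y (0, 1) rfl]
    rw [faceOf_dirZ P he] at hXY
    rcases hv with rfl | rfl
    · simp only [if_neg (show ¬ (0 = 3) by norm_num), if_neg (show ¬ (0 = 2) by norm_num),
        sub_zero] at hXY
      rw [← hXY]
      rfl
    · rw [crossing_comm, ← hXY]
      congr 1; ext <;> simp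
  · simp only [hv, false_and]
    rw [crossing_ne, par_eq_zero.2 (fun h => h)]
    have : e = 1 ∨ e = 3 := by omega
    rcases this with rfl | rfl <;> simp [dirZ, dx]

theorem path_crossing (h : Model Γ a D t) (htree : Γ.TreeBonded a) (hc : Γ.Conn a) {r i : ℕ}
    (hr : r < D.n) (hi : i < D.n) (o : Cell) (f g : ℕ) (X Y : ℕ → ℕ)
    (hXY : ∀ y, D.cell y + o = ((X y : ℤ), (Y y : ℤ))) :
    pairSum (crossing D R f g) ((Γ.treePath a (D.cell r) (D.cell i)).map (· + o)) =
      par (Odd (∑ y ∈ Finset.range D.n, ind01 (∃ z, D.Up y z ∧ ¬ D.Reach y r i ∧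
        ¬ D.Reach z r i ∧ D.CrossP R (X y) (Y y) f g))) := by
  classical
  rw [par_odd_sum, h.pairSum_treePath htree hc hr hi o (crossing_comm f g)
    (fun x y hxy => crossing_ne f g hxy)]
  refine Finset.sum_congr rfl fun y _ => ?_
  rw [hXY, crossing_up _ _ _ _ _ rfl]
  unfold par
  by_cases h1 : ∃ z, D.Up y z ∧ ¬ D.Reach y r i ∧ ¬ D.Reach z r i <;>
    by_cases h2 : D.CrossP R (X y) (Y y) f g
  · obtain ⟨z, a1, a2, a3⟩ := h1
    rw [if_pos ⟨z, a1, a2, a3⟩, if_pos h2, if_pos ⟨z, a1, a2, a3, h2⟩]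
  · rw [if_pos h1, if_neg h2, if_neg]
    rintro ⟨z, _, _, _, h3⟩; exact h2 h3
  · rw [if_neg h1, if_neg]
    rintro ⟨z, a1, a2, a3, _⟩; exact h1 ⟨z, a1, a2, a3⟩
  · rw [if_neg h1, if_neg]
    rintro ⟨z, a1, a2, a3, _⟩; exact h1 ⟨z, a1, a2, a3⟩

/-- The difference of the indices at the faces of f and of the root is a single sum over the curve,
in which an edge counts if it crosses exactly one of the two rays. The curve consists of the two
paths, the edge of g and the root edge, and these are the four terms of `Inst.Side`. -/
theorem side_eq (h : Docking Γ a D t R) {f g : ℕ} (hg : g < 4 * D.n)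
    (hf' : D.nbr R f < D.n) (hg' : D.nbr R g < D.n) :
    h.trees.side (D.edge R g) (D.edge R f) = par (D.Side R g f) := by
  rw [Trees.side, face hf', h.face_root, Inst.Side, par_xor, par_xor, par_xor]
  simp only [Trees.idx, Trees.around]
  have e1 : pairSum (crossing D R f (Inst.root R)) (h.trees.L (D.edge R g).1) =
      par (D.Odd1 R f g) := by
    simp only [Inst.edge]
    rw [h.trees_L, Inst.Odd1]
    exact path_crossing h.toModel h.tree h.conn h.p_lt (by omega) _ _ _ _ _
      (fun y => (D.pos₁_eq R y).symm)
  have e2 : pairSum (crossing D R f (Inst.root R)) (h.trees.M (D.edge R g).2) =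
      par (D.Odd2 R f g) := by
    simp only [Inst.edge]
    rw [h.trees_M, Inst.Odd2]
    exact path_crossing h.toModel h.tree h.conn h.q_lt hg' _ _ _ _ _
      (fun y => (D.pos₂_eq R y).symm)
  have e3 : crossing D R f (Inst.root R) (D.edge R g).1 (D.edge R g).2 =
      par (Inst.Vert g ∧ D.CrossP R (D.fx R g) (D.fy R g) f (Inst.root R)) := by
    simp only [Inst.edge]
    rw [edge_snd hg']
    exact crossing_dirZ _ _ _ _ (Nat.mod_lt _ (by norm_num)) _ _ (Inst.face_eq g)
  have e4 : crossing D R f (Inst.root R) h.trees.p₀ h.trees.q₀ =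
      par (Inst.Vert (Inst.root R) ∧ D.CrossP R (D.fx R (Inst.root R)) (D.fy R (Inst.root R)) f
        (Inst.root R)) := by
    have := h.face_root
    rw [h.trees_p, h.trees_q, D.pos₂_q] at this ⊢
    rw [crossing_dirZ _ _ _ _ h.d_lt _ _ this, Inst.Vert, Inst.root_mod h.d_lt]
  rw [← e1, ← e2, ← e3, ← e4]
  have split : ∀ l, pairSum (crossing D R f (Inst.root R)) l = _ := fun l =>
    (pairSum_add_apply _ _ l).symm
  rw [split, split]
  simp only [crossing]
  ring

/-- The root is left out: it is no edge of the order, but a starting point that may precede every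
slot. -/
theorem rel_iff (h : Docking Γ a D t R) {f g : ℕ} (hf : f < 4 * D.n) (hg : g < 4 * D.n)
    (hne : f ≠ Inst.root R) : D.Rel R f g ↔
      D.nbr R f < D.n ∧ D.nbr R g < D.n ∧ h.trees.Lt (D.edge R f) (D.edge R g) := by
  rw [Inst.Rel, or_iff_right hne]
  constructor
  · rintro ⟨hg', hf', hfg, c1, c2, hs⟩
    refine ⟨hf', hg', fun e => hfg (h.edge_inj hf hg hf' hg' e), ⟨?_, ?_⟩, ?_⟩
    · exact (h.not_conf_iff (by omega) hg').1 c1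
    · exact (h.not_conf_iff (by omega) hf').1 c2
    · rw [h.side_eq hg hf' hg', par_eq_zero]; exact hs
  · rintro ⟨hf', hg', hfg, ⟨c1, c2⟩, hs⟩
    refine ⟨hg', hf', fun e => hfg (by rw [e]), ?_, ?_, ?_⟩
    · exact (h.not_conf_iff (by omega) hg').2 c1
    · exact (h.not_conf_iff (by omega) hf').2 c2
    · rw [h.side_eq hg hf' hg', par_eq_zero] at hs; exact hs

end Docking

end WordRAM.TreeUAV

/-! ### Chains and families of compatible slots -/

namespace WordRAM.TreeUAV

open TwoHAM Planar

/-- If some summand has been cut, both sums reach τ through it alone; otherwise the sums are equal.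
-/
theorem le_sum_iff_of_cut {ι : Type*} {F : Finset ι} {f g : ι → ℕ} {τ : ℕ}
    (h : ∀ i ∈ F, f i = g i ∨ (τ ≤ f i ∧ τ ≤ g i)) : τ ≤ ∑ i ∈ F, f i ↔ τ ≤ ∑ i ∈ F, g i := by
  by_cases h' : ∃ i ∈ F, τ ≤ f i ∧ τ ≤ g i
  · obtain ⟨i, hi, h1, h2⟩ := h'
    exact iff_of_true (h1.trans (Finset.single_le_sum (fun _ _ => Nat.zero_le _) hi))
      (h2.trans (Finset.single_le_sum (fun _ _ => Nat.zero_le _) hi))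
  · rw [Finset.sum_congr rfl fun i hi => (h i hi).resolve_right fun h1 => h' ⟨i, hi, h1⟩]

variable {m : ℕ} {Γ : System (Fin m)} {a : Config (Fin m)} {D : Inst} {t : ℕ → Tile (Fin m)}
  {R : Root}

open Classical in
/-- The cell at the other end of the bond at a slot, where the root is a slot as well. -/
noncomputable def Inst.far (D : Inst) (R : Root) (g : ℕ) : ℕ :=
  if g = Inst.root R then R.q else D.nbr R g

noncomputable def Inst.farW (D : Inst) (R : Root) (g : ℕ) : ℕ := D.W (g / 4) (g % 4) (D.far R g)

noncomputable def Inst.farS (D : Inst) (R : Root) (g : ℕ) : ℕ := D.S (g / 4) (g % 4) (D.far R g)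

/-- `F` is a set of slots that can have bonds at the same time. -/
structure Docking.Family (h : Docking Γ a D t R) (F : Finset ℕ) : Prop where
  lt : ∀ g ∈ F, g < 4 * D.n
  nbr : ∀ g ∈ F, D.nbr R g < D.n
  comp : ∀ f ∈ F, ∀ g ∈ F, f ≠ g → h.trees.Comp (D.edge R f) (D.edge R g)

namespace Docking

theorem root_lt (h : Docking Γ a D t R) : Inst.root R < 4 * D.n := by
  have := h.p_lt
  have := h.d_lt
  unfold Inst.root
  omega

theorem nbr_root (h : Docking Γ a D t R) : D.nbr R (Inst.root R) = D.n := by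
  rcases D.nbr_spec R (Inst.root R) with h1 | h1
  · exact absurd ⟨Inst.root_div h.d_lt, Inst.root_mod h.d_lt⟩ h1.2.2.1
  · exact h1.1

theorem Family.not_root {h : Docking Γ a D t R} {F : Finset ℕ} (hF : h.Family F) :
    Inst.root R ∉ F := fun h' => by
  have := hF.nbr _ h'
  rw [h.nbr_root] at this
  exact lt_irrefl _ this

theorem Family.mono {h : Docking Γ a D t R} {F E : Finset ℕ} (hF : h.Family F) (hE : E ⊆ F) :
    h.Family E :=
  ⟨fun g hg => hF.lt g (hE hg), fun g hg => hF.nbr g (hE hg),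
    fun f hf g hg => hF.comp f (hE hf) g (hE hg)⟩

theorem Family.good {h : Docking Γ a D t R} {F : Finset ℕ} (hF : h.Family F) {g : ℕ}
    (hg : g ∈ F) : h.trees.Good (D.edge R g) := h.good (hF.lt g hg) (hF.nbr g hg)

theorem far_root (R : Root) : D.far R (Inst.root R) = R.q := if_pos rfl

theorem Family.far_eq {h : Docking Γ a D t R} {F : Finset ℕ} (hF : h.Family F) {g : ℕ}
    (hg : g ∈ F) : D.far R g = D.nbr R g :=
  if_neg fun e : g = Inst.root R => hF.not_root (e ▸ hg)

theorem Family.sum_farW {h : Docking Γ a D t R} {F : Finset ℕ} (hF : h.Family F) :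
    ∑ g ∈ insert (Inst.root R) F, D.farW R g = D.W R.p R.d R.q + ∑ g ∈ F, D.slotW R g := by
  rw [Finset.sum_insert hF.not_root, Inst.farW, far_root, Inst.root_div h.d_lt,
    Inst.root_mod h.d_lt]
  congr 1
  exact Finset.sum_congr rfl fun g hg => by rw [Inst.farW, hF.far_eq hg]; rfl

theorem Family.far_lt {h : Docking Γ a D t R} {F : Finset ℕ} (hF : h.Family F) {g : ℕ}
    (hg : g ∈ insert (Inst.root R) F) : g < 4 * D.n ∧ D.far R g < D.n := by
  rcases Finset.mem_insert.1 hg with rfl | hg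
  · exact ⟨h.root_lt, by rw [far_root]; exact h.q_lt⟩
  · exact ⟨hF.lt g hg, by rw [hF.far_eq hg]; exact hF.nbr g hg⟩

theorem Family.pos_far {h : Docking Γ a D t R} {F : Finset ℕ} (hF : h.Family F) {g : ℕ}
    (hg : g ∈ insert (Inst.root R) F) :
    D.pos₂ R (D.far R g) = D.pos₁ R (g / 4) + dirZ (g % 4) := by
  rcases Finset.mem_insert.1 hg with rfl | hg
  · rw [far_root, D.pos₂_q, Inst.root_div h.d_lt, Inst.root_mod h.d_lt]
  · rw [hF.far_eq hg, edge_snd (hF.nbr g hg)]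

theorem Family.far_inj {h : Docking Γ a D t R} {F : Finset ℕ} (hF : h.Family F) {g f : ℕ}
    (hg : g ∈ insert (Inst.root R) F) (hf : f ∈ insert (Inst.root R) F) (e1 : g / 4 = f / 4)
    (e2 : D.far R g = D.far R f) : g = f := by
  have e3 := hF.pos_far hg
  rw [e2, hF.pos_far hf, e1, add_right_inj] at e3
  have := dirZ_inj (Nat.mod_lt _ (by norm_num)) (Nat.mod_lt _ (by norm_num)) e3
  omega

theorem Family.temp_le_iff {h : Docking Γ a D t R} {F : Finset ℕ} (hF : h.Family F) :
    D.temp ≤ D.W R.p R.d R.q + ∑ g ∈ F, D.slotW R g ↔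
      D.temp ≤ ∑ g ∈ insert (Inst.root R) F, D.farS R g := by
  rw [← hF.sum_farW]
  refine le_sum_iff_of_cut fun g hg => ?_
  obtain ⟨h1, h2⟩ := hF.far_lt hg
  exact h.W_cases (by omega) (Nat.mod_lt _ (by norm_num)) h2

theorem crossBond_cell (h : Docking Γ a D t R) {i j : ℕ} (hi : i < D.n) (hj : j < D.n) :
    Γ.crossBond a (D.off₂ R - D.off₁ R) (D.cell i) (D.cell j) =
      Γ.link (t i) (t j) (D.pos₂ R j - D.pos₁ R i) := by
  rw [System.crossBond_eq (h.tile i hi) (h.tile j hj), D.pos₁_eq, D.pos₂_eq]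
  congr 1; ring

theorem Family.crossBond_far {h : Docking Γ a D t R} {F : Finset ℕ} (hF : h.Family F) {g : ℕ}
    (hg : g ∈ insert (Inst.root R) F) :
    Γ.crossBond a (D.off₂ R - D.off₁ R) (D.cell (g / 4)) (D.cell (D.far R g)) = D.farS R g := by
  obtain ⟨h1, h2⟩ := hF.far_lt hg
  rw [h.crossBond_cell (by omega) h2, hF.pos_far hg, add_sub_cancel_left, Inst.farS,
    h.S_eq (by omega) (Nat.mod_lt _ (by norm_num)) h2]

theorem Family.farS_pos {h : Docking Γ a D t R} {F : Finset ℕ} (hF : h.Family F) {g : ℕ}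
    (hg : g ∈ insert (Inst.root R) F) : 0 < D.farS R g := by
  rw [Inst.farS]
  rcases Finset.mem_insert.1 hg with rfl | hg
  · rw [far_root, Inst.root_div h.d_lt, Inst.root_mod h.d_lt]; exact h.pos
  · rw [hF.far_eq hg]; exact (valid (hF.nbr g hg)).2.1.2

/-- By transitivity all earlier slots are to the left of the new one. Therefore they are compatible
with it and different from it, and every weight is counted once. -/
theorem exists_family_of_chain (h : Docking Γ a D t R) {f r w : ℕ} (hch : D.Chain R f r w) :
    ∃ F : Finset ℕ, h.Family F ∧ F.card = r ∧ w = D.W R.p R.d R.q + ∑ g ∈ F, D.slotW R g ∧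
      ((f = Inst.root R ∧ F = ∅) ∨
        (f ∈ F ∧ ∀ g ∈ F, g ≠ f → h.trees.Lt (D.edge R g) (D.edge R f))) := by
  induction hch with
  | nil => exact ⟨∅, ⟨by simp, by simp, by simp⟩, by simp, by simp, Or.inl ⟨rfl, rfl⟩⟩
  | @snoc f g r w _ hg hfg ih =>
    obtain ⟨F, hF, hcard, hw, hf⟩ := ih
    have hlt : ∀ g' ∈ F, h.trees.Lt (D.edge R g') (D.edge R g) := by
      rcases hf with ⟨-, rfl⟩ | ⟨hfF, hmax⟩
      · simp
      · have hne : f ≠ Inst.root R := fun e => hF.not_root (e ▸ hfF)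
        obtain ⟨_, hg', hl⟩ := (h.rel_iff (hF.lt f hfF) hg hne).1 hfg
        intro g' hg'F
        by_cases e : g' = f
        · rw [e]; exact hl
        · exact Trees.Lt.trans (hF.good hg'F) (hF.good hfF) (h.good hg hg') (hmax g' hg'F e) hl
    have hgF : g ∉ F := fun hgF => (hlt g hgF).1 rfl
    refine ⟨insert g F, ⟨?_, ?_, ?_⟩, ?_, ?_, Or.inr ⟨Finset.mem_insert_self _ _, ?_⟩⟩
    · intro x hx
      rcases Finset.mem_insert.1 hx with rfl | hx
      · exact hg
      · exact hF.lt x hx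
    · intro x hx
      rcases Finset.mem_insert.1 hx with rfl | hx
      · exact hfg.1
      · exact hF.nbr x hx
    · intro x hx y hy hne
      rcases Finset.mem_insert.1 hx with rfl | hx' <;>
        rcases Finset.mem_insert.1 hy with rfl | hy'
      · exact absurd rfl hne
      · exact (hlt y hy').2.1.symm
      · exact (hlt x hx').2.1
      · exact hF.comp x hx' y hy' hne
    · rw [Finset.card_insert_of_notMem hgF, hcard]
    · rw [Finset.sum_insert hgF, hw]; ring
    · intro x hx hne
      rcases Finset.mem_insert.1 hx with rfl | hx
      · exact absurd rfl hne
      · exact hlt x hx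

/-- Compatible slots are comparable, and the relation is transitive, so finite families are totally
ordered. -/
theorem Family.exists_max {h : Docking Γ a D t R} {F : Finset ℕ} (hF : h.Family F)
    (hne : F.Nonempty) :
    ∃ f ∈ F, ∀ g ∈ F, g ≠ f → h.trees.Lt (D.edge R g) (D.edge R f) := by
  classical
  induction hne using Finset.Nonempty.cons_induction with
  | singleton a => exact ⟨a, by simp, by simp⟩
  | cons x F hx hne ih =>
    obtain ⟨f, hf, hmax⟩ := ih (hF.mono (Finset.subset_cons hx))
    have hxf : x ≠ f := fun e => hx (e ▸ hf)
    have hxF : x ∈ Finset.cons x F hx := Finset.mem_cons_self _ _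
    have hfF : f ∈ Finset.cons x F hx := Finset.mem_cons_of_mem hf
    have hne' : D.edge R x ≠ D.edge R f := fun e =>
      hxf (h.edge_inj (hF.lt x hxF) (hF.lt f hfF) (hF.nbr x hxF) (hF.nbr f hfF) e)
    rcases Trees.lt_or_lt (hF.good hxF) (hF.good hfF) hne' (hF.comp x hxF f hfF hxf) with hl | hl
    · refine ⟨f, hfF, fun g hg hgf => ?_⟩
      rcases Finset.mem_cons.1 hg with rfl | hg
      · exact hl
      · exact hmax g hg hgf
    · refine ⟨x, hxF, fun g hg hgx => ?_⟩
      rcases Finset.mem_cons.1 hg with rfl | hg'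
      · exact absurd rfl hgx
      · by_cases e : g = f
        · rw [e]; exact hl
        · exact Trees.Lt.trans (hF.good hg) (hF.good hfF) (hF.good hxF) (hmax g hg' e) hl

/-- The family is sorted by removing its rightmost member; the member that is rightmost among the
others precedes it in the chain, or the root does if there is no other. -/
theorem Family.chain {h : Docking Γ a D t R} {F : Finset ℕ} (hF : h.Family F) :
    ∃ f, D.Chain R f F.card (D.W R.p R.d R.q + ∑ g ∈ F, D.slotW R g) ∧
      ((f = Inst.root R ∧ F = ∅) ∨
        (f ∈ F ∧ ∀ g ∈ F, g ≠ f → h.trees.Lt (D.edge R g) (D.edge R f))) := by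
  induction hN : F.card generalizing F with
  | zero =>
    rw [Finset.card_eq_zero] at hN
    subst hN
    exact ⟨_, by simpa using Inst.Chain.nil, Or.inl ⟨rfl, rfl⟩⟩
  | succ N ih =>
    have hne : F.Nonempty := Finset.card_pos.1 (by omega)
    obtain ⟨g, hg, hmax⟩ := hF.exists_max hne
    have hE := hF.mono (Finset.erase_subset g F)
    obtain ⟨f, hf, hf'⟩ := ih hE (by rw [Finset.card_erase_of_mem hg, hN]; rfl)
    refine ⟨g, ?_, Or.inr ⟨hg, hmax⟩⟩
    have hrel : D.Rel R f g := by
      rcases hf' with ⟨rfl, -⟩ | ⟨hfE, -⟩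
      · exact ⟨hF.nbr g hg, Or.inl rfl⟩
      · have hfF := Finset.mem_of_mem_erase hfE
        rw [h.rel_iff (hF.lt f hfF) (hF.lt g hg) fun e => hF.not_root (e ▸ hfF)]
        exact ⟨hF.nbr f hfF, hF.nbr g hg, hmax f hfF (Finset.ne_of_mem_erase hfE)⟩
    have := Inst.Chain.snoc hf (hF.lt g hg) hrel
    rw [add_assoc, Finset.sum_erase_add _ _ hg] at this
    exact this

end Docking

/-- The slots of a chain are distinct, and there are 4n of them. This depends on transitivity, hence
on planarity and on the connected tree. -/
theorem Model.short (h : Model Γ a D t) (htree : Γ.TreeBonded a) (hc : Γ.Conn a) : D.Short := by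
  intro R hp hd hq hpos f r w hch
  have hD : Docking Γ a D t R := ⟨h, htree, hc, hp, hq, hd, hpos⟩
  obtain ⟨F, hF, rfl, -, -⟩ := hD.exists_family_of_chain hch
  have : F ⊆ Finset.range (4 * D.n) := fun g hg => Finset.mem_range.2 (hF.lt g hg)
  simpa using Finset.card_le_card this

end WordRAM.TreeUAV

/-! ### Bad chains and rogue pairs -/

namespace WordRAM.TreeUAV

open TwoHAM Planar

variable {m : ℕ} {Γ : System (Fin m)} {a : Config (Fin m)} {D : Inst} {t : ℕ → Tile (Fin m)}
  {R : Root}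

/-- The path from a cell of the union is a suffix of one of the given paths, so it reaches r without
leaving the union. -/
theorem conn_union_paths {G : Type} {Γ : System G} {a : Config G} (htree : Γ.TreeBonded a)
    (hc : Γ.Conn a) {r : ℤ × ℤ} (hr : r ∈ a.dom) {X S : Finset (ℤ × ℤ)} (hX : X ⊆ a.dom)
    (hne : X.Nonempty) (hS : ∀ z, z ∈ S ↔ ∃ x ∈ X, z ∈ Γ.treePath a r x) :
    S ⊆ a.dom ∧ r ∈ S ∧ X ⊆ S ∧ Γ.Conn (a.restrict S) := by
  have hP := System.pathSys_treePath htree hc hr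
  have hSa : S ⊆ a.dom := fun z hz => by
    obtain ⟨x, hx, hz⟩ := (hS z).1 hz
    exact System.mem_dom_of_mem_treePath htree hc hr (hX hx) hz
  obtain ⟨x₀, hx₀⟩ := hne
  have hrS : r ∈ S := (hS r).2 ⟨x₀, hx₀, hP.root_mem (hX hx₀)⟩
  refine ⟨hSa, hrS, fun x hx => (hS x).2 ⟨x, hx, hP.self_mem (hX hx)⟩, ?_⟩
  have hdom := Config.restrict_dom hSa
  refine System.Conn.of_center (p := r) (by rw [hdom]; exact hrS) fun z hz => ?_
  rw [hdom] at hz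
  obtain ⟨x, hx, hzx⟩ := (hS z).1 hz
  have hsub : ∀ y ∈ Γ.treePath a r z, y ∈ S := fun y hy =>
    (hS y).2 ⟨x, hx, (System.treePath_suffix htree hc hr (hX hx) hzx).subset hy⟩
  have hb := hc.bondPath hr (hSa hz)
  obtain ⟨s, hs⟩ := hb.head
  have hch := hb.chain
  have hl := hb.last
  rw [hs] at hch hl hsub
  refine rtg_map id ?_ (rtg_symm (R := fun i j => 0 < Γ.bond a i j ∧ i ∈ S ∧ j ∈ S)
    (fun i j hij => ⟨by rw [Γ.bond_comm]; exact hij.1, hij.2.2, hij.2.1⟩)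
    (rtg_of_chain (P := fun y => y ∈ S) hch hsub (List.mem_of_getLast? hl)))
  intro i j hij
  change 0 < Γ.bond (a.restrict S) i j
  rw [System.bond_restrict hij.2.1 hij.2.2]
  exact hij.1

theorem le_double_sum {ι α β : Type*} {F : Finset ι} {S : Finset α} {T : Finset β}
    {w : α → β → ℕ} (e : ι → α) (e' : ι → β) (hS : ∀ i ∈ F, e i ∈ S) (hT : ∀ i ∈ F, e' i ∈ T)
    (hinj : ∀ i ∈ F, ∀ j ∈ F, e i = e j → e' i = e' j → i = j) :
    ∑ i ∈ F, w (e i) (e' i) ≤ ∑ x ∈ S, ∑ y ∈ T, w x y := by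
  classical
  rw [← Finset.sum_product' S T w]
  calc ∑ i ∈ F, w (e i) (e' i) = ∑ z ∈ F.image fun i => (e i, e' i), w z.1 z.2 := by
        rw [Finset.sum_image]
        intro i hi j hj hij
        simp only [Prod.mk.injEq] at hij
        exact hinj i hi j hj hij.1 hij.2
    _ ≤ _ := by
        refine Finset.sum_le_sum_of_subset fun z hz => ?_
        obtain ⟨i, hi, rfl⟩ := Finset.mem_image.1 hz
        exact Finset.mem_product.2 ⟨hS i hi, hT i hi⟩

theorem double_sum_le {ι α β : Type*} {F : Finset ι} {S : Finset α} {T : Finset β}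
    {w : α → β → ℕ} (e : ι → α) (e' : ι → β)
    (h : ∀ x ∈ S, ∀ y ∈ T, 0 < w x y → ∃ i ∈ F, e i = x ∧ e' i = y) :
    ∑ x ∈ S, ∑ y ∈ T, w x y ≤ ∑ i ∈ F, w (e i) (e' i) := by
  classical
  rw [← Finset.sum_product' S T w]
  calc ∑ z ∈ S ×ˢ T, w z.1 z.2 ≤ ∑ z ∈ F.image fun i => (e i, e' i), w z.1 z.2 := by
        refine Finset.sum_le_sum_of_ne_zero fun z hz hne => ?_
        obtain ⟨h1, h2⟩ := Finset.mem_product.1 hz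
        obtain ⟨i, hi, e1, e2⟩ := h _ h1 _ h2 (Nat.pos_of_ne_zero hne)
        exact Finset.mem_image.2 ⟨i, hi, by rw [e1, e2]⟩
    _ ≤ _ := Finset.sum_image_le_of_nonneg (fun _ _ => Nat.zero_le _)

namespace Docking

/-- The two parts are the unions of the paths from the root cells to the ends of the bonds in the
chain. They may touch in further bonds, which only add to the sum. -/
theorem rogue_of_bad (h : Docking Γ a D t R) (hb : D.Bad R) : Γ.Rogue a := by
  classical
  obtain ⟨f, r, w, hch, hle⟩ := hb
  obtain ⟨F, hF, hcard, rfl, -⟩ := h.exists_family_of_chain hch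
  rw [hF.temp_le_iff] at hle
  have hne : F.Nonempty := Finset.card_pos.1 (by omega)
  obtain ⟨g₀, hg₀⟩ := hne
  have hlt4 : ∀ g ∈ F, g / 4 < D.n := fun g hg => by have := hF.lt g hg; omega
  obtain ⟨S, hS⟩ : ∃ S : Finset (ℤ × ℤ), ∀ z, z ∈ S ↔ ∃ x ∈ F.image fun g => D.cell (g / 4),
      z ∈ Γ.treePath a (D.cell R.p) x :=
    ⟨(F.image fun g => D.cell (g / 4)).biUnion fun x => (Γ.treePath a (D.cell R.p) x).toFinset,
      fun z => by simp⟩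
  obtain ⟨T, hT⟩ : ∃ T : Finset (ℤ × ℤ), ∀ z, z ∈ T ↔ ∃ x ∈ F.image fun g => D.cell (D.nbr R g),
      z ∈ Γ.treePath a (D.cell R.q) x :=
    ⟨(F.image fun g => D.cell (D.nbr R g)).biUnion fun x =>
      (Γ.treePath a (D.cell R.q) x).toFinset, fun z => by simp⟩
  obtain ⟨hSa, hpS, hXS, hSc⟩ := conn_union_paths h.tree h.conn (h.mem h.p_lt)
    (X := F.image fun g => D.cell (g / 4)) (fun x hx => by
      obtain ⟨g, hg, rfl⟩ := Finset.mem_image.1 hx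
      exact h.mem (hlt4 g hg)) ⟨_, Finset.mem_image_of_mem _ hg₀⟩ hS
  obtain ⟨hTa, hqT, hYT, hTc⟩ := conn_union_paths h.tree h.conn (h.mem h.q_lt)
    (X := F.image fun g => D.cell (D.nbr R g)) (fun x hx => by
      obtain ⟨g, hg, rfl⟩ := Finset.mem_image.1 hx
      exact h.mem (hF.nbr g hg)) ⟨_, Finset.mem_image_of_mem _ hg₀⟩ hT
  have memS : ∀ g ∈ insert (Inst.root R) F, D.cell (g / 4) ∈ S := by
    intro g hg
    rcases Finset.mem_insert.1 hg with rfl | hg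
    · rw [Inst.root_div h.d_lt]; exact hpS
    · exact hXS (Finset.mem_image_of_mem _ hg)
  have memT : ∀ g ∈ insert (Inst.root R) F, D.cell (D.far R g) ∈ T := by
    intro g hg
    rcases Finset.mem_insert.1 hg with rfl | hg
    · rw [far_root]; exact hqT
    · rw [hF.far_eq hg]; exact hYT (Finset.mem_image_of_mem _ hg)
  have inj : ∀ g ∈ insert (Inst.root R) F, ∀ f ∈ insert (Inst.root R) F,
      D.cell (g / 4) = D.cell (f / 4) → D.cell (D.far R g) = D.cell (D.far R f) → g = f := by
    intro g hg f hf e1 e2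
    obtain ⟨a1, a2⟩ := hF.far_lt hg
    obtain ⟨b1, b2⟩ := hF.far_lt hf
    exact hF.far_inj hg hf (h.cell_inj (by omega) (by omega) e1) (h.cell_inj a2 b2 e2)
  have r0 : Inst.root R ∈ insert (Inst.root R) F := Finset.mem_insert_self _ _
  have g0 : g₀ ∈ insert (Inst.root R) F := Finset.mem_insert_of_mem hg₀
  refine ⟨D.off₂ R - D.off₁ R, S, hSa, T, hTa, hSc, hTc, ?_, ?_,
    _, memS _ r0, _, memT _ r0, _, memS _ g0, _, memT _ g0, ?_, ?_, ?_⟩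
  -- A common position would lie on the first path of one bond and on the second path of another or
  -- of the same bond; the former contradicts compatibility, the latter the choice of usable slots.
  · intro x hx y hy e
    obtain ⟨x', hx', hxp⟩ := (hS x).1 hx
    obtain ⟨g, hg, rfl⟩ := Finset.mem_image.1 hx'
    obtain ⟨y', hy', hyp⟩ := (hT y).1 hy
    obtain ⟨g', hg', rfl⟩ := Finset.mem_image.1 hy'
    have m1 : x + D.off₁ R ∈ h.trees.L (D.edge R g).1 := by
      simp only [Inst.edge]
      rw [h.trees_L]; exact List.mem_map_of_mem hxp
    have m2 : y + D.off₂ R ∈ h.trees.M (D.edge R g').2 := by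
      simp only [Inst.edge]
      rw [h.trees_M]; exact List.mem_map_of_mem hyp
    have e' : x + D.off₁ R = y + D.off₂ R := by rw [e]; ring
    rw [e'] at m1
    by_cases hgg : g = g'
    · subst hgg
      exact (hF.good hg).disj _ m1 m2
    · exact (hF.comp g hg g' hg' hgg).1 _ m1 m2
  · rw [← h.temp]
    refine hle.trans (le_trans (le_of_eq ?_) (le_double_sum (fun g => D.cell (g / 4))
      (fun g => D.cell (D.far R g)) memS memT inj))
    exact Finset.sum_congr rfl fun g hg => (hF.crossBond_far hg).symm
  · rintro ⟨e1, e2⟩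
    exact hF.not_root (inj _ r0 _ g0 e1 e2 ▸ hg₀)
  · rw [hF.crossBond_far r0]; exact hF.farS_pos r0
  · rw [hF.crossBond_far g0]; exact hF.farS_pos g0

end Docking

/-- One of the bonds between the parts is taken as root. The parts are connected and disjoint, so
they contain all paths to the other bonds, and these bonds form a family, which sorts into a chain.
-/
theorem Model.exists_bad_of_rogue (h : Model Γ a D t) (htree : Γ.TreeBonded a) (hc : Γ.Conn a)
    (hr : Γ.Rogue a) :
    ∃ p < D.n, ∃ d < 4, ∃ q < D.n, 0 < D.S p d q ∧ D.Bad ⟨p, d, q⟩ := by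
  classical
  obtain ⟨o, S, hSa, T, hTa, hSc, hTc, hdisj, hle, x, hx, y, hy, x', hx', y', hy', hne, hb, hb'⟩ := hr
  obtain ⟨p, hp, rfl⟩ := h.surj x (hSa hx)
  obtain ⟨q, hq, rfl⟩ := h.surj y (hTa hy)
  have hb0 := hb
  rw [System.crossBond_eq (h.tile p hp) (h.tile q hq)] at hb
  obtain ⟨d, hd, hdir⟩ := exists_dirZ_of_link hb
  rw [hdir, ← h.S_eq hp hd hq] at hb
  refine ⟨p, hp, d, hd, q, hq, hb, ?_⟩
  set R : Root := ⟨p, d, q⟩ with hR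
  have hD : Docking Γ a D t R := ⟨h, htree, hc, hp, hq, hd, hb⟩
  -- The root bond determines the relative position of the two copies.
  have ho : o = D.off₂ R - D.off₁ R := by
    have : o = dirZ d + D.cell p - D.cell q := by rw [← hdir]; ring
    rw [this]
    simp only [Inst.off₁, Inst.off₂, hR]; ring
  subst ho
  have inS : ∀ i < D.n, D.cell i ∈ S → ∀ z ∈ hD.trees.L (D.pos₁ R i), z - D.off₁ R ∈ S := by
    intro i hi hiS z hz
    rw [hD.trees_L, List.mem_map] at hz
    obtain ⟨z, hz, rfl⟩ := hz
    rw [add_sub_cancel_right]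
    exact System.treePath_subset htree hSc hSa hx hiS z hz
  have inT : ∀ i < D.n, D.cell i ∈ T → ∀ z ∈ hD.trees.M (D.pos₂ R i), z - D.off₂ R ∈ T := by
    intro i hi hiT z hz
    rw [hD.trees_M, List.mem_map] at hz
    obtain ⟨z, hz, rfl⟩ := hz
    rw [add_sub_cancel_right]
    exact System.treePath_subset htree hTc hTa hy hiT z hz
  have disj : ∀ i < D.n, D.cell i ∈ S → ∀ j < D.n, D.cell j ∈ T →
      ∀ z ∈ hD.trees.L (D.pos₁ R i), z ∉ hD.trees.M (D.pos₂ R j) := by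
    intro i hi hiS j hj hjT z hz hz'
    exact hdisj _ (inS i hi hiS z hz) _ (inT j hj hjT z hz') (by ring)
  set F : Finset ℕ := (Finset.range (4 * D.n)).filter fun g => D.nbr R g < D.n ∧
    D.cell (g / 4) ∈ S ∧ D.cell (D.nbr R g) ∈ T with hFdef
  have memF : ∀ g, g ∈ F ↔ g < 4 * D.n ∧ D.nbr R g < D.n ∧ D.cell (g / 4) ∈ S ∧
      D.cell (D.nbr R g) ∈ T := fun g => by
    rw [hFdef, Finset.mem_filter, Finset.mem_range]
  have hF : hD.Family F := by
    refine ⟨fun g hg => ((memF g).1 hg).1, fun g hg => ((memF g).1 hg).2.1, ?_⟩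
    intro f hf g hg _
    obtain ⟨f1, f2, f3, f4⟩ := (memF f).1 hf
    obtain ⟨g1, g2, g3, g4⟩ := (memF g).1 hg
    exact ⟨disj _ (by omega) f3 _ g2 g4, disj _ (by omega) g3 _ f2 f4⟩
  -- No bond between the parts is missed: its paths stay inside the disjoint parts, so apart from
  -- the root it belongs to a usable slot of the family.
  have cover : ∀ x ∈ S, ∀ y ∈ T, 0 < Γ.crossBond a (D.off₂ R - D.off₁ R) x y →
      ∃ g ∈ insert (Inst.root R) F, D.cell (g / 4) = x ∧ D.cell (D.far R g) = y := by
    intro x hx y hy hb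
    obtain ⟨i, hi, rfl⟩ := h.surj x (hSa hx)
    obtain ⟨j, hj, rfl⟩ := h.surj y (hTa hy)
    rw [hD.crossBond_cell hi hj] at hb
    obtain ⟨e, he, hdir⟩ := exists_dirZ_of_link hb
    rw [hdir, ← h.S_eq hi he hj] at hb
    have hpos : D.pos₂ R j = D.pos₁ R i + dirZ e := by rw [← hdir]; ring
    have m1 : (4 * i + e) / 4 = i := by omega
    have m2 : (4 * i + e) % 4 = e := by omega
    by_cases hr : i = p ∧ e = d
    · obtain ⟨rfl, rfl⟩ := hr
      refine ⟨_, Finset.mem_insert_self _ _, ?_, ?_⟩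
      · rw [Inst.root_div hD.d_lt]
      · rw [Docking.far_root]
        congr 1
        refine hD.pos₂_inj hq hj ?_
        rw [hpos]
        exact D.pos₂_q R
    · have hv : D.Valid R (4 * i + e) j := by
        refine ⟨hj, ⟨Inst.meets_coord_iff.2 ?_, ?_⟩, ?_, ?_⟩
        · rw [m1, m2, hpos]
        · rw [m1, m2]; exact hb
        · rw [m1, m2]; exact hr
        · rw [m1, hD.not_conf_iff hi hj]; exact disj i hi hx j hj hy
      have hn := h.inj.nbr_eq hv
      have hgF : 4 * i + e ∈ F := (memF _).2 ⟨by omega, by rw [hn]; exact hj, by rw [m1]; exact hx,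
        by rw [hn]; exact hy⟩
      exact ⟨_, Finset.mem_insert_of_mem hgF, by rw [m1], by rw [hF.far_eq hgF, hn]⟩
  -- A rogue pair has two different bonds, and they cannot both be the root.
  have hFne : F.Nonempty := by
    by_contra hemp
    rw [Finset.not_nonempty_iff_eq_empty] at hemp
    rw [hemp] at cover
    obtain ⟨g, hg, e1, e2⟩ := cover _ hx _ hy hb0
    obtain ⟨g', hg', e1', e2'⟩ := cover _ hx' _ hy' hb'
    simp only [insert_empty_eq, Finset.mem_singleton] at hg hg'
    subst hg hg'
    exact hne ⟨e1.symm.trans e1', e2.symm.trans e2'⟩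
  obtain ⟨f, hch, -⟩ := hF.chain
  have hcard : F.card = F.card - 1 + 1 := (Nat.sub_add_cancel (Finset.card_pos.2 hFne)).symm
  rw [hcard] at hch
  refine ⟨f, _, _, hch, hF.temp_le_iff.2 ?_⟩
  rw [h.temp]
  refine hle.trans ((double_sum_le (fun g => D.cell (g / 4)) (fun g => D.cell (D.far R g))
    cover).trans (le_of_eq ?_))
  exact Finset.sum_congr rfl fun g hg => hF.crossBond_far hg

/-- The criterion that the program checks. -/
theorem Model.crit_iff (h : Model Γ a D t) (htree : Γ.TreeBonded a) (hn : 0 < D.n) :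
    D.Crit ↔ Γ.UniquelyProduces a.assembly := by
  rw [System.uniquelyProduces_iff htree, Inst.Crit, h.conn_iff hn, h.strong_iff, h.tiles_iff]
  constructor
  · rintro ⟨h1, h2, h3, h4⟩
    refine ⟨h3, h2, h1, (h.leaf_iff h3).1 ?_, fun hr => ?_⟩
    · intro p hp d hd q hq hpos hle
      by_contra hl
      exact h4 p hp d hd q hq hpos (Or.inl ⟨hle, hl⟩)
    · obtain ⟨p, hp, d, hd, q, hq, hpos, hb⟩ := h.exists_bad_of_rogue htree h3 hr
      exact h4 p hp d hd q hq hpos (Or.inr hb)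
  · rintro ⟨h3, h2, h1, h4, h5⟩
    refine ⟨h1, h2, h3, ?_⟩
    rintro p hp d hd q hq hpos (⟨hle, hl⟩ | hb)
    · exact hl ((h.leaf_iff h3).2 h4 p hp d hd q hq hpos hle)
    · exact h5 (Docking.rogue_of_bad (R := ⟨p, d, q⟩) ⟨h, htree, h3, hp, hq, hd, hpos⟩ hb)

end WordRAM.TreeUAV

/-! ## Access to the input arrays -/

namespace TwoHAM

theorem getD_flatMap {α β : Type*} (f : α → List β) (d : β) :
    ∀ (l : List α) (k b : ℕ) (hk : k < l.length), b < (f l[k]).length →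
      (l.flatMap f).getD (((l.map fun x => (f x).length).take k).sum + b) d = (f l[k]).getD b d
  | [], k, b, hk, _ => absurd hk (by simp)
  | x :: l, 0, b, hk, hb => by
    simp only [List.getElem_cons_zero] at hb
    simp only [List.flatMap_cons, List.take_zero, List.sum_nil, zero_add, List.getElem_cons_zero]
    exact List.getD_append _ _ _ _ hb
  | x :: l, k + 1, b, hk, hb => by
    simp only [List.getElem_cons_succ] at hb
    simp only [List.flatMap_cons, List.map_cons, List.take_succ_cons, List.sum_cons,
      List.getElem_cons_succ]
    rw [List.getD_append_right _ _ _ _ (by omega), add_assoc, Nat.add_sub_cancel_left]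
    exact getD_flatMap f d l k b (by simpa using hk) hb

theorem getD_flatMap_const {α β : Type*} (f : α → List β) (d : β) {c : ℕ}
    (hc : ∀ x, (f x).length = c) (l : List α) (k b : ℕ) (hk : k < l.length) (hb : b < c) :
    (l.flatMap f).getD (c * k + b) d = (f l[k]).getD b d := by
  rw [← getD_flatMap f d l k b hk (by rwa [hc])]
  congr 2
  have : (l.map fun x => (f x).length) = List.replicate l.length c := by
    simp only [hc]; simp
  rw [this, List.take_replicate, List.sum_replicate, min_eq_left hk.le, smul_eq_mul, mul_comm]

theorem getD_scanl_add (l : List ℕ) (x k : ℕ) (hk : k ≤ l.length) :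
    (l.scanl (· + ·) x).getD k 0 = x + (l.take k).sum := by
  induction l generalizing x k with
  | nil =>
    have : k = 0 := by simpa using hk
    subst this; simp
  | cons y l ih =>
    cases k with
    | zero => simp [List.scanl_cons]
    | succ k =>
      rw [List.scanl_cons, List.getD_cons_succ, ih _ _ (by simpa using hk)]
      simp [add_assoc]

theorem length_binary (n : ℕ) : (binary n).length = n.size := by
  rw [binary, List.length_map, Nat.size_eq_bits_len]

theorem getD_binary (n b : ℕ) : (binary n).getD b 0 = (n.testBit b).toNat := by
  rw [Nat.testBit_eq_inth]
  change _ = (n.bits.getD b false).toNat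
  rw [binary]
  exact List.getD_map (l := n.bits) (n := b) false Bool.toNat

theorem size_le_log (n : ℕ) : n.size ≤ Nat.log 2 n + 1 :=
  Nat.size_le.2 (Nat.lt_pow_succ_log_self (by norm_num) n)

variable {m : ℕ} (Γ : System (Fin m))

theorem length_strengths : Γ.strengths.length = m * m := by
  simp [System.strengths]

theorem getD_strengths (g h : Fin m) : Γ.strengths.getD (m * g + h) 0 = Γ.str g h := by
  rw [System.strengths, getD_flatMap_const (c := m) _ 0 (by simp) _ _ _ (by simp) h.2]
  simp [List.getD]

theorem mul_add_lt (g h : Fin m) : m * g + h < m * m := by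
  have h1 := g.2
  have h2 := h.2
  calc m * g + h < m * g + m := by omega
    _ = m * (g + 1) := by ring
    _ ≤ m * m := Nat.mul_le_mul_left _ (by omega)

theorem getElem_strengths (g h : Fin m) :
    Γ.strengths[m * g + h]'(by rw [length_strengths]; exact mul_add_lt g h) = Γ.str g h := by
  rw [← getD_strengths Γ g h, List.getD_eq_getElem]

/-- The position at which the bits of a strength start. -/
def offset (Γ : System (Fin m)) (k : ℕ) : ℕ :=
  ((Γ.strengths.map fun s => (binary s).length).take k).sum

theorem offset_succ (g h : Fin m) :
    offset Γ (m * g + h + 1) = offset Γ (m * g + h) + (Γ.str g h).size := by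
  have hlt : m * g + h < (Γ.strengths.map fun s => (binary s).length).length := by
    rw [List.length_map, length_strengths]; exact mul_add_lt g h
  rw [offset, List.sum_take_succ _ _ hlt, List.getElem_map, getElem_strengths, length_binary]
  rfl

theorem getD_offsets {k : ℕ} (hk : k ≤ m * m) :
    ((Γ.strengths.map fun s => (binary s).length).scanl (· + ·) 0).getD k 0 = offset Γ k := by
  rw [getD_scanl_add _ _ _ (by rw [List.length_map, length_strengths]; exact hk), zero_add]
  rfl

theorem getD_bits (g h : Fin m) {b : ℕ} (hb : b < (Γ.str g h).size) :
    (Γ.strengths.flatMap binary).getD (offset Γ (m * g + h) + b) 0 =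
      ((Γ.str g h).testBit b).toNat := by
  have hlt : m * g + h < Γ.strengths.length := by
    rw [length_strengths]; exact mul_add_lt g h
  rw [offset, getD_flatMap binary 0 _ _ _ hlt (by rwa [getElem_strengths, length_binary]),
    getElem_strengths, getD_binary]

end TwoHAM

/-! ### Bits of numbers, and the size of the initial memory -/

namespace WordRAM

open TwoHAM

theorem bv_testBit (n k : ℕ) : bv (fun b => (n.testBit b).toNat) k = n % 2 ^ k := by
  induction k with
  | zero => simp [bv, Nat.mod_one]
  | succ k ih =>
    rw [bv_succ, ih, Nat.mod_pow_succ, Nat.toNat_testBit, mul_comm]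

theorem getD_le_sum (l : List ℕ) (i : ℕ) : l.getD i 0 ≤ l.sum := by
  by_cases h : i < l.length
  · rw [List.getD_eq_getElem _ _ h]
    exact List.le_sum_of_mem (List.getElem_mem h)
  · rw [List.getD_eq_default _ _ (by omega)]; omega

theorem init_le_magnitude (input : List (List ℕ)) (a i : ℕ) :
    (State.init input).arr a i ≤ magnitude input := by
  simp only [State.init, magnitude]
  by_cases h : a < input.length
  · rw [List.getD_eq_getElem _ _ h]
    have h1 := getD_le_sum input[a] i
    have h2 : (input[a]).length + (input[a]).sum ≤ (input.map fun a => a.length + a.sum).sum :=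
      List.le_sum_of_mem (List.mem_map.2 ⟨_, List.getElem_mem h, rfl⟩)
    omega
  · rw [List.getD_eq_default input _ (by omega)]; simp

theorem init_bounded {input : List (List ℕ)} (h6 : input.length ≤ 6) :
    (State.init input).Bounded (magnitude input) where
  var x := Nat.zero_le _
  arr a i := by
    have hN : 0 < magnitude input := by simp [magnitude]
    unfold arrDeg
    split_ifs with ha
    · rw [pow_one]; exact init_le_magnitude input a i
    · simp only [State.init]
      rw [List.getD_eq_default input _ (by omega)]; simp

end WordRAM

/-! ### The instance that is read from the input -/

namespace WordRAM.TreeUAV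

open TwoHAM

variable {m : ℕ}

open Classical in
/-- The numerical data of an input. -/
noncomputable def inst (Γ : System (Fin m)) (ts : List (Tile (Fin m)))
    (cs : List ((ℕ × ℕ) × Tile (Fin m))) : Inst where
  n := cs.length
  T := ts.length
  L := (binary Γ.temp).length
  m := m
  cx i := (State.init (encode Γ ts cs)).arr 2 (6 * i)
  cy i := (State.init (encode Γ ts cs)).arr 2 (6 * i + 1)
  gl i d := (State.init (encode Γ ts cs)).arr 2 (6 * i + 2 + d)
  tg i d := (State.init (encode Γ ts cs)).arr 1 (4 * i + d)
  st g h := if H : g < m ∧ h < m then Γ.str ⟨g, H.1⟩ ⟨h, H.2⟩ else 0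
  wc g h := bv (capBit (State.init (encode Γ ts cs)) (binary Γ.temp).length (g * m + h))
    (binary Γ.temp).length
  temp := Γ.temp

variable {Γ : System (Fin m)} {A : Config (Fin m)} {ts : List (Tile (Fin m))}
  {cs : List ((ℕ × ℕ) × Tile (Fin m))}

theorem words_getD (t : Tile (Fin m)) {d : ℕ} (hd : d < 4) :
    t.words.getD d 0 = ((t.glue d : Fin m) : ℕ) := by
  interval_cases d <;> simp [Tile.words, Tile.glue]

theorem arr_cells (Γ : System (Fin m)) (ts : List (Tile (Fin m))) {i b : ℕ}
    (hi : i < cs.length) (hb : b < 6) : (State.init (encode Γ ts cs)).arr 2 (6 * i + b) =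
      (cs[i].1.1 :: cs[i].1.2 :: cs[i].2.words).getD b 0 := by
  change (cs.flatMap fun c => c.1.1 :: c.1.2 :: c.2.words).getD (6 * i + b) 0 = _
  exact getD_flatMap_const (c := 6) _ 0 (fun x => by simp [Tile.words]) _ _ _ hi hb

theorem inst_cx {i : ℕ} (hi : i < cs.length) : (inst Γ ts cs).cx i = cs[i].1.1 :=
  arr_cells Γ ts hi (b := 0) (by norm_num)

theorem inst_cy {i : ℕ} (hi : i < cs.length) : (inst Γ ts cs).cy i = cs[i].1.2 :=
  arr_cells Γ ts hi (b := 1) (by norm_num)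

theorem inst_gl {i : ℕ} (hi : i < cs.length) {d : ℕ} (hd : d < 4) :
    (inst Γ ts cs).gl i d = ((cs[i].2.glue d : Fin m) : ℕ) := by
  change (State.init (encode Γ ts cs)).arr 2 (6 * i + 2 + d) = _
  rw [add_assoc, arr_cells Γ ts hi (by omega), ← words_getD _ hd, add_comm 2 d]
  rfl

theorem inst_tg {k : ℕ} (hk : k < ts.length) {d : ℕ} (hd : d < 4) :
    (inst Γ ts cs).tg k d = ((ts[k].glue d : Fin m) : ℕ) := by
  change (ts.flatMap Tile.words).getD (4 * k + d) 0 = _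
  rw [getD_flatMap_const (c := 4) _ 0 (fun x => by simp [Tile.words]) _ _ _ hk hd,
    words_getD _ hd]

theorem inst_st (g h : Fin m) : (inst Γ ts cs).st g h = Γ.str g h := by
  simp [inst]

theorem offsets_arr (g h : Fin m) :
    (State.init (encode Γ ts cs)).arr 4 ((g : ℕ) * m + h) = offset Γ (m * g + h) ∧
    (State.init (encode Γ ts cs)).arr 4 ((g : ℕ) * m + h + 1) =
      offset Γ (m * g + h) + (Γ.str g h).size := by
  have h1 := mul_add_lt g h
  rw [mul_comm (g : ℕ) m, ← offset_succ]
  exact ⟨getD_offsets Γ h1.le, getD_offsets Γ h1⟩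

/-- A strength with more bits than the temperature is larger than it, and the program substitutes
the temperature. Otherwise positions behind the last bit of the strength are read as zeros. -/
theorem capBit_eq (Γ : System (Fin m)) (ts : List (Tile (Fin m)))
    (cs : List ((ℕ × ℕ) × Tile (Fin m))) (g h : Fin m) (b : ℕ) :
    capBit (State.init (encode Γ ts cs)) (binary Γ.temp).length ((g : ℕ) * m + h) b =
      ((if Γ.temp.size < (Γ.str g h).size then Γ.temp else Γ.str g h).testBit b).toNat := by
  obtain ⟨e1, e2⟩ := offsets_arr (Γ := Γ) (ts := ts) (cs := cs) g h
  have e3 : (State.init (encode Γ ts cs)).arr 3 b = (Γ.temp.testBit b).toNat :=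
    getD_binary Γ.temp b
  rw [capBit, e1, e2, e3, Nat.add_sub_cancel_left, length_binary]
  by_cases hL : Γ.temp.size < (Γ.str g h).size
  · simp [hL]
  · simp only [hL, if_false, Nat.sub_zero, mul_one, zero_mul, add_zero]
    by_cases hb : b < (Γ.str g h).size
    · rw [if_pos hb, one_mul]
      exact getD_bits Γ g h hb
    · rw [if_neg hb, zero_mul, Nat.testBit_lt_two_pow (Nat.size_le.1 (not_lt.1 hb))]
      rfl

theorem inst_wc (g h : Fin m) : (inst Γ ts cs).wc g h =
    if Γ.temp.size < (Γ.str g h).size then Γ.temp else Γ.str g h := by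
  change bv (capBit (State.init (encode Γ ts cs)) (binary Γ.temp).length ((g : ℕ) * m + h))
    (binary Γ.temp).length = _
  rw [bv_congr fun b _ => capBit_eq Γ ts cs g h b, bv_testBit, Nat.mod_eq_of_lt]
  rw [length_binary]
  split_ifs with hL
  · exact Nat.lt_size_self _
  · exact Nat.size_le.1 (not_lt.1 hL)

theorem cellList_tile (hcs : A.CellList cs) {i : ℕ} (hi : i < cs.length) :
    A.tile ((inst Γ ts cs).cell i) = some cs[i].2 := by
  rw [Inst.cell, inst_cx hi, inst_cy hi, hcs.2]
  exact ⟨_, _, rfl, List.getElem_mem hi⟩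

theorem exists_model (Γ : System (Fin m)) (hts : Γ.TileList ts) (hcs : A.CellList cs)
    (t₀ : Tile (Fin m)) :
    Model Γ A (inst Γ ts cs) fun i => (cs.map Prod.snd).getD i t₀ := by
  have ht : ∀ i (hi : i < cs.length), (cs.map Prod.snd).getD i t₀ = cs[i].2 := fun i hi => by
    rw [List.getD_eq_getElem _ _ (by simpa using hi), List.getElem_map]
  refine ⟨?_, ?_, ?_, ?_, inst_st, ?_, rfl, ?_, ?_⟩
  · intro i hi
    rw [ht i hi]
    exact cellList_tile hcs hi
  · intro p hp
    obtain ⟨s, hs⟩ := Config.exists_tile hp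
    obtain ⟨x, y, rfl, hmem⟩ := (hcs.2 p s).1 hs
    obtain ⟨i, hi, e⟩ := List.getElem_of_mem hmem
    refine ⟨i, hi, ?_⟩
    rw [Inst.cell, inst_cx hi, inst_cy hi, e]
  · intro i hi j hj e1 e2
    rw [inst_cx hi, inst_cx hj] at e1
    rw [inst_cy hi, inst_cy hj] at e2
    have hi' : i < (cs.map Prod.fst).length := by rw [List.length_map]; exact hi
    have hj' : j < (cs.map Prod.fst).length := by rw [List.length_map]; exact hj
    refine (List.Nodup.getElem_inj_iff hcs.1 (hi := hi') (hj := hj')).1 ?_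
    rw [List.getElem_map, List.getElem_map]
    exact Prod.ext e1 e2
  · intro i hi d hd
    rw [ht i hi, inst_gl hi hd]
  · intro g h
    rw [inst_wc]
    split_ifs with hL
    · exact Or.inr ⟨le_rfl, (Nat.lt_size_self _).le.trans (Nat.lt_size.1 hL)⟩
    · exact Or.inl rfl
  · intro s hs
    obtain ⟨k, hk, e⟩ := List.getElem_of_mem ((hts.2 s).2 hs)
    exact ⟨k, hk, fun d hd => by rw [inst_tg hk hd, e]⟩
  · intro k hk
    exact ⟨ts[k], (hts.2 _).1 (List.getElem_mem hk), fun d hd => inst_tg hk hd⟩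

theorem env_of_agree (s : State) (harr : s.arr = (State.init (encode Γ ts cs)).arr)
    (v1 : s.var 1 = cs.length) (v3 : s.var 3 = (binary Γ.temp).length) (v4 : s.var 4 = ts.length)
    (v5 : s.var 5 = 4 * cs.length) (v6 : s.var 6 = 4) (v7 : s.var 7 = cs.length + 1)
    (v10 : s.var 10 = m) : Env (inst Γ ts cs) s := by
  have hcap : capBit s = capBit (State.init (encode Γ ts cs)) := by
    funext L k b
    simp only [capBit, harr]
  refine ⟨v1, v3, v4, v5, v6, v7, v10, ?_, ?_, ?_, ?_, ?_, ?_, ?_, ?_, ?_, ?_⟩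
  · intro i hi d hd; rw [harr]; rfl
  · intro i hi; rw [harr]; rfl
  · intro i hi; rw [harr]; rfl
  · intro i hi d hd; rw [harr]; rfl
  · intro b hb
    rw [harr]
    exact (getD_binary Γ.temp b).le.trans (Bool.toNat_le _)
  · rw [harr]
    refine (bv_congr fun b _ => getD_binary Γ.temp b).trans ?_
    rw [bv_testBit]
    refine Nat.mod_eq_of_lt ?_
    change _ < 2 ^ (binary Γ.temp).length
    rw [length_binary]
    exact Nat.lt_size_self _
  · intro i hi d hd
    rw [inst_gl hi hd]
    exact Fin.is_lt _
  · intro g hg h hh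
    obtain ⟨e1, e2⟩ := offsets_arr (Γ := Γ) (ts := ts) (cs := cs) ⟨g, hg⟩ ⟨h, hh⟩
    have e3 := inst_st (Γ := Γ) (ts := ts) (cs := cs) ⟨g, hg⟩ ⟨h, hh⟩
    simp only at e1 e2 e3
    change 0 < s.arr 4 (g * m + h + 1) - s.arr 4 (g * m + h) ↔ _
    rw [harr, e1, e2, e3, Nat.add_sub_cancel_left, Nat.size_pos]
  · intro g hg h hh b hb
    rw [hcap]
    exact (capBit_eq Γ ts cs ⟨g, hg⟩ ⟨h, hh⟩ b).le.trans (Bool.toNat_le _)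
  · intro g hg h hh
    rw [hcap]
    rfl

theorem card_dom (hcs : A.CellList cs) : A.dom.card = cs.length := by
  classical
  have hinj : Function.Injective fun p : ℕ × ℕ => ((p.1 : ℤ), (p.2 : ℤ)) := by
    rintro ⟨x, y⟩ ⟨x', y'⟩ e
    simpa using e
  have : A.dom = ((cs.map Prod.fst).map fun p : ℕ × ℕ => ((p.1 : ℤ), (p.2 : ℤ))).toFinset := by
    ext p
    rw [List.mem_toFinset, List.map_map, List.mem_map]
    constructor
    · intro hp
      obtain ⟨s, hs⟩ := Config.exists_tile hp
      obtain ⟨x, y, rfl, hmem⟩ := (hcs.2 p s).1 hs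
      exact ⟨_, hmem, rfl⟩
    · rintro ⟨⟨⟨x, y⟩, s⟩, hmem, rfl⟩
      exact Config.mem_dom_of_tile ((hcs.2 _ s).2 ⟨x, y, rfl, hmem⟩)
  rw [this, List.toFinset_card_of_nodup (hcs.1.map hinj), List.length_map, List.length_map]

/-- Every tile type must occur in the assembly. This justifies the rejection at the start, without
which the time would depend on the number of tile types. -/
theorem length_le_of_uniquelyProduces (htree : Γ.TreeBonded A) (hts : Γ.TileList ts)
    (hcs : A.CellList cs) (h : Γ.UniquelyProduces A.assembly) : ts.length ≤ cs.length := by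
  obtain ⟨-, -, htiles, -⟩ := (System.uniquelyProduces_iff htree).1 h
  rw [← List.length_map (as := cs) Prod.snd]
  refine (List.subperm_of_subset hts.1 fun s hs => ?_).length_le
  obtain ⟨p, hp⟩ := (htiles s).1 ((hts.2 s).1 hs)
  obtain ⟨x, y, -, hmem⟩ := (hcs.2 p s).1 hp
  exact List.mem_map.2 ⟨_, hmem, rfl⟩

end WordRAM.TreeUAV

/-! ### The compiled program -/

namespace WordRAM.TreeUAV

open TwoHAM

/-- Set up the constants; reject if there are more tile types than cells. -/
def program : Prog :=
  .seq (.assign 1 (.get 0 2)) <| .seq (.assign 3 (.get 0 3)) <| .seq (.assign 4 (.get 0 1)) <|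
  .seq (.assign 5 (4 * Expr.var 1)) <| .seq (.assign 6 4) <| .seq (.assign 7 (Expr.var 1 + 1)) <|
  .seq (.assign 10 (.get 0 0)) <|
  .ite (Expr.blt (.var 1) (.var 4)) .skip (.seq (.assign 0 1) mainC.comp)

theorem exec_assign_bounded {w N : ℕ} (hS : Setting w N) {s : State} (hs : s.Bounded N) {x v : ℕ}
    {e : Expr} (he : e.small) (hv : e.val s = v) (hx : x < 1000) (hb : v ≤ N ^ 4) :
    Exec w (.assign x e) s (e.cost + 1) (s.setVar x v) ∧ (s.setVar x v).Bounded N := by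
  subst hv
  exact ⟨exec_assign' hS hs x e he, hs.setVar (by rw [varDeg_lo hx]; exact hb)⟩

theorem exec_program {w N n L T m : ℕ} (hS : Setting w N) {s₀ : State} (h₀ : s₀.Bounded N)
    (hvar : ∀ x, s₀.var x = 0) (e0 : s₀.arr 0 0 = m) (e1 : s₀.arr 0 1 = T) (e2 : s₀.arr 0 2 = n)
    (e3 : s₀.arr 0 3 = L) (hn : 0 < n) (hL : 0 < L) :
    (n < T ∧ ∃ t s, Exec w program s₀ t s ∧ t ≤ 50 ∧ s.var 0 = 0) ∨
    (T ≤ n ∧ ∃ t s σ, Exec w program s₀ t s ∧ t ≤ (mainC.poly.1 + 50) * n ^ 5 * L ∧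
      s.var 0 = (mainC.run σ).var 0 ∧ σ.arr = s₀.arr ∧ σ.var 0 = 1 ∧ σ.var 1 = n ∧ σ.var 3 = L ∧
      σ.var 4 = T ∧ σ.var 5 = 4 * n ∧ σ.var 6 = 4 ∧ σ.var 7 = n + 1 ∧ σ.var 10 = m) := by
  have hN := hS.two_le
  have hle : ∀ i, s₀.arr 0 i ≤ N := fun i => by simpa [arrDeg] using h₀.arr 0 i
  -- The derived constants 4n, 4 and n + 1 also respect the bound for variables.
  have hN4 : 4 * N ≤ N ^ 4 := by
    calc 4 * N ≤ N ^ 2 * N := Nat.mul_le_mul_right _ (by nlinarith)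
      _ ≤ N ^ 2 * N ^ 2 := Nat.mul_le_mul_left _ (by nlinarith)
      _ = N ^ 4 := by ring
  have hm := hle 0
  have hT := hle 1
  have hn' := hle 2
  have hL' := hle 3
  rw [e0] at hm
  rw [e1] at hT
  rw [e2] at hn'
  rw [e3] at hL'
  obtain ⟨x1, b1⟩ := exec_assign_bounded hS h₀ (x := 1) (v := n) (e := .get 0 2) (by decide)
    (by simpa using e2) (by norm_num) (by omega)
  obtain ⟨x2, b2⟩ := exec_assign_bounded hS b1 (x := 3) (v := L) (e := .get 0 3) (by decide)
    (by simpa using e3) (by norm_num) (by omega)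
  obtain ⟨x3, b3⟩ := exec_assign_bounded hS b2 (x := 4) (v := T) (e := .get 0 1) (by decide)
    (by simpa using e1) (by norm_num) (by omega)
  obtain ⟨x4, b4⟩ := exec_assign_bounded hS b3 (x := 5) (v := 4 * n) (e := 4 * Expr.var 1)
    (by decide) (by simp) (by norm_num) (by omega)
  obtain ⟨x5, b5⟩ := exec_assign_bounded hS b4 (x := 6) (v := 4) (e := 4) (by decide)
    (by simp) (by norm_num) (by omega)
  obtain ⟨x6, b6⟩ := exec_assign_bounded hS b5 (x := 7) (v := n + 1) (e := Expr.var 1 + 1)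
    (by decide) (by simp) (by norm_num) (by omega)
  obtain ⟨x7, b7⟩ := exec_assign_bounded hS b6 (x := 10) (v := m) (e := .get 0 0) (by decide)
    (by simpa using e0) (by norm_num) (by omega)
  obtain ⟨s, hs⟩ : ∃ s, s = (((((((s₀.setVar 1 n).setVar 3 L).setVar 4 T).setVar 5 (4 * n)).setVar
    6 4).setVar 7 (n + 1)).setVar 10 m) := ⟨_, rfl⟩
  rw [← hs] at x7 b7
  have hcond : (Expr.blt (.var 1) (.var 4)).eval w s = if n < T then 1 else 0 := by
    rw [Expr.eval_eq_val hN hS.pow_le b7 _ (by decide)]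
    simp [hs]
  rcases Nat.lt_or_ge n T with hlt | hge
  · left
    rw [if_pos hlt] at hcond
    refine ⟨hlt, _, _, .seq x1 (.seq x2 (.seq x3 (.seq x4 (.seq x5 (.seq x6 (.seq x7
      (.iteTrue (by rw [hcond]; norm_num) (.skip s)))))))), by decide, ?_⟩
    simp [hs, hvar]
  · right
    rw [if_neg (by omega)] at hcond
    obtain ⟨x8, b8⟩ := exec_assign_bounded hS b7 (x := 0) (v := 1) (e := 1) (by decide)
      (by simp) (by norm_num) (by omega)
    -- The values of the loop bounds. That they are linear in n uses that the number of tile types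
    -- is at most n, as ensured by the test just passed.
    let β : ℕ → ℕ := fun b => if 0 < b ∧ b < 10 then (s.setVar 0 1).var b else 0
    have hβ : ∀ b, LeMono n L (β b) (5, (boundDeg b).1, (boundDeg b).2) := by
      intro b
      by_cases hb : 0 < b ∧ b < 10
      · obtain ⟨hb0, hb1⟩ := hb
        interval_cases b <;> simp [LeMono, β, boundDeg, hs, hvar] <;> omega
      · simp only [LeMono, β, if_neg hb]; omega
    obtain ⟨t, s', hex, ht, hag, -⟩ := Cmd.exec_comp hS mainC mainC_wt (s.setVar 0 1)
      (s.setVar 0 1) ⟨fun _ _ => rfl, rfl⟩ b8 (β := β)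
      (fun b hb0 hb1 => by simp only [β, if_pos (And.intro hb0 hb1)])
    refine ⟨hge, _, _, s.setVar 0 1, .seq x1 (.seq x2 (.seq x3 (.seq x4 (.seq x5 (.seq x6 (.seq x7
      (.iteFalse hcond (.seq x8 hex)))))))), ?_, hag.var 0 (Or.inl (by norm_num)),
      ?_, ?_, ?_, ?_, ?_, ?_, ?_, ?_, ?_⟩
    · have h1 := Cmd.time_le hn hL hβ mainC
      have h2 := LeMono.mono hn hL h1 le_rfl mainC_poly.1 mainC_poly.2
      have h3 : 1 ≤ n ^ 5 * L := Nat.mul_pos (by positivity) hL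
      simp only [LeMono, pow_one] at h2
      have h4 : (mainC.poly.1 + 50) * n ^ 5 * L = mainC.poly.1 * n ^ 5 * L + 50 * (n ^ 5 * L) := by
        ring
      rw [h4]
      -- The set-up takes fewer than 45 steps, which the additional 50 in the constant absorbs
      -- because n and L are positive.
      have hc : ∀ A B : ℕ, A ≤ 45 → t ≤ B → A + t ≤ B + 50 * (n ^ 5 * L) := by
        intro A B hA hB; omega
      have := hc 45 _ le_rfl (ht.trans h2)
      refine le_trans ?_ this
      simp only [Expr.cost, Expr.blt]
      omega
    all_goals simp [hs]

end WordRAM.TreeUAV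

theorem theorem3 :
    ∃ (P : WordRAM.Prog) (k c : ℕ),
      ∀ (m : ℕ) (Γ : TwoHAM.System (Fin m)) (A : TwoHAM.Config (Fin m)),
        A.dom.Nonempty → Γ.TreeBonded A →
        ∀ (ts : List (TwoHAM.Tile (Fin m))) (cs : List ((ℕ × ℕ) × TwoHAM.Tile (Fin m))),
          Γ.TileList ts → A.CellList cs →
          ∀ w : ℕ, WordRAM.WordsSuffice k w (TwoHAM.encode Γ ts cs) →
            WordRAM.DecidesWithin w P (TwoHAM.encode Γ ts cs)
              (Γ.UniquelyProduces A.assembly)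
              (c * A.dom.card ^ 5 * (Nat.log 2 Γ.temp + 1)) := by
  open WordRAM WordRAM.TreeUAV TwoHAM in
  refine ⟨program, 50, mainC.poly.1 + 50, fun m Γ A hne htree ts cs hts hcs w hw => ?_⟩
  have hS : Setting w (magnitude (encode Γ ts cs)) := ⟨by simp [magnitude], hw⟩
  have hcard := card_dom hcs
  have hn : 0 < cs.length := by rw [← hcard]; exact hne.card_pos
  have hL : 0 < (binary Γ.temp).length := by
    rw [length_binary, Nat.size_pos]; exact Γ.temp_pos
  have hlog : (binary Γ.temp).length ≤ Nat.log 2 Γ.temp + 1 := by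
    rw [length_binary]; exact size_le_log _
  obtain ⟨p, hp⟩ := hne
  obtain ⟨t₀, -⟩ := Config.exists_tile hp
  have hM := exists_model Γ hts hcs t₀
  rw [hcard]
  have hbound : (mainC.poly.1 + 50) * cs.length ^ 5 * (binary Γ.temp).length ≤
      (mainC.poly.1 + 50) * cs.length ^ 5 * (Nat.log 2 Γ.temp + 1) := Nat.mul_le_mul_left _ hlog
  rcases exec_program hS (init_bounded (input := encode Γ ts cs) (by simp [encode]))
    (fun _ => rfl) rfl rfl rfl rfl hn hL with ⟨hlt, t, s, hex, ht, h0⟩ |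
      ⟨-, t, s, σ, hex, ht, hs, harr, s0, s1, s3, s4, s5, s6, s7, s10⟩
  -- With more tile types than cells the answer is negative, and it is given in constant time.
  · refine ⟨t, s, hex, ?_, fun h => ?_, fun _ => h0⟩
    · have h1 : 1 ≤ cs.length ^ 5 * (Nat.log 2 Γ.temp + 1) := Nat.mul_pos (by positivity) (by omega)
      calc t ≤ 50 := ht
        _ ≤ (mainC.poly.1 + 50) * 1 := by omega
        _ ≤ (mainC.poly.1 + 50) * (cs.length ^ 5 * (Nat.log 2 Γ.temp + 1)) :=
          Nat.mul_le_mul_left _ h1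
        _ = _ := (mul_assoc _ _ _).symm
    · have := length_le_of_uniquelyProduces htree hts hcs h
      exact absurd hlt (not_lt.2 this)
  · have hE := env_of_agree σ harr s1 s3 s4 s5 s6 s7 s10
    -- Chains are known to be short only for a connected assembly, so the bound is passed on under
    -- the condition that the connectivity test succeeds.
    have hmain := run_mainC hM.inj hn hE (fun hr => hM.short htree ((hM.conn_iff hn).1 hr)) s0
    rw [hM.crit_iff htree hn, ← hs] at hmain
    exact ⟨t, s, hex, ht.trans hbound, hmain.1, hmain.2⟩
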